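/- **Setting.** Let $\theta$ be a non-negative integer-valued random variable with $E\theta^3<\infty$. Let $\theta_j$, $j\in\mathbb Z$, be copies of $\theta$ and, for $j\in\mathbb Z$, $k\ge 1$, let $\rho^j_k=(\rho^j_{k,1},\dots,\rho^j_{k,k})$ be a random vector with values in $[j,j+1)^k$, such that the families $(\theta_j,(\rho^j_k)_{k\ge1})$, $j\in\mathbb Z$, are independent. Let $\nu=\sum_{j\in\mathbb Z}\sum_{n=1}^{\theta_j}\delta_{\kappa_{j,n}}$, $\kappa_{j,n}=\rho^j_{\theta_j,n}$ (a quasi-homogeneous initial measure). Let $0<\alpha\le2$. Particles start from the atoms $\kappa_{j,n}$ of $\nu$ and move, without branching, along $\kappa_{j,n}+\eta^{j,n}_t$, where the $\eta^{j,n}$ are standard symmetric $\alpha$-stable Lévy processes in $\mathbb R$ (i.e. $Ee^{iz\eta_t}=e^{-t|z|^\alpha}$), independent of each other and of the $\theta_j,\rho^j_k$. Let $N_s(A)$ be the number of particles in $A\subset\mathbb R$ at time $s$ and $$X_T(t)=\frac1{F_T}\int_0^{Tt}(N_s-EN_s)\,ds,\qquad t\ge0,$$ regarded as a process with values in the space $\mathcal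 S'(\mathbb R)$ of tempered distributions. Let $\Rightarrow_f$ denote weak convergence of finite-dimensional distributions of $\mathcal S'(\mathbb R)$-valued processes as $T\to\infty$, let $\lambda$ be Lebesgue measure, let $\mathcal S(\mathbb R)$ be the space of rapidly decreasing $C^\infty$ functions, let $p_t$ be the transition density of the standard symmetric $\alpha$-stable process, and $G\varphi=\int_0^\infty p_t*\varphi\,dt$ (for $\alpha<1$). **Theorem.** (a) Let $\alpha>1$ and $F_T=T^{1-1/(2\alpha)}$. Then $$X_T\Rightarrow_f K_1\lambda\left(\sqrt{E\theta}\,\zeta^H+\sqrt{\operatorname{Var}\theta}\,\vartheta^H\right),\qquad H=1-\frac1{2\alpha},\qquad K_1=\left(\frac{\Gamma(2-2H)}{\pi\alpha H(2H-1)}\right)^{1/2},$$ where $\zeta^H,\vartheta^H$ are independent, $\zeta^H$ is a sub-fractional Brownian motion, i.e. a continuous centered Gaussian process with covariance $C^H(s,t)=s^{2H}+t^{2H}-\frac12\left((s+t)^{2H}+|s-t|^{2H}\right)$, and $\vartheta^H$ is a centered Gaussian process with covariance $Q^H(s,t)=\frac12\operatorname{sgn}(2H-1)\left((s+t)^{2H}-s^{2H}-t^{2H}\right)$.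 (b) Let $\alpha=1$ and $F_T=\sqrt{T\log T}$. Then $X_T\Rightarrow_f K_2\lambda\beta$, where $\beta$ is a standard Brownian motion in $\mathbb R$ and $K_2=\sqrt{\frac2\pi E\theta}$. (c) Let $\alpha<1$ and $F_T=\sqrt T$. Then $X_T\Rightarrow_f X$, where $X$ is an $\mathcal S'(\mathbb R)$-valued homogeneous Wiener process, i.e. a continuous centered Gaussian process in $\mathcal S'(\mathbb R)$, with covariance $$E\langle X(t),\varphi\rangle\langle X(s),\psi\rangle=2E\theta\,(s\wedge t)\int_{\mathbb R}\varphi(x)\,G\psi(x)\,dx,\qquad\varphi,\psi\in\mathcal S(\mathbb R).$$ -/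

import Mathlib

open MeasureTheory ProbabilityTheory Filter Topology
open scoped NNReal SchwartzMap

namespace OccupationTime

noncomputable section

/-! ### Tempered distributions on the real line -/

/-- The space `𝒮'(ℝ)` of real tempered distributions: continuous linear functionals on the real
Schwartz space, with the topology of pointwise convergence on test functions (the topology that
Mathlib puts on its complex counterpart `TemperedDistribution`). -/
abbrev TemperedDist : Type := 𝓢(ℝ, ℝ) →Lₚₜ[ℝ] ℝ

open scoped Classical in
/-- A measure on `ℝ` regarded as a tempered distribution `φ ↦ ∫ φ dμ`. The value `0` is used if `μ`
is not of temperate growth. -/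
def toDist (μ : Measure ℝ) : TemperedDist :=
  if h : μ.HasTemperateGrowth then
    haveI := h
    ContinuousLinearMap.toPointwiseConvergenceCLM ℝ (RingHom.id ℝ) _ _
      (SchwartzMap.integralCLM (V := ℝ) ℝ μ)
  else 0

theorem toDist_apply (μ : Measure ℝ) [h : μ.HasTemperateGrowth] (φ : 𝓢(ℝ, ℝ)) :
    toDist μ φ = ∫ x, φ x ∂μ := by
  rw [toDist, dif_pos h]
  rfl

/-- Weak convergence of finite-dimensional distributions, as `T → ∞`, of `𝒮'(ℝ)`-valued processes
`X T = (X T t)_{t ≥ 0}` to an `𝒮'(ℝ)`-valued process `Y`: for all times `t 0, …, t (m - 1)` the laws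
of `(X T (t i))_i` converge weakly, as Borel probability measures on the topological space
`𝒮'(ℝ)ᵐ`, to the law of `(Y (t i))_i`. -/
def TendstoFDD {Ω Ω' : Type*} [MeasurableSpace Ω] [MeasurableSpace Ω']
    (X : ℝ → ℝ≥0 → Ω → TemperedDist) (P : Measure Ω) [IsProbabilityMeasure P]
    (Y : ℝ≥0 → Ω' → TemperedDist) (P' : Measure Ω') [IsProbabilityMeasure P'] : Prop :=
  ∀ (m : ℕ) (t : Fin m → ℝ≥0),
    letI : MeasurableSpace (Fin m → TemperedDist) := borel _
    haveI : BorelSpace (Fin m → TemperedDist) := ⟨rfl⟩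
    TendstoInDistribution (fun (T : ℝ) (ω : Ω) (i : Fin m) => X T (t i) ω) atTop
      (fun (ω : Ω') (i : Fin m) => Y (t i) ω) (fun _ => P) P'

/-! ### Symmetric stable processes, their semigroup and potential operator -/

/-- Right-continuous with left limits. -/
def IsCadlag (f : ℝ≥0 → ℝ) : Prop :=
  ∀ t, ContinuousWithinAt f (Set.Ici t) t ∧ ∃ l, Tendsto f (𝓝[<] t) (𝓝 l)

/-- The standard symmetric `α`-stable Lévy process in `ℝ` started from `0`, i.e. the Lévy process
with `E exp(i z η_t) = exp(-t|z|^α)`. -/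
structure IsStableLevy {Ω : Type*} [MeasurableSpace Ω] (α : ℝ) (η : ℝ≥0 → Ω → ℝ)
    (P : Measure Ω) : Prop where
  measurable : ∀ t, Measurable (η t)
  zero : ∀ᵐ ω ∂P, η 0 ω = 0
  indep_increments : HasIndepIncrements η P
  charFun_increment : ∀ s t : ℝ≥0, s ≤ t → ∀ z : ℝ,
    charFun (P.map (fun ω => η t ω - η s ω)) z
      = ((Real.exp (-((t : ℝ) - (s : ℝ)) * |z| ^ α) : ℝ) : ℂ)
  cadlag : ∀ᵐ ω ∂P, IsCadlag (fun t => η t ω)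

/-- The transition density `p_t(x)` of the standard symmetric `α`-stable process (for `t > 0`),
the inverse Fourier transform of `z ↦ exp(-t|z|^α)`. -/
def stableDensity (α t x : ℝ) : ℝ :=
  (1 / (2 * Real.pi)) * ∫ z : ℝ, Real.cos (x * z) * Real.exp (-t * |z| ^ α)

/-- The semigroup `𝒯_t φ = p_t * φ` (for `t > 0`). -/
def stableSemigroup (α t : ℝ) (φ : ℝ → ℝ) (x : ℝ) : ℝ :=
  ∫ y : ℝ, stableDensity α t (x - y) * φ y

/-- The potential operator `G φ = ∫_0^∞ 𝒯_t φ dt` (for `α < 1`). -/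
def potential (α : ℝ) (φ : ℝ → ℝ) (x : ℝ) : ℝ :=
  ∫ t in Set.Ioi (0 : ℝ), stableSemigroup α t φ x

/-! ### The particle system -/

/-- The random data defining a quasi-homogeneous initial measure: `θ j` is the number of points in
`[j, j+1)`, and `ρ j k` is the vector of their positions in case that `θ j = k`, so that the initial
measure is `∑_j ∑_{n < θ j} δ_{ρ j (θ j) n}`. -/
structure IsQuasiHomogeneous {Ω : Type*} [MeasurableSpace Ω] (θ : ℤ → Ω → ℕ)
    (ρ : ℤ → (k : ℕ) → Ω → Fin k → ℝ) (P : Measure Ω) : Prop where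
  measurable_number : ∀ j, Measurable (θ j)
  measurable_position : ∀ j k, Measurable (ρ j k)
  position_mem : ∀ (j : ℤ) (k : ℕ) (ω : Ω) (n : Fin k), ρ j k ω n ∈ Set.Ico (j : ℝ) ((j : ℝ) + 1)
  identDistrib : ∀ j, IdentDistrib (θ j) (θ 0) P P
  integrable_cube : Integrable (fun ω => (θ 0 ω : ℝ) ^ 3) P
  indep : iIndepFun (fun (j : ℤ) (ω : Ω) => (θ j ω, fun k : ℕ => ρ j k ω)) P

/-- The system without branching: the initial configuration is quasi-homogeneous, and the
displacements `η (j, n)` of the particles (the `n`-th particle of the interval `[j, j+1)` moves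
along `t ↦ ρ j (θ j) n + η (j, n) t`) are standard `α`-stable Lévy processes, independent of each
other and of the initial configuration. -/
structure IsStableSystem {Ω : Type*} [MeasurableSpace Ω] (α : ℝ) (θ : ℤ → Ω → ℕ)
    (ρ : ℤ → (k : ℕ) → Ω → Fin k → ℝ) (η : ℤ × ℕ → ℝ≥0 → Ω → ℝ) (P : Measure Ω) : Prop where
  initial : IsQuasiHomogeneous θ ρ P
  motion : ∀ i, IsStableLevy α (η i) P
  indep_motion : iIndepFun (fun (i : ℤ × ℕ) (ω : Ω) (t : ℝ≥0) => η i t ω) P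
  indep_initial : IndepFun (fun (ω : Ω) (j : ℤ) => (θ j ω, fun k : ℕ => ρ j k ω))
    (fun (ω : Ω) (i : ℤ × ℕ) (t : ℝ≥0) => η i t ω) P

/-- The empirical process: `N_s(A)` is the number of particles in `A` at time `s`. -/
def empirical {Ω : Type*} (θ : ℤ → Ω → ℕ) (ρ : ℤ → (k : ℕ) → Ω → Fin k → ℝ)
    (η : ℤ × ℕ → ℝ≥0 → Ω → ℝ) (s : ℝ≥0) (ω : Ω) : Measure ℝ :=
  Measure.sum fun j : ℤ =>
    ∑ n : Fin (θ j ω), Measure.dirac (ρ j (θ j ω) ω n + η (j, (n : ℕ)) s ω)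

/-- The rescaled occupation time fluctuation process
`X_T(t) = (1 / F_T) ∫_0^{Tt} (N_s - E N_s) ds` of a measure-valued process `N`, as a process with
values in `𝒮'(ℝ)`. Here `Measure.bind` is the integral of a family of measures; in particular
`P.bind (N s)` is `E N_s`. -/
def fluctuation {Ω : Type*} [MeasurableSpace Ω] (N : ℝ≥0 → Ω → Measure ℝ) (P : Measure Ω)
    (F : ℝ → ℝ) (T : ℝ) (t : ℝ≥0) (ω : Ω) : TemperedDist :=
  (F T)⁻¹ •
    (toDist ((volume.restrict (Set.Ioc (0 : ℝ) (T * t))).bind fun s => N s.toNNReal ω)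
      - toDist ((volume.restrict (Set.Ioc (0 : ℝ) (T * t))).bind fun s => P.bind (N s.toNNReal)))

/-! ### The limit processes -/

/-- A centered real Gaussian process with covariance function `C`. -/
structure IsCenteredGaussian {Ω : Type*} [MeasurableSpace Ω] (ξ : ℝ≥0 → Ω → ℝ)
    (C : ℝ → ℝ → ℝ) (P : Measure Ω) : Prop where
  gaussian : IsGaussianProcess ξ P
  centered : ∀ t, ∫ ω, ξ t ω ∂P = 0
  covariance : ∀ s t : ℝ≥0, ∫ ω, ξ s ω * ξ t ω ∂P = C s t

/-- The covariance `C^H` of sub-fractional Brownian motion. -/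
def subFBMCov (H s t : ℝ) : ℝ :=
  s ^ (2 * H) + t ^ (2 * H) - (1 / 2) * ((s + t) ^ (2 * H) + |s - t| ^ (2 * H))

/-- The covariance `Q^H`. -/
def initCov (H s t : ℝ) : ℝ :=
  (1 / 2) * Real.sign (2 * H - 1) * ((s + t) ^ (2 * H) - s ^ (2 * H) - t ^ (2 * H))

/-- Sub-fractional Brownian motion with parameter `H`. -/
structure IsSubFBM {Ω : Type*} [MeasurableSpace Ω] (H : ℝ) (ζ : ℝ≥0 → Ω → ℝ)
    (P : Measure Ω) : Prop extends IsCenteredGaussian ζ (subFBMCov H) P where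
  continuous_paths : ∀ᵐ ω ∂P, Continuous (fun t => ζ t ω)

/-- An `𝒮'(ℝ)`-valued homogeneous Wiener process with covariance
`E⟨W(s), φ⟩⟨W(t), ψ⟩ = (s ∧ t) Q(φ, ψ)`: a continuous centered Gaussian process in `𝒮'(ℝ)` with this
covariance. -/
structure IsHomogeneousWiener {Ω : Type*} [MeasurableSpace Ω] (W : ℝ≥0 → Ω → TemperedDist)
    (Q : 𝓢(ℝ, ℝ) → 𝓢(ℝ, ℝ) → ℝ) (P : Measure Ω) : Prop where
  gaussian : IsGaussianProcess (fun (p : ℝ≥0 × 𝓢(ℝ, ℝ)) (ω : Ω) => W p.1 ω p.2) P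
  centered : ∀ (t : ℝ≥0) (φ : 𝓢(ℝ, ℝ)), ∫ ω, W t ω φ ∂P = 0
  covariance : ∀ (s t : ℝ≥0) (φ ψ : 𝓢(ℝ, ℝ)),
    ∫ ω, W s ω φ * W t ω ψ ∂P = min (s : ℝ) (t : ℝ) * Q φ ψ
  continuous_paths : ∀ᵐ ω ∂P, Continuous (fun t => W t ω)

end

end OccupationTime

namespace OccupationTime

open scoped ENNReal BoundedContinuousFunction FourierTransform

/-! ### Separability of the Schwartz space -/

/-! Group the particles by the unit cell in which they start. The contributions of different cells
are independent, so a linear combination of values `X_T(t_i)` on test functions is `1/F_T` times a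
series of independent centered variables. A Lyapunov estimate (`norm_integral_exp_series_sub_le`)
compares the characteristic function of such a series with the Gaussian one of the same variance, up
to five times the sum of the third absolute moments. It remains to compute the variance
asymptotically and to show that the third moments are negligible.

Everything is measured against the weight `w(x) = 1/(1+x²)`, which dominates Schwartz functions up
to a constant, and against `U(S)`, the integral over `[0,S]` of the decay rate `(1 ∨ s)^(-1/α)` of
the semigroup `𝒯_s` on `w`. By the Markov property the third moments of the cell contributions sum
to at most a constant times `S U(S)²`. In each regime `T U(Ta)/F_T²` stays bounded and `U(Ta)/F_T`
tends to zero, so the Lyapunov error vanishes after norming.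

For the variance, let `a(x)` and `A(x)` be the first two moments of the functional of one particle
started at `x`. If all particles of a cell started at the same `x`, conditioning on their number
would give the cell variance `Eθ (A - a²) + Var θ a²`. The true positions matter only through the
oscillation of `a` and `A` over the cell. The derivative of the stable density is `O(1/(1+x²))`, so
these oscillations are summable over the cells, and the total variance is the integral of the
expression above over `x`, up to `O(U²)` (`exists_abs_tsum_variance_sub_le`). The law of the
positions inside a cell therefore plays no role in the limit.

Invariance of Lebesgue measure and self-adjointness of the semigroup reduce the two integrals to `∬
c(|s-u|)` and `∬ c(s+u)`, where `c(r) = ∫ φ 𝒯_r ψ`. With `D` the double primitive of the even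
extension of `c`, these are `D(A)+D(B)-D(A-B)` and `D(A+B)-D(A)-D(B)`. Since `c(r) ~ p_1(0) r^(-1/α)
∫φ ∫ψ`, one has `D(Ta)/F_T² → q(φ,ψ) a^γ`, with `γ = 2 - 1/α` for `α > 1` and `γ = 1` otherwise (for
`α < 1` the primitive of `c` converges to `∫ φ Gψ`). For `γ = 2H` the limits are the covariances
`C^H` and `Q^H`. For `γ = 1` the second combination vanishes, which removes `Var θ`, and the first
gives Brownian covariance.

Convergence in `𝒮'(ℝ)` also needs tightness and Borel measurability. The Schwartz space is separable
and metrizable, polars of neighbourhoods of zero are compact and countably many of them exhaust the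
dual, and the Borel sets of a finite power of the dual are generated by countably many evaluations.
Tightness follows from `|X_T(φ)| ≤ Ξ ‖φ‖` with one random variable `Ξ` of bounded mean: writing
`(1+x²)φ(x)` as the integral of its derivative over `(-∞, x]` expresses every `X_T(φ)` through the
fluctuations of the cut weights `w 1_{[y,∞)}`. -/

theorem abs_le_integral_abs_deriv (g : 𝓢(ℝ, ℝ)) (x : ℝ) : |g x| ≤ ∫ y, |deriv g y| := by
  have hint : Integrable (fun y => deriv g y) := (SchwartzMap.derivCLM ℝ ℝ g).integrable
  have h0 : Tendsto g atBot (𝓝 0) :=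
    g.tendsto_cocompact.mono_left (_root_.atBot_le_cocompact)
  have h1 : ∫ y in Set.Iic x, deriv g y = g x - 0 :=
    integral_Iic_of_hasDerivAt_of_tendsto' (fun y _ => g.hasDerivAt y) hint.integrableOn h0
  rw [sub_zero] at h1
  rw [← h1]
  calc |∫ y in Set.Iic x, deriv g y| ≤ ∫ y in Set.Iic x, |deriv g y| := abs_integral_le_integral_abs
    _ ≤ ∫ y, |deriv g y| :=
      setIntegral_le_integral hint.abs (Eventually.of_forall fun y => abs_nonneg _)

theorem iterate_derivCLM_apply (l : ℕ) (f : 𝓢(ℝ, ℝ)) :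
    (((SchwartzMap.derivCLM ℝ ℝ)^[l] f : 𝓢(ℝ, ℝ)) : ℝ → ℝ) = iteratedDeriv l f := by
  induction l with
  | zero => simp
  | succ l ih =>
    rw [Function.iterate_succ_apply', iteratedDeriv_succ, ← ih]
    rfl

/-- The derivative of `x ↦ x ^ k * f^(l) x` as an element of `L¹`. -/
noncomputable def weightedDeriv (k l : ℕ) : 𝓢(ℝ, ℝ) →L[ℝ] Lp ℝ 1 (volume : Measure ℝ) :=
  (SchwartzMap.toLpCLM ℝ ℝ 1 volume).comp ((SchwartzMap.derivCLM ℝ ℝ).comp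
    ((SchwartzMap.smulLeftCLM ℝ (fun x : ℝ => x ^ k)).comp ((SchwartzMap.derivCLM ℝ ℝ) ^ l)))

/-- The fundamental theorem of calculus bounds a supremum by the `L¹` norm of a derivative. Thus
`L¹` norms generate the Schwartz topology; unlike spaces with a sup norm, `L¹` is readily separable.
-/
theorem seminorm_le_norm_weightedDeriv (k l : ℕ) (f : 𝓢(ℝ, ℝ)) :
    SchwartzMap.seminorm ℝ k l f ≤ ‖weightedDeriv k l f‖ := by
  set g : 𝓢(ℝ, ℝ) := SchwartzMap.smulLeftCLM ℝ (fun x : ℝ => x ^ k)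
    (((SchwartzMap.derivCLM ℝ ℝ) ^ l) f) with hg
  have hgx (x : ℝ) : g x = x ^ k * iteratedDeriv l f x := by
    rw [hg, SchwartzMap.smulLeftCLM_apply_apply (by fun_prop), ← iterate_derivCLM_apply]
    simp
  have hn : ‖weightedDeriv k l f‖ = ∫ y, |deriv g y| := by
    have : weightedDeriv k l f = (SchwartzMap.derivCLM ℝ ℝ g).toLp 1 volume := rfl
    rw [this, SchwartzMap.norm_toLp_one]
    rfl
  refine SchwartzMap.seminorm_le_bound' ℝ k l f (norm_nonneg _) fun x => ?_
  rw [hn]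
  have := abs_le_integral_abs_deriv g x
  rwa [hgx, abs_mul, abs_pow] at this

/-- The maps `weightedDeriv` embed the Schwartz space topologically into a countable product of
copies of `L¹`. That product is second countable, and the property passes to subspaces. -/
instance secondCountable_schwartz : SecondCountableTopology 𝓢(ℝ, ℝ) := by
  let Φ : 𝓢(ℝ, ℝ) →L[ℝ] (ℕ × ℕ → Lp ℝ 1 (volume : Measure ℝ)) :=
    ContinuousLinearMap.pi fun p => weightedDeriv p.1 p.2
  have : IsInducing Φ := by
    -- For topological groups it is enough to compare neighbourhoods of zero: one inclusion is
    -- continuity, the other is the seminorm bound.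
    refine (IsTopologicalAddGroup.isInducing_iff_nhds_zero (f := Φ)).2 (le_antisymm ?_ ?_)
    · exact (Φ.continuous.tendsto' 0 0 (map_zero _)).le_comap
    · have := ((schwartz_withSeminorms ℝ ℝ ℝ).tendsto_nhds (fun f : 𝓢(ℝ, ℝ) => f)
        (f := comap Φ (𝓝 0)) 0).2 ?_
      · exact this
      rintro ⟨k, l⟩ ε hε
      have hc : Tendsto (fun f => ‖Φ f (k, l)‖) (comap Φ (𝓝 0)) (𝓝 0) := by
        have h1 : Tendsto (fun v : ℕ × ℕ → Lp ℝ 1 (volume : Measure ℝ) => ‖v (k, l)‖) (𝓝 0) (𝓝 0) :=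
          Continuous.tendsto' (by fun_prop) _ _ (by simp)
        exact h1.comp tendsto_comap
      filter_upwards [hc.eventually (gt_mem_nhds hε)] with f hf
      rw [sub_zero]
      exact (seminorm_le_norm_weightedDeriv k l f).trans_lt hf
  have : Fact ((1 : ENNReal) ≠ ⊤) := ⟨ENNReal.one_ne_top⟩
  exact IsInducing.secondCountableTopology ‹IsInducing Φ›

/-! ### Weak duals: compact sets and Borel measurability -/

section Dual

variable {E : Type*} [AddCommGroup E] [Module ℝ E] [TopologicalSpace E]

/-- Tuples of functionals bounded by one on a set. -/
def polarTuple (ι : Type*) (V : Set E) : Set (ι → E →Lₚₜ[ℝ] ℝ) :=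
  {u | ∀ i, ∀ x ∈ V, |u i x| ≤ 1}

theorem continuous_eval_tuple {ι : Type*} (i : ι) (x : E) :
    Continuous fun u : ι → E →Lₚₜ[ℝ] ℝ => u i x :=
  (ContinuousEvalConst.continuous_eval_const x).comp (continuous_apply i)

theorem isInducing_eval_tuple (ι : Type*) :
    IsInducing fun (u : ι → E →Lₚₜ[ℝ] ℝ) (i : ι) (x : E) => u i x :=
  IsInducing.piMap fun _ => (PointwiseConvergenceCLM.isEmbedding_coeFn (RingHom.id ℝ) E ℝ).isInducing

variable [IsTopologicalAddGroup E] [ContinuousSMul ℝ E]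

theorem continuous_of_abs_le_one {V : Set E} (hV : V ∈ 𝓝 0) (f : E →ₗ[ℝ] ℝ)
    (hf : ∀ x ∈ V, |f x| ≤ 1) : Continuous f := by
  refine continuous_of_continuousAt_zero f ?_
  rw [ContinuousAt, map_zero, Metric.tendsto_nhds]
  intro ε hε
  have h2 : (0 : ℝ) < ε / 2 := by positivity
  have : Tendsto (fun x : E => (ε / 2)⁻¹ • x) (𝓝 0) (𝓝 0) :=
    Continuous.tendsto' (by fun_prop) _ _ (by simp)
  filter_upwards [this hV] with x hx
  have := hf _ hx
  rw [map_smul, smul_eq_mul, abs_mul, abs_inv, abs_of_pos h2, inv_mul_le_iff₀ h2] at this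
  rw [dist_zero_right, Real.norm_eq_abs]
  linarith

/-- Banach–Alaoglu. Each `x` is absorbed by `V`, so the polar lies in a product of compact
intervals. It is closed there, because a pointwise limit is linear and bounded by one on `V`, hence
continuous. -/
theorem isCompact_polarTuple (ι : Type*) {V : Set E} (hV : V ∈ 𝓝 0) :
    IsCompact (polarTuple ι V) := by
  have habs (x : E) : ∃ c : ℝ, 0 < c ∧ c⁻¹ • x ∈ V := by
    have : Tendsto (fun n : ℝ => n⁻¹ • x) atTop (𝓝 ((0 : ℝ) • x)) :=
      (tendsto_inv_atTop_zero).smul_const x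
    rw [zero_smul] at this
    obtain ⟨n, hn, hn'⟩ := ((this.eventually_mem hV).and (eventually_gt_atTop 0)).exists
    exact ⟨n, hn', hn⟩
  choose c hc hcV using habs
  rw [(isInducing_eval_tuple ι).isCompact_iff]
  have hcomp : IsCompact (Set.univ.pi fun _ : ι => Set.univ.pi fun x : E => Set.Icc (-c x) (c x)) :=
    isCompact_univ_pi fun _ => isCompact_univ_pi fun x => isCompact_Icc
  refine hcomp.of_isClosed_subset ?_ ?_
  · have : (fun (u : ι → E →Lₚₜ[ℝ] ℝ) (i : ι) (x : E) => u i x) '' polarTuple ι V =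
        {f | (∀ i x y, f i (x + y) = f i x + f i y) ∧ (∀ i (r : ℝ) x, f i (r • x) = r * f i x) ∧
          ∀ i, ∀ x ∈ V, |f i x| ≤ 1} := by
      ext f
      constructor
      · rintro ⟨u, hu, rfl⟩
        exact ⟨fun i x y => map_add (u i) x y, fun i r x => map_smul (u i) r x, hu⟩
      · rintro ⟨h1, h2, h3⟩
        let L (i : ι) : E →ₗ[ℝ] ℝ :=
          { toFun := f i, map_add' := h1 i, map_smul' := h2 i }
        refine ⟨fun i => (⟨L i, continuous_of_abs_le_one hV (L i) (h3 i)⟩ : E →L[ℝ] ℝ), ?_, rfl⟩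
        exact h3
    rw [this]
    have hx (i : ι) (x : E) : Continuous fun f : ι → E → ℝ => f i x := by fun_prop
    simp only [Set.ofPred_and, Set.ofPred_forall]
    refine ((isClosed_iInter fun i => isClosed_iInter fun x => isClosed_iInter fun y =>
      isClosed_eq (hx _ _) ((hx _ _).add (hx _ _))).inter
      ((isClosed_iInter fun i => isClosed_iInter fun r => isClosed_iInter fun x =>
      isClosed_eq (hx _ _) (continuous_const.mul (hx _ _))).inter ?_))
    exact isClosed_iInter fun i => isClosed_iInter fun x => isClosed_iInter fun _ =>
      isClosed_le (hx _ _).abs continuous_const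
  · rintro _ ⟨u, hu, rfl⟩ i _ x _
    have := hu i _ (hcV x)
    rw [map_smul, smul_eq_mul, abs_mul, abs_inv, abs_of_pos (hc x), inv_mul_le_iff₀ (hc x)] at this
    rw [mul_one] at this
    exact abs_le.1 this

-- A continuous functional is bounded by one near zero, so the polars of a countable basis exhaust
-- the dual. This σ-compactness serves the description of the Borel sets and the tightness of a
-- single law.
omit [IsTopologicalAddGroup E] [ContinuousSMul ℝ E] in
theorem exists_mem_polarTuple {ι : Type*} [Finite ι] {V : ℕ → Set E}
    (hV : (𝓝 (0 : E)).HasAntitoneBasis V) (u : ι → E →Lₚₜ[ℝ] ℝ) : ∃ n, u ∈ polarTuple ι (V n) := by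
  have : ∀ᶠ x in 𝓝 (0 : E), ∀ i, |u i x| ≤ 1 := by
    rw [eventually_all]
    intro i
    have h : Tendsto (fun x => |u i x|) (𝓝 0) (𝓝 0) :=
      ((u i).continuous.abs).tendsto' _ _ (by
        have h0 : u i 0 = 0 := map_zero (u i)
        exact abs_eq_zero.2 h0)
    filter_upwards [h.eventually (gt_mem_nhds one_pos)] with x hx using hx.le
  obtain ⟨n, hn⟩ := hV.mem_iff.1 this
  exact ⟨n, fun i x hx => hn hx i⟩

omit [IsTopologicalAddGroup E] [ContinuousSMul ℝ E] in
theorem polarTuple_anti (ι : Type*) {V W : Set E} (h : V ⊆ W) :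
    polarTuple ι W ⊆ polarTuple ι V := fun _ hu i x hx => hu i x (h hx)

omit [IsTopologicalAddGroup E] [ContinuousSMul ℝ E] in
theorem isClosed_polarTuple (ι : Type*) (V : Set E) : IsClosed (polarTuple ι V) := by
  simp only [polarTuple, Set.ofPred_forall]
  exact isClosed_iInter fun i => isClosed_iInter fun x => isClosed_iInter fun _ =>
    isClosed_le (continuous_eval_tuple i x).abs continuous_const

variable [FirstCountableTopology E] [TopologicalSpace.SeparableSpace E]

open TopologicalSpace in
/-- The Borel σ-algebra of a finite power of the weak dual is generated by countably many
evaluations. -/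
theorem borel_tuple_le (ι : Type*) [Finite ι] :
    borel (ι → E →Lₚₜ[ℝ] ℝ) ≤ MeasurableSpace.comap
      (fun u (p : ι × ℕ) => u p.1 (denseSeq E p.2)) inferInstance := by
  set J : (ι → E →Lₚₜ[ℝ] ℝ) → (ι × ℕ → ℝ) := fun u p => u p.1 (denseSeq E p.2) with hJ
  let _ : MeasurableSpace (ι → E →Lₚₜ[ℝ] ℝ) := MeasurableSpace.comap J inferInstance
  have hJm : Measurable J := comap_measurable J
  have hJc : Continuous J := continuous_pi fun p => continuous_eval_tuple _ _
  have hJinj : Function.Injective J := by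
    intro u v huv
    funext i
    refine DFunLike.coe_injective ?_
    refine (denseRange_denseSeq E).equalizer (u i).continuous (v i).continuous ?_
    funext n
    exact congrFun huv (i, n)
  obtain ⟨V₀, hV₀⟩ := (𝓝 (0 : E)).exists_antitone_basis
  -- Open neighbourhoods are used so that the dense sequence is dense in `V n`; then countably many
  -- evaluations decide membership in the polar.
  let V (n : ℕ) : Set E := interior (V₀ n)
  have hV : (𝓝 (0 : E)).HasAntitoneBasis V := by
    refine ⟨⟨fun t => ?_⟩, fun m n hmn => interior_mono (hV₀.antitone hmn)⟩
    constructor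
    · intro ht
      obtain ⟨n, hn⟩ := hV₀.mem_iff.1 ht
      exact ⟨n, trivial, interior_subset.trans hn⟩
    · rintro ⟨n, -, hn⟩
      exact mem_of_superset (interior_mem_nhds.2 (hV₀.mem n)) hn
  have hK (n : ℕ) : MeasurableSet (polarTuple ι (V n)) := by
    have : polarTuple ι (V n) =
        ⋂ i, ⋂ k, {u | denseSeq E k ∈ V n → |J u (i, k)| ≤ 1} := by
      ext u
      simp only [Set.mem_iInter]
      constructor
      · intro hu i k hk
        exact hu i _ hk
      · intro hu i x hx
        have hcl : x ∈ closure (V n ∩ Set.range (denseSeq E)) :=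
          (denseRange_denseSeq E).open_subset_closure_inter isOpen_interior hx
        have hclosed : IsClosed {x : E | |u i x| ≤ 1} :=
          isClosed_le (u i).continuous.abs continuous_const
        refine closure_minimal ?_ hclosed hcl
        rintro _ ⟨hk, k, rfl⟩
        exact hu i k hk
    rw [this]
    refine MeasurableSet.iInter fun i => MeasurableSet.iInter fun k => ?_
    by_cases h : denseSeq E k ∈ V n
    · simp only [h, true_imp_iff]
      have : Measurable fun u => |J u (i, k)| := (((measurable_pi_apply (i, k)).comp hJm)).abs
      exact measurableSet_le this measurable_const
    · simp [h]
  refine MeasurableSpace.generateFrom_le fun O hO => ?_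
  -- An open set is the union of its traces on the compact polars. On a compact set the continuous
  -- injection `J` is a closed embedding, so each trace is the trace of the `J`-preimage of an open
  -- set.
  have hOU : O = ⋃ n, O ∩ polarTuple ι (V n) := by
    rw [← Set.inter_iUnion, Set.iUnion_eq_univ_iff.2 (exists_mem_polarTuple hV), Set.inter_univ]
  rw [hOU]
  refine MeasurableSet.iUnion fun n => ?_
  have hcomp := isCompact_polarTuple ι (hV.mem n)
  have := isCompact_iff_compactSpace.1 hcomp
  have hemb : IsClosedEmbedding fun u : polarTuple ι (V n) => J u :=
    (hJc.comp continuous_subtype_val).isClosedEmbedding (hJinj.comp Subtype.val_injective)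
  obtain ⟨G, hG, hGO⟩ := hemb.isInducing.isOpen_iff.1 ((show IsOpen O from hO).preimage continuous_subtype_val :
    IsOpen ((↑) ⁻¹' O : Set (polarTuple ι (V n))))
  have : O ∩ polarTuple ι (V n) = J ⁻¹' G ∩ polarTuple ι (V n) := by
    ext u
    refine and_congr_left fun hu => ?_
    exact (Set.ext_iff.1 hGO ⟨u, hu⟩).symm
  rw [this]
  exact (hJm hG.measurableSet).inter (hK n)

open TopologicalSpace in
/-- A map into a finite power of the weak dual is a.e. measurable if its evaluations are. -/
theorem aemeasurable_tuple {ι Ω : Type*} [Finite ι] [MeasurableSpace Ω] {P : Measure Ω}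
    [MeasurableSpace (ι → E →Lₚₜ[ℝ] ℝ)] [BorelSpace (ι → E →Lₚₜ[ℝ] ℝ)]
    {X : Ω → ι → E →Lₚₜ[ℝ] ℝ} (hX : ∀ i x, AEMeasurable (fun ω => X ω i x) P) :
    AEMeasurable X P := by
  set J : (ι → E →Lₚₜ[ℝ] ℝ) → (ι × ℕ → ℝ) := fun u p => u p.1 (denseSeq E p.2) with hJ
  have hJX : AEMeasurable (fun ω => J (X ω)) P := aemeasurable_pi_iff.2 fun p => hX _ _
  set N := toMeasurable P {ω | ¬ J (X ω) = hJX.mk _ ω} with hN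
  have hN0 : P N = 0 := by
    rw [hN, measure_toMeasurable]
    exact hJX.ae_eq_mk
  have hNm : MeasurableSet N := measurableSet_toMeasurable _ _
  classical
  -- Off the measurable null set `N` the countably many evaluations agree with a measurable version;
  -- on `N` the map is replaced by `0`, whose evaluations are constant.
  refine ⟨N.piecewise (fun _ => 0) X, ?_, ?_⟩
  · have key : Measurable[_, MeasurableSpace.comap J inferInstance] (N.piecewise (fun _ => 0) X) := by
      rw [measurable_comap_iff]
      have : J ∘ N.piecewise (fun _ => 0) X = N.piecewise (fun _ => 0) (hJX.mk _) := by
        funext ω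
        by_cases hω : ω ∈ N
        · simp only [Function.comp_apply, Set.piecewise_eq_of_mem _ _ _ hω]
          rfl
        · simp only [Function.comp_apply, Set.piecewise_eq_of_notMem _ _ _ hω]
          by_contra hne
          exact hω (subset_toMeasurable _ _ hne)
      rw [this]
      exact measurable_const.piecewise hNm hJX.measurable_mk
    have hb : ‹MeasurableSpace (ι → E →Lₚₜ[ℝ] ℝ)› ≤ MeasurableSpace.comap J inferInstance := by
      rw [BorelSpace.measurable_eq (α := ι → E →Lₚₜ[ℝ] ℝ)]
      exact borel_tuple_le ι
    exact key.mono le_rfl hb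
  · refine measure_mono_null (fun ω hω => ?_) hN0
    by_contra hn
    exact hω (Set.piecewise_eq_of_notMem _ _ _ hn).symm

end Dual

/-! ### A criterion for weak convergence -/

theorem integral_sub_abs_le {B : Type*} [TopologicalSpace B] [MeasurableSpace B] [BorelSpace B]
    (f g : B →ᵇ ℝ) {K : Set B} (hK : MeasurableSet K) {ε M : ℝ} (hε : 0 ≤ ε)
    (hf : ∀ u, |f u| ≤ M) (hg : ∀ u, |g u| ≤ M) (hfg : ∀ u ∈ K, |f u - g u| ≤ ε)
    (μ : Measure B) [IsProbabilityMeasure μ] :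
    |∫ u, f u ∂μ - ∫ u, g u ∂μ| ≤ ε + 2 * M * (μ Kᶜ).toReal := by
  rw [← integral_sub (f.integrable μ) (g.integrable μ)]
  have hi : Integrable (fun u => |f u - g u|) μ := ((f - g).integrable μ).abs
  have hM : 0 ≤ M := by
    obtain ⟨u, -⟩ := nonempty_of_measure_ne_zero (μ := μ) (s := Set.univ) (by simp)
    exact (abs_nonneg _).trans (hf u)
  calc |∫ u, f u - g u ∂μ| ≤ ∫ u, |f u - g u| ∂μ := abs_integral_le_integral_abs
    _ ≤ ∫ u, (ε + Kᶜ.indicator (fun _ => 2 * M) u) ∂μ := by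
        refine integral_mono hi ((integrable_const _).add
          ((integrable_const _).indicator hK.compl)) fun u => ?_
        by_cases hu : u ∈ K
        · simpa [hu] using hfg u hu
        · have h1 := abs_sub (f u) (g u)
          have := hf u
          have := hg u
          simp only [Set.mem_compl_iff, hu, not_false_eq_true, Set.indicator_of_mem]
          linarith
    _ = ε + 2 * M * (μ Kᶜ).toReal := by
        rw [integral_add (integrable_const _) ((integrable_const _).indicator hK.compl),
          integral_indicator_const _ hK.compl]
        simp [Measure.real, mul_comm]

/-- Weak convergence from tightness and weak convergence of finite-dimensional projections along a
separating family of continuous functions. -/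
theorem tendsto_probabilityMeasure_of_projections {B A ι : Type*} [TopologicalSpace B] [T2Space B]
    [MeasurableSpace B] [BorelSpace B] (e : A → C(B, ℝ))
    (sep : ∀ u v, (∀ a, e a u = e a v) → u = v) {l : Filter ι} {μ : ι → ProbabilityMeasure B}
    {μ₀ : ProbabilityMeasure B}
    (tight : ∀ ε : ℝ, 0 < ε → ∃ K, IsCompact K ∧ (∀ᶠ n in l, ((μ n : Measure B) Kᶜ).toReal ≤ ε) ∧
      ((μ₀ : Measure B) Kᶜ).toReal ≤ ε)
    (hfin : ∀ (s : Finset A) (h : (s → ℝ) →ᵇ ℝ),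
      Tendsto (fun n => ∫ u, h (fun a => e a u) ∂(μ n : Measure B)) l
        (𝓝 (∫ u, h (fun a => e a u) ∂(μ₀ : Measure B)))) :
    Tendsto μ l (𝓝 μ₀) := by
  rw [ProbabilityMeasure.tendsto_iff_forall_integral_tendsto]
  intro f
  rw [Metric.tendsto_nhds]
  intro ε' hε'
  set M := ‖f‖ + 1 with hM
  have hM0 : 0 < M := by positivity
  have hfM (u : B) : |f u| ≤ M := (f.norm_coe_le_norm u).trans (by linarith)
  -- With this choice each of the two comparisons of `f` and `G` costs at most `ε'/8 + ε'/8`, which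
  -- together with `ε'/4` for `G` itself stays below `ε'`.
  set ε : ℝ := min (ε' / 8) (ε' / (16 * M)) with hε
  have hε0 : 0 < ε := by positivity
  have hε1 : ε ≤ ε' / 8 := min_le_left _ _
  have hε2 : 2 * M * ε ≤ ε' / 8 := by
    calc 2 * M * ε ≤ 2 * M * (ε' / (16 * M)) := by gcongr; exact min_le_right _ _
      _ = ε' / 8 := by field_simp; norm_num
  obtain ⟨K, hKc, hKn, hK0⟩ := tight ε hε0
  have hKm : MeasurableSet K := hKc.isClosed.measurableSet
  have := isCompact_iff_compactSpace.1 hKc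
  let r (a : A) : C(K, ℝ) := (e a).restrict K
  have hsep : (Algebra.adjoin ℝ (Set.range r)).SeparatesPoints := by
    intro u v huv
    have : ∃ a, e a u ≠ e a v := by
      by_contra! h
      exact huv (Subtype.ext (sep _ _ h))
    obtain ⟨a, ha⟩ := this
    exact ⟨r a, ⟨r a, Algebra.subset_adjoin ⟨a, rfl⟩, rfl⟩, ha⟩
  -- Stone–Weierstrass on the compact `K`: a polynomial in finitely many projections approximates
  -- `f` there.
  obtain ⟨g, hg⟩ := ContinuousMap.exists_mem_subalgebra_near_continuousMap_of_separatesPoints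
    (Algebra.adjoin ℝ (Set.range r)) hsep ((f : C(B, ℝ)).restrict K) ε hε0
  obtain ⟨g, hgmem⟩ := g
  obtain ⟨p, hp⟩ : g ∈ (MvPolynomial.aeval (R := ℝ) r).range := by
    rwa [← Algebra.adjoin_range_eq_range_aeval]
  replace hp : MvPolynomial.aeval r p = g := hp
  obtain ⟨s, q, rfl⟩ := MvPolynomial.exists_finset_rename p
  have hgq (u : K) : g u = MvPolynomial.eval (fun a : s => e a u) q := by
    rw [← hp]
    have h2 : (ContinuousMap.evalAlgHom ℝ ℝ u : C(K, ℝ) →ₐ[ℝ] ℝ)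
      (MvPolynomial.aeval r (MvPolynomial.rename (↑) q)) =
      MvPolynomial.eval (fun a : s => e a u) q := by
      rw [MvPolynomial.comp_aeval_apply, MvPolynomial.aeval_rename, MvPolynomial.aeval_eq_eval]
      rfl
    exact h2
  -- Truncation at `±M` makes the polynomial bounded. It fixes `f` and is 1-Lipschitz, so the
  -- approximation on `K` survives.
  let h : (s → ℝ) →ᵇ ℝ := BoundedContinuousFunction.ofNormedAddCommGroup
    (fun y => max (-M) (min M (MvPolynomial.eval y q)))
    (continuous_const.max (continuous_const.min (MvPolynomial.continuous_eval q))) M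
    (fun y => by
      rw [Real.norm_eq_abs, abs_le]
      exact ⟨le_max_left _ _, max_le (by linarith) (min_le_left _ _)⟩)
  let G : B →ᵇ ℝ := h.compContinuous ⟨fun u (a : s) => e a u, by fun_prop⟩
  have hGM (u : B) : |G u| ≤ M := by
    rw [abs_le]
    exact ⟨le_max_left _ _, max_le (by linarith) (min_le_left _ _)⟩
  have hfG (u : B) (hu : u ∈ K) : |f u - G u| ≤ ε := by
    have h1 : |g ⟨u, hu⟩ - f u| ≤ ε := by
      have := (ContinuousMap.norm_coe_le_norm _ (⟨u, hu⟩ : K)).trans hg.le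
      simpa using this
    rw [hgq] at h1
    have h2 := abs_le.1 (hfM u)
    have h3 : f u = max (-M) (min M (f u)) := by
      rw [min_eq_right h2.2, max_eq_right h2.1]
    rw [h3, abs_sub_comm]
    refine (abs_max_sub_max_le_max _ _ _ _).trans ?_
    rw [sub_self, abs_zero]
    refine max_le hε0.le ((abs_min_sub_min_le_max _ _ _ _).trans ?_)
    rw [sub_self, abs_zero]
    exact max_le hε0.le h1
  have hlim := (Metric.tendsto_nhds.1 (hfin s h)) (ε' / 4) (by positivity)
  filter_upwards [hKn, hlim] with n hn hn'
  have a1 := integral_sub_abs_le f G hKm hε0.le hfM hGM hfG (μ n : Measure B)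
  have a2 := integral_sub_abs_le f G hKm hε0.le hfM hGM hfG (μ₀ : Measure B)
  have a3 : 2 * M * ((μ n : Measure B) Kᶜ).toReal ≤ ε' / 8 := le_trans (by gcongr) hε2
  have a4 : 2 * M * ((μ₀ : Measure B) Kᶜ).toReal ≤ ε' / 8 := le_trans (by gcongr) hε2
  have a5 : |∫ u, G u ∂(μ n : Measure B) - ∫ u, G u ∂(μ₀ : Measure B)| < ε' / 4 := hn'
  rw [Real.dist_eq]
  rw [abs_lt] at a5 ⊢
  rw [abs_le] at a1 a2
  constructor <;> linarith [a1.1, a1.2, a2.1, a2.2, a5.1, a5.2]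

theorem charFun_map_toLp {Ω s : Type*} [Fintype s] [MeasurableSpace Ω] {Q : Measure Ω}
    {Z : Ω → s → ℝ} {t : EuclideanSpace ℝ s}
    (hZ : AEMeasurable (fun ω => (WithLp.toLp 2 (Z ω) : EuclideanSpace ℝ s)) Q) :
    charFun (Q.map (fun ω => (WithLp.toLp 2 (Z ω) : EuclideanSpace ℝ s))) t =
      ∫ ω, Complex.exp ((∑ a, t a * Z ω a : ℝ) * Complex.I) ∂Q := by
  rw [charFun_apply, integral_map hZ (by fun_prop)]
  simp [PiLp.inner_apply]

theorem integral_map_toLp {Ω s : Type*} [Fintype s] [MeasurableSpace Ω] {Q : Measure Ω}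
    (f : (s → ℝ) →ᵇ ℝ) {Z : Ω → s → ℝ}
    (hZ : AEMeasurable (fun ω => (WithLp.toLp 2 (Z ω) : EuclideanSpace ℝ s)) Q) :
    ∫ x, f x.ofLp ∂(Q.map (fun ω => (WithLp.toLp 2 (Z ω) : EuclideanSpace ℝ s))) =
      ∫ ω, f (Z ω) ∂Q := by
  rw [integral_map hZ]
  exact (f.continuous.comp (by fun_prop)).aestronglyMeasurable

/-- Finite-dimensional weak convergence from convergence of characteristic functions. -/
theorem tendsto_integral_of_tendsto_charFun {ι : Type*} {l : Filter ι} [l.IsCountablyGenerated]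
    {Ω Ω' : Type*} [MeasurableSpace Ω] [MeasurableSpace Ω'] {P : Measure Ω} {P' : Measure Ω'}
    [IsProbabilityMeasure P] [IsProbabilityMeasure P'] {s : Type*} [Fintype s]
    {X : ι → Ω → s → ℝ} {Y : Ω' → s → ℝ} (hX : ∀ n, AEMeasurable (X n) P) (hY : AEMeasurable Y P')
    (h : ∀ c : s → ℝ, Tendsto (fun n => ∫ ω, Complex.exp ((∑ a, c a * X n ω a : ℝ) * Complex.I) ∂P)
      l (𝓝 (∫ ω, Complex.exp ((∑ a, c a * Y ω a : ℝ) * Complex.I) ∂P')))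
    (f : (s → ℝ) →ᵇ ℝ) :
    Tendsto (fun n => ∫ ω, f (X n ω) ∂P) l (𝓝 (∫ ω, f (Y ω) ∂P')) := by
  -- Lévy's continuity theorem is applied along sequences of parameters, after a change to the
  -- Euclidean norm that characteristic functions require.
  refine tendsto_of_seq_tendsto fun k hk => ?_
  have hm : Measurable (WithLp.toLp 2 : (s → ℝ) → EuclideanSpace ℝ s) := by fun_prop
  have hX' (n : ι) : AEMeasurable (fun ω => (WithLp.toLp 2 (X n ω) : EuclideanSpace ℝ s)) P :=
    hm.comp_aemeasurable (hX n)
  have hY' : AEMeasurable (fun ω => (WithLp.toLp 2 (Y ω) : EuclideanSpace ℝ s)) P' :=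
    hm.comp_aemeasurable hY
  let μ (n : ℕ) : ProbabilityMeasure (EuclideanSpace ℝ s) :=
    ⟨P.map (fun ω => WithLp.toLp 2 (X (k n) ω)), Measure.isProbabilityMeasure_map (hX' _)⟩
  let μ₀ : ProbabilityMeasure (EuclideanSpace ℝ s) :=
    ⟨P'.map (fun ω => WithLp.toLp 2 (Y ω)), Measure.isProbabilityMeasure_map hY'⟩
  have hμ : Tendsto μ atTop (𝓝 μ₀) := by
    refine ProbabilityMeasure.tendsto_of_tendsto_charFun fun t => ?_
    have h1 := (h (fun a => t a)).comp hk
    rw [← charFun_map_toLp hY'] at h1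
    refine h1.congr fun n => ?_
    exact (charFun_map_toLp (hX' (k n))).symm
  have := (ProbabilityMeasure.tendsto_iff_forall_integral_tendsto.1 hμ)
    (f.compContinuous ⟨WithLp.ofLp, by fun_prop⟩)
  rw [← integral_map_toLp f hY']
  refine this.congr fun n => ?_
  exact integral_map_toLp f (hX' (k n))

/-- Convergence of finite-dimensional distributions in `𝒮'(ℝ)` from convergence of characteristic
functions and equicontinuity in probability. -/
theorem tendstoFDD_of_charFun {Ω Ω' : Type*} [MeasurableSpace Ω] [MeasurableSpace Ω']
    {X : ℝ → ℝ≥0 → Ω → TemperedDist} {P : Measure Ω} [IsProbabilityMeasure P]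
    {Y : ℝ≥0 → Ω' → TemperedDist} {P' : Measure Ω'} [IsProbabilityMeasure P']
    (hX : ∀ T t φ, AEMeasurable (fun ω => X T t ω φ) P)
    (hY : ∀ t φ, AEMeasurable (fun ω => Y t ω φ) P')
    (tight : ∀ t, ∃ (q : 𝓢(ℝ, ℝ) → ℝ) (C : ℝ), Tendsto q (𝓝 0) (𝓝 0) ∧ ∀ᶠ T in atTop,
      ∃ Ξ : Ω → ℝ, Integrable Ξ P ∧ 0 ≤ Ξ ∧ ∫ ω, Ξ ω ∂P ≤ C ∧ ∀ᵐ ω ∂P, ∀ φ, |X T t ω φ| ≤ Ξ ω * q φ)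
    (hchar : ∀ (m : ℕ) (t : Fin m → ℝ≥0) (ψ : Fin m → 𝓢(ℝ, ℝ)),
      Tendsto (fun T => ∫ ω, Complex.exp ((∑ i, X T (t i) ω (ψ i) : ℝ) * Complex.I) ∂P) atTop
        (𝓝 (∫ ω, Complex.exp ((∑ i, Y (t i) ω (ψ i) : ℝ) * Complex.I) ∂P'))) :
    TendstoFDD X P Y P' := by
  intro m t
  let _ : MeasurableSpace (Fin m → TemperedDist) := borel _
  have _ : BorelSpace (Fin m → TemperedDist) := ⟨rfl⟩
  have hXm (T : ℝ) : AEMeasurable (fun ω (i : Fin m) => X T (t i) ω) P :=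
    aemeasurable_tuple fun i φ => hX T (t i) φ
  have hYm : AEMeasurable (fun ω (i : Fin m) => Y (t i) ω) P' :=
    aemeasurable_tuple fun i φ => hY (t i) φ
  refine ⟨hXm, hYm, ?_⟩
  let e (a : Fin m × 𝓢(ℝ, ℝ)) : C(Fin m → TemperedDist, ℝ) :=
    ⟨fun u => u a.1 a.2, continuous_eval_tuple _ _⟩
  refine tendsto_probabilityMeasure_of_projections e ?_ ?_ ?_
  · intro u v h
    funext i
    exact DFunLike.ext _ _ fun φ => h (i, φ)
  · intro ε hε
    obtain ⟨V, hV⟩ := (𝓝 (0 : 𝓢(ℝ, ℝ))).exists_antitone_basis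
    let K (n : ℕ) : Set (Fin m → TemperedDist) := polarTuple (Fin m) (V n)
    have hKmono : Monotone K := fun a b hab => polarTuple_anti _ (hV.antitone hab)
    have hKm (n : ℕ) : MeasurableSet (K n) := (isClosed_polarTuple _ _).measurableSet
    have h0 : ∀ᶠ n in atTop, ((P'.map (fun ω (i : Fin m) => Y (t i) ω)) (K n)ᶜ).toReal ≤ ε := by
      have _ : IsProbabilityMeasure (P'.map (fun ω (i : Fin m) => Y (t i) ω)) :=
        Measure.isProbabilityMeasure_map hYm
      have h1 : Tendsto (fun n => (P'.map (fun ω (i : Fin m) => Y (t i) ω)) (K n)ᶜ) atTop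
          (𝓝 ((P'.map (fun ω (i : Fin m) => Y (t i) ω)) (⋂ n, (K n)ᶜ))) :=
        tendsto_measure_iInter_atTop (fun n => (hKm n).compl.nullMeasurableSet)
          (fun a b hab => Set.compl_subset_compl.2 (hKmono hab)) ⟨0, measure_ne_top _ _⟩
      have h2 : ⋂ n, (K n)ᶜ = ∅ := by
        rw [← Set.compl_iUnion, Set.compl_empty_iff, Set.iUnion_eq_univ_iff]
        exact exists_mem_polarTuple hV
      rw [h2, measure_empty] at h1
      have h3 := (ENNReal.tendsto_toReal ENNReal.zero_ne_top).comp h1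
      exact (h3.eventually (gt_mem_nhds (by simpa using hε))).mono fun n hn => hn.le
    -- The limit law charges some polar almost fully by exhaustion. For the approximating laws, `Ξ <
    -- R` together with `q ≤ 1/R` on `V n` forces membership in the polar, and Markov's inequality
    -- bounds the probability that `R ≤ Ξ`.
    choose q C hq hC using fun i => tight (t i)
    have hδ : 0 < ε / (m + 1) := by positivity
    obtain ⟨R, hR0, hR⟩ : ∃ R : ℝ, 0 < R ∧ ∀ i, C i / R ≤ ε / (m + 1) := by
      have : ∀ᶠ R : ℝ in atTop, ∀ i, C i / R ≤ ε / (m + 1) := by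
        rw [eventually_all]
        intro i
        exact ((tendsto_const_nhds.div_atTop tendsto_id).eventually (gt_mem_nhds hδ)).mono
          fun _ h => h.le
      obtain ⟨R, h1, h2⟩ := ((eventually_gt_atTop 0).and this).exists
      exact ⟨R, h1, h2⟩
    have h1 : ∀ᶠ n in atTop, ∀ i, ∀ φ ∈ V n, q i φ ≤ R⁻¹ := by
      rw [eventually_all]
      intro i
      obtain ⟨n, hn⟩ := hV.mem_iff.1 ((hq i).eventually (gt_mem_nhds (inv_pos.2 hR0)))
      filter_upwards [eventually_ge_atTop n] with k hk φ hφ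
      exact (hn (hV.antitone hk hφ) : q i φ < R⁻¹).le
    obtain ⟨n, hn0, hn1⟩ := (h0.and h1).exists
    refine ⟨K n, isCompact_polarTuple _ (hV.mem n), ?_, hn0⟩
    have hall : ∀ᶠ T in atTop, ∀ i, ∃ Ξ : Ω → ℝ, Integrable Ξ P ∧ 0 ≤ Ξ ∧ ∫ ω, Ξ ω ∂P ≤ C i ∧
        ∀ᵐ ω ∂P, ∀ φ, |X T (t i) ω φ| ≤ Ξ ω * q i φ := eventually_all.2 hC
    filter_upwards [hall] with T hT
    choose Ξ hΞi hΞ0 hΞC hΞ using hT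
    change ((P.map (fun ω (i : Fin m) => X T (t i) ω)) (K n)ᶜ).toReal ≤ ε
    rw [Measure.map_apply_of_aemeasurable (hXm T) (hKm n).compl]
    have hsub : P ((fun ω (i : Fin m) => X T (t i) ω) ⁻¹' (K n)ᶜ) ≤
        P (⋃ i, {ω | R ≤ Ξ i ω}) := by
      refine measure_mono_ae ?_
      filter_upwards [ae_all_iff.2 hΞ] with ω hω hmem
      change ω ∈ ⋃ i, {ω | R ≤ Ξ i ω}
      by_contra hcon
      simp only [Set.mem_iUnion, not_exists] at hcon
      refine hmem fun i φ hφ => (hω i φ).trans ?_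
      have h2 : Ξ i ω < R := lt_of_not_ge (hcon i)
      have h3 := hn1 i φ hφ
      have h4 : 0 ≤ Ξ i ω := hΞ0 i ω
      calc Ξ i ω * q i φ ≤ Ξ i ω * R⁻¹ := by gcongr
        _ ≤ R * R⁻¹ := by gcongr
        _ = 1 := mul_inv_cancel₀ hR0.ne'
    have hmarkov (i : Fin m) : (P {ω | R ≤ Ξ i ω}).toReal ≤ ε / (m + 1) := by
      refine le_trans ?_ (hR i)
      rw [le_div_iff₀ hR0, mul_comm]
      exact (mul_meas_ge_le_integral_of_nonneg (Eventually.of_forall (hΞ0 i)) (hΞi i) R).trans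
        (hΞC i)
    calc _ ≤ (P (⋃ i, {ω | R ≤ Ξ i ω})).toReal := ENNReal.toReal_mono (measure_ne_top _ _) hsub
      _ ≤ ∑ i, (P {ω | R ≤ Ξ i ω}).toReal := measureReal_iUnion_fintype_le _
      _ ≤ ∑ _i : Fin m, ε / (m + 1) := Finset.sum_le_sum fun i _ => hmarkov i
      _ = m * (ε / (m + 1)) := by simp
      _ ≤ ε := by
        rw [mul_div_assoc', div_le_iff₀ (by positivity)]
        nlinarith
  · intro s h
    have key := tendsto_integral_of_tendsto_charFun (l := (atTop : Filter ℝ)) (P := P) (P' := P')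
      (s := s) (X := fun T ω a => X T (t a.1.1) ω a.1.2) (Y := fun ω a => Y (t a.1.1) ω a.1.2)
      (fun T => aemeasurable_pi_iff.2 fun a => hX _ _ _)
      (aemeasurable_pi_iff.2 fun a => hY _ _) ?_ h
    · have hcyl : Continuous fun u : Fin m → TemperedDist => h fun a : s => e a u := by fun_prop
      have e1 (T : ℝ) : ∫ u, h (fun a : s => e a u) ∂(P.map (fun ω (i : Fin m) => X T (t i) ω)) =
          ∫ ω, h (fun a => X T (t a.1.1) ω a.1.2) ∂P :=
        integral_map (hXm T) hcyl.aestronglyMeasurable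
      have e2 : ∫ u, h (fun a : s => e a u) ∂(P'.map (fun ω (i : Fin m) => Y (t i) ω)) =
          ∫ ω, h (fun a => Y (t a.1.1) ω a.1.2) ∂P' :=
        integral_map hYm hcyl.aestronglyMeasurable
      simp only [ProbabilityMeasure.coe_mk]
      rw [e2]
      exact key.congr fun T => (e1 T).symm
    · intro c
      -- A linear combination of finitely many evaluations is regrouped into one test function per
      -- time, so that the hypothesis on characteristic functions applies.
      have hsum (u : Fin m → TemperedDist) : ∑ a : s, c a * u a.1.1 a.1.2 =
          ∑ i, u i (∑ a : s, if a.1.1 = i then c a • a.1.2 else 0) := by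
        have (i : Fin m) : u i (∑ a : s, if a.1.1 = i then c a • a.1.2 else 0) =
            ∑ a : s, if a.1.1 = i then c a * u i a.1.2 else 0 := by
          have := map_sum (u i : 𝓢(ℝ, ℝ) →L[ℝ] ℝ) (fun a : s => if a.1.1 = i then c a • a.1.2 else 0)
            Finset.univ
          refine this.trans (Finset.sum_congr rfl fun a _ => ?_)
          split_ifs with hi
          · exact map_smul (u i : 𝓢(ℝ, ℝ) →L[ℝ] ℝ) _ _
          · exact map_zero (u i : 𝓢(ℝ, ℝ) →L[ℝ] ℝ)
        simp only [this]
        rw [Finset.sum_comm]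
        simp
      have := hchar m t (fun i => ∑ a : s, if a.1.1 = i then c a • a.1.2 else 0)
      simp only [← hsum (fun i => X _ (t i) _), ← hsum (fun i => Y (t i) _)] at this
      exact this

/-! ### The symmetric stable density -/

theorem integrableOn_rpow_mul_exp {α : ℝ} (hα : 0 < α) {q : ℝ} (hq : -1 < q) :
    IntegrableOn (fun z : ℝ => z ^ q * Real.exp (-z ^ α)) (Set.Ioi 0) :=
  integrableOn_rpow_mul_exp_neg_rpow hq hα

theorem integrable_exp_neg_mul_abs_rpow {α t : ℝ} (hα : 0 < α) (ht : 0 < t) :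
    Integrable fun z : ℝ => Real.exp (-t * |z| ^ α) := by
  have h := integrableOn_rpow_mul_exp_neg_mul_rpow (s := 0) (by norm_num) hα ht
  simp only [Real.rpow_zero, one_mul] at h
  have h1 : IntegrableOn (fun z : ℝ => Real.exp (-t * |z| ^ α)) (Set.Ioi 0) :=
    h.congr_fun (fun z hz => by rw [abs_of_pos hz]) measurableSet_Ioi
  have h2 : IntegrableOn (fun z : ℝ => Real.exp (-t * |z| ^ α)) (Set.Iic 0) := by
    rw [integrableOn_Iic_iff_integrableOn_Iio]
    have := (Measure.measurePreserving_neg (volume : Measure ℝ)).integrableOn_comp_preimage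
      (Homeomorph.neg ℝ).measurableEmbedding (f := fun z : ℝ => Real.exp (-t * |z| ^ α))
      (s := Set.Ioi 0)
    simp only [Function.comp_def, abs_neg, Set.neg_preimage, Set.neg_Ioi, neg_zero] at this
    exact this.2 h1
  rw [← integrableOn_univ, ← Set.Iic_union_Ioi (a := (0 : ℝ))]
  exact h2.union h1

theorem integrable_cos_mul_exp {α t : ℝ} (hα : 0 < α) (ht : 0 < t) (x : ℝ) :
    Integrable fun z : ℝ => Real.cos (x * z) * Real.exp (-t * |z| ^ α) := by
  refine (integrable_exp_neg_mul_abs_rpow hα ht).mono' (by fun_prop) ?_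
  refine Eventually.of_forall fun z => ?_
  rw [norm_mul, Real.norm_eq_abs, Real.norm_eq_abs, Real.abs_exp]
  exact mul_le_of_le_one_left (Real.exp_nonneg _) (Real.abs_cos_le_one _)

/-- Substitution `z ↦ t^(-1/α) z` in the Fourier integral; this is the self-similarity behind all
decay rates below. -/
theorem stableDensity_eq_scaled {α t : ℝ} (hα : 0 < α) (ht : 0 < t) (x : ℝ) :
    stableDensity α t x = t ^ (-1 / α) * stableDensity α 1 (x * t ^ (-1 / α)) := by
  have hc : 0 < t ^ (-1 / α) := Real.rpow_pos_of_pos ht _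
  have h := Measure.integral_comp_mul_left
    (fun z : ℝ => Real.cos (x * z) * Real.exp (-t * |z| ^ α)) (t ^ (-1 / α))
  have h2 (z : ℝ) : t * |t ^ (-1 / α) * z| ^ α = |z| ^ α := by
    rw [abs_mul, abs_of_pos hc, Real.mul_rpow hc.le (abs_nonneg _), ← Real.rpow_mul ht.le,
      div_mul_cancel₀ _ hα.ne', Real.rpow_neg_one, mul_inv_cancel_left₀ ht.ne']
  simp only [neg_mul, h2] at h
  rw [abs_of_pos (inv_pos.2 hc), smul_eq_mul] at h
  simp only [stableDensity, neg_mul, one_mul, mul_assoc]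
  rw [h]
  field_simp

theorem stableDensity_neg (α t x : ℝ) : stableDensity α t (-x) = stableDensity α t x := by
  simp [stableDensity]

theorem stableDensity_one_eq {α : ℝ} (x : ℝ) :
    stableDensity α 1 x = Real.pi⁻¹ * ∫ z in Set.Ioi (0 : ℝ), Real.cos (x * z) * Real.exp (-z ^ α) := by
  have := integral_comp_abs (f := fun z => Real.cos (x * z) * Real.exp (-z ^ α))
  have h (z : ℝ) : Real.cos (x * |z|) = Real.cos (x * z) := by
    rcases abs_choice z with h | h <;> rw [h]
    rw [mul_neg, Real.cos_neg]
  simp only [h] at this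
  simp only [stableDensity, neg_mul, one_mul]
  rw [this]
  field_simp

theorem abs_stableDensity_le {α t : ℝ} (hα : 0 < α) (ht : 0 < t) (x : ℝ) :
    |stableDensity α t x| ≤ stableDensity α t 0 := by
  rw [stableDensity, stableDensity, abs_mul, abs_of_pos (by positivity)]
  gcongr
  refine abs_integral_le_integral_abs.trans ?_
  refine integral_mono (integrable_cos_mul_exp hα ht x).abs (integrable_cos_mul_exp hα ht 0) fun z => ?_
  simp only [zero_mul, Real.cos_zero, one_mul, abs_mul, Real.abs_exp]
  exact mul_le_of_le_one_left (Real.exp_nonneg _) (Real.abs_cos_le_one _)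

theorem stableDensity_one_zero {α : ℝ} (hα : 0 < α) :
    stableDensity α 1 0 = Real.Gamma (1 / α) / (Real.pi * α) := by
  rw [stableDensity_one_eq]
  simp only [zero_mul, Real.cos_zero, one_mul]
  rw [integral_exp_neg_rpow hα, Real.Gamma_add_one (by positivity)]
  field_simp

theorem stableDensity_one_zero_pos {α : ℝ} (hα : 0 < α) : 0 < stableDensity α 1 0 := by
  rw [stableDensity_one_zero hα]
  have := Real.Gamma_pos_of_pos (s := 1 / α) (by positivity)
  positivity

/-- The derivative of the stable density at time one. -/
noncomputable def stableDensityDeriv (α x : ℝ) : ℝ :=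
  Real.pi⁻¹ * ∫ z in Set.Ioi (0 : ℝ), -(z * Real.sin (x * z)) * Real.exp (-z ^ α)

theorem hasDerivAt_stableDensity_one {α : ℝ} (hα : 0 < α) (x : ℝ) :
    HasDerivAt (stableDensity α 1) (stableDensityDeriv α x) x := by
  have h0 := integrableOn_rpow_mul_exp hα (q := 0) (by norm_num)
  have h1 := integrableOn_rpow_mul_exp hα (q := 1) (by norm_num)
  simp only [Real.rpow_zero, Real.rpow_one, one_mul] at h0 h1
  have hfun : stableDensity α 1 = fun x => Real.pi⁻¹ *
      ∫ z in Set.Ioi (0 : ℝ), Real.cos (x * z) * Real.exp (-z ^ α) :=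
    funext fun x => stableDensity_one_eq x
  rw [hfun]
  refine HasDerivAt.const_mul _ ?_
  refine (hasDerivAt_integral_of_dominated_loc_of_deriv_le (𝕜 := ℝ) (s := Set.univ)
    (F := fun x z => Real.cos (x * z) * Real.exp (-z ^ α))
    (F' := fun x z => -(z * Real.sin (x * z)) * Real.exp (-z ^ α))
    (bound := fun z => z * Real.exp (-z ^ α)) Filter.univ_mem ?_ ?_ ?_ ?_ h1 ?_).2
  · exact Eventually.of_forall fun y => by fun_prop
  · refine h0.mono' (by fun_prop) (Eventually.of_forall fun z => ?_)
    rw [norm_mul, Real.norm_eq_abs, Real.norm_eq_abs, Real.abs_exp]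
    exact mul_le_of_le_one_left (Real.exp_nonneg _) (Real.abs_cos_le_one _)
  · fun_prop
  · filter_upwards [ae_restrict_mem measurableSet_Ioi] with z (hz : 0 < z) y _
    rw [norm_mul, norm_neg, norm_mul, Real.norm_eq_abs, Real.norm_eq_abs, Real.norm_eq_abs,
      Real.abs_exp, abs_of_pos hz]
    gcongr
    exact mul_le_of_le_one_right hz.le (Real.abs_sin_le_one _)
  · refine Eventually.of_forall fun z y _ => ?_
    have h2 : HasDerivAt (fun y : ℝ => y * z) z y := hasDerivAt_mul_const z
    exact ((h2.cos).mul_const (Real.exp (-z ^ α))).congr_deriv (by ring)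

theorem tendsto_rpow_mul_exp_neg_rpow {α : ℝ} (hα : 0 < α) (q : ℝ) :
    Tendsto (fun z : ℝ => z ^ q * Real.exp (-z ^ α)) atTop (𝓝 0) := by
  have h := (tendsto_rpow_mul_exp_neg_mul_atTop_nhds_zero (q / α) 1 one_pos).comp
    (tendsto_rpow_atTop hα)
  refine h.congr' ?_
  filter_upwards [eventually_gt_atTop 0] with z hz
  simp only [Function.comp_apply]
  rw [← Real.rpow_mul hz.le, mul_div_cancel₀ _ hα.ne', neg_mul, one_mul]

/-- Two integrations by parts in `∫ z exp(-z^α) sin(xz) dz` produce a factor `x⁻²`. The second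
derivative of `z exp(-z^α)` behaves like `z^(α-1)` at zero, which is integrable for every `α > 0`. A
bound integrable in `x` is what makes oscillations over cells summable. -/
theorem exists_abs_stableDensityDeriv_le {α : ℝ} (hα : 0 < α) :
    ∃ C, 0 < C ∧ ∀ x, |stableDensityDeriv α x| ≤ C / (1 + x ^ 2) := by
  have h1 := integrableOn_rpow_mul_exp hα (q := 1) (by norm_num)
  simp only [Real.rpow_one] at h1
  set f : ℝ → ℝ := fun z => z * Real.exp (-z ^ α) with hf
  set f' : ℝ → ℝ := fun z => Real.exp (-z ^ α) - α * (z ^ α * Real.exp (-z ^ α)) with hf'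
  set f'' : ℝ → ℝ := fun z => α ^ 2 * (z ^ (2 * α - 1) * Real.exp (-z ^ α))
    - α * (α + 1) * (z ^ (α - 1) * Real.exp (-z ^ α)) with hf''
  have hfi : IntegrableOn f (Set.Ioi 0) := h1
  have hf'i : IntegrableOn f' (Set.Ioi 0) := by
    have h0 := integrableOn_rpow_mul_exp hα (q := 0) (by norm_num)
    simp only [Real.rpow_zero, one_mul] at h0
    exact h0.sub ((integrableOn_rpow_mul_exp hα (q := α) (by linarith)).const_mul _)
  have hf''i : IntegrableOn f'' (Set.Ioi 0) :=
    ((integrableOn_rpow_mul_exp hα (q := 2 * α - 1) (by linarith)).const_mul _).sub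
      ((integrableOn_rpow_mul_exp hα (q := α - 1) (by linarith)).const_mul _)
  have hexp (z : ℝ) (hz : 0 < z) : HasDerivAt (fun z : ℝ => Real.exp (-z ^ α))
      (Real.exp (-z ^ α) * (-(α * z ^ (α - 1)))) z :=
    ((Real.hasDerivAt_rpow_const (Or.inl hz.ne')).neg).exp
  have hfd (z : ℝ) (hz : z ∈ Set.Ioi (0 : ℝ)) : HasDerivAt f (f' z) z := by
    have hz0 : z ≠ 0 := ne_of_gt hz
    refine ((hasDerivAt_id z).mul (hexp z hz)).congr_deriv ?_
    simp only [hf', id, Real.rpow_sub_one hz0]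
    field_simp
    ring
  have hf'd (z : ℝ) (hz : z ∈ Set.Ioi (0 : ℝ)) : HasDerivAt f' (f'' z) z := by
    have hz0 : z ≠ 0 := ne_of_gt hz
    refine ((hexp z hz).sub (((Real.hasDerivAt_rpow_const (p := α) (Or.inl hz0)).mul
      (hexp z hz)).const_mul α)).congr_deriv ?_
    simp only [hf'']
    have : (z : ℝ) ^ (2 * α - 1) = z ^ α * z ^ (α - 1) := by
      rw [← Real.rpow_add hz]; ring_nf
    rw [this]
    ring
  have hcα : Continuous fun z : ℝ => z ^ α := Real.continuous_rpow_const hα.le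
  have hfc : Continuous f := by fun_prop
  have hf'c : Continuous f' := by fun_prop
  have hft : Tendsto f atTop (𝓝 0) := by
    simpa using tendsto_rpow_mul_exp_neg_rpow hα 1
  have hf't : Tendsto f' atTop (𝓝 0) := by
    have := (tendsto_rpow_mul_exp_neg_rpow hα 0).sub
      ((tendsto_rpow_mul_exp_neg_rpow hα α).const_mul α)
    simpa using this
  have hbd (g : ℝ → ℝ) (hg : Continuous g) (hg1 : ∀ z, |g z| ≤ 1) {F : ℝ → ℝ}
      (hF : IntegrableOn F (Set.Ioi 0) volume) : IntegrableOn (fun z => F z * g z) (Set.Ioi 0) :=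
    Integrable.mul_bdd (c := 1) hF (by fun_prop) (Eventually.of_forall hg1)
  have hbt (g : ℝ → ℝ) (hg1 : ∀ z, |g z| ≤ 1) {F : ℝ → ℝ} (hF : Tendsto F atTop (𝓝 0)) (c : ℝ) :
      Tendsto (fun z => F z * (c * g z)) atTop (𝓝 0) := by
    have h3 : Tendsto (fun z => |c| * |F z|) atTop (𝓝 0) := by simpa using hF.abs.const_mul |c|
    refine squeeze_zero_norm (fun z => ?_) h3
    rw [norm_mul, norm_mul, Real.norm_eq_abs, Real.norm_eq_abs, Real.norm_eq_abs]
    nlinarith [hg1 z, abs_nonneg (F z), abs_nonneg c, mul_nonneg (abs_nonneg (F z)) (abs_nonneg c)]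
  set A : ℝ := ∫ z in Set.Ioi (0 : ℝ), |f z| with hA
  set B : ℝ := ∫ z in Set.Ioi (0 : ℝ), |f'' z| with hB
  have hA0 : 0 ≤ A := integral_nonneg fun z => abs_nonneg _
  have hB0 : 0 ≤ B := integral_nonneg fun z => abs_nonneg _
  have hint (g : ℝ → ℝ) (hg : Continuous g) (hg1 : ∀ z, |g z| ≤ 1) {F : ℝ → ℝ}
      (hF : IntegrableOn F (Set.Ioi 0)) :
      |∫ z in Set.Ioi (0 : ℝ), F z * g z| ≤ ∫ z in Set.Ioi (0 : ℝ), |F z| := by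
    refine abs_integral_le_integral_abs.trans (integral_mono (hbd g hg hg1 hF).abs hF.abs fun z => ?_)
    simp only [abs_mul]
    exact mul_le_of_le_one_right (abs_nonneg _) (hg1 z)
  have hS (x : ℝ) : stableDensityDeriv α x =
      -(Real.pi⁻¹ * ∫ z in Set.Ioi (0 : ℝ), f z * Real.sin (x * z)) := by
    rw [stableDensityDeriv, ← mul_neg, ← integral_neg]
    congr 2
    funext z
    simp only [hf]
    ring
  have hbound1 (x : ℝ) : |∫ z in Set.Ioi (0 : ℝ), f z * Real.sin (x * z)| ≤ A :=
    hint _ (by fun_prop) (fun z => Real.abs_sin_le_one _) hfi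
  have hbound2 (x : ℝ) (hx : x ≠ 0) :
      x ^ 2 * |∫ z in Set.Ioi (0 : ℝ), f z * Real.sin (x * z)| ≤ B := by
    have hsin (z : ℝ) : HasDerivAt (fun z : ℝ => x⁻¹ * Real.sin (x * z)) (Real.cos (x * z)) z := by
      have h2 : HasDerivAt (fun z : ℝ => x * z) x z := hasDerivAt_const_mul x
      exact ((h2.sin).const_mul x⁻¹).congr_deriv (by field_simp)
    have hcos (z : ℝ) : HasDerivAt (fun z : ℝ => -x⁻¹ * Real.cos (x * z)) (Real.sin (x * z)) z := by
      have h2 : HasDerivAt (fun z : ℝ => x * z) x z := hasDerivAt_const_mul x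
      exact ((h2.cos).const_mul (-x⁻¹)).congr_deriv (by field_simp)
    -- The boundary term at zero vanishes because `f 0 = 0`; in the second integration by parts it
    -- vanishes because `sin 0 = 0`.
    have i1 := integral_Ioi_mul_deriv_eq_deriv_mul (a := 0) (a' := 0) (b' := 0) hfd
      (fun z _ => hcos z) (hbd _ (by fun_prop) (fun z => Real.abs_sin_le_one _) hfi)
      (by
        have := (hbd (fun z => Real.cos (x * z)) (by fun_prop)
          (fun z => Real.abs_cos_le_one _) hf'i).mul_const (-x⁻¹)
        refine this.congr (Eventually.of_forall fun z => ?_)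
        simp only [Pi.mul_apply]
        ring)
      ((Continuous.tendsto' (by fun_prop) _ _ (by simp [hf])).mono_left nhdsWithin_le_nhds)
      (hbt _ (fun z => Real.abs_cos_le_one _) hft _)
    have i2 := integral_Ioi_mul_deriv_eq_deriv_mul (a := 0) (a' := 0) (b' := 0) hf'd
      (fun z _ => hsin z) (hbd _ (by fun_prop) (fun z => Real.abs_cos_le_one _) hf'i)
      (by
        have := (hbd (fun z => Real.sin (x * z)) (by fun_prop)
          (fun z => Real.abs_sin_le_one _) hf''i).mul_const (x⁻¹)
        refine this.congr (Eventually.of_forall fun z => ?_)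
        simp only [Pi.mul_apply]
        ring)
      ((Continuous.tendsto' (by fun_prop) _ _ (by simp)).mono_left nhdsWithin_le_nhds)
      (hbt _ (fun z => Real.abs_sin_le_one _) hf't _)
    have e1 : ∫ z in Set.Ioi (0 : ℝ), f' z * (-x⁻¹ * Real.cos (x * z)) =
        -x⁻¹ * ∫ z in Set.Ioi (0 : ℝ), f' z * Real.cos (x * z) := by
      rw [← integral_const_mul]; congr 1; funext z; ring
    have e2 : ∫ z in Set.Ioi (0 : ℝ), f'' z * (x⁻¹ * Real.sin (x * z)) =
        x⁻¹ * ∫ z in Set.Ioi (0 : ℝ), f'' z * Real.sin (x * z) := by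
      rw [← integral_const_mul]; congr 1; funext z; ring
    rw [e1, i2, e2] at i1
    rw [i1]
    have : x ^ 2 * |0 - 0 - -x⁻¹ * (0 - 0 - x⁻¹ * ∫ z in Set.Ioi (0 : ℝ), f'' z * Real.sin (x * z))|
        = |∫ z in Set.Ioi (0 : ℝ), f'' z * Real.sin (x * z)| := by
      rw [← sq_abs x, ← abs_pow, ← abs_mul, ← abs_neg]
      congr 1
      field_simp
      ring
    rw [this]
    exact hint _ (by fun_prop) (fun z => Real.abs_sin_le_one _) hf''i
  refine ⟨Real.pi⁻¹ * (A + B) + 1, by positivity, fun x => ?_⟩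
  have hpos : 0 < 1 + x ^ 2 := by positivity
  rw [le_div_iff₀ hpos, hS, abs_neg, abs_mul, abs_of_pos (inv_pos.2 Real.pi_pos), mul_assoc]
  have : |∫ z in Set.Ioi (0 : ℝ), f z * Real.sin (x * z)| * (1 + x ^ 2) ≤ A + B := by
    rw [mul_add, mul_one, mul_comm _ (x ^ 2)]
    refine add_le_add (hbound1 x) ?_
    by_cases hx : x = 0
    · simpa [hx] using hB0
    · exact hbound2 x hx
  calc _ ≤ Real.pi⁻¹ * (A + B) := by gcongr
    _ ≤ _ := by linarith

/-! ### The law of a stable variable has the stable density -/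

theorem continuous_stableDensity {α t : ℝ} (hα : 0 < α) (ht : 0 < t) :
    Continuous (stableDensity α t) := by
  have h : Continuous (stableDensity α 1) :=
    continuous_iff_continuousAt.2 fun x => (hasDerivAt_stableDensity_one hα x).continuousAt
  have : stableDensity α t = fun x => t ^ (-1 / α) * stableDensity α 1 (x * t ^ (-1 / α)) :=
    funext fun x => stableDensity_eq_scaled hα ht x
  rw [this]
  fun_prop

/-- The change of variable `z = 2πv` passes to the normalisation of the Fourier transform on
Schwartz functions; the imaginary part cancels under `z ↦ -z`. -/
theorem stableDensity_eq_complex_integral {α t : ℝ} (hα : 0 < α) (ht : 0 < t) (x : ℝ) :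
    (stableDensity α t x : ℂ) = ∫ v : ℝ, Complex.exp (2 * Real.pi * v * x * Complex.I) *
      (Real.exp (-t * |2 * Real.pi * v| ^ α) : ℝ) := by
  have hk := integrable_exp_neg_mul_abs_rpow hα ht
  have hkc : Integrable fun z : ℝ => Complex.exp (z * x * Complex.I) *
      (Real.exp (-t * |z| ^ α) : ℝ) := by
    refine Integrable.bdd_mul (c := 1) hk.ofReal (by fun_prop) (Eventually.of_forall fun z => ?_)
    rw [← Complex.ofReal_mul, Complex.norm_exp_ofReal_mul_I]
  have h1 := Measure.integral_comp_mul_left (fun z : ℝ => Complex.exp (z * x * Complex.I) *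
      (Real.exp (-t * |z| ^ α) : ℝ)) (2 * Real.pi)
  have h2 : ∫ z : ℝ, Complex.exp (z * x * Complex.I) * (Real.exp (-t * |z| ^ α) : ℝ) =
      ∫ z : ℝ, ((Real.cos (x * z) * Real.exp (-t * |z| ^ α) : ℝ) : ℂ) := by
    have hneg := integral_neg_eq_self (fun z : ℝ => Complex.exp (z * x * Complex.I) *
      (Real.exp (-t * |z| ^ α) : ℝ)) volume
    have hkn : Integrable fun z : ℝ => Complex.exp ((-z : ℝ) * x * Complex.I) *
      (Real.exp (-t * |-z| ^ α) : ℝ) := hkc.comp_neg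
    have hadd := integral_add hkc hkn
    have hd : (2 : ℂ) * ∫ z : ℝ, ((Real.cos (x * z) * Real.exp (-t * |z| ^ α) : ℝ) : ℂ) =
      ∫ z : ℝ, (Complex.exp (z * x * Complex.I) * (Real.exp (-t * |z| ^ α) : ℝ) +
        Complex.exp ((-z : ℝ) * x * Complex.I) * (Real.exp (-t * |-z| ^ α) : ℝ)) := by
      rw [← integral_const_mul]
      congr 1
      funext z
      rw [abs_neg, ← add_mul, Complex.ofReal_mul, Complex.ofReal_cos, Complex.cos]
      push_cast
      rw [← mul_assoc, mul_div_cancel₀ _ (two_ne_zero)]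
      ring_nf
    rw [hneg] at hadd
    rw [hadd, ← two_mul] at hd
    exact (mul_left_cancel₀ two_ne_zero hd).symm
  rw [h2, integral_complex_ofReal] at h1
  rw [stableDensity, Complex.ofReal_mul]
  rw [abs_of_pos (by positivity), Complex.real_smul] at h1
  rw [one_div, ← h1]
  push_cast
  rfl

/-- Parseval's identity between a law and its inverse Fourier transform. -/
theorem integral_eq_integral_mul_stableDensity {α t : ℝ} (hα : 0 < α) (ht : 0 < t)
    (μ : Measure ℝ) [IsProbabilityMeasure μ]
    (hμ : ∀ z, charFun μ z = ((Real.exp (-t * |z| ^ α) : ℝ) : ℂ)) (f : 𝓢(ℝ, ℂ)) :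
    ∫ x, f x ∂μ = ∫ x, f x * (stableDensity α t x : ℂ) := by
  set g : 𝓢(ℝ, ℂ) := 𝓕⁻ f with hg
  have hf : 𝓕 g = f := FourierTransform.fourier_fourierInv_eq f
  have hfx (x : ℝ) : f x = ∫ v : ℝ, Complex.exp (-2 * Real.pi * v * x * Complex.I) * g v := by
    rw [← hf, SchwartzMap.fourier_coe, Real.fourier_eq']
    congr 1
    funext v
    simp only [smul_eq_mul, RCLike.inner_apply, conj_trivial]
    congr 2
    push_cast
    ring
  have hgx (x : ℝ) : g x = ∫ v : ℝ, Complex.exp (2 * Real.pi * v * x * Complex.I) * f v := by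
    rw [hg, SchwartzMap.fourierInv_coe, Real.fourierInv_eq']
    congr 1
    funext v
    simp only [smul_eq_mul, RCLike.inner_apply, conj_trivial]
    congr 2
    push_cast
    ring
  have hk : Integrable fun v : ℝ => ((Real.exp (-t * |2 * Real.pi * v| ^ α) : ℝ) : ℂ) :=
    ((integrable_exp_neg_mul_abs_rpow hα ht).comp_mul_left' (by positivity)).ofReal
  have hcf (v : ℝ) : ∫ x : ℝ, Complex.exp (-2 * Real.pi * v * x * Complex.I) ∂μ =
      (Real.exp (-t * |2 * Real.pi * v| ^ α) : ℝ) := by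
    have := hμ (-2 * Real.pi * v)
    rw [charFun_apply_real] at this
    rw [neg_mul, neg_mul, abs_neg] at this
    rw [← this]
    congr 1
    funext x
    push_cast
    ring_nf
  have hL : ∫ x, f x ∂μ = ∫ v, g v * (Real.exp (-t * |2 * Real.pi * v| ^ α) : ℝ) := by
    simp_rw [hfx]
    rw [integral_integral_swap]
    · congr 1
      funext v
      rw [integral_mul_const, hcf, mul_comm]
    · have h1 : Integrable (fun p : ℝ × ℝ => (1 : ℂ) * g p.2) (μ.prod volume) :=
        (integrable_const (1 : ℂ)).mul_prod g.integrable
      simp only [one_mul] at h1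
      refine h1.bdd_mul (c := 1) (by fun_prop) (Eventually.of_forall fun p => ?_)
      have : (-2 * Real.pi * p.2 * p.1 * Complex.I : ℂ) =
        ((-2 * Real.pi * p.2 * p.1 : ℝ) : ℂ) * Complex.I := by push_cast; ring
      rw [this, Complex.norm_exp_ofReal_mul_I]
  rw [hL]
  simp_rw [stableDensity_eq_complex_integral hα ht, ← integral_const_mul]
  rw [integral_integral_swap]
  · congr 1
    funext v
    rw [hgx, ← integral_mul_const]
    congr 1
    funext x
    rw [← mul_assoc, mul_comm (f x)]
    ring_nf
  · have h1 : Integrable (fun p : ℝ × ℝ => f p.1 *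
        ((Real.exp (-t * |2 * Real.pi * p.2| ^ α) : ℝ) : ℂ)) (volume.prod volume) :=
      f.integrable.mul_prod hk
    have h2 := h1.bdd_mul (c := 1)
      (f := fun p : ℝ × ℝ => Complex.exp (2 * Real.pi * p.2 * p.1 * Complex.I)) (by fun_prop)
      (Eventually.of_forall fun p => ?_)
    · refine h2.congr (Eventually.of_forall fun p => ?_)
      simp only [Function.uncurry]
      ring
    · have : (2 * Real.pi * p.2 * p.1 * Complex.I : ℂ) =
        ((2 * Real.pi * p.2 * p.1 : ℝ) : ℂ) * Complex.I := by push_cast; ring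
      rw [this, Complex.norm_exp_ofReal_mul_I]

/-- A probability measure that integrates smooth compactly supported functions like a continuous
density does has this density. -/
theorem eq_withDensity_of_integral_eq (μ : Measure ℝ) [IsProbabilityMeasure μ] {p : ℝ → ℝ}
    (hp : Continuous p)
    (h : ∀ f : ℝ → ℝ, ContDiff ℝ ((⊤ : ℕ∞) : WithTop ℕ∞) f → HasCompactSupport f →
      ∫ x, f x ∂μ = ∫ x, f x * p x) :
    (∀ x, 0 ≤ p x) ∧ μ = volume.withDensity (fun x => ENNReal.ofReal (p x)) := by
  have hpos (x : ℝ) : 0 ≤ p x := by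
    by_contra! hx
    obtain ⟨ε, hε, hε'⟩ := Metric.mem_nhds_iff.1 (hp.continuousAt.eventually (gt_mem_nhds hx))
    -- A bump supported where `p` is negative would have nonnegative integral against `μ` and
    -- negative integral against `p`.
    let b : ContDiffBump x := ⟨ε / 2, ε, by positivity, by linarith⟩
    have h1 := h b b.contDiff b.hasCompactSupport
    have h2 : 0 ≤ ∫ x, b x ∂μ := integral_nonneg fun y => b.nonneg
    have h3 : 0 < ∫ y, -(b y * p y) := by
      refine Continuous.integral_pos_of_hasCompactSupport_nonneg_nonzero (x := x)
        (b.continuous.mul hp).neg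
        (b.hasCompactSupport.mul_right.neg) (fun y => ?_) ?_
      · by_cases hy : y ∈ Metric.ball x ε
        · have h4 : p y < 0 := hε' hy
          have h5 : 0 ≤ b y := b.nonneg
          simp only [Pi.zero_apply]
          nlinarith
        · have : b y = 0 := by
            rw [← Function.notMem_support, b.support_eq]
            exact hy
          simp [this]
      · have : b x = 1 := b.one_of_mem_closedBall (by simp [b]; positivity)
        simp [this, hx.ne]
    rw [integral_neg] at h3
    linarith
  refine ⟨hpos, ?_⟩
  set ν := volume.withDensity (fun x => ENNReal.ofReal (p x)) with hν
  have hlin {c : ℝ} (b : ContDiffBump c) :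
      ∫⁻ x, ENNReal.ofReal (b x) ∂μ = ∫⁻ x, ENNReal.ofReal (b x) ∂ν := by
    have hbc : Continuous b := b.continuous
    rw [hν, lintegral_withDensity_eq_lintegral_mul _ (by fun_prop) (by fun_prop),
      ← ofReal_integral_eq_lintegral_ofReal _ (Eventually.of_forall fun x => b.nonneg),
      h b b.contDiff b.hasCompactSupport, ofReal_integral_eq_lintegral_ofReal]
    · refine lintegral_congr fun x => ?_
      rw [Pi.mul_apply, mul_comm, ENNReal.ofReal_mul (hpos x)]
    · exact (by fun_prop : Continuous fun x => b x * p x).integrable_of_hasCompactSupport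
        b.hasCompactSupport.mul_right
    · exact Eventually.of_forall fun x => mul_nonneg b.nonneg (hpos x)
    · exact hbc.integrable_of_hasCompactSupport b.hasCompactSupport
  -- A bump function lies between the indicators of a closed ball and a larger open ball, and an
  -- open ball is an increasing union of closed ones. Hence equal integrals of bumps give equal
  -- measures of balls.
  have hle (ρ₁ ρ₂ : Measure ℝ) (hρ : ∀ {c : ℝ} (b : ContDiffBump c),
      ∫⁻ x, ENNReal.ofReal (b x) ∂ρ₁ = ∫⁻ x, ENNReal.ofReal (b x) ∂ρ₂) (c r : ℝ) :
      ρ₁ (Metric.ball c r) ≤ ρ₂ (Metric.ball c r) := by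
    have hU : Metric.ball c r = ⋃ n : ℕ, Metric.closedBall c (r - 1 / (n + 1)) := by
      ext y
      simp only [Metric.mem_ball, Set.mem_iUnion, Metric.mem_closedBall]
      constructor
      · intro hy
        obtain ⟨n, hn⟩ := exists_nat_one_div_lt (sub_pos.2 hy)
        exact ⟨n, by linarith⟩
      · rintro ⟨n, hn⟩
        have : (0 : ℝ) < 1 / (n + 1) := by positivity
        linarith
    have hmono : Monotone fun n : ℕ => Metric.closedBall c (r - 1 / ((n : ℝ) + 1)) := by
      intro a b hab
      refine Metric.closedBall_subset_closedBall ?_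
      have : (1 : ℝ) / (b + 1) ≤ 1 / (a + 1) := by gcongr
      linarith
    conv_lhs => rw [hU]
    rw [hmono.measure_iUnion]
    refine iSup_le fun n => ?_
    have hn : (0 : ℝ) < 1 / (n + 1) := by positivity
    have hbump {c : ℝ} (b : ContDiffBump c) :
        ρ₁ (Metric.closedBall c b.rIn) ≤ ρ₂ (Metric.ball c b.rOut) := by
      calc ρ₁ (Metric.closedBall c b.rIn)
          = ∫⁻ x, (Metric.closedBall c b.rIn).indicator 1 x ∂ρ₁ := by
              rw [lintegral_indicator_one Metric.isClosed_closedBall.measurableSet]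
        _ ≤ ∫⁻ x, ENNReal.ofReal (b x) ∂ρ₁ := lintegral_mono fun x => by
            by_cases hx : x ∈ Metric.closedBall c b.rIn
            · rw [Set.indicator_of_mem hx, b.one_of_mem_closedBall hx]
              simp
            · rw [Set.indicator_of_notMem hx]
              exact zero_le
        _ = ∫⁻ x, ENNReal.ofReal (b x) ∂ρ₂ := hρ b
        _ ≤ ∫⁻ x, (Metric.ball c b.rOut).indicator 1 x ∂ρ₂ := lintegral_mono fun x => by
            by_cases hx : x ∈ Metric.ball c b.rOut
            · simp [hx, b.le_one]
            · have : b x = 0 := by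
                rw [← Function.notMem_support, b.support_eq]; exact hx
              simp [this]
        _ = ρ₂ (Metric.ball c b.rOut) := by
          rw [lintegral_indicator_one Metric.isOpen_ball.measurableSet]
    by_cases hr0 : 0 < r
    · have h5 : max (r / 2) (r - 1 / ((n : ℝ) + 1)) < r := max_lt (by linarith) (by linarith)
      have h6 : 0 < max (r / 2) (r - 1 / ((n : ℝ) + 1)) := lt_max_of_lt_left (by linarith)
      exact (measure_mono (Metric.closedBall_subset_closedBall (le_max_right _ _))).trans
        (hbump (c := c) ⟨max (r / 2) (r - 1 / ((n : ℝ) + 1)), r, h6, h5⟩)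
    · rw [Metric.closedBall_eq_empty.2 (by linarith), measure_empty]
      exact zero_le
  refine Real.measure_ext_Ioo_rat fun a b => ?_
  rw [Real.Ioo_eq_ball]
  exact le_antisymm (hle μ ν hlin _ _) (hle ν μ (fun b => (hlin b).symm) _ _)

/-- Nonnegativity is not visible from the Fourier integral; it comes from the existence of a law
with this characteristic function, through Parseval's identity on test functions. -/
theorem stableDensity_nonneg_and_eq_withDensity {α t : ℝ} (hα : 0 < α) (ht : 0 < t)
    (μ : Measure ℝ) [IsProbabilityMeasure μ]
    (hμ : ∀ z, charFun μ z = ((Real.exp (-t * |z| ^ α) : ℝ) : ℂ)) :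
    (∀ x, 0 ≤ stableDensity α t x) ∧
      μ = volume.withDensity (fun x => ENNReal.ofReal (stableDensity α t x)) := by
  refine eq_withDensity_of_integral_eq μ (continuous_stableDensity hα ht) fun f hf hfc => ?_
  have hF : HasCompactSupport (fun x => (f x : ℂ)) := hfc.comp_left Complex.ofReal_zero
  have hF' : ContDiff ℝ ((⊤ : ℕ∞) : WithTop ℕ∞) (fun x => (f x : ℂ)) :=
    Complex.ofRealCLM.contDiff.comp hf
  have := integral_eq_integral_mul_stableDensity hα ht μ hμ (hF.toSchwartzMap hF')
  change ∫ x, (f x : ℂ) ∂μ = ∫ x, (f x : ℂ) * (stableDensity α t x : ℂ) at this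
  simp only [← Complex.ofReal_mul] at this
  rw [integral_complex_ofReal, integral_complex_ofReal] at this
  exact_mod_cast this

/-! ### The stable semigroup -/

/-- The reference weight `1 / (1 + x²)`. -/
noncomputable def weight (x : ℝ) : ℝ := (1 + x ^ 2)⁻¹

theorem weight_pos (x : ℝ) : 0 < weight x := by unfold weight; positivity

theorem weight_le_one (x : ℝ) : weight x ≤ 1 :=
  inv_le_one_of_one_le₀ (by nlinarith [sq_nonneg x])

@[fun_prop]
theorem continuous_weight : Continuous weight :=
  Continuous.inv₀ (by fun_prop) fun x => by positivity

@[fun_prop]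
theorem measurable_weight : Measurable weight := continuous_weight.measurable

theorem integrable_weight : Integrable weight := integrable_inv_one_add_sq

theorem integral_weight : ∫ x, weight x = Real.pi := integral_univ_inv_one_add_sq

theorem lintegral_weight : ∫⁻ x, ENNReal.ofReal (weight x) = ENNReal.ofReal Real.pi := by
  rw [← ofReal_integral_eq_lintegral_ofReal integrable_weight
    (Eventually.of_forall fun x => (weight_pos x).le), integral_weight]

/-- If `|x - y| ≤ 1` then `y² ≤ 2x² + 2`, so `1 + y² ≤ 3(1 + x²)`. The weight is thus comparable to
its mean over any unit cell. -/
theorem weight_le_three_mul {x y : ℝ} (h : |x - y| ≤ 1) : weight x ≤ 3 * weight y := by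
  unfold weight
  rw [← div_eq_mul_inv, inv_eq_one_div, div_le_div_iff₀ (by positivity) (by positivity)]
  have := abs_le.1 h
  nlinarith [sq_nonneg (x + (x - y)), sq_nonneg (x - y), sq_nonneg (2 * x - y)]

/-- The rate of decay `(1 ∨ s) ^ (-1/α)` of the stable semigroup. -/
noncomputable def rate (α s : ℝ) : ℝ := (max 1 s) ^ (-1 / α)

theorem rate_pos (α s : ℝ) : 0 < rate α s := Real.rpow_pos_of_pos (by positivity) _

theorem rate_le_one {α : ℝ} (hα : 0 < α) (s : ℝ) : rate α s ≤ 1 :=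
  Real.rpow_le_one_of_one_le_of_nonpos (le_max_left _ _)
    (div_nonpos_of_nonpos_of_nonneg (by norm_num) hα.le)

theorem rate_of_le_one (α : ℝ) {s : ℝ} (hs : s ≤ 1) : rate α s = 1 := by
  rw [rate, max_eq_left hs, Real.one_rpow]

theorem rate_of_one_le (α : ℝ) {s : ℝ} (hs : 1 ≤ s) : rate α s = s ^ (-1 / α) := by
  rw [rate, max_eq_right hs]

@[fun_prop]
theorem continuous_rate (α : ℝ) : Continuous (rate α) :=
  Continuous.rpow_const (by fun_prop) fun s => Or.inl (by positivity)

/-- A Markov kernel of laws with characteristic functions `exp(-s|z|^α)`, indexed by `s ≥ 0`. -/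
structure IsStableKernel (α : ℝ) (ν : Kernel ℝ ℝ) : Prop where
  markov : IsMarkovKernel ν
  charFun_eq : ∀ s, 0 ≤ s → ∀ z, charFun (ν s) z = ((Real.exp (-s * |z| ^ α) : ℝ) : ℂ)

namespace IsStableKernel

variable {α : ℝ} {ν : Kernel ℝ ℝ}

theorem eq_of_charFun (hν : IsStableKernel α ν) {s : ℝ} (hs : 0 ≤ s) {μ : Measure ℝ}
    [IsFiniteMeasure μ] (h : ∀ z, charFun μ z = ((Real.exp (-s * |z| ^ α) : ℝ) : ℂ)) : μ = ν s := by
  have := hν.markov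
  exact Measure.ext_of_charFun (funext fun z => (h z).trans (hν.charFun_eq s hs z).symm)

theorem map_neg (hν : IsStableKernel α ν) {s : ℝ} (hs : 0 ≤ s) : (ν s).map (fun z => -z) = ν s := by
  have := hν.markov
  have : IsFiniteMeasure ((ν s).map fun z => -z) := by infer_instance
  refine hν.eq_of_charFun hs fun z => ?_
  have h1 : (fun z : ℝ => -z) = fun z => (-1) * z := by funext z; ring
  rw [h1, charFun_map_mul, hν.charFun_eq s hs]
  simp

theorem conv_eq (hν : IsStableKernel α ν) {s t : ℝ} (hs : 0 ≤ s) (ht : 0 ≤ t) :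
    (ν s).conv (ν t) = ν (s + t) := by
  have := hν.markov
  refine hν.eq_of_charFun (add_nonneg hs ht) fun z => ?_
  rw [charFun_conv, hν.charFun_eq s hs, hν.charFun_eq t ht, ← Complex.ofReal_mul, ← Real.exp_add]
  ring_nf

theorem stableDensity_nonneg (hν : IsStableKernel α ν) (hα : 0 < α) {s : ℝ} (hs : 0 < s) (x : ℝ) :
    0 ≤ stableDensity α s x := by
  have := hν.markov
  exact (stableDensity_nonneg_and_eq_withDensity hα hs (ν s) (hν.charFun_eq s hs.le)).1 x

theorem eq_withDensity (hν : IsStableKernel α ν) (hα : 0 < α) {s : ℝ} (hs : 0 < s) :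
    ν s = volume.withDensity (fun x => ENNReal.ofReal (stableDensity α s x)) := by
  have := hν.markov
  exact (stableDensity_nonneg_and_eq_withDensity hα hs (ν s) (hν.charFun_eq s hs.le)).2

theorem lintegral_add (hν : IsStableKernel α ν) (hα : 0 < α) {s : ℝ} (hs : 0 < s) {g : ℝ → ℝ≥0∞}
    (hg : Measurable g) (x : ℝ) :
    ∫⁻ z, g (x + z) ∂ν s = ∫⁻ z, ENNReal.ofReal (stableDensity α s (z - x)) * g z := by
  have hc := continuous_stableDensity hα hs
  rw [hν.eq_withDensity hα hs, lintegral_withDensity_eq_lintegral_mul _ (by fun_prop) (by fun_prop)]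
  have := lintegral_add_left_eq_self (μ := volume)
    (fun z => ENNReal.ofReal (stableDensity α s (z - x)) * g z) x
  rw [← this]
  refine lintegral_congr fun z => ?_
  rw [Pi.mul_apply, add_sub_cancel_left]

theorem integral_add (hν : IsStableKernel α ν) (hα : 0 < α) {s : ℝ} (hs : 0 < s) (g : ℝ → ℝ)
    (x : ℝ) : ∫ z, g (x + z) ∂ν s = ∫ z, stableDensity α s (z - x) * g z := by
  have hc := continuous_stableDensity hα hs
  have := integral_add_left_eq_self (μ := volume) (fun z => stableDensity α s (z - x) * g z) x
  rw [hν.eq_withDensity hα hs, ← this]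
  rw [integral_withDensity_eq_integral_toReal_smul (by fun_prop) (by simp)]
  congr 1
  funext z
  rw [ENNReal.toReal_ofReal (hν.stableDensity_nonneg hα hs z), add_sub_cancel_left, smul_eq_mul]

/-- Uniform decay of the semigroup on the reference weight. -/
theorem lintegral_weight_le (hν : IsStableKernel α ν) (hα : 0 < α) (s : ℝ) (x : ℝ) :
    ∫⁻ z, ENNReal.ofReal (weight (x + z)) ∂ν s ≤
      ENNReal.ofReal ((1 + stableDensity α 1 0 * Real.pi) * rate α s) := by
  have := hν.markov
  have hp := stableDensity_one_zero_pos hα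
  rcases le_or_gt s 1 with h1 | h1
  · rw [rate_of_le_one α h1, mul_one]
    calc ∫⁻ z, ENNReal.ofReal (weight (x + z)) ∂ν s ≤ ∫⁻ _, 1 ∂ν s :=
          lintegral_mono fun z => ENNReal.ofReal_le_one.2 (weight_le_one _)
      _ = ENNReal.ofReal 1 := by simp
      _ ≤ _ := ENNReal.ofReal_le_ofReal (by have := Real.pi_pos; nlinarith [mul_pos hp Real.pi_pos])
  · have hs0 : 0 < s := by linarith
    rw [rate_of_one_le α h1.le, hν.lintegral_add hα hs0 (g := fun z => ENNReal.ofReal (weight z))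
      (by fun_prop)]
    have hr : 0 < s ^ (-1 / α) := Real.rpow_pos_of_pos hs0 _
    calc ∫⁻ z, ENNReal.ofReal (stableDensity α s (z - x)) * ENNReal.ofReal (weight z)
        ≤ ∫⁻ z, ENNReal.ofReal (s ^ (-1 / α) * stableDensity α 1 0) * ENNReal.ofReal (weight z) := by
          refine lintegral_mono fun z => ?_
          gcongr
          have := (le_abs_self _).trans (abs_stableDensity_le hα hs0 (z - x))
          rwa [stableDensity_eq_scaled hα hs0 0, zero_mul] at this
      _ = ENNReal.ofReal (s ^ (-1 / α) * stableDensity α 1 0 * Real.pi) := by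
          rw [lintegral_const_mul _ (by fun_prop), lintegral_weight, ← ENNReal.ofReal_mul (by positivity)]
      _ ≤ _ := ENNReal.ofReal_le_ofReal (by nlinarith)

end IsStableKernel

/-! ### Oscillation of the semigroup over unit cells. -/

theorem tsum_lintegral_Ico (f : ℝ → ℝ≥0∞) :
    ∑' j : ℤ, ∫⁻ v in Set.Ico (j : ℝ) (j + 1), f v = ∫⁻ v, f v := by
  rw [← lintegral_iUnion (fun _ => measurableSet_Ico) (Set.pairwise_disjoint_Ico_intCast ℝ),
    iUnion_Ico_intCast, setLIntegral_univ]

theorem hasDerivAt_stableDensity {α : ℝ} (hα : 0 < α) {s : ℝ} (hs : 0 < s) (x : ℝ) :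
    HasDerivAt (stableDensity α s)
      (s ^ (-1 / α) * (stableDensityDeriv α (x * s ^ (-1 / α)) * s ^ (-1 / α))) x := by
  have : stableDensity α s = fun x => s ^ (-1 / α) * stableDensity α 1 (x * s ^ (-1 / α)) :=
    funext fun x => stableDensity_eq_scaled hα hs x
  rw [this]
  exact ((hasDerivAt_stableDensity_one hα (x * s ^ (-1 / α))).comp x
    (hasDerivAt_mul_const _)).const_mul _

/-- The increments of the stable density over unit cells. -/
theorem ofReal_abs_stableDensity_sub_le {α C : ℝ} (hα : 0 < α)
    (hC : ∀ x, |stableDensityDeriv α x| ≤ C / (1 + x ^ 2)) {s : ℝ} (hs : 0 < s) {a b : ℝ} {x y : ℝ}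
    (hx : x ∈ Set.Ico a b) (hy : y ∈ Set.Ico a b) (z : ℝ) :
    ENNReal.ofReal |stableDensity α s (z - x) - stableDensity α s (z - y)| ≤
      ∫⁻ v in Set.Ico a b, ENNReal.ofReal
        (C * (s ^ (-1 / α) * s ^ (-1 / α)) * weight ((z - v) * s ^ (-1 / α))) := by
  set c := s ^ (-1 / α) with hc
  have hc0 : 0 < c := Real.rpow_pos_of_pos hs _
  set F : ℝ → ℝ := fun v => stableDensity α s (z - v) with hF
  set F' : ℝ → ℝ := fun v => -(c * (stableDensityDeriv α ((z - v) * c) * c)) with hF'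
  have hFd (v : ℝ) : HasDerivAt F (F' v) v := by
    have h1 := (hasDerivAt_stableDensity hα hs (z - v)).comp v ((hasDerivAt_id v).const_sub z)
    exact h1.congr_deriv (by simp [hF', hc])
  have hFm : Measurable F' := by
    have : F' = deriv F := funext fun v => (hFd v).deriv.symm
    rw [this]
    exact measurable_deriv F
  have hbound (v : ℝ) : |F' v| ≤ C * (c * c) * weight ((z - v) * c) := by
    have := hC ((z - v) * c)
    rw [div_eq_mul_inv] at this
    rw [hF', abs_neg, abs_mul, abs_mul, abs_of_pos hc0]
    calc c * (|stableDensityDeriv α ((z - v) * c)| * c)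
        ≤ c * ((C * (1 + ((z - v) * c) ^ 2)⁻¹) * c) := by gcongr
      _ = _ := by unfold weight; ring
  have hint (a b : ℝ) : IntervalIntegrable F' volume a b := by
    have h2 : IntervalIntegrable (fun v => C * (c * c) * weight ((z - v) * c)) volume a b :=
      Continuous.intervalIntegrable (by fun_prop) a b
    exact h2.mono_fun' hFm.aestronglyMeasurable (Eventually.of_forall hbound)
  wlog hxy : y ≤ x generalizing x y
  · rw [abs_sub_comm]
    exact this hy hx (not_le.1 hxy).le
  have hftc := intervalIntegral.integral_eq_sub_of_hasDerivAt (fun v _ => hFd v) (hint y x)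
  change ENNReal.ofReal |F x - F y| ≤ _
  -- The increment is the integral of the derivative over a segment inside the cell. Enlarging the
  -- segment to the whole cell gives a bound independent of `x` and `y`.
  rw [← hftc, intervalIntegral.integral_of_le hxy, ← Real.norm_eq_abs, ofReal_norm]
  calc ‖∫ v in Set.Ioc y x, F' v‖ₑ ≤ ∫⁻ v in Set.Ioc y x, ‖F' v‖ₑ := enorm_integral_le_lintegral_enorm _
    _ ≤ ∫⁻ v in Set.Ico a b, ‖F' v‖ₑ :=
        lintegral_mono_set fun v hv => ⟨hy.1.trans hv.1.le, hv.2.trans_lt hx.2⟩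
    _ ≤ _ := by
        refine lintegral_mono fun v => ?_
        rw [← ofReal_norm]
        exact ENNReal.ofReal_le_ofReal (hbound v)

theorem lintegral_weight_scaled (z : ℝ) {c : ℝ} (hc : 0 < c) :
    ∫⁻ v, ENNReal.ofReal (weight ((z - v) * c)) = ENNReal.ofReal (c⁻¹ * Real.pi) := by
  have h1 := lintegral_sub_left_eq_self (μ := volume) (fun v => ENNReal.ofReal (weight (v * c))) z
  rw [h1, ← ofReal_integral_eq_lintegral_ofReal]
  · have := Measure.integral_comp_mul_right weight c
    rw [this, integral_weight, abs_of_pos (by positivity), smul_eq_mul]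
  · exact (integrable_comp_mul_right_iff weight hc.ne').2 integrable_weight
  · exact Eventually.of_forall fun v => (weight_pos _).le

theorem ofReal_weight_le_lintegral_cell {j : ℤ} {x : ℝ} (hx : x ∈ Set.Ico (j : ℝ) (j + 1)) (z : ℝ) :
    ENNReal.ofReal (weight (x + z)) ≤
      3 * ∫⁻ v in Set.Ico (j : ℝ) (j + 1), ENNReal.ofReal (weight (v + z)) := by
  have h1 : ENNReal.ofReal (weight (x + z)) =
      ∫⁻ _ in Set.Ico (j : ℝ) (j + 1), ENNReal.ofReal (weight (x + z)) := by
    simp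
  rw [h1, ← lintegral_const_mul _ (by fun_prop)]
  refine setLIntegral_mono (by fun_prop) fun v hv => ?_
  rw [← ENNReal.ofReal_ofNat, ← ENNReal.ofReal_mul (by norm_num)]
  refine ENNReal.ofReal_le_ofReal (weight_le_three_mul ?_)
  rw [abs_le]
  constructor <;> linarith [hx.1, hx.2, hv.1, hv.2]

theorem ofReal_abs_integral_le_lintegral {X : Type*} [MeasurableSpace X] (μ : Measure X) (f : X → ℝ) :
    ENNReal.ofReal |∫ x, f x ∂μ| ≤ ∫⁻ x, ENNReal.ofReal |f x| ∂μ := by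
  have := enorm_integral_le_lintegral_enorm (μ := μ) f
  simpa only [← ofReal_norm, Real.norm_eq_abs] using this

theorem ofReal_abs_sub_le (a b : ℝ) :
    ENNReal.ofReal |a - b| ≤ ENNReal.ofReal |a| + ENNReal.ofReal |b| := by
  rw [← ENNReal.ofReal_add (abs_nonneg _) (abs_nonneg _)]
  exact ENNReal.ofReal_le_ofReal (abs_sub a b)

/-- The oscillation of the semigroup over unit cells is summable, at the same rate as its decay. -/
theorem IsStableKernel.exists_oscillation {α : ℝ} {ν : Kernel ℝ ℝ} (hν : IsStableKernel α ν)
    (hα : 0 < α) : ∃ (C : ℝ) (δ : ℤ → ℝ → ℝ≥0∞), 0 ≤ C ∧ (∀ j, Measurable (δ j)) ∧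
      (∀ s, 0 ≤ s → ∑' j, δ j s ≤ ENNReal.ofReal (C * rate α s)) ∧
      ∀ s, 0 ≤ s → ∀ g : ℝ → ℝ, Measurable g → (∀ x, |g x| ≤ weight x) → ∀ (j : ℤ),
        ∀ x ∈ Set.Ico (j : ℝ) (j + 1), ∀ y ∈ Set.Ico (j : ℝ) (j + 1),
          ENNReal.ofReal |∫ z, g (x + z) ∂ν s - ∫ z, g (y + z) ∂ν s| ≤ δ j s := by
  have := hν.markov
  obtain ⟨C, hC0, hC⟩ := exists_abs_stableDensityDeriv_le hα
  -- For `s ≤ 1` the derivative bound degenerates as `s → 0`. Here each of the two values is bounded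
  -- by three times the cell integral of the weight, whence the factor 6.
  set δ₁ : ℤ → ℝ → ℝ≥0∞ := fun j s =>
    6 * ∫⁻ z, (∫⁻ v in Set.Ico (j : ℝ) (j + 1), ENNReal.ofReal (weight (v + z))) ∂ν s with hδ₁
  -- For `s > 1` the derivative bound carries `c²` with `c = s^(-1/α)`, and summing the scaled
  -- weight over all cells costs `π/c`. One factor `c` remains, the same rate as for the decay
  -- itself.
  set δ₂ : ℤ → ℝ → ℝ≥0∞ := fun j s =>
    ∫⁻ z, ENNReal.ofReal (weight z) * ∫⁻ v in Set.Ico (j : ℝ) (j + 1), ENNReal.ofReal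
        (C * (s ^ (-1 / α) * s ^ (-1 / α)) * weight ((z - v) * s ^ (-1 / α))) with hδ₂
  have hcell (j : ℤ) : Measurable fun z =>
      ∫⁻ v in Set.Ico (j : ℝ) (j + 1), ENNReal.ofReal (weight (v + z)) := by
    have : Measurable fun p : ℝ × ℝ => ENNReal.ofReal (weight (p.2 + p.1)) := by fun_prop
    exact this.lintegral_prod_right'
  have hm₁ (j : ℤ) : Measurable (δ₁ j) := (hcell j).lintegral_kernel.const_mul _
  have hpow : Measurable fun s : ℝ => s ^ (-1 / α) := by fun_prop
  have hin (j : ℤ) : Measurable fun p : ℝ × ℝ => ∫⁻ v in Set.Ico (j : ℝ) (j + 1), ENNReal.ofReal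
        (C * (p.1 ^ (-1 / α) * p.1 ^ (-1 / α)) * weight ((p.2 - v) * p.1 ^ (-1 / α))) := by
    have : Measurable fun p : (ℝ × ℝ) × ℝ => ENNReal.ofReal
        (C * (p.1.1 ^ (-1 / α) * p.1.1 ^ (-1 / α)) *
          weight ((p.1.2 - p.2) * p.1.1 ^ (-1 / α))) := by fun_prop
    exact this.lintegral_prod_right'
  have hwin (j : ℤ) (s : ℝ) : Measurable fun z : ℝ => ENNReal.ofReal (weight z) *
      ∫⁻ v in Set.Ico (j : ℝ) (j + 1), ENNReal.ofReal
        (C * (s ^ (-1 / α) * s ^ (-1 / α)) * weight ((z - v) * s ^ (-1 / α))) :=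
    Measurable.mul (by fun_prop) ((hin j).comp (measurable_prodMk_left (x := s)))
  have hm₂ (j : ℤ) : Measurable (δ₂ j) := by
    have : Measurable fun p : ℝ × ℝ => ENNReal.ofReal (weight p.2) *
        ∫⁻ v in Set.Ico (j : ℝ) (j + 1), ENNReal.ofReal
        (C * (p.1 ^ (-1 / α) * p.1 ^ (-1 / α)) * weight ((p.2 - v) * p.1 ^ (-1 / α))) :=
      Measurable.mul (by fun_prop) (hin j)
    exact this.lintegral_prod_right'
  refine ⟨max (6 * Real.pi) (Real.pi * C * Real.pi), fun j s => if s ≤ 1 then δ₁ j s else δ₂ j s,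
    by positivity, fun j => Measurable.ite measurableSet_Iic (hm₁ j) (hm₂ j), fun s hs => ?_,
    fun s hs g hgm hg j x hx y hy => ?_⟩
  · rcases le_or_gt s 1 with h1 | h1
    · simp only [h1, if_true, rate_of_le_one α h1, mul_one, hδ₁]
      rw [ENNReal.tsum_mul_left, ← lintegral_tsum fun j => (hcell j).aemeasurable]
      simp_rw [tsum_lintegral_Ico, fun z => lintegral_add_right_eq_self (μ := volume)
        (fun v => ENNReal.ofReal (weight v)) z, lintegral_weight]
      rw [lintegral_const, measure_univ, mul_one, ← ENNReal.ofReal_ofNat,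
        ← ENNReal.ofReal_mul (by norm_num)]
      exact ENNReal.ofReal_le_ofReal (le_max_left _ _)
    · have hs0 : 0 < s := by linarith
      have hc : 0 < s ^ (-1 / α) := Real.rpow_pos_of_pos hs0 _
      simp only [not_le.2 h1, if_false, rate_of_one_le α h1.le, hδ₂]
      rw [← lintegral_tsum fun j => (hwin j s).aemeasurable]
      have h2 (z : ℝ) : ∑' j : ℤ, ENNReal.ofReal (weight z) *
          ∫⁻ v in Set.Ico (j : ℝ) (j + 1), ENNReal.ofReal
            (C * (s ^ (-1 / α) * s ^ (-1 / α)) * weight ((z - v) * s ^ (-1 / α))) =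
          ENNReal.ofReal (weight z) * ENNReal.ofReal (C * s ^ (-1 / α) * Real.pi) := by
        rw [ENNReal.tsum_mul_left, tsum_lintegral_Ico]
        simp_rw [ENNReal.ofReal_mul (by positivity : 0 ≤ C * (s ^ (-1 / α) * s ^ (-1 / α)))]
        rw [lintegral_const_mul _ (by fun_prop), lintegral_weight_scaled z hc,
          ← ENNReal.ofReal_mul (by positivity)]
        congr 2
        field_simp
      simp_rw [h2]
      rw [lintegral_mul_const _ (by fun_prop), lintegral_weight, ← ENNReal.ofReal_mul Real.pi_pos.le]
      refine ENNReal.ofReal_le_ofReal ?_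
      calc Real.pi * (C * s ^ (-1 / α) * Real.pi) = (Real.pi * C * Real.pi) * s ^ (-1 / α) := by ring
        _ ≤ _ := by gcongr; exact le_max_right _ _
  · dsimp only
    split_ifs with h1
    · have key (x : ℝ) (hx : x ∈ Set.Ico (j : ℝ) (j + 1)) : ENNReal.ofReal |∫ z, g (x + z) ∂ν s| ≤
          3 * ∫⁻ z, (∫⁻ v in Set.Ico (j : ℝ) (j + 1), ENNReal.ofReal (weight (v + z))) ∂ν s := by
        rw [← lintegral_const_mul _ (hcell j)]
        exact (ofReal_abs_integral_le_lintegral _ _).trans (lintegral_mono fun z =>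
          (ENNReal.ofReal_le_ofReal (hg _)).trans (ofReal_weight_le_lintegral_cell hx z))
      refine (ofReal_abs_sub_le _ _).trans ((add_le_add (key x hx) (key y hy)).trans ?_)
      rw [← add_mul, hδ₁]
      norm_num
    · have hs0 : 0 < s := by linarith
      have hint (x : ℝ) : Integrable fun z => stableDensity α s (z - x) * g z := by
        have hcd := continuous_stableDensity hα hs0
        refine (integrable_weight.const_mul (stableDensity α s 0)).mono'
          (by fun_prop) (Eventually.of_forall fun z => ?_)
        rw [norm_mul]
        exact mul_le_mul (abs_stableDensity_le hα hs0 _) (hg z) (norm_nonneg _)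
          (hν.stableDensity_nonneg hα hs0 0)
      rw [hν.integral_add hα hs0, hν.integral_add hα hs0, ← integral_sub (hint x) (hint y)]
      refine (ofReal_abs_integral_le_lintegral _ _).trans (lintegral_mono fun z => ?_)
      rw [← sub_mul, abs_mul, ENNReal.ofReal_mul (abs_nonneg _), mul_comm]
      gcongr
      · exact hg z
      · exact ofReal_abs_stableDensity_sub_le hα hC hs0 hx hy z

/-- The mean value `x ↦ ∫ g(x + z) ν_s(dz)`, i.e. the semigroup. -/
noncomputable def semi (ν : Kernel ℝ ℝ) (s : ℝ) (g : ℝ → ℝ) (x : ℝ) : ℝ := ∫ z, g (x + z) ∂ν s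

theorem IsStableKernel.exists_oscillation_semi {α : ℝ} {ν : Kernel ℝ ℝ} (hν : IsStableKernel α ν)
    (hα : 0 < α) : ∃ (C : ℝ) (δ : ℤ → ℝ → ℝ≥0∞), 0 ≤ C ∧ (∀ j, Measurable (δ j)) ∧
      (∀ s, 0 ≤ s → ∑' j, δ j s ≤ ENNReal.ofReal (C * rate α s)) ∧
      ∀ s, 0 ≤ s → ∀ (K : ℝ) (g : ℝ → ℝ), 0 < K → Measurable g → (∀ x, |g x| ≤ K * weight x) →
        ∀ (j : ℤ), ∀ x ∈ Set.Ico (j : ℝ) (j + 1), ∀ y ∈ Set.Ico (j : ℝ) (j + 1),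
          ENNReal.ofReal |semi ν s g x - semi ν s g y| ≤ ENNReal.ofReal K * δ j s := by
  obtain ⟨C, δ, hC, hδ, hsum, h⟩ := hν.exists_oscillation hα
  refine ⟨C, δ, hC, hδ, hsum, fun s hs K g hK hgm hg j x hx y hy => ?_⟩
  have h1 := h s hs (fun x => K⁻¹ * g x) (by fun_prop) (fun x => by
    rw [abs_mul, abs_of_pos (inv_pos.2 hK), inv_mul_le_iff₀ hK]
    exact hg x) j x hx y hy
  rw [integral_const_mul, integral_const_mul, ← mul_sub, abs_mul, abs_of_pos (inv_pos.2 hK)] at h1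
  calc ENNReal.ofReal |semi ν s g x - semi ν s g y|
      = ENNReal.ofReal K * ENNReal.ofReal (K⁻¹ * |semi ν s g x - semi ν s g y|) := by
        rw [← ENNReal.ofReal_mul hK.le, mul_inv_cancel_left₀ hK.ne']
    _ ≤ _ := by gcongr; exact h1

/-! ### The decay rate integrated over time. -/

/-- The constant in the decay bound of the semigroup. -/
noncomputable def decayConst (α : ℝ) : ℝ := 1 + stableDensity α 1 0 * Real.pi

theorem decayConst_pos {α : ℝ} (hα : 0 < α) : 0 < decayConst α := by
  have := stableDensity_one_zero_pos hα
  have := Real.pi_pos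
  unfold decayConst
  positivity

/-- The integral of the rate of decay up to time `S`. -/
noncomputable def totalRate (α S : ℝ) : ℝ := ∫ s in Set.Ioc 0 S, rate α s

theorem totalRate_nonneg (α S : ℝ) : 0 ≤ totalRate α S :=
  integral_nonneg fun s => (rate_pos α s).le

theorem integrableOn_rate {α : ℝ} (S : ℝ) : IntegrableOn (rate α) (Set.Ioc 0 S) :=
  (continuous_rate α).integrableOn_Ioc

theorem ofReal_totalRate (α S : ℝ) :
    ∫⁻ s in Set.Ioc 0 S, ENNReal.ofReal (rate α s) = ENNReal.ofReal (totalRate α S) :=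
  (ofReal_integral_eq_lintegral_ofReal (integrableOn_rate S)
    (Eventually.of_forall fun s => (rate_pos α s).le)).symm

/-- The times after `s` and the times before `s` each lie at distances in `[0, S]`, so each side
contributes at most `totalRate α S`. -/
theorem lintegral_rate_abs_sub_le {α S s : ℝ} (hs : s ∈ Set.Ioc 0 S) :
    ∫⁻ u in Set.Ioc 0 S, ENNReal.ofReal (rate α |u - s|) ≤ ENNReal.ofReal (2 * totalRate α S) := by
  set f : ℝ → ℝ≥0∞ := (Set.Icc 0 S).indicator fun v => ENNReal.ofReal (rate α v) with hf
  have hfm : Measurable f := Measurable.indicator (by fun_prop) measurableSet_Icc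
  have hfi : ∫⁻ v, f v = ENNReal.ofReal (totalRate α S) := by
    rw [hf, lintegral_indicator measurableSet_Icc, ← setLIntegral_congr Ioc_ae_eq_Icc,
      ofReal_totalRate]
  calc ∫⁻ u in Set.Ioc 0 S, ENNReal.ofReal (rate α |u - s|)
      ≤ ∫⁻ u, (f (u - s) + f (s - u)) := by
        rw [← lintegral_indicator measurableSet_Ioc]
        refine lintegral_mono fun u => ?_
        by_cases hu : u ∈ Set.Ioc 0 S
        swap
        · rw [Set.indicator_of_notMem hu]
          exact zero_le
        rw [Set.indicator_of_mem hu]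
        rcases le_total s u with h | h
        · refine le_trans (le_of_eq ?_) le_self_add
          rw [hf, Set.indicator_of_mem (by constructor <;> linarith [hs.1, hs.2, hu.1, hu.2]),
            abs_of_nonneg (sub_nonneg.2 h)]
        · refine le_trans (le_of_eq ?_) le_add_self
          rw [hf, Set.indicator_of_mem (by constructor <;> linarith [hs.1, hs.2, hu.1, hu.2]),
            abs_of_nonpos (sub_nonpos.2 h), neg_sub]
    _ = ENNReal.ofReal (2 * totalRate α S) := by
        rw [lintegral_add_left (by fun_prop), lintegral_sub_right_eq_self f,
          lintegral_sub_left_eq_self f, hfi, ← ENNReal.ofReal_add (totalRate_nonneg _ _)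
          (totalRate_nonneg _ _), two_mul]

/-! ### Symmetrisation of triple time integrals. -/

theorem lintegral_sum_permutations (ρ : Measure ℝ) [SFinite ρ] {G : ℝ → ℝ → ℝ → ℝ≥0∞}
    (hGm : Measurable fun p : ℝ × ℝ × ℝ => G p.1 p.2.1 p.2.2) :
    ∫⁻ a, ∫⁻ b, ∫⁻ c,
        (G a b c + G a c b + G b a c + G b c a + G c a b + G c b a) ∂ρ ∂ρ ∂ρ =
      6 * ∫⁻ a, ∫⁻ b, ∫⁻ c, G a b c ∂ρ ∂ρ ∂ρ := by
  have swap12 (F : ℝ → ℝ → ℝ → ℝ≥0∞) (hF : Measurable fun p : ℝ × ℝ × ℝ => F p.1 p.2.1 p.2.2) :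
      ∫⁻ a, ∫⁻ b, ∫⁻ c, F b a c ∂ρ ∂ρ ∂ρ = ∫⁻ a, ∫⁻ b, ∫⁻ c, F a b c ∂ρ ∂ρ ∂ρ := by
    refine lintegral_lintegral_swap (Measurable.aemeasurable ?_)
    exact (hF.comp (by fun_prop : Measurable fun p : (ℝ × ℝ) × ℝ =>
      (p.1.2, p.1.1, p.2))).lintegral_prod_right'
  have swap23 (F : ℝ → ℝ → ℝ → ℝ≥0∞) (hF : Measurable fun p : ℝ × ℝ × ℝ => F p.1 p.2.1 p.2.2) :
      ∫⁻ a, ∫⁻ b, ∫⁻ c, F a c b ∂ρ ∂ρ ∂ρ = ∫⁻ a, ∫⁻ b, ∫⁻ c, F a b c ∂ρ ∂ρ ∂ρ :=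
    lintegral_congr fun a => lintegral_lintegral_swap
      (hF.comp (by fun_prop : Measurable fun p : ℝ × ℝ => (a, p.2, p.1))).aemeasurable
  have g2 : Measurable fun p : ℝ × ℝ × ℝ => G p.1 p.2.2 p.2.1 :=
    hGm.comp (by fun_prop : Measurable fun p : ℝ × ℝ × ℝ => (p.1, p.2.2, p.2.1))
  have g3 : Measurable fun p : ℝ × ℝ × ℝ => G p.2.1 p.1 p.2.2 :=
    hGm.comp (by fun_prop : Measurable fun p : ℝ × ℝ × ℝ => (p.2.1, p.1, p.2.2))
  have g4 : Measurable fun p : ℝ × ℝ × ℝ => G p.2.1 p.2.2 p.1 :=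
    hGm.comp (by fun_prop : Measurable fun p : ℝ × ℝ × ℝ => (p.2.1, p.2.2, p.1))
  have g5 : Measurable fun p : ℝ × ℝ × ℝ => G p.2.2 p.1 p.2.1 :=
    hGm.comp (by fun_prop : Measurable fun p : ℝ × ℝ × ℝ => (p.2.2, p.1, p.2.1))
  have g6 : Measurable fun p : ℝ × ℝ × ℝ => G p.2.2 p.2.1 p.1 :=
    hGm.comp (by fun_prop : Measurable fun p : ℝ × ℝ × ℝ => (p.2.2, p.2.1, p.1))
  have add3 (F F' : ℝ → ℝ → ℝ → ℝ≥0∞) (hF : Measurable fun p : ℝ × ℝ × ℝ => F p.1 p.2.1 p.2.2) :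
      ∫⁻ a, ∫⁻ b, ∫⁻ c, (F a b c + F' a b c) ∂ρ ∂ρ ∂ρ =
        ∫⁻ a, ∫⁻ b, ∫⁻ c, F a b c ∂ρ ∂ρ ∂ρ + ∫⁻ a, ∫⁻ b, ∫⁻ c, F' a b c ∂ρ ∂ρ ∂ρ := by
    have e2 : Measurable fun p : ℝ × ℝ => ∫⁻ c, F p.1 p.2 c ∂ρ :=
      (hF.comp (by fun_prop : Measurable fun p : (ℝ × ℝ) × ℝ =>
        (p.1.1, p.1.2, p.2))).lintegral_prod_right'
    have e1 : Measurable fun a : ℝ => ∫⁻ b, ∫⁻ c, F a b c ∂ρ ∂ρ := e2.lintegral_prod_right'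
    rw [← lintegral_add_left e1]
    refine lintegral_congr fun a => ?_
    have e2a : Measurable fun b : ℝ => ∫⁻ c, F a b c ∂ρ := e2.comp measurable_prodMk_left
    rw [← lintegral_add_left e2a]
    refine lintegral_congr fun b => ?_
    have e3 : Measurable fun c : ℝ => F a b c :=
      hF.comp (by fun_prop : Measurable fun c : ℝ => (a, b, c))
    rw [← lintegral_add_left e3]
  rw [add3 _ (fun a b c => G c b a) ((((hGm.add g2).add g3).add g4).add g5),
    add3 _ (fun a b c => G c a b) (((hGm.add g2).add g3).add g4),
    add3 _ (fun a b c => G b c a) ((hGm.add g2).add g3),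
    add3 _ (fun a b c => G b a c) (hGm.add g2), add3 _ (fun a b c => G a c b) hGm,
    swap23 G hGm, swap12 G hGm, swap12 (fun a b c => G a c b) g2, swap23 G hGm,
    swap23 (fun a b c => G b a c) g3, swap12 G hGm,
    swap12 (fun a b c => G c a b) g5, swap23 (fun a b c => G b a c) g3, swap12 G hGm]
  ring

/-- A bound on sorted triples extends to all triples of nonnegative times by symmetry of `H`.
Summing over the six orderings avoids splitting the domain of integration. -/
theorem le_sum_permutations (H G : ℝ → ℝ → ℝ → ℝ≥0∞) (hH1 : ∀ a b c, H a b c = H b a c)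
    (hH2 : ∀ a b c, H a b c = H a c b)
    (hsort : ∀ a b c, 0 ≤ a → a ≤ b → b ≤ c → H a b c ≤ G a b c) {a b c : ℝ} (ha : 0 ≤ a)
    (hb : 0 ≤ b) (hc : 0 ≤ c) :
    H a b c ≤ G a b c + G a c b + G b a c + G b c a + G c a b + G c b a := by
  have p1 : G a b c ≤ G a b c + G a c b + G b a c + G b c a + G c a b + G c b a := by
    simp only [add_assoc]; exact le_self_add
  have p2 : G a c b ≤ G a b c + G a c b + G b a c + G b c a + G c a b + G c b a := by
    simp only [add_assoc]; exact le_add_left le_self_add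
  have p3 : G b a c ≤ G a b c + G a c b + G b a c + G b c a + G c a b + G c b a := by
    simp only [add_assoc]; exact le_add_left (le_add_left le_self_add)
  have p4 : G b c a ≤ G a b c + G a c b + G b a c + G b c a + G c a b + G c b a := by
    simp only [add_assoc]; exact le_add_left (le_add_left (le_add_left le_self_add))
  have p5 : G c a b ≤ G a b c + G a c b + G b a c + G b c a + G c a b + G c b a := by
    simp only [add_assoc]
    exact le_add_left (le_add_left (le_add_left (le_add_left le_self_add)))
  have p6 : G c b a ≤ G a b c + G a c b + G b a c + G b c a + G c a b + G c b a := le_add_self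
  rcases le_total a b with h1 | h1 <;> rcases le_total b c with h2 | h2 <;>
    rcases le_total a c with h3 | h3
  · exact (hsort a b c ha h1 h2).trans p1
  · exact (hsort a b c ha h1 h2).trans p1
  · rw [hH2]; exact (hsort a c b ha h3 h2).trans p2
  · rw [hH2, hH1]; exact (hsort c a b hc h3 h1).trans p5
  · rw [hH1]; exact (hsort b a c hb h1 h3).trans p3
  · rw [hH1, hH2]; exact (hsort b c a hb h2 h3).trans p4
  · rw [hH1, hH2, hH1]; exact (hsort c b a hc h2 h1).trans p6
  · rw [hH1, hH2, hH1]; exact (hsort c b a hc h2 h1).trans p6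

theorem lintegral_lintegral_cube {E : Type*} [MeasurableSpace E] (μ : Measure E) [SFinite μ]
    (ρ : Measure ℝ) [SFinite ρ] {W : E → ℝ → ℝ≥0∞} (hWm : Measurable fun p : E × ℝ => W p.1 p.2) :
    ∫⁻ f, (∫⁻ s, W f s ∂ρ) ^ 3 ∂μ =
      ∫⁻ a, ∫⁻ b, ∫⁻ c, ∫⁻ f, W f a * W f b * W f c ∂μ ∂ρ ∂ρ ∂ρ := by
  have hWm1 (f : E) : Measurable (W f) := hWm.comp measurable_prodMk_left
  have hcube (f : E) : (∫⁻ s, W f s ∂ρ) ^ 3 = ∫⁻ a, ∫⁻ b, ∫⁻ c, W f a * W f b * W f c ∂ρ ∂ρ ∂ρ := by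
    have h1 (a b : ℝ) : ∫⁻ c, W f a * W f b * W f c ∂ρ = W f a * W f b * ∫⁻ c, W f c ∂ρ :=
      lintegral_const_mul _ (hWm1 f)
    have h2 (a : ℝ) : ∫⁻ b, W f a * W f b * ∫⁻ c, W f c ∂ρ ∂ρ =
        W f a * (∫⁻ b, W f b ∂ρ) * ∫⁻ c, W f c ∂ρ := by
      rw [lintegral_mul_const _ ((hWm1 f).const_mul _), lintegral_const_mul _ (hWm1 f)]
    simp_rw [h1, h2]
    rw [lintegral_mul_const _ ((hWm1 f).mul_const _), lintegral_mul_const _ (hWm1 f)]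
    ring
  have hWc (c : ℝ) : Measurable fun f => W f c := hWm.comp measurable_prodMk_right
  simp_rw [hcube]
  have e4 : Measurable fun q : E × ℝ × ℝ × ℝ => W q.1 q.2.1 * W q.1 q.2.2.1 * W q.1 q.2.2.2 := by
    fun_prop
  have e3 : Measurable fun q : E × ℝ × ℝ => ∫⁻ c, W q.1 q.2.1 * W q.1 q.2.2 * W q.1 c ∂ρ :=
    (e4.comp (by fun_prop : Measurable fun p : (E × ℝ × ℝ) × ℝ =>
      (p.1.1, p.1.2.1, p.1.2.2, p.2))).lintegral_prod_right'
  have e2 : Measurable fun q : E × ℝ => ∫⁻ b, ∫⁻ c, W q.1 q.2 * W q.1 b * W q.1 c ∂ρ ∂ρ :=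
    (e3.comp (by fun_prop : Measurable fun p : (E × ℝ) × ℝ =>
      (p.1.1, p.1.2, p.2))).lintegral_prod_right'
  rw [lintegral_lintegral_swap e2.aemeasurable]
  refine lintegral_congr fun a => ?_
  have e3a : Measurable fun p : E × ℝ => ∫⁻ c, W p.1 a * W p.1 p.2 * W p.1 c ∂ρ :=
    e3.comp (by fun_prop : Measurable fun p : E × ℝ => (p.1, a, p.2))
  rw [lintegral_lintegral_swap e3a.aemeasurable]
  refine lintegral_congr fun b => ?_
  have e4a : Measurable fun p : E × ℝ => W p.1 a * W p.1 b * W p.1 p.2 :=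
    e4.comp (by fun_prop : Measurable fun p : E × ℝ => (p.1, a, b, p.2))
  rw [lintegral_lintegral_swap e4a.aemeasurable]

/-! ### Paths with stationary independent increments and their occupation times. -/

/-- A path space with stationary independent increments of laws `ν_s`. -/
structure IsMarkovPath (ν : Kernel ℝ ℝ) {E : Type*} [MeasurableSpace E] (μ : Measure E)
    (R : E → ℝ → ℝ) : Prop where
  prob : IsProbabilityMeasure μ
  measurable : Measurable (fun p : E × ℝ => R p.1 p.2)
  map_eq : ∀ s u r, 0 ≤ s → s ≤ u → u ≤ r →
    μ.map (fun f => (R f s, R f u - R f s, R f r - R f u)) =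
      (ν s).prod ((ν (u - s)).prod (ν (r - u)))

namespace IsMarkovPath

variable {α : ℝ} {ν : Kernel ℝ ℝ} {E : Type*} [MeasurableSpace E] {μ : Measure E} {R : E → ℝ → ℝ}

theorem measurable_apply (h : IsMarkovPath ν μ R) (s : ℝ) : Measurable fun f => R f s :=
  h.measurable.comp measurable_prodMk_right

theorem lintegral_three (h : IsMarkovPath ν μ R) (hν : IsStableKernel α ν) {s u r : ℝ} (hs : 0 ≤ s)
    (hsu : s ≤ u) (hur : u ≤ r) {F : ℝ × ℝ × ℝ → ℝ≥0∞} (hF : Measurable F) :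
    ∫⁻ f, F (R f s, R f u, R f r) ∂μ =
      ∫⁻ a, ∫⁻ b, ∫⁻ c, F (a, a + b, a + b + c) ∂ν (r - u) ∂ν (u - s) ∂ν s := by
  have := hν.markov
  have h1 := h.measurable_apply
  have hG : Measurable fun p : ℝ × ℝ × ℝ => F (p.1, p.1 + p.2.1, p.1 + p.2.1 + p.2.2) := by
    fun_prop
  have h2 : ∫⁻ f, F (R f s, R f u, R f r) ∂μ =
      ∫⁻ p, F (p.1, p.1 + p.2.1, p.1 + p.2.1 + p.2.2)
        ∂(μ.map (fun f => (R f s, R f u - R f s, R f r - R f u))) := by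
    rw [lintegral_map hG (by fun_prop)]
    simp
  rw [h2, h.map_eq s u r hs hsu hur, lintegral_prod _ hG.aemeasurable]
  refine lintegral_congr fun a => ?_
  rw [lintegral_prod]
  fun_prop

theorem lintegral_one (h : IsMarkovPath ν μ R) (hν : IsStableKernel α ν) {s : ℝ} (hs : 0 ≤ s)
    {F : ℝ → ℝ≥0∞} (hF : Measurable F) : ∫⁻ f, F (R f s) ∂μ = ∫⁻ a, F a ∂ν s := by
  have := hν.markov
  have := h.lintegral_three hν hs le_rfl le_rfl (F := fun p => F p.1) (by fun_prop)
  simpa using this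

theorem map_one (h : IsMarkovPath ν μ R) (hν : IsStableKernel α ν) {s : ℝ} (hs : 0 ≤ s) :
    μ.map (fun f => R f s) = ν s := by
  refine Measure.ext_of_lintegral _ fun F hF => ?_
  rw [lintegral_map hF (h.measurable_apply s), h.lintegral_one hν hs hF]

theorem integral_one (h : IsMarkovPath ν μ R) (hν : IsStableKernel α ν) {s : ℝ} (hs : 0 ≤ s)
    {g : ℝ → ℝ} (hg : Measurable g) (x : ℝ) : ∫ f, g (x + R f s) ∂μ = semi ν s g x := by
  rw [semi, ← h.map_one hν hs, integral_map (h.measurable_apply s).aemeasurable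
    (by exact (hg.comp (measurable_const_add x)).aestronglyMeasurable)]

theorem map_two (h : IsMarkovPath ν μ R) (hν : IsStableKernel α ν) {s u : ℝ} (hs : 0 ≤ s)
    (hsu : s ≤ u) : μ.map (fun f => (R f s, R f u)) =
      ((ν s).prod (ν (u - s))).map (fun p => (p.1, p.1 + p.2)) := by
  have := hν.markov
  have h1 := h.measurable_apply
  refine Measure.ext_of_lintegral _ fun F hF => ?_
  rw [lintegral_map hF (by fun_prop), lintegral_map hF (by fun_prop), lintegral_prod _ (by fun_prop)]
  have := h.lintegral_three hν hs hsu le_rfl (F := fun p => F (p.1, p.2.1)) (by fun_prop)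
  simpa using this

theorem integral_two (h : IsMarkovPath ν μ R) (hν : IsStableKernel α ν) {s u : ℝ} (hs : 0 ≤ s)
    (hsu : s ≤ u) {g g' : ℝ → ℝ} (hg : Measurable g) (hg' : Measurable g') {K K' : ℝ}
    (hK : ∀ x, |g x| ≤ K) (hK' : ∀ x, |g' x| ≤ K') (x : ℝ) :
    ∫ f, g (x + R f s) * g' (x + R f u) ∂μ = semi ν s (fun y => g y * semi ν (u - s) g' y) x := by
  have := hν.markov
  have h1 := h.measurable_apply
  have h2 : ∫ f, g (x + R f s) * g' (x + R f u) ∂μ =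
      ∫ p, g (x + p.1) * g' (x + p.2) ∂(μ.map (fun f => (R f s, R f u))) := by
    rw [integral_map (by fun_prop) (by fun_prop)]
  rw [h2, h.map_two hν hs hsu, integral_map (by fun_prop) (by fun_prop), integral_prod]
  · simp only [integral_const_mul, semi, add_assoc]
  · refine Integrable.of_bound (C := K * K') (by fun_prop) (Eventually.of_forall fun p => ?_)
    rw [norm_mul]
    exact mul_le_mul (hK _) (hK' _) (norm_nonneg _) ((abs_nonneg _).trans (hK 0))

/-- The increments are integrated out from the latest time backwards. The decay bound is uniform in
the starting point, so each of the last two factors contributes `decayConst α * rate α` of its time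
gap. -/
theorem lintegral_weight_three_le (h : IsMarkovPath ν μ R) (hν : IsStableKernel α ν) (hα : 0 < α)
    {s u r : ℝ} (hs : 0 ≤ s) (hsu : s ≤ u) (hur : u ≤ r) (x : ℝ) :
    ∫⁻ f, ENNReal.ofReal (weight (x + R f s)) * ENNReal.ofReal (weight (x + R f u)) *
        ENNReal.ofReal (weight (x + R f r)) ∂μ ≤
      (∫⁻ z, ENNReal.ofReal (weight (x + z)) ∂ν s) * ENNReal.ofReal (decayConst α * rate α |u - s|) *
        ENNReal.ofReal (decayConst α * rate α |r - u|) := by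
  have := hν.markov
  rw [h.lintegral_three hν hs hsu hur (F := fun p => ENNReal.ofReal (weight (x + p.1)) *
    ENNReal.ofReal (weight (x + p.2.1)) * ENNReal.ofReal (weight (x + p.2.2))) (by fun_prop),
    abs_of_nonneg (sub_nonneg.2 hsu), abs_of_nonneg (sub_nonneg.2 hur)]
  dsimp only
  rw [mul_assoc, ← lintegral_mul_const _ (by fun_prop)]
  refine lintegral_mono fun a => ?_
  calc ∫⁻ b, ∫⁻ c, ENNReal.ofReal (weight (x + a)) * ENNReal.ofReal (weight (x + (a + b))) *
          ENNReal.ofReal (weight (x + (a + b + c))) ∂ν (r - u) ∂ν (u - s)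
      ≤ ∫⁻ b, ENNReal.ofReal (weight (x + a)) * (ENNReal.ofReal (weight ((x + a) + b)) *
          ENNReal.ofReal (decayConst α * rate α (r - u))) ∂ν (u - s) := by
        refine lintegral_mono fun b => ?_
        rw [lintegral_const_mul _ (by fun_prop), mul_assoc, add_assoc]
        gcongr
        simp_rw [← add_assoc x (a + b)]
        exact hν.lintegral_weight_le hα _ _
    _ = ENNReal.ofReal (weight (x + a)) * ((∫⁻ b, ENNReal.ofReal (weight ((x + a) + b)) ∂ν (u - s)) *
          ENNReal.ofReal (decayConst α * rate α (r - u))) := by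
        rw [lintegral_const_mul _ (by fun_prop), lintegral_mul_const _ (by fun_prop)]
    _ ≤ _ := by
        gcongr
        exact hν.lintegral_weight_le hα _ _

theorem lintegral_occupation (h : IsMarkovPath ν μ R) (hν : IsStableKernel α ν) (S x : ℝ) :
    ∫⁻ f, ∫⁻ s in Set.Ioc 0 S, ENNReal.ofReal (weight (x + R f s)) ∂volume ∂μ =
      ∫⁻ s in Set.Ioc 0 S, ∫⁻ z, ENNReal.ofReal (weight (x + z)) ∂ν s := by
  have := h.prob
  have hR := h.measurable
  rw [lintegral_lintegral_swap (Measurable.aemeasurable (by fun_prop))]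
  refine setLIntegral_congr_fun measurableSet_Ioc fun s hs => ?_
  exact h.lintegral_one hν hs.1.le (F := fun y => ENNReal.ofReal (weight (x + y))) (by fun_prop)

/-- The third moment of the occupation time of the reference weight. -/
theorem lintegral_occupation_cube (h : IsMarkovPath ν μ R) (hν : IsStableKernel α ν) (hα : 0 < α)
    (S x : ℝ) :
    ∫⁻ f, (∫⁻ s in Set.Ioc 0 S, ENNReal.ofReal (weight (x + R f s))) ^ 3 ∂μ ≤
      ENNReal.ofReal (24 * (decayConst α * totalRate α S) ^ 2) *
        ∫⁻ s in Set.Ioc 0 S, ∫⁻ z, ENNReal.ofReal (weight (x + z)) ∂ν s := by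
  have := h.prob
  have := hν.markov
  have hR := h.measurable
  have hd := (decayConst_pos hα).le
  have hU := totalRate_nonneg α S
  set ρ : Measure ℝ := volume.restrict (Set.Ioc 0 S) with hρ
  set W : E → ℝ → ℝ≥0∞ := fun f s => ENNReal.ofReal (weight (x + R f s)) with hW
  have hWm : Measurable fun p : E × ℝ => W p.1 p.2 := by fun_prop
  set m : ℝ → ℝ≥0∞ := fun s => ∫⁻ z, ENNReal.ofReal (weight (x + z)) ∂ν s with hm
  have hmm : Measurable m := by
    have : Measurable fun z => ENNReal.ofReal (weight (x + z)) := by fun_prop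
    exact this.lintegral_kernel
  set k : ℝ → ℝ → ℝ≥0∞ := fun a b => ENNReal.ofReal (decayConst α * rate α |b - a|) with hk
  have hkm : Measurable fun p : ℝ × ℝ => k p.1 p.2 := by fun_prop
  have hkm1 (a : ℝ) : Measurable (k a) := by fun_prop
  have hkint (a : ℝ) (ha : a ∈ Set.Ioc 0 S) :
      ∫⁻ b, k a b ∂ρ ≤ ENNReal.ofReal (decayConst α * (2 * totalRate α S)) := by
    simp_rw [hk, ENNReal.ofReal_mul hd]
    rw [lintegral_const_mul _ (by fun_prop)]
    gcongr
    exact lintegral_rate_abs_sub_le ha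
  set H : ℝ → ℝ → ℝ → ℝ≥0∞ := fun a b c => ∫⁻ f, W f a * W f b * W f c ∂μ with hH
  set G : ℝ → ℝ → ℝ → ℝ≥0∞ := fun a b c => m a * k a b * k b c with hG
  have hGm : Measurable fun p : ℝ × ℝ × ℝ => G p.1 p.2.1 p.2.2 := by
    have h1 : Measurable fun p : ℝ × ℝ × ℝ => k p.1 p.2.1 := by fun_prop
    have h2 : Measurable fun p : ℝ × ℝ × ℝ => k p.2.1 p.2.2 := by fun_prop
    exact ((hmm.comp measurable_fst).mul h1).mul h2
  have hsort (a b c : ℝ) (ha : 0 ≤ a) (hab : a ≤ b) (hbc : b ≤ c) : H a b c ≤ G a b c := by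
    simp only [hH, hG, hW, hm, hk]
    exact h.lintegral_weight_three_le hν hα ha hab hbc x
  have hH1 (a b c : ℝ) : H a b c = H b a c := by simp only [hH, mul_comm (W _ a)]
  have hH2 (a b c : ℝ) : H a b c = H a c b := by simp only [hH, mul_right_comm]
  have hall (a b c : ℝ) (ha : 0 ≤ a) (hb : 0 ≤ b) (hc : 0 ≤ c) :
      H a b c ≤ G a b c + G a c b + G b a c + G b c a + G c a b + G c b a :=
    le_sum_permutations H G hH1 hH2 hsort ha hb hc
  have hswap : ∫⁻ f, (∫⁻ s, W f s ∂ρ) ^ 3 ∂μ = ∫⁻ a, ∫⁻ b, ∫⁻ c, H a b c ∂ρ ∂ρ ∂ρ :=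
    lintegral_lintegral_cube μ ρ (W := W) hWm
  have hmem : ∀ᵐ a ∂ρ, a ∈ Set.Ioc 0 S := ae_restrict_mem measurableSet_Ioc
  rw [hswap]
  clear_value H G k m W
  -- Each of the two chained kernels integrates to at most `2 * decayConst α * totalRate α S`, which
  -- gives the 4; the six orderings turn it into 24.
  have I1 : ∫⁻ a, ∫⁻ b, ∫⁻ c, G a b c ∂ρ ∂ρ ∂ρ ≤
      ENNReal.ofReal (4 * (decayConst α * totalRate α S) ^ 2) * ∫⁻ a, m a ∂ρ := by
    rw [← lintegral_const_mul _ hmm]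
    refine lintegral_mono_ae ?_
    filter_upwards [hmem] with a ha
    calc ∫⁻ b, ∫⁻ c, G a b c ∂ρ ∂ρ
        ≤ ∫⁻ b, m a * k a b * ENNReal.ofReal (decayConst α * (2 * totalRate α S)) ∂ρ := by
          refine lintegral_mono_ae ?_
          filter_upwards [hmem] with b hb
          simp only [hG]
          rw [lintegral_const_mul _ (hkm1 b)]
          gcongr
          exact hkint b hb
      _ = m a * (∫⁻ b, k a b ∂ρ) * ENNReal.ofReal (decayConst α * (2 * totalRate α S)) := by
          rw [lintegral_mul_const _ ((hkm1 a).const_mul _), lintegral_const_mul _ (hkm1 a)]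
      _ ≤ m a * ENNReal.ofReal (decayConst α * (2 * totalRate α S)) *
            ENNReal.ofReal (decayConst α * (2 * totalRate α S)) := by
          gcongr
          exact hkint a ha
      _ = _ := by
          rw [mul_assoc, ← ENNReal.ofReal_mul (by positivity), mul_comm]
          ring_nf
  calc ∫⁻ a, ∫⁻ b, ∫⁻ c, H a b c ∂ρ ∂ρ ∂ρ
      ≤ ∫⁻ a, ∫⁻ b, ∫⁻ c,
          (G a b c + G a c b + G b a c + G b c a + G c a b + G c b a) ∂ρ ∂ρ ∂ρ := by
        refine lintegral_mono_ae ?_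
        filter_upwards [hmem] with a ha
        refine lintegral_mono_ae ?_
        filter_upwards [hmem] with b hb
        refine lintegral_mono_ae ?_
        filter_upwards [hmem] with c hc
        exact hall a b c ha.1.le hb.1.le hc.1.le
    _ = 6 * ∫⁻ a, ∫⁻ b, ∫⁻ c, G a b c ∂ρ ∂ρ ∂ρ := lintegral_sum_permutations ρ hGm
    _ ≤ 6 * (ENNReal.ofReal (4 * (decayConst α * totalRate α S) ^ 2) * ∫⁻ a, m a ∂ρ) := by gcongr
    _ = _ := by
        rw [← mul_assoc, ← ENNReal.ofReal_ofNat, ← ENNReal.ofReal_mul (by norm_num)]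
        ring_nf

end IsMarkovPath

/-! ### Additive functionals of a path and the mean occupation of the weight. -/

/-- The additive functional `∫_0^S g(s, x + R_s) ds` of a path. -/
noncomputable def occ {E : Type*} (R : E → ℝ → ℝ) (S : ℝ) (g : ℝ → ℝ → ℝ) (x : ℝ) (f : E) : ℝ :=
  ∫ s in Set.Ioc 0 S, g s (x + R f s)

/-- The mean of the additive functional of the reference weight. -/
noncomputable def meanWeight (ν : Kernel ℝ ℝ) (S x : ℝ) : ℝ :=
  ∫ s in Set.Ioc 0 S, semi ν s weight x

theorem occ_weight_nonneg {E : Type*} {R : E → ℝ → ℝ} {S : ℝ} (x : ℝ) (f : E) :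
    0 ≤ occ R S (fun _ => weight) x f :=
  integral_nonneg fun _ => (weight_pos _).le

theorem occ_weight_le {E : Type*} {R : E → ℝ → ℝ} {S : ℝ} (hS : 0 ≤ S) (x : ℝ) (f : E) :
    occ R S (fun _ => weight) x f ≤ S := by
  have h := norm_setIntegral_le_of_norm_le_const (μ := volume) (s := Set.Ioc 0 S) (C := 1)
    (f := fun s => weight (x + R f s)) (by simp) (fun s _ => by
      rw [Real.norm_eq_abs, abs_of_pos (weight_pos _)]; exact weight_le_one _)
  have h2 := (le_abs_self _).trans h
  simpa [occ, hS] using h2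

section

variable {E : Type*} [MeasurableSpace E] {R : E → ℝ → ℝ} {S K : ℝ} {g : ℝ → ℝ → ℝ}

theorem abs_le_of_le_weight (hK : 0 ≤ K) (hgK : ∀ s x, |g s x| ≤ K * weight x) (s x : ℝ) :
    |g s x| ≤ K :=
  (hgK s x).trans (mul_le_of_le_one_right hK (weight_le_one x))

theorem measurable_occ (hR : Measurable fun p : E × ℝ => R p.1 p.2)
    (hg : Measurable (Function.uncurry g)) : Measurable fun p : ℝ × E => occ R S g p.1 p.2 := by
  have h1 : Measurable fun q : (ℝ × E) × ℝ => g q.2 (q.1.1 + R q.1.2 q.2) :=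
    hg.comp (measurable_snd.prodMk (measurable_fst.fst.add
      (hR.comp (measurable_fst.snd.prodMk measurable_snd))))
  exact h1.stronglyMeasurable.integral_prod_right.measurable

theorem abs_occ_le (hR : Measurable fun p : E × ℝ => R p.1 p.2)
    (hgK : ∀ s x, |g s x| ≤ K * weight x) (x : ℝ) (f : E) :
    |occ R S g x f| ≤ K * occ R S (fun _ => weight) x f := by
  have hRf : Measurable (R f) := by fun_prop
  have h1 : Integrable (fun s => weight (x + R f s)) (volume.restrict (Set.Ioc 0 S)) :=
    Integrable.of_bound (C := 1) (by fun_prop) (Eventually.of_forall fun s => by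
      rw [Real.norm_eq_abs, abs_of_pos (weight_pos _)]; exact weight_le_one _)
  rw [occ, occ, ← integral_const_mul]
  exact norm_integral_le_of_norm_le (f := fun s => g s (x + R f s))
    (g := fun s => K * weight (x + R f s)) (h1.const_mul K) (Eventually.of_forall fun s => hgK _ _)

theorem ofReal_occ_weight (hR : Measurable fun p : E × ℝ => R p.1 p.2) (x : ℝ) (f : E) :
    ENNReal.ofReal (occ R S (fun _ => weight) x f) =
      ∫⁻ s in Set.Ioc 0 S, ENNReal.ofReal (weight (x + R f s)) := by
  have hRf : Measurable (R f) := by fun_prop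
  refine ofReal_integral_eq_lintegral_ofReal ?_ (Eventually.of_forall fun s => (weight_pos _).le)
  exact Integrable.of_bound (C := 1) (by fun_prop) (Eventually.of_forall fun s => by
    rw [Real.norm_eq_abs, abs_of_pos (weight_pos _)]; exact weight_le_one _)

theorem abs_occ_le_mul (hR : Measurable fun p : E × ℝ => R p.1 p.2) (hS : 0 ≤ S) (hK : 0 ≤ K)
    (hgK : ∀ s x, |g s x| ≤ K * weight x) (x : ℝ) (f : E) : |occ R S g x f| ≤ K * S :=
  (abs_occ_le hR hgK x f).trans (by gcongr; exact occ_weight_le hS x f)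

end

theorem IsStableKernel.measurable_semi {α : ℝ} {ν : Kernel ℝ ℝ} (hν : IsStableKernel α ν)
    {X : Type*} [MeasurableSpace X] {h : X → ℝ → ℝ} (hh : Measurable (Function.uncurry h))
    {t y : X → ℝ} (ht : Measurable t) (hy : Measurable y) :
    Measurable fun p => semi ν (t p) (h p) (y p) := by
  have := hν.markov
  have h1 : Measurable fun q : X × ℝ => h q.1 (y q.1 + q.2) :=
    hh.comp (measurable_fst.prodMk ((hy.comp measurable_fst).add measurable_snd))
  exact (h1.stronglyMeasurable.integral_kernel_prod_right' (κ := ν.comap t ht)).measurable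

theorem IsStableKernel.abs_semi_le {α : ℝ} {ν : Kernel ℝ ℝ} (hν : IsStableKernel α ν)
    {h : ℝ → ℝ} {K : ℝ} (hK : ∀ x, |h x| ≤ K) (s x : ℝ) : |semi ν s h x| ≤ K := by
  have := hν.markov
  have := norm_integral_le_of_norm_le_const (μ := ν s) (f := fun z => h (x + z))
    (Eventually.of_forall fun z => hK (x + z))
  simpa [semi] using this

theorem IsStableKernel.abs_semi_le_semi_weight {α : ℝ} {ν : Kernel ℝ ℝ} (hν : IsStableKernel α ν)
    {h : ℝ → ℝ} {K : ℝ} (hK : ∀ x, |h x| ≤ K * weight x) (s x : ℝ) :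
    |semi ν s h x| ≤ K * semi ν s weight x := by
  have := hν.markov
  rw [semi, semi, ← integral_const_mul]
  refine norm_integral_le_of_norm_le (f := fun z => h (x + z))
    (g := fun z => K * weight (x + z)) ?_ (Eventually.of_forall fun z => hK (x + z))
  refine Integrable.const_mul (Integrable.of_bound (C := 1) (by fun_prop)
    (Eventually.of_forall fun s => ?_)) K
  rw [Real.norm_eq_abs, abs_of_pos (weight_pos _)]
  exact weight_le_one _

theorem ofReal_semi_weight {α : ℝ} {ν : Kernel ℝ ℝ} (hν : IsStableKernel α ν) (s x : ℝ) :
    ENNReal.ofReal (semi ν s weight x) = ∫⁻ z, ENNReal.ofReal (weight (x + z)) ∂ν s := by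
  have := hν.markov
  refine ofReal_integral_eq_lintegral_ofReal ?_ (Eventually.of_forall fun s => (weight_pos _).le)
  exact Integrable.of_bound (C := 1) (by fun_prop) (Eventually.of_forall fun s => by
    rw [Real.norm_eq_abs, abs_of_pos (weight_pos _)]; exact weight_le_one _)

theorem semi_weight_nonneg (ν : Kernel ℝ ℝ) (s x : ℝ) : 0 ≤ semi ν s weight x :=
  integral_nonneg fun _ => (weight_pos _).le

theorem semi_weight_le {α : ℝ} {ν : Kernel ℝ ℝ} (hν : IsStableKernel α ν) (hα : 0 < α) (s x : ℝ) :
    semi ν s weight x ≤ decayConst α * rate α s := by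
  rw [← ENNReal.ofReal_le_ofReal_iff (mul_pos (decayConst_pos hα) (rate_pos α s)).le,
    ofReal_semi_weight hν]
  exact hν.lintegral_weight_le hα s x

theorem integrable_semi_weight {α : ℝ} {ν : Kernel ℝ ℝ} (hν : IsStableKernel α ν) (S x : ℝ) :
    Integrable (fun s => semi ν s weight x) (volume.restrict (Set.Ioc 0 S)) := by
  refine Integrable.of_bound (C := 1) ?_ (Eventually.of_forall fun s => ?_)
  · exact (hν.measurable_semi (h := fun _ => weight) (by fun_prop) measurable_id
      measurable_const).aestronglyMeasurable
  · exact hν.abs_semi_le (fun x => by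
      rw [abs_of_pos (weight_pos _)]; exact weight_le_one _) s x

theorem meanWeight_nonneg (ν : Kernel ℝ ℝ) (S x : ℝ) : 0 ≤ meanWeight ν S x :=
  integral_nonneg fun s => semi_weight_nonneg ν s x

theorem meanWeight_le {α : ℝ} {ν : Kernel ℝ ℝ} (hν : IsStableKernel α ν) (hα : 0 < α) (S x : ℝ) :
    meanWeight ν S x ≤ decayConst α * totalRate α S := by
  rw [meanWeight, totalRate, ← integral_const_mul]
  exact integral_mono (integrable_semi_weight hν S x)
    ((integrableOn_rate S).const_mul _) fun s => semi_weight_le hν hα s x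

theorem ofReal_meanWeight {α : ℝ} {ν : Kernel ℝ ℝ} (hν : IsStableKernel α ν) (S x : ℝ) :
    ENNReal.ofReal (meanWeight ν S x) =
      ∫⁻ s in Set.Ioc 0 S, ∫⁻ z, ENNReal.ofReal (weight (x + z)) ∂ν s := by
  rw [meanWeight, ofReal_integral_eq_lintegral_ofReal (integrable_semi_weight hν S x)
    (Eventually.of_forall fun s => semi_weight_nonneg ν s x)]
  simp_rw [ofReal_semi_weight hν]

theorem measurable_meanWeight {α : ℝ} {ν : Kernel ℝ ℝ} (hν : IsStableKernel α ν) (S : ℝ) :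
    Measurable (meanWeight ν S) := by
  have h1 : Measurable fun q : ℝ × ℝ => semi ν q.2 weight q.1 :=
    hν.measurable_semi (h := fun _ => weight) (by fun_prop) measurable_snd measurable_fst
  exact h1.stronglyMeasurable.integral_prod_right.measurable

/-- Translation invariance of Lebesgue measure: at each time the semigroup preserves the total mass
`π` of the weight. -/
theorem lintegral_meanWeight {α : ℝ} {ν : Kernel ℝ ℝ} (hν : IsStableKernel α ν) (S : ℝ) :
    ∫⁻ x, ENNReal.ofReal (meanWeight ν S x) = ENNReal.ofReal (S * Real.pi) := by
  have := hν.markov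
  have h0 : Measurable fun q : (ℝ × ℝ) × ℝ => ENNReal.ofReal (weight (q.1.1 + q.2)) := by fun_prop
  have h1 : Measurable fun q : ℝ × ℝ => ∫⁻ z, ENNReal.ofReal (weight (q.1 + z)) ∂ν q.2 :=
    h0.lintegral_kernel_prod_right' (κ := ν.comap Prod.snd measurable_snd)
  simp_rw [ofReal_meanWeight hν]
  rw [lintegral_lintegral_swap h1.aemeasurable]
  have h2 (s : ℝ) : ∫⁻ x, ∫⁻ z, ENNReal.ofReal (weight (x + z)) ∂ν s = ENNReal.ofReal Real.pi := by
    rw [lintegral_lintegral_swap (Measurable.aemeasurable (by fun_prop))]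
    simp_rw [fun z => lintegral_add_right_eq_self (μ := volume)
      (fun v => ENNReal.ofReal (weight v)) z, lintegral_weight]
    simp
  simp_rw [h2]
  rw [setLIntegral_const, Real.volume_Ioc, sub_zero, mul_comm,
    ENNReal.ofReal_mul' Real.pi_pos.le]

theorem integrable_meanWeight {α : ℝ} {ν : Kernel ℝ ℝ} (hν : IsStableKernel α ν) (S : ℝ) :
    Integrable (meanWeight ν S) := by
  refine ⟨(measurable_meanWeight hν S).aestronglyMeasurable, ?_⟩
  rw [hasFiniteIntegral_iff_ofReal (Eventually.of_forall (meanWeight_nonneg ν S)),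
    lintegral_meanWeight hν]
  exact ENNReal.ofReal_lt_top

theorem integral_meanWeight {α : ℝ} {ν : Kernel ℝ ℝ} (hν : IsStableKernel α ν) {S : ℝ}
    (hS : 0 ≤ S) : ∫ x, meanWeight ν S x = S * Real.pi := by
  rw [integral_eq_lintegral_of_nonneg_ae (Eventually.of_forall (meanWeight_nonneg ν S))
    (measurable_meanWeight hν S).aestronglyMeasurable, lintegral_meanWeight hν,
    ENNReal.toReal_ofReal (mul_nonneg hS Real.pi_pos.le)]

theorem meanWeight_le_three_mul {α : ℝ} {ν : Kernel ℝ ℝ} (hν : IsStableKernel α ν) (S : ℝ)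
    {x y : ℝ} (h : |x - y| ≤ 1) : meanWeight ν S x ≤ 3 * meanWeight ν S y := by
  have := hν.markov
  rw [meanWeight, meanWeight, ← integral_const_mul]
  refine integral_mono (integrable_semi_weight hν S x)
    ((integrable_semi_weight hν S y).const_mul 3) fun s => ?_
  have hi (x : ℝ) : Integrable (fun z => weight (x + z)) (ν s) :=
    Integrable.of_bound (C := 1) (by fun_prop) (Eventually.of_forall fun s => by
      rw [Real.norm_eq_abs, abs_of_pos (weight_pos _)]; exact weight_le_one _)
  dsimp only
  rw [semi, semi, ← integral_const_mul]
  exact integral_mono (hi x) ((hi y).const_mul 3) fun z =>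
    weight_le_three_mul (by rwa [add_sub_add_right_eq_sub])

namespace IsMarkovPath

variable {α : ℝ} {ν : Kernel ℝ ℝ} {E : Type*} [MeasurableSpace E] {μ : Measure E} {R : E → ℝ → ℝ}
  {S K : ℝ} {g : ℝ → ℝ → ℝ}

theorem measurable_occ_apply (h : IsMarkovPath ν μ R) (hg : Measurable (Function.uncurry g)) (x : ℝ) :
    Measurable fun f => occ R S g x f :=
  (measurable_occ h.measurable hg).comp measurable_prodMk_left

theorem integral_occ_weight (h : IsMarkovPath ν μ R) (hν : IsStableKernel α ν) (S x : ℝ) :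
    ∫ f, occ R S (fun _ => weight) x f ∂μ = meanWeight ν S x := by
  rw [integral_eq_lintegral_of_nonneg_ae (Eventually.of_forall (occ_weight_nonneg x))
    (h.measurable_occ_apply (g := fun _ => weight) (by fun_prop) x).aestronglyMeasurable]
  simp_rw [ofReal_occ_weight h.measurable]
  rw [h.lintegral_occupation hν, ← ofReal_meanWeight hν,
    ENNReal.toReal_ofReal (meanWeight_nonneg _ _ _)]

theorem integrable_occ_pow (h : IsMarkovPath ν μ R) (hS : 0 ≤ S) (hK : 0 ≤ K)
    (hg : Measurable (Function.uncurry g)) (hgK : ∀ s x, |g s x| ≤ K * weight x) (x : ℝ) (p : ℕ) :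
    Integrable (fun f => occ R S g x f ^ p) μ := by
  have := h.prob
  refine Integrable.of_bound (C := (K * S) ^ p)
    ((h.measurable_occ_apply hg x).pow_const p).aestronglyMeasurable
    (Eventually.of_forall fun f => ?_)
  rw [norm_pow]
  exact pow_le_pow_left₀ (norm_nonneg _) (abs_occ_le_mul h.measurable hS hK hgK x f) p

theorem integral_occ_weight_cube_le (h : IsMarkovPath ν μ R) (hν : IsStableKernel α ν) (hα : 0 < α)
    (S x : ℝ) : ∫ f, occ R S (fun _ => weight) x f ^ 3 ∂μ ≤
      24 * (decayConst α * totalRate α S) ^ 2 * meanWeight ν S x := by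
  have hm := meanWeight_nonneg ν S x
  rw [integral_eq_lintegral_of_nonneg_ae
    (Eventually.of_forall fun f => pow_nonneg (occ_weight_nonneg x f) 3)
    ((h.measurable_occ_apply (g := fun _ => weight) (by fun_prop) x).pow_const 3).aestronglyMeasurable]
  simp_rw [ENNReal.ofReal_pow (occ_weight_nonneg x _), ofReal_occ_weight h.measurable]
  refine ENNReal.toReal_le_of_le_ofReal (by positivity)
    ((h.lintegral_occupation_cube hν hα S x).trans (le_of_eq ?_))
  rw [← ofReal_meanWeight hν, ← ENNReal.ofReal_mul (by positivity)]

/-- Interpolation between the first and third moments: `y (y - D)² ≥ 0` gives `2D y² ≤ y³ + D² y`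
with `D = decayConst α * totalRate α S`. The bounds `24 D²` and `D²` add up to `25 D² ≤ 2D · 13D`.
-/
theorem integral_occ_weight_sq_le (h : IsMarkovPath ν μ R) (hν : IsStableKernel α ν) (hα : 0 < α)
    (hS : 0 < S) (x : ℝ) : ∫ f, occ R S (fun _ => weight) x f ^ 2 ∂μ ≤
      13 * (decayConst α * totalRate α S) * meanWeight ν S x := by
  have hU : 0 < totalRate α S := by
    rw [totalRate, setIntegral_pos_iff_support_of_nonneg_ae
      (Eventually.of_forall fun s => (rate_pos α s).le) (integrableOn_rate S),
      Function.support_eq_univ (fun s => (rate_pos α s).ne'), Set.univ_inter]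
    simp [hS]
  set D := decayConst α * totalRate α S with hD
  have hD0 : 0 < D := mul_pos (decayConst_pos hα) hU
  have hw : Measurable (Function.uncurry fun _ : ℝ => weight) := by fun_prop
  have hb (s x : ℝ) : |(fun _ : ℝ => weight) s x| ≤ 1 * weight x := by
    rw [one_mul, abs_of_pos (weight_pos x)]
  have i1 := h.integrable_occ_pow hS.le zero_le_one hw hb x 1
  have i2 := h.integrable_occ_pow hS.le zero_le_one hw hb x 2
  have i3 := h.integrable_occ_pow hS.le zero_le_one hw hb x 3
  simp only [pow_one] at i1
  have h3 := h.integral_occ_weight_cube_le hν hα S x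
  have h1 := h.integral_occ_weight hν S x
  have key : 2 * D * ∫ f, occ R S (fun _ => weight) x f ^ 2 ∂μ ≤
      ∫ f, occ R S (fun _ => weight) x f ^ 3 ∂μ + D ^ 2 * ∫ f, occ R S (fun _ => weight) x f ∂μ := by
    rw [← integral_const_mul, ← integral_const_mul, ← integral_add i3 (i1.const_mul _)]
    refine integral_mono (i2.const_mul _) (i3.add (i1.const_mul _)) fun f => ?_
    have := occ_weight_nonneg (R := R) (S := S) x f
    dsimp only
    nlinarith [mul_nonneg this (sq_nonneg (occ R S (fun _ => weight) x f - D))]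
  rw [h1] at key
  have : 2 * D * ∫ f, occ R S (fun _ => weight) x f ^ 2 ∂μ ≤
      2 * D * (13 * D * meanWeight ν S x) := by
    have := meanWeight_nonneg ν S x
    nlinarith [mul_nonneg (sq_nonneg D) this]
  exact le_of_mul_le_mul_left this (by positivity)

end IsMarkovPath

/-! ### First and second moments of additive functionals. -/

/-- The two-time correlation of a path functional, for ordered times. -/
noncomputable def corr (ν : Kernel ℝ ℝ) (g : ℝ → ℝ → ℝ) (s u x : ℝ) : ℝ :=
  semi ν s (fun y => g s y * semi ν (u - s) (g u) y) x

/-- The mean of the additive functional. -/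
noncomputable def occMean (ν : Kernel ℝ ℝ) (S : ℝ) (g : ℝ → ℝ → ℝ) (x : ℝ) : ℝ :=
  ∫ s in Set.Ioc 0 S, semi ν s (g s) x

/-- The second moment of the additive functional. -/
noncomputable def occSq (ν : Kernel ℝ ℝ) (S : ℝ) (g : ℝ → ℝ → ℝ) (x : ℝ) : ℝ :=
  ∫ s in Set.Ioc 0 S, ∫ u in Set.Ioc 0 S, corr ν g (min s u) (max s u) x

section

variable {α : ℝ} {ν : Kernel ℝ ℝ} {S K : ℝ} {g : ℝ → ℝ → ℝ}

theorem measurable_semi_time (hν : IsStableKernel α ν) (hg : Measurable (Function.uncurry g)) :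
    Measurable fun p : ℝ × ℝ => semi ν p.1 (g p.1) p.2 :=
  hν.measurable_semi (X := ℝ × ℝ) (h := fun p => g p.1)
    (hg.comp (measurable_fst.fst.prodMk measurable_snd)) measurable_fst measurable_snd

theorem measurable_corr (hν : IsStableKernel α ν) (hg : Measurable (Function.uncurry g)) :
    Measurable fun p : ℝ × ℝ × ℝ => corr ν g p.1 p.2.1 p.2.2 := by
  have h1 : Measurable fun q : (ℝ × ℝ × ℝ) × ℝ =>
      semi ν (q.1.2.1 - q.1.1) (g q.1.2.1) q.2 :=
    hν.measurable_semi (X := (ℝ × ℝ × ℝ) × ℝ) (h := fun q => g q.1.2.1)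
      (hg.comp (measurable_fst.fst.snd.fst.prodMk measurable_snd)) (by fun_prop) measurable_snd
  have h2 : Measurable fun q : (ℝ × ℝ × ℝ) × ℝ => g q.1.1 q.2 :=
    hg.comp (measurable_fst.fst.prodMk measurable_snd)
  exact hν.measurable_semi (X := ℝ × ℝ × ℝ)
    (h := fun p y => g p.1 y * semi ν (p.2.1 - p.1) (g p.2.1) y) (h2.mul h1) measurable_fst
    measurable_snd.snd

theorem measurable_corr_min_max (hν : IsStableKernel α ν) (hg : Measurable (Function.uncurry g)) :
    Measurable fun p : ℝ × ℝ × ℝ => corr ν g (min p.1 p.2.1) (max p.1 p.2.1) p.2.2 :=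
  (measurable_corr hν hg).comp (by fun_prop : Measurable fun p : ℝ × ℝ × ℝ =>
    (min p.1 p.2.1, max p.1 p.2.1, p.2.2))

theorem abs_corr_le (hν : IsStableKernel α ν) (hK : 0 ≤ K)
    (hgK : ∀ s x, |g s x| ≤ K * weight x) (s u x : ℝ) : |corr ν g s u x| ≤ K * K := by
  refine hν.abs_semi_le (fun y => ?_) s x
  rw [abs_mul]
  exact mul_le_mul (abs_le_of_le_weight hK hgK _ _)
    (hν.abs_semi_le (abs_le_of_le_weight hK hgK u) _ _) (abs_nonneg _) hK

theorem abs_semi_le_rate (hν : IsStableKernel α ν) (hα : 0 < α) (hK : 0 ≤ K)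
    {h : ℝ → ℝ} (hgK : ∀ x, |h x| ≤ K * weight x) (s x : ℝ) :
    |semi ν s h x| ≤ K * (decayConst α * rate α s) :=
  (hν.abs_semi_le_semi_weight hgK s x).trans
    (mul_le_mul_of_nonneg_left (semi_weight_le hν hα s x) hK)

theorem abs_occMean_le (hν : IsStableKernel α ν)
    (hgK : ∀ s x, |g s x| ≤ K * weight x) (x : ℝ) :
    |occMean ν S g x| ≤ K * meanWeight ν S x := by
  rw [occMean, meanWeight, ← integral_const_mul]
  exact norm_integral_le_of_norm_le (f := fun s => semi ν s (g s) x)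
    (g := fun s => K * semi ν s weight x) ((integrable_semi_weight hν S x).const_mul K)
    (Eventually.of_forall fun s => hν.abs_semi_le_semi_weight (hgK s) s x)

theorem integrable_semi_time (hν : IsStableKernel α ν) (hK : 0 ≤ K)
    (hg : Measurable (Function.uncurry g)) (hgK : ∀ s x, |g s x| ≤ K * weight x) (x : ℝ) :
    Integrable (fun s => semi ν s (g s) x) (volume.restrict (Set.Ioc 0 S)) := by
  refine Integrable.of_bound (C := K) ?_ (Eventually.of_forall fun s => ?_)
  · exact ((measurable_semi_time hν hg).comp
      (by fun_prop : Measurable fun s : ℝ => (s, x))).aestronglyMeasurable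
  · exact hν.abs_semi_le (abs_le_of_le_weight hK hgK s) s x

theorem measurable_occMean (hν : IsStableKernel α ν) (hg : Measurable (Function.uncurry g)) :
    Measurable (occMean ν S g) := by
  have h1 : Measurable fun q : ℝ × ℝ => semi ν q.2 (g q.2) q.1 :=
    (measurable_semi_time hν hg).comp measurable_swap
  exact h1.stronglyMeasurable.integral_prod_right.measurable

/-- The integrated oscillation of the semigroup over unit cells controls the oscillation of the
first two moments of additive functionals. -/
theorem IsStableKernel.exists_oscillation_occ (hν : IsStableKernel α ν) (hα : 0 < α) :
    ∃ C : ℝ, 0 ≤ C ∧ ∀ S, ∃ ε : ℤ → ℝ, (∀ j, 0 ≤ ε j) ∧ Summable ε ∧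
      ∑' j, ε j ≤ C * totalRate α S ∧
      ∀ (K : ℝ) (g : ℝ → ℝ → ℝ), 0 < K → Measurable (Function.uncurry g) →
        (∀ s x, |g s x| ≤ K * weight x) →
        ∀ (j : ℤ), ∀ x ∈ Set.Ico (j : ℝ) (j + 1), ∀ y ∈ Set.Ico (j : ℝ) (j + 1),
          |occMean ν S g x - occMean ν S g y| ≤ K * ε j ∧
          |occSq ν S g x - occSq ν S g y| ≤
            K ^ 2 * (4 * decayConst α * totalRate α S) * ε j := by
  obtain ⟨C, δ, hC, hδm, hδs, hδ⟩ := hν.exists_oscillation_semi hα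
  refine ⟨C, hC, fun S => ?_⟩
  have hU := totalRate_nonneg α S
  have hd := (decayConst_pos hα).le
  set ρ : Measure ℝ := volume.restrict (Set.Ioc 0 S) with hρ
  have hmem : ∀ᵐ a ∂ρ, a ∈ Set.Ioc 0 S := ae_restrict_mem measurableSet_Ioc
  have hsum : ∑' j, ∫⁻ s, δ j s ∂ρ ≤ ENNReal.ofReal (C * totalRate α S) := by
    rw [← lintegral_tsum fun j => (hδm j).aemeasurable, ENNReal.ofReal_mul hC, ← ofReal_totalRate,
      ← lintegral_const_mul _ (by fun_prop)]
    refine lintegral_mono_ae ?_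
    filter_upwards [hmem] with s hs
    rw [← ENNReal.ofReal_mul hC]
    exact hδs s hs.1.le
  have htop : ∑' j, ∫⁻ s, δ j s ∂ρ ≠ ⊤ := (hsum.trans_lt ENNReal.ofReal_lt_top).ne
  have hfin (j : ℤ) : ∫⁻ s, δ j s ∂ρ ≠ ⊤ := ENNReal.ne_top_of_tsum_ne_top htop j
  refine ⟨fun j => (∫⁻ s, δ j s ∂ρ).toReal, fun j => ENNReal.toReal_nonneg,
    ENNReal.summable_toReal htop, ?_, fun K g hK hg hgK j x hx y hy => ⟨?_, ?_⟩⟩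
  · rw [← ENNReal.tsum_toReal_eq hfin]
    exact ENNReal.toReal_le_of_le_ofReal (mul_nonneg hC hU) hsum
  · rw [← ENNReal.ofReal_le_ofReal_iff (mul_nonneg hK.le ENNReal.toReal_nonneg),
      ENNReal.ofReal_mul hK.le, ENNReal.ofReal_toReal (hfin j), occMean, occMean,
      ← integral_sub (integrable_semi_time hν hK.le hg hgK x)
        (integrable_semi_time hν hK.le hg hgK y), ← lintegral_const_mul _ (hδm j)]
    refine (ofReal_abs_integral_le_lintegral _ _).trans (lintegral_mono_ae ?_)
    filter_upwards [hmem] with s hs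
    exact hδ s hs.1.le K (g s) hK (hg.comp measurable_prodMk_left) (hgK s) j x hx y hy
  · have hcm := measurable_corr_min_max hν hg
    have hint1 (s x : ℝ) : Integrable (fun u => corr ν g (min s u) (max s u) x) ρ :=
      Integrable.of_bound (C := K * K) (hcm.comp (by fun_prop : Measurable fun u : ℝ =>
        (s, u, x))).aestronglyMeasurable (Eventually.of_forall fun u => abs_corr_le hν hK.le hgK _ _ _)
    have hint2 (x : ℝ) : Integrable (fun s => ∫ u, corr ν g (min s u) (max s u) x ∂ρ) ρ := by
      have : Measurable fun q : ℝ × ℝ => corr ν g (min q.1 q.2) (max q.1 q.2) x :=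
        hcm.comp (by fun_prop : Measurable fun q : ℝ × ℝ => (q.1, q.2, x))
      refine (Integrable.of_bound (μ := ρ.prod ρ) (C := K * K) this.aestronglyMeasurable
        (Eventually.of_forall fun u => abs_corr_le hν hK.le hgK _ _ _)).integral_prod_left
    -- The correlation is the semigroup at the earlier time `s` applied to `g_s 𝒯_{u-s} g_u`. This
    -- function is below `K² decayConst α rate(u-s)` times the weight, so the oscillation bound at
    -- time `s` applies.
    have hk (s u : ℝ) (hs : 0 ≤ s) (hsu : s ≤ u) :
        ENNReal.ofReal |corr ν g s u x - corr ν g s u y| ≤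
          ENNReal.ofReal (K ^ 2 * (decayConst α * rate α |u - s|)) * δ j s := by
      have hr := rate_pos α (u - s)
      have hgs (s : ℝ) : Measurable (g s) := hg.comp measurable_prodMk_left
      rw [abs_of_nonneg (sub_nonneg.2 hsu)]
      have hm : Measurable fun y => g s y * semi ν (u - s) (g u) y :=
        (hgs s).mul (hν.measurable_semi (h := fun _ => g u) ((hgs u).comp measurable_snd)
          measurable_const measurable_id)
      by_cases hd0 : decayConst α = 0
      · exact absurd hd0 (decayConst_pos hα).ne'
      refine hδ s hs (K ^ 2 * (decayConst α * rate α (u - s))) _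
        (mul_pos (by positivity) (mul_pos (decayConst_pos hα) hr)) hm (fun z => ?_) j x hx y hy
      rw [abs_mul]
      calc |g s z| * |semi ν (u - s) (g u) z|
          ≤ (K * weight z) * (K * (decayConst α * rate α (u - s))) :=
            mul_le_mul (hgK s z) (abs_semi_le_rate hν hα hK.le (hgK u) _ _) (abs_nonneg _)
              (mul_nonneg hK.le (weight_pos z).le)
        _ = _ := by ring
    -- Either time may be the earlier one; adding both candidates gives one bound for the whole
    -- square of times.
    have hk2 (s u : ℝ) (hs : 0 ≤ s) (hu : 0 ≤ u) :
        ENNReal.ofReal |corr ν g (min s u) (max s u) x - corr ν g (min s u) (max s u) y| ≤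
          ENNReal.ofReal (K ^ 2 * decayConst α) *
            (δ j s * ENNReal.ofReal (rate α |u - s|) + δ j u * ENNReal.ofReal (rate α |s - u|)) := by
      rcases le_total s u with h | h
      · rw [min_eq_left h, max_eq_right h]
        refine (hk s u hs h).trans ?_
        rw [← mul_assoc, ENNReal.ofReal_mul (by positivity), mul_assoc, mul_comm _ (δ j s)]
        gcongr
        exact le_self_add
      · rw [min_eq_right h, max_eq_left h]
        refine (hk u s hu h).trans ?_
        rw [← mul_assoc, ENNReal.ofReal_mul (by positivity), mul_assoc, mul_comm _ (δ j u)]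
        gcongr
        exact le_add_self
    have hrm : Measurable fun p : ℝ × ℝ => ENNReal.ofReal (rate α |p.2 - p.1|) := by fun_prop
    have hδ1 : Measurable fun p : ℝ × ℝ => δ j p.1 * ENNReal.ofReal (rate α |p.2 - p.1|) :=
      ((hδm j).comp measurable_fst).mul hrm
    have hδ2 : Measurable fun p : ℝ × ℝ => δ j p.2 * ENNReal.ofReal (rate α |p.1 - p.2|) :=
      hδ1.comp measurable_swap
    have hI : ∫⁻ s, ∫⁻ u, δ j s * ENNReal.ofReal (rate α |u - s|) ∂ρ ∂ρ ≤
        ENNReal.ofReal (2 * totalRate α S) * ∫⁻ s, δ j s ∂ρ := by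
      rw [← lintegral_const_mul _ (hδm j)]
      refine lintegral_mono_ae ?_
      filter_upwards [hmem] with s hs
      have : Measurable fun u : ℝ => ENNReal.ofReal (rate α |u - s|) := by fun_prop
      rw [lintegral_const_mul _ this, mul_comm]
      gcongr
      exact lintegral_rate_abs_sub_le hs
    rw [← ENNReal.ofReal_le_ofReal_iff (mul_nonneg (by positivity) ENNReal.toReal_nonneg),
      ENNReal.ofReal_mul (by positivity), ENNReal.ofReal_toReal (hfin j), occSq, occSq,
      ← integral_sub (hint2 x) (hint2 y)]
    calc _ ≤ ∫⁻ s, ENNReal.ofReal |∫ u, corr ν g (min s u) (max s u) x ∂ρ -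
            ∫ u, corr ν g (min s u) (max s u) y ∂ρ| ∂ρ := ofReal_abs_integral_le_lintegral _ _
      _ ≤ ∫⁻ s, ∫⁻ u, ENNReal.ofReal (K ^ 2 * decayConst α) * (δ j s * ENNReal.ofReal (rate α |u - s|)
            + δ j u * ENNReal.ofReal (rate α |s - u|)) ∂ρ ∂ρ := by
          refine lintegral_mono_ae ?_
          filter_upwards [hmem] with s hs
          rw [← integral_sub (hint1 s x) (hint1 s y)]
          refine (ofReal_abs_integral_le_lintegral _ _).trans (lintegral_mono_ae ?_)
          filter_upwards [hmem] with u hu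
          exact hk2 s u hs.1.le hu.1.le
      _ = ENNReal.ofReal (K ^ 2 * decayConst α) *
            (∫⁻ s, ∫⁻ u, δ j s * ENNReal.ofReal (rate α |u - s|) ∂ρ ∂ρ +
              ∫⁻ s, ∫⁻ u, δ j u * ENNReal.ofReal (rate α |s - u|) ∂ρ ∂ρ) := by
          have f1 : Measurable fun s => ∫⁻ u, δ j s * ENNReal.ofReal (rate α |u - s|) ∂ρ :=
            hδ1.lintegral_prod_right'
          have f2 : Measurable fun s => ∫⁻ u, δ j u * ENNReal.ofReal (rate α |s - u|) ∂ρ :=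
            hδ2.lintegral_prod_right'
          rw [← lintegral_add_left f1, ← lintegral_const_mul _ (f1.fun_add f2)]
          refine lintegral_congr fun s => ?_
          have e1 : Measurable fun u => δ j s * ENNReal.ofReal (rate α |u - s|) :=
            hδ1.comp measurable_prodMk_left
          have e2 : Measurable fun u => δ j u * ENNReal.ofReal (rate α |s - u|) :=
            hδ2.comp measurable_prodMk_left
          rw [lintegral_const_mul _ (e1.fun_add e2), lintegral_add_left e1]
      -- The second double integral equals the first after exchanging the variables; two terms with
      -- factor `2 * totalRate α S` give the 4 in the claim.
      _ ≤ ENNReal.ofReal (K ^ 2 * decayConst α) *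
            (ENNReal.ofReal (2 * totalRate α S) * ∫⁻ s, δ j s ∂ρ +
              ENNReal.ofReal (2 * totalRate α S) * ∫⁻ s, δ j s ∂ρ) := by
          have hI' : ∫⁻ s, ∫⁻ u, δ j u * ENNReal.ofReal (rate α |s - u|) ∂ρ ∂ρ ≤
              ENNReal.ofReal (2 * totalRate α S) * ∫⁻ s, δ j s ∂ρ := by
            rw [lintegral_lintegral_swap hδ2.aemeasurable]
            exact hI
          gcongr
      _ = _ := by
          rw [← add_mul, ← mul_assoc, ← ENNReal.ofReal_add (by positivity) (by positivity),
            ← ENNReal.ofReal_mul (by positivity)]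
          ring_nf

end

namespace IsMarkovPath

variable {α : ℝ} {ν : Kernel ℝ ℝ} {E : Type*} [MeasurableSpace E] {μ : Measure E} {R : E → ℝ → ℝ}
  {S K : ℝ} {g : ℝ → ℝ → ℝ}

theorem integral_occ (h : IsMarkovPath ν μ R) (hν : IsStableKernel α ν) (hK : 0 ≤ K)
    (hg : Measurable (Function.uncurry g)) (hgK : ∀ s x, |g s x| ≤ K * weight x) (x : ℝ) :
    ∫ f, occ R S g x f ∂μ = occMean ν S g x := by
  have := h.prob
  have hm : Measurable fun p : E × ℝ => g p.2 (x + R p.1 p.2) :=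
    hg.comp (measurable_snd.prodMk (h.measurable.const_add x))
  simp only [occ, occMean]
  rw [integral_integral_swap (Integrable.of_bound (C := K) hm.aestronglyMeasurable
    (Eventually.of_forall fun p => abs_le_of_le_weight hK hgK _ _))]
  refine setIntegral_congr_fun measurableSet_Ioc fun s hs => ?_
  exact h.integral_one hν hs.1.le (hg.comp measurable_prodMk_left) x

/-- The square is written as a double time integral. By symmetry the two factors may be ordered in
time, where the Markov property identifies their mean with `corr`. -/
theorem integral_occ_sq (h : IsMarkovPath ν μ R) (hν : IsStableKernel α ν) (hK : 0 ≤ K)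
    (hg : Measurable (Function.uncurry g)) (hgK : ∀ s x, |g s x| ≤ K * weight x) (x : ℝ) :
    ∫ f, occ R S g x f ^ 2 ∂μ = occSq ν S g x := by
  have := h.prob
  have hgs (s : ℝ) : Measurable (g s) := hg.comp measurable_prodMk_left
  set ρ : Measure ℝ := volume.restrict (Set.Ioc 0 S) with hρ
  have hb := abs_le_of_le_weight hK hgK
  have hm : Measurable fun p : E × ℝ => g p.2 (x + R p.1 p.2) :=
    hg.comp (measurable_snd.prodMk (h.measurable.const_add x))
  have hsq (f : E) : occ R S g x f ^ 2 =
      ∫ s, ∫ u, g s (x + R f s) * g u (x + R f u) ∂ρ ∂ρ := by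
    simp_rw [integral_const_mul, integral_mul_const, sq]
    rfl
  have hbb (a b : ℝ) (y z : ℝ) : ‖g a y * g b z‖ ≤ K * K := by
    rw [norm_mul]; exact mul_le_mul (hb _ _) (hb _ _) (norm_nonneg _) hK
  have hm3 : Measurable fun p : (E × ℝ) × ℝ =>
      g p.1.2 (x + R p.1.1 p.1.2) * g p.2 (x + R p.1.1 p.2) :=
    (hm.comp measurable_fst).mul (hm.comp (measurable_fst.fst.prodMk measurable_snd))
  simp_rw [hsq]
  rw [integral_integral_swap]
  · refine setIntegral_congr_fun measurableSet_Ioc fun s hs => ?_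
    rw [integral_integral_swap]
    · refine setIntegral_congr_fun measurableSet_Ioc fun u hu => ?_
      rcases le_total s u with hsu | hsu
      · rw [min_eq_left hsu, max_eq_right hsu]
        exact h.integral_two hν hs.1.le hsu (hgs s) (hgs u) (hb s) (hb u) x
      · rw [min_eq_right hsu, max_eq_left hsu]
        simp_rw [mul_comm (g s _)]
        exact h.integral_two hν hu.1.le hsu (hgs u) (hgs s) (hb u) (hb s) x
    · exact Integrable.of_bound (C := K * K) (hm3.comp (by fun_prop : Measurable fun p : E × ℝ =>
        ((p.1, s), p.2))).aestronglyMeasurable (Eventually.of_forall fun p => hbb _ _ _ _)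
  · refine Integrable.of_bound (C := K * K * ρ.real Set.univ) ?_ (Eventually.of_forall fun p => ?_)
    · exact (hm3.stronglyMeasurable.integral_prod_right (ν := ρ)).aestronglyMeasurable
    · exact norm_integral_le_of_norm_le_const (Eventually.of_forall fun u => hbb _ _ _ _)

end IsMarkovPath

/-! ### The semigroup acting on functions over Lebesgue measure. -/

namespace IsStableKernel

variable {α : ℝ} {ν : Kernel ℝ ℝ}

theorem measurable_semi_apply (hν : IsStableKernel α ν) {h : ℝ → ℝ} (hh : Measurable h) (s : ℝ) :
    Measurable (semi ν s h) :=
  hν.measurable_semi (h := fun _ => h) (hh.comp measurable_snd) measurable_const measurable_id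

theorem integrable_comp_add (hν : IsStableKernel α ν) (s : ℝ) {h : ℝ → ℝ} (hm : Measurable h)
    (hi : Integrable h) :
    Integrable (fun p : ℝ × ℝ => h (p.1 + p.2)) ((volume : Measure ℝ).prod (ν s)) := by
  have := hν.markov
  rw [integrable_prod_iff' (Measurable.aestronglyMeasurable (by fun_prop))]
  refine ⟨Eventually.of_forall fun z => hi.comp_add_right z, ?_⟩
  simp_rw [fun z => integral_add_right_eq_self (μ := volume) (fun x => ‖h x‖) z]
  exact integrable_const _

theorem integrable_semi (hν : IsStableKernel α ν) (s : ℝ) {h : ℝ → ℝ} (hm : Measurable h)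
    (hi : Integrable h) : Integrable (semi ν s h) := by
  have := hν.markov
  exact (hν.integrable_comp_add s hm hi).integral_prod_left

theorem integral_semi (hν : IsStableKernel α ν) (s : ℝ) {h : ℝ → ℝ} (hm : Measurable h)
    (hi : Integrable h) : ∫ x, semi ν s h x = ∫ x, h x := by
  have := hν.markov
  simp only [semi]
  rw [integral_integral_swap (hν.integrable_comp_add s hm hi)]
  simp_rw [fun z => integral_add_right_eq_self (μ := volume) (fun x => h x) z]
  simp

/-- Self-adjointness: translate `x` by `-z`, then use that `ν s` is symmetric under `z ↦ -z`. -/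
theorem integral_mul_semi_comm (hν : IsStableKernel α ν) {s : ℝ} (hs : 0 ≤ s) {f h : ℝ → ℝ} {K : ℝ}
    (hf : Measurable f) (hfi : Integrable f) (hh : Measurable h) (hK : ∀ x, |h x| ≤ K) :
    ∫ x, semi ν s f x * h x = ∫ x, f x * semi ν s h x := by
  have := hν.markov
  have h1 : Integrable (fun p : ℝ × ℝ => f (p.1 + p.2) * h p.1) ((volume : Measure ℝ).prod (ν s)) :=
    (hν.integrable_comp_add s hf hfi).mul_bdd (c := K)
      (Measurable.aestronglyMeasurable (by fun_prop)) (Eventually.of_forall fun p => hK _)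
  have h2 : Integrable (fun p : ℝ × ℝ => f p.1 * h (p.1 - p.2)) ((volume : Measure ℝ).prod (ν s)) :=
    (hfi.comp_fst (ν s)).mul_bdd (c := K)
      (Measurable.aestronglyMeasurable (by fun_prop)) (Eventually.of_forall fun p => hK _)
  calc ∫ x, semi ν s f x * h x = ∫ x, ∫ z, f (x + z) * h x ∂ν s := by
        simp_rw [integral_mul_const]; rfl
    _ = ∫ z, (∫ x, f (x + z) * h x) ∂ν s := integral_integral_swap h1
    _ = ∫ z, (∫ x, f x * h (x - z)) ∂ν s := by
        congr 1; funext z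
        rw [← integral_sub_right_eq_self (μ := volume) (fun x => f (x + z) * h x) z]
        simp
    _ = ∫ x, ∫ z, f x * h (x - z) ∂ν s := (integral_integral_swap h2).symm
    _ = ∫ x, f x * semi ν s h x := by
        congr 1; funext x
        rw [integral_const_mul, semi]
        conv_rhs => rw [← hν.map_neg hs]
        rw [integral_map (by fun_prop) (Measurable.aestronglyMeasurable (by fun_prop))]
        simp [sub_eq_add_neg]

theorem semi_semi (hν : IsStableKernel α ν) {s u : ℝ} (hs : 0 ≤ s) (hu : 0 ≤ u) {h : ℝ → ℝ} {K : ℝ}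
    (hh : Measurable h) (hK : ∀ x, |h x| ≤ K) (x : ℝ) :
    semi ν s (semi ν u h) x = semi ν (s + u) h x := by
  have := hν.markov
  simp only [semi]
  rw [← hν.conv_eq hs hu, integral_conv]
  · simp only [add_assoc]
  · exact Integrable.of_bound (C := K) (Measurable.aestronglyMeasurable (by fun_prop))
      (Eventually.of_forall fun p => hK _)

theorem integral_semi_mul_semi (hν : IsStableKernel α ν) {s u : ℝ} (hs : 0 ≤ s) (hu : 0 ≤ u)
    {f h : ℝ → ℝ} {K : ℝ} (hf : Measurable f) (hfi : Integrable f) (hh : Measurable h)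
    (hK : ∀ x, |h x| ≤ K) :
    ∫ x, semi ν s f x * semi ν u h x = ∫ x, f x * semi ν (s + u) h x := by
  rw [hν.integral_mul_semi_comm hs hf hfi (hν.measurable_semi_apply hh u)
    (fun x => hν.abs_semi_le hK u x)]
  simp_rw [hν.semi_semi hs hu hh hK]

end IsStableKernel

section

variable {α : ℝ} {ν : Kernel ℝ ℝ} {S K : ℝ} {g : ℝ → ℝ → ℝ}

theorem integrable_of_abs_le_weight {h : ℝ → ℝ} (hh : Measurable h) (hK : ∀ x, |h x| ≤ K * weight x) :
    Integrable h :=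
  (integrable_weight.const_mul K).mono' hh.aestronglyMeasurable (Eventually.of_forall hK)

theorem sq_occMean_le (hν : IsStableKernel α ν) (hα : 0 < α)
    (hgK : ∀ s x, |g s x| ≤ K * weight x) (x : ℝ) :
    occMean ν S g x ^ 2 ≤ K ^ 2 * (decayConst α * totalRate α S) * meanWeight ν S x := by
  have h1 := abs_occMean_le (S := S) hν hgK x
  have h2 := meanWeight_le hν hα S x
  have h3 := meanWeight_nonneg ν S x
  calc occMean ν S g x ^ 2 = |occMean ν S g x| ^ 2 := (sq_abs _).symm
    _ ≤ (K * meanWeight ν S x) ^ 2 := by gcongr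
    _ = K ^ 2 * meanWeight ν S x * meanWeight ν S x := by ring
    _ ≤ _ := by gcongr

theorem integrable_sq_occMean (hν : IsStableKernel α ν) (hα : 0 < α)
    (hg : Measurable (Function.uncurry g)) (hgK : ∀ s x, |g s x| ≤ K * weight x) :
    Integrable fun x => occMean ν S g x ^ 2 :=
  ((integrable_meanWeight hν S).const_mul _).mono'
    ((measurable_occMean hν hg).pow_const 2).aestronglyMeasurable
    (Eventually.of_forall fun x => by
      rw [Real.norm_eq_abs, abs_of_nonneg (sq_nonneg _)]
      exact sq_occMean_le hν hα hgK x)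

theorem abs_corr_integrand_le (hν : IsStableKernel α ν) (hK : 0 ≤ K)
    (hgK : ∀ s x, |g s x| ≤ K * weight x) (s u y : ℝ) :
    |g s y * semi ν (u - s) (g u) y| ≤ K * K * weight y := by
  rw [abs_mul, mul_right_comm]
  exact mul_le_mul (hgK s y) (hν.abs_semi_le (abs_le_of_le_weight hK hgK u) _ _) (abs_nonneg _)
    (mul_nonneg hK (weight_pos y).le)

theorem measurable_corr_integrand (hν : IsStableKernel α ν) (hg : Measurable (Function.uncurry g))
    (s u : ℝ) : Measurable fun y => g s y * semi ν (u - s) (g u) y :=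
  (hg.comp measurable_prodMk_left : Measurable (g s)).mul
    (hν.measurable_semi_apply (hg.comp measurable_prodMk_left) _)

theorem integral_corr (hν : IsStableKernel α ν) (hK : 0 ≤ K)
    (hg : Measurable (Function.uncurry g)) (hgK : ∀ s x, |g s x| ≤ K * weight x) (s u : ℝ) :
    ∫ x, corr ν g s u x = ∫ x, g s x * semi ν (u - s) (g u) x :=
  hν.integral_semi s (measurable_corr_integrand hν hg s u)
    (integrable_of_abs_le_weight (measurable_corr_integrand hν hg s u)
      (abs_corr_integrand_le hν hK hgK s u))

theorem integrable_corr_prod (hν : IsStableKernel α ν) (hK : 0 ≤ K)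
    (hg : Measurable (Function.uncurry g)) (hgK : ∀ s x, |g s x| ≤ K * weight x)
    (ρ : Measure (ℝ × ℝ)) [IsFiniteMeasure ρ] :
    Integrable (fun p : ℝ × ℝ × ℝ => corr ν g (min p.2.1 p.2.2) (max p.2.1 p.2.2) p.1)
      ((volume : Measure ℝ).prod ρ) := by
  have hm : Measurable fun p : ℝ × ℝ × ℝ => corr ν g (min p.2.1 p.2.2) (max p.2.1 p.2.2) p.1 :=
    (measurable_corr_min_max hν hg).comp
      (by fun_prop : Measurable fun p : ℝ × ℝ × ℝ => (p.2.1, p.2.2, p.1))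
  have hci (s u : ℝ) : Integrable (corr ν g s u) :=
    hν.integrable_semi s (measurable_corr_integrand hν hg s u)
      (integrable_of_abs_le_weight (measurable_corr_integrand hν hg s u)
        (abs_corr_integrand_le hν hK hgK s u))
  rw [integrable_prod_iff' hm.aestronglyMeasurable]
  refine ⟨Eventually.of_forall fun p => hci (min p.1 p.2) (max p.1 p.2), ?_⟩
  refine Integrable.of_bound (C := K * K * Real.pi) ?_ (Eventually.of_forall fun p => ?_)
  · exact hm.aestronglyMeasurable.norm.prod_swap.integral_prod_right'
  · rw [Real.norm_eq_abs, abs_of_nonneg (integral_nonneg fun _ => norm_nonneg _)]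
    calc ∫ x, ‖corr ν g (min p.1 p.2) (max p.1 p.2) x‖
        ≤ ∫ x, K * K * semi ν (min p.1 p.2) weight x :=
          integral_mono (hci _ _).norm
            ((hν.integrable_semi _ measurable_weight integrable_weight).const_mul _) fun x =>
            hν.abs_semi_le_semi_weight (abs_corr_integrand_le hν hK hgK _ _) _ x
      _ = K * K * Real.pi := by
          rw [integral_const_mul, hν.integral_semi _ measurable_weight integrable_weight,
            integral_weight]

theorem occSq_eq_integral_prod (hν : IsStableKernel α ν) (hK : 0 ≤ K)
    (hg : Measurable (Function.uncurry g)) (hgK : ∀ s x, |g s x| ≤ K * weight x) (x : ℝ) :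
    occSq ν S g x = ∫ p : ℝ × ℝ, corr ν g (min p.1 p.2) (max p.1 p.2) x
      ∂((volume.restrict (Set.Ioc 0 S)).prod (volume.restrict (Set.Ioc 0 S))) := by
  rw [integral_prod]
  · rfl
  · exact Integrable.of_bound (C := K * K) ((measurable_corr_min_max hν hg).comp
      (by fun_prop : Measurable fun p : ℝ × ℝ => (p.1, p.2, x))).aestronglyMeasurable
      (Eventually.of_forall fun p => abs_corr_le hν hK hgK _ _ _)

theorem integrable_occSq (hν : IsStableKernel α ν) (hK : 0 ≤ K)
    (hg : Measurable (Function.uncurry g)) (hgK : ∀ s x, |g s x| ≤ K * weight x) :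
    Integrable (occSq ν S g) := by
  have := (integrable_corr_prod hν hK hg hgK
    ((volume.restrict (Set.Ioc 0 S)).prod (volume.restrict (Set.Ioc 0 S)))).integral_prod_left
  exact this.congr (Eventually.of_forall fun x => (occSq_eq_integral_prod hν hK hg hgK x).symm)

/-- The overlap `∫ f 𝒯_r h`. -/
noncomputable def overlap (ν : Kernel ℝ ℝ) (f h : ℝ → ℝ) (r : ℝ) : ℝ := ∫ x, f x * semi ν r h x

theorem overlap_comm (hν : IsStableKernel α ν) {f h : ℝ → ℝ} {r : ℝ} (hr : 0 ≤ r) {K' : ℝ}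
    (hf : Measurable f) (hfK : ∀ x, |f x| ≤ K' * weight x) (hh : Measurable h) (hK : ∀ x, |h x| ≤ K) :
    overlap ν f h r = ∫ x, semi ν r f x * h x :=
  (hν.integral_mul_semi_comm hr hf (integrable_of_abs_le_weight hf hfK) hh hK).symm

/-- Lebesgue measure is invariant, so integrating the correlation over the starting point removes
the earlier time and leaves the overlap at the time difference. When `u ≤ s`, self-adjointness
restores the order of the two functions. -/
theorem integral_occSq (hν : IsStableKernel α ν) (hK : 0 ≤ K)
    (hg : Measurable (Function.uncurry g)) (hgK : ∀ s x, |g s x| ≤ K * weight x) :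
    ∫ x, occSq ν S g x =
      ∫ s in Set.Ioc 0 S, ∫ u in Set.Ioc 0 S, overlap ν (g s) (g u) |s - u| := by
  set ρ := volume.restrict (Set.Ioc 0 S)
  have hint := integrable_corr_prod hν hK hg hgK (ρ.prod ρ)
  have hgs (s : ℝ) : Measurable (g s) := hg.comp measurable_prodMk_left
  have h1 : ∫ x, occSq ν S g x =
      ∫ p : ℝ × ℝ, (∫ x, corr ν g (min p.1 p.2) (max p.1 p.2) x) ∂(ρ.prod ρ) := by
    rw [← integral_integral_swap
      (f := fun x (p : ℝ × ℝ) => corr ν g (min p.1 p.2) (max p.1 p.2) x) hint]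
    exact integral_congr_ae (Eventually.of_forall fun x => occSq_eq_integral_prod hν hK hg hgK x)
  have h2 (s u : ℝ) : ∫ x, corr ν g (min s u) (max s u) x = overlap ν (g s) (g u) |s - u| := by
    rw [integral_corr hν hK hg hgK]
    rcases le_total s u with h | h
    · rw [min_eq_left h, max_eq_right h, abs_of_nonpos (sub_nonpos.2 h), neg_sub]
      rfl
    · rw [min_eq_right h, max_eq_left h, abs_of_nonneg (sub_nonneg.2 h),
        overlap_comm hν (sub_nonneg.2 h) (hgs s) (hgK s) (hgs u) (abs_le_of_le_weight hK hgK u)]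
      simp_rw [mul_comm]
  rw [h1, integral_prod]
  · simp_rw [h2]
  · exact hint.integral_prod_right

/-- Self-adjointness and the semigroup property merge `𝒯_s g_s · 𝒯_u g_u` into an overlap at time `s
+ u`. The sum of the times appears instead of their difference because the square of a mean involves
two independent paths. -/
theorem integral_sq_occMean (hν : IsStableKernel α ν) (hK : 0 ≤ K)
    (hg : Measurable (Function.uncurry g)) (hgK : ∀ s x, |g s x| ≤ K * weight x) :
    ∫ x, occMean ν S g x ^ 2 =
      ∫ s in Set.Ioc 0 S, ∫ u in Set.Ioc 0 S, overlap ν (g s) (g u) (s + u) := by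
  set ρ := volume.restrict (Set.Ioc 0 S) with hρ
  have hgs (s : ℝ) : Measurable (g s) := hg.comp measurable_prodMk_left
  have hmt := measurable_semi_time hν hg
  set F : ℝ × ℝ × ℝ → ℝ := fun p => semi ν p.2.1 (g p.2.1) p.1 * semi ν p.2.2 (g p.2.2) p.1 with hF
  have hFm : Measurable F :=
    (hmt.comp (by fun_prop : Measurable fun p : ℝ × ℝ × ℝ => (p.2.1, p.1))).mul
      (hmt.comp (by fun_prop : Measurable fun p : ℝ × ℝ × ℝ => (p.2.2, p.1)))
  have hFb (x s u : ℝ) : |F (x, s, u)| ≤ K * K * semi ν s weight x := by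
    rw [hF, abs_mul, mul_right_comm]
    exact mul_le_mul (hν.abs_semi_le_semi_weight (hgK s) _ _)
      (hν.abs_semi_le (abs_le_of_le_weight hK hgK u) _ _) (abs_nonneg _)
      (mul_nonneg hK (semi_weight_nonneg ν s x))
  have hwi (s : ℝ) := hν.integrable_semi s measurable_weight integrable_weight
  have hFi (s u : ℝ) : Integrable fun x => F (x, s, u) :=
    ((hwi s).const_mul (K * K)).mono' (hFm.comp (by fun_prop : Measurable fun x : ℝ =>
      (x, s, u))).aestronglyMeasurable (Eventually.of_forall fun x => hFb x s u)
  have hint : Integrable F ((volume : Measure ℝ).prod (ρ.prod ρ)) := by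
    rw [integrable_prod_iff' hFm.aestronglyMeasurable]
    refine ⟨Eventually.of_forall fun p => hFi p.1 p.2, ?_⟩
    refine Integrable.of_bound (C := K * K * Real.pi) ?_ (Eventually.of_forall fun p => ?_)
    · exact hFm.aestronglyMeasurable.norm.prod_swap.integral_prod_right'
    · rw [Real.norm_eq_abs, abs_of_nonneg (integral_nonneg fun _ => norm_nonneg _)]
      calc ∫ x, ‖F (x, p)‖ ≤ ∫ x, K * K * semi ν p.1 weight x :=
            integral_mono (hFi _ _).norm ((hwi p.1).const_mul _) fun x => hFb x p.1 p.2
        _ = K * K * Real.pi := by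
            rw [integral_const_mul, hν.integral_semi _ measurable_weight integrable_weight,
              integral_weight]
  have h1 (x : ℝ) : occMean ν S g x ^ 2 = ∫ p, F (x, p) ∂(ρ.prod ρ) := by
    rw [occMean, sq, ← hρ]
    exact (integral_prod_mul (fun s => semi ν s (g s) x) (fun s => semi ν s (g s) x)).symm
  simp_rw [h1]
  rw [integral_integral_swap (f := fun x p => F (x, p)) hint, integral_prod]
  · refine setIntegral_congr_fun measurableSet_Ioc fun s hs => ?_
    refine setIntegral_congr_fun measurableSet_Ioc fun u hu => ?_
    exact hν.integral_semi_mul_semi hs.1.le hu.1.le (hgs s)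
      (integrable_of_abs_le_weight (hgs s) (hgK s)) (hgs u) (abs_le_of_le_weight hK hgK u)
  · exact hint.integral_prod_right

end

/-! ### Sums over the particles of one cell. -/

theorem measurable_sum_range {X M : Type*} [MeasurableSpace X] [AddCommMonoid M] [MeasurableSpace M]
    [MeasurableAdd₂ M] {N : X → ℕ} (hN : Measurable N) {F : ℕ → X → M} (hF : ∀ n, Measurable (F n)) :
    Measurable fun x => ∑ n ∈ Finset.range (N x), F n x := by
  have h : Measurable fun p : ℕ × X => ∑ n ∈ Finset.range p.1, F n p.2 :=
    measurable_from_prod_countable_right fun k =>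
      Finset.measurable_fun_sum (Finset.range k) fun n _ => hF n
  exact h.comp (hN.prodMk measurable_id)

/-- The distribution of the initial points of a unit cell. -/
structure IsCellLaw {I : Type*} [MeasurableSpace I] (θ : I → ℕ) (κ : I → ℕ → ℝ) (j : ℤ)
    (π : Measure I) : Prop where
  prob : IsProbabilityMeasure π
  measurable_number : Measurable θ
  measurable_position : ∀ n, Measurable fun i => κ i n
  mem : ∀ i, ∀ n < θ i, κ i n ∈ Set.Ico (j : ℝ) (j + 1)
  integrable : Integrable (fun i => (θ i : ℝ) ^ 3) π

/-- The sum of a functional over the particles of a cell. -/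
noncomputable def cellSum {I E : Type*} (θ : I → ℕ) (κ : I → ℕ → ℝ) (Y : ℝ → E → ℝ)
    (p : I × (ℕ → E)) : ℝ :=
  ∑ n ∈ Finset.range (θ p.1), Y (κ p.1 n) (p.2 n)

theorem abs_cellSum_le {I E : Type*} {θ : I → ℕ} {κ : I → ℕ → ℝ} {Y Z : ℝ → E → ℝ}
    (h : ∀ x f, |Y x f| ≤ Z x f) (p : I × (ℕ → E)) : |cellSum θ κ Y p| ≤ cellSum θ κ Z p :=
  (Finset.abs_sum_le_sum_abs _ _).trans (Finset.sum_le_sum fun _ _ => h _ _)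

theorem abs_cellSum_le_mul {I E : Type*} {θ : I → ℕ} {κ : I → ℕ → ℝ} {Y : ℝ → E → ℝ} {B : ℝ}
    (hB : ∀ x f, |Y x f| ≤ B) (p : I × (ℕ → E)) : |cellSum θ κ Y p| ≤
      B * θ p.1 := by
  refine (abs_cellSum_le (Z := fun _ _ => B) hB p).trans (le_of_eq ?_)
  simp [cellSum, mul_comm]

section

variable {E : Type*} [MeasurableSpace E] {μ : ℕ → Measure E} [∀ n, IsProbabilityMeasure (μ n)] {Y : ℝ → E → ℝ}
  {B : ℝ}

theorem integrable_apply_infinitePi (hY : Measurable (Function.uncurry Y)) (hB : ∀ x f, |Y x f| ≤ B)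
    (x : ℝ) (n : ℕ) :
    Integrable (fun X : ℕ → E => Y x (X n)) (Measure.infinitePi μ) :=
  Integrable.of_bound (C := B) ((hY.comp measurable_prodMk_left).comp
    (measurable_pi_apply n)).aestronglyMeasurable (Eventually.of_forall fun _ => hB _ _)

theorem integral_apply_infinitePi {h : E → ℝ} (hh : Measurable h) (n : ℕ) :
    ∫ X : ℕ → E, h (X n) ∂(Measure.infinitePi μ) = ∫ f, h f ∂μ n := by
  have := (measurePreserving_eval_infinitePi μ n).map_eq
  conv_rhs => rw [← this]
  rw [integral_map (measurable_pi_apply n).aemeasurable hh.aestronglyMeasurable]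

theorem integral_sum_infinitePi (hY : Measurable (Function.uncurry Y)) (hB : ∀ x f, |Y x f| ≤ B)
    (k : ℕ) (x : ℕ → ℝ) :
    ∫ X : ℕ → E, ∑ n ∈ Finset.range k, Y (x n) (X n) ∂(Measure.infinitePi μ) =
      ∑ n ∈ Finset.range k, ∫ f, Y (x n) f ∂μ n := by
  rw [integral_finsetSum _ fun n _ => integrable_apply_infinitePi hY hB (x n) n]
  exact Finset.sum_congr rfl fun n _ => integral_apply_infinitePi (hY.comp measurable_prodMk_left) n

/-- Given the starting points the summands are independent, so variances add. -/
theorem integral_sq_sum_infinitePi (hY : Measurable (Function.uncurry Y))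
    (hB : ∀ x f, |Y x f| ≤ B) (k : ℕ) (x : ℕ → ℝ) :
    ∫ X : ℕ → E, (∑ n ∈ Finset.range k, Y (x n) (X n)) ^ 2 ∂(Measure.infinitePi μ) =
      (∑ n ∈ Finset.range k, ∫ f, Y (x n) f ∂μ n) ^ 2 +
        ∑ n ∈ Finset.range k, (∫ f, Y (x n) f ^ 2 ∂μ n - (∫ f, Y (x n) f ∂μ n) ^ 2) := by
  set Q := Measure.infinitePi μ
  have hYx (x : ℝ) : Measurable (Y x) := hY.comp measurable_prodMk_left
  have hL (n : ℕ) : MemLp (fun X : ℕ → E => Y (x n) (X n)) 2 Q :=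
    MemLp.of_bound (C := B) ((hYx _).comp (measurable_pi_apply n)).aestronglyMeasurable
      (Eventually.of_forall fun _ => hB _ _)
  have hind : iIndepFun (fun (n : ℕ) (X : ℕ → E) => Y (x n) (X n)) Q :=
    iIndepFun_infinitePi (X := fun n => Y (x n)) fun n => hYx (x n)
  have hv := IndepFun.variance_sum (s := Finset.range k) (fun n _ => hL n)
    (fun n _ m _ hnm => hind.indepFun hnm)
  have hsum : (∑ n ∈ Finset.range k, fun X : ℕ → E => Y (x n) (X n)) =
      fun X => ∑ n ∈ Finset.range k, Y (x n) (X n) := by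
    funext X; simp
  rw [hsum, variance_eq_sub (memLp_finsetSum _ fun n _ => hL n)] at hv
  have hv' (n : ℕ) : variance (fun X : ℕ → E => Y (x n) (X n)) Q =
      ∫ f, Y (x n) f ^ 2 ∂μ n - (∫ f, Y (x n) f ∂μ n) ^ 2 := by
    rw [variance_eq_sub (hL n), integral_apply_infinitePi (hYx _) n]
    simp only [Pi.pow_apply]
    rw [integral_apply_infinitePi (h := fun f => Y (x n) f ^ 2) ((hYx _).pow_const 2) n]
  have hs : ∫ X : ℕ → E, ∑ n ∈ Finset.range k, Y (x n) (X n) ∂Q =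
    ∑ n ∈ Finset.range k, ∫ f, Y (x n) f ∂μ n := integral_sum_infinitePi hY hB k x
  rw [hs, Finset.sum_congr rfl fun n _ => hv' n] at hv
  simp only [Pi.pow_apply] at hv
  linarith

variable {I : Type*} [MeasurableSpace I] {θ : I → ℕ} {κ : I → ℕ → ℝ} {j : ℤ} {π : Measure I}

theorem IsCellLaw.integrable_pow (h : IsCellLaw θ κ j π) {p : ℕ} (hp : p ≤ 3) :
    Integrable (fun i => (θ i : ℝ) ^ p) π := by
  have := h.prob
  have hm := h.measurable_number
  refine (h.integrable.add (integrable_const 1)).mono'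
    (Measurable.aestronglyMeasurable (by fun_prop)) (Eventually.of_forall fun i => ?_)
  rw [norm_pow, Real.norm_natCast, Pi.add_apply]
  rcases Nat.eq_zero_or_pos (θ i) with h0 | h0
  · rw [h0]
    rcases Nat.eq_zero_or_pos p with h1 | h1
    · simp [h1]
    · simp [h1.ne']
  · have : (1 : ℝ) ≤ θ i := by exact_mod_cast h0
    linarith [pow_le_pow_right₀ this hp]

theorem IsCellLaw.measurable_cellSum (h : IsCellLaw θ κ j π) (hY : Measurable (Function.uncurry Y)) :
    Measurable (cellSum θ κ Y) := by
  refine measurable_sum_range (h.measurable_number.comp measurable_fst) fun n => ?_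
  exact hY.comp (((h.measurable_position n).comp measurable_fst).prodMk
    ((measurable_pi_apply n).comp measurable_snd))

theorem IsCellLaw.integrable_cellSum_pow (h : IsCellLaw θ κ j π)
    (hY : Measurable (Function.uncurry Y)) (hB : ∀ x f, |Y x f| ≤ B) {p : ℕ} (hp : p ≤ 3) :
    Integrable (fun q => cellSum θ κ Y q ^ p) (π.prod (Measure.infinitePi μ)) := by
  have := h.prob
  refine (((h.integrable_pow hp).comp_fst (Measure.infinitePi μ)).const_mul
    (B ^ p)).mono' ((h.measurable_cellSum hY).pow_const p).aestronglyMeasurable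
    (Eventually.of_forall fun q => ?_)
  rw [norm_pow, ← mul_pow]
  exact pow_le_pow_left₀ (norm_nonneg _) (abs_cellSum_le_mul hB q) p

theorem IsCellLaw.integral_cellSum (h : IsCellLaw θ κ j π)
    (hY : Measurable (Function.uncurry Y)) (hB : ∀ x f, |Y x f| ≤ B) :
    ∫ q, cellSum θ κ Y q ∂(π.prod (Measure.infinitePi μ)) =
      ∫ i, ∑ n ∈ Finset.range (θ i), ∫ f, Y (κ i n) f ∂μ n ∂π := by
  have := h.prob
  have hi := h.integrable_cellSum_pow (μ := μ) hY hB (p := 1) (by norm_num)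
  simp only [pow_one] at hi
  rw [integral_prod _ hi]
  congr 1; funext i
  exact integral_sum_infinitePi hY hB (θ i) (κ i)

theorem IsCellLaw.integral_cellSum_sq (h : IsCellLaw θ κ j π)
    (hY : Measurable (Function.uncurry Y)) (hB : ∀ x f, |Y x f| ≤ B) :
    ∫ q, cellSum θ κ Y q ^ 2 ∂(π.prod (Measure.infinitePi μ)) =
      ∫ i, ((∑ n ∈ Finset.range (θ i), ∫ f, Y (κ i n) f ∂μ n) ^ 2 + ∑ n ∈ Finset.range (θ i),
        (∫ f, Y (κ i n) f ^ 2 ∂μ n - (∫ f, Y (κ i n) f ∂μ n) ^ 2)) ∂π := by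
  have := h.prob
  rw [integral_prod _ (h.integrable_cellSum_pow (μ := μ) hY hB (p := 2) (by norm_num))]
  congr 1; funext i
  exact integral_sq_sum_infinitePi hY hB (θ i) (κ i)

/-- Moments of sums over a cell. -/
theorem IsCellLaw.integral_cellSum_pow_le (h : IsCellLaw θ κ j π)
    (hY : Measurable (Function.uncurry Y)) (hY0 : ∀ x f, 0 ≤ Y x f) (hB : ∀ x f, |Y x f| ≤ B) {p : ℕ}
    (hp : p + 1 ≤ 3) {M : ℝ}
    (hM : ∀ n, ∀ x ∈ Set.Ico (j : ℝ) (j + 1), ∫ f, Y x f ^ (p + 1) ∂μ n ≤ M) :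
    ∫ q, cellSum θ κ Y q ^ (p + 1) ∂(π.prod (Measure.infinitePi μ)) ≤
      (∫ i, (θ i : ℝ) ^ (p + 1) ∂π) * M := by
  have := h.prob
  have hYp : Measurable (Function.uncurry fun x f => Y x f ^ (p + 1)) := hY.pow_const (p + 1)
  have hB0 : 0 ≤ B := by
    obtain ⟨f⟩ : Nonempty E := nonempty_of_isProbabilityMeasure (μ 0)
    exact (abs_nonneg _).trans (hB 0 f)
  have hBp (x : ℝ) (f : E) : |Y x f ^ (p + 1)| ≤ B ^ (p + 1) := by
    rw [abs_pow]; exact pow_le_pow_left₀ (abs_nonneg _) (hB x f) _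
  rw [integral_prod _ (h.integrable_cellSum_pow (μ := μ) hY hB hp), ← integral_mul_const]
  refine integral_mono (h.integrable_cellSum_pow (μ := μ) hY hB hp).integral_prod_left
    ((h.integrable_pow hp).mul_const M) fun i => ?_
  -- The power mean inequality for `θ i` nonnegative summands; this is how moments of the number of
  -- points enter.
  have h1 (X : ℕ → E) : cellSum θ κ Y (i, X) ^ (p + 1) ≤
      (θ i : ℝ) ^ p * ∑ n ∈ Finset.range (θ i), Y (κ i n) (X n) ^ (p + 1) := by
    rcases Nat.eq_zero_or_pos (θ i) with h0 | h0
    · simp [cellSum, h0]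
    have := pow_sum_div_card_le_sum_pow (s := Finset.range (θ i)) (f := fun n => Y (κ i n) (X n))
      (fun n _ => hY0 _ _) p
    rw [Finset.card_range, div_le_iff₀ (by positivity)] at this
    rw [mul_comm]
    exact this
  have hi1 : Integrable (fun X : ℕ → E => cellSum θ κ Y (i, X) ^ (p + 1))
      (Measure.infinitePi μ) := by
    refine Integrable.of_bound (C := (B * θ i) ^ (p + 1)) (((h.measurable_cellSum hY).comp
      measurable_prodMk_left).pow_const _).aestronglyMeasurable (Eventually.of_forall fun X => ?_)
    rw [norm_pow]
    exact pow_le_pow_left₀ (norm_nonneg _) (abs_cellSum_le_mul hB (i, X)) _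
  have hi2 : Integrable (fun X : ℕ → E => ∑ n ∈ Finset.range (θ i), Y (κ i n) (X n) ^ (p + 1))
      (Measure.infinitePi μ) :=
    integrable_finsetSum _ fun n _ => integrable_apply_infinitePi hYp hBp (κ i n) n
  calc ∫ X : ℕ → E, cellSum θ κ Y (i, X) ^ (p + 1) ∂(Measure.infinitePi μ)
      ≤ ∫ X : ℕ → E, (θ i : ℝ) ^ p * ∑ n ∈ Finset.range (θ i), Y (κ i n) (X n) ^ (p + 1)
          ∂(Measure.infinitePi μ) := integral_mono hi1 (hi2.const_mul _) h1
    _ = (θ i : ℝ) ^ p * ∑ n ∈ Finset.range (θ i), ∫ f, Y (κ i n) f ^ (p + 1) ∂μ n := by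
        rw [integral_const_mul, integral_sum_infinitePi hYp hBp (θ i) (κ i)]
    _ ≤ (θ i : ℝ) ^ p * ∑ n ∈ Finset.range (θ i), M := by
        gcongr with n hn
        exact hM n _ (h.mem i n (Finset.mem_range.1 hn))
    _ = (θ i : ℝ) ^ (p + 1) * M := by
        rw [Finset.sum_const, Finset.card_range, nsmul_eq_mul]; ring

/-- The variance of a sum over a cell, when the first two moments of the summands oscillate little
over the cell. -/
theorem IsCellLaw.abs_variance_cellSum_sub_le (h : IsCellLaw θ κ j π)
    (hY : Measurable (Function.uncurry Y)) (hB : ∀ x f, |Y x f| ≤ B) {a A : ℝ → ℝ}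
    (ha : ∀ n x, ∫ f, Y x f ∂μ n = a x) (hA : ∀ n x, ∫ f, Y x f ^ 2 ∂μ n = A x) {ε ε' M : ℝ}
    (hε : ∀ x ∈ Set.Ico (j : ℝ) (j + 1), ∀ y ∈ Set.Ico (j : ℝ) (j + 1), |a x - a y| ≤ ε)
    (hε' : ∀ x ∈ Set.Ico (j : ℝ) (j + 1), ∀ y ∈ Set.Ico (j : ℝ) (j + 1), |A x - A y| ≤ ε')
    (hM : ∀ x, |a x| ≤ M) {x : ℝ} (hx : x ∈ Set.Ico (j : ℝ) (j + 1)) :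
    |variance (cellSum θ κ Y) (π.prod (Measure.infinitePi μ)) -
        ((∫ i, (θ i : ℝ) ∂π) * (A x - a x ^ 2) + variance (fun i => (θ i : ℝ)) π * a x ^ 2)| ≤
      (∫ i, (θ i : ℝ) ∂π) * (ε' + 2 * M * ε) + (∫ i, (θ i : ℝ) ^ 2 ∂π) * (4 * M * ε + 2 * ε ^ 2) := by
  have := h.prob
  have hθm := h.measurable_number
  have hε0 : 0 ≤ ε := (abs_nonneg _).trans (hε x hx x hx)
  have hM0 : 0 ≤ M := (abs_nonneg _).trans (hM x)
  have hYx : Measurable fun p : E × ℝ => Y p.2 p.1 := hY.comp measurable_swap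
  have ham : Measurable a := by
    have := (hY.stronglyMeasurable.integral_prod_right (ν := μ 0)).measurable
    exact (funext (ha 0) : (fun x => ∫ f, Y x f ∂μ 0) = a) ▸ this
  have hAm : Measurable A := by
    have := (Measurable.stronglyMeasurable (f := Function.uncurry fun x f => Y x f ^ 2)
      (hY.pow_const 2) |>.integral_prod_right (ν := μ 0)).measurable
    exact (funext (hA 0) : (fun x => ∫ f, Y x f ^ 2 ∂μ 0) = A) ▸ this
  have i1 : Integrable (fun i => (θ i : ℝ)) π := by
    simpa using h.integrable_pow (p := 1) (by norm_num)
  have i2 : Integrable (fun i => (θ i : ℝ) ^ 2) π := h.integrable_pow (by norm_num)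
  set m₁ := ∫ i, (θ i : ℝ) ∂π with hm₁
  set m₂ := ∫ i, (θ i : ℝ) ^ 2 ∂π with hm₂
  have hθ2 : MemLp (fun i => (θ i : ℝ)) 2 π :=
    (memLp_two_iff_integrable_sq (Measurable.aestronglyMeasurable (by fun_prop))).2 i2
  have hvθ : variance (fun i => (θ i : ℝ)) π = m₂ - m₁ ^ 2 := variance_eq_sub hθ2
  have hm₁₂ : m₁ ^ 2 ≤ m₂ := by
    have := variance_nonneg (fun i => (θ i : ℝ)) π
    linarith
  have hm₁0 : 0 ≤ m₁ := integral_nonneg fun i => Nat.cast_nonneg _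
  have hm₂0 : 0 ≤ m₂ := (sq_nonneg _).trans hm₁₂
  -- Moving all starting points of the cell to `x` changes the conditional mean from `θ a(x) + r` to
  -- `θ a(x)` and the conditional variance from `θ (A(x) - a(x)²) + t` to `θ (A(x) - a(x)²)`. Both
  -- `r` and `t` are small multiples of `θ`.
  set r : I → ℝ := fun i => ∑ n ∈ Finset.range (θ i), (a (κ i n) - a x) with hr
  set t : I → ℝ := fun i => ∑ n ∈ Finset.range (θ i),
    ((A (κ i n) - a (κ i n) ^ 2) - (A x - a x ^ 2)) with ht
  have hrm : Measurable r := measurable_sum_range hθm fun n =>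
    (ham.comp (h.measurable_position n)).sub_const _
  have htm : Measurable t := measurable_sum_range hθm fun n =>
    ((hAm.comp (h.measurable_position n)).sub ((ham.comp (h.measurable_position n)).pow_const 2)).sub_const _
  have hrb (i : I) : |r i| ≤ ε * θ i := by
    refine (Finset.abs_sum_le_sum_abs _ _).trans ?_
    refine (Finset.sum_le_sum fun n hn => hε _ (h.mem i n (Finset.mem_range.1 hn)) x hx).trans ?_
    simp [mul_comm]
  have htb (i : I) : |t i| ≤ (ε' + 2 * M * ε) * θ i := by
    refine (Finset.abs_sum_le_sum_abs _ _).trans ?_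
    refine (Finset.sum_le_sum (g := fun _ => ε' + 2 * M * ε) fun n hn => ?_).trans
      (le_of_eq (by rw [Finset.sum_const, Finset.card_range, nsmul_eq_mul, mul_comm]))
    have hmem := h.mem i n (Finset.mem_range.1 hn)
    have e1 := hε _ hmem x hx
    have e2 := hε' _ hmem x hx
    have e3 : |a (κ i n) + a x| ≤ 2 * M := (abs_add_le _ _).trans (by linarith [hM (κ i n), hM x])
    have e4 : (A (κ i n) - a (κ i n) ^ 2) - (A x - a x ^ 2) =
        (A (κ i n) - A x) - (a (κ i n) + a x) * (a (κ i n) - a x) := by ring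
    rw [e4]
    refine (abs_sub _ _).trans (add_le_add e2 ?_)
    rw [abs_mul]
    exact mul_le_mul e3 e1 (abs_nonneg _) (by positivity)
  have ir : Integrable r π := (i1.const_mul ε).mono' hrm.aestronglyMeasurable
    (Eventually.of_forall hrb)
  have it : Integrable t π := (i1.const_mul _).mono' htm.aestronglyMeasurable
    (Eventually.of_forall htb)
  have hθrb (i : I) : |θ i * r i| ≤ ε * (θ i : ℝ) ^ 2 := by
    rw [abs_mul, Nat.abs_cast]
    calc (θ i : ℝ) * |r i| ≤ θ i * (ε * θ i) := by gcongr; exact hrb i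
      _ = _ := by ring
  have hr2b (i : I) : |r i ^ 2| ≤ ε ^ 2 * (θ i : ℝ) ^ 2 := by
    rw [abs_pow, ← mul_pow]
    exact pow_le_pow_left₀ (abs_nonneg _) (hrb i) 2
  have iθr : Integrable (fun i => θ i * r i) π := (i2.const_mul ε).mono'
    (Measurable.aestronglyMeasurable (by fun_prop)) (Eventually.of_forall hθrb)
  have ir2 : Integrable (fun i => r i ^ 2) π := (i2.const_mul (ε ^ 2)).mono'
    (Measurable.aestronglyMeasurable (by fun_prop)) (Eventually.of_forall hr2b)
  have bound {u v : I → ℝ} {c : ℝ} (hu : ∀ i, |u i| ≤ c * v i) (hv : Integrable v π) :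
      |∫ i, u i ∂π| ≤ c * ∫ i, v i ∂π := by
    rw [← integral_const_mul]
    exact norm_integral_le_of_norm_le (f := u) (hv.const_mul c) (Eventually.of_forall hu)
  have b1 : |∫ i, r i ∂π| ≤ ε * m₁ := bound hrb i1
  have b2 : |∫ i, t i ∂π| ≤ (ε' + 2 * M * ε) * m₁ := bound htb i1
  have b3 : |∫ i, θ i * r i ∂π| ≤ ε * m₂ := bound hθrb i2
  have b4 : |∫ i, r i ^ 2 ∂π| ≤ ε ^ 2 * m₂ := bound hr2b i2
  have hS (i : I) : ∑ n ∈ Finset.range (θ i), ∫ f, Y (κ i n) f ∂μ n = θ i * a x + r i := by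
    simp only [ha, hr, Finset.sum_sub_distrib, Finset.sum_const, Finset.card_range, nsmul_eq_mul]
    ring
  have hT (i : I) : ∑ n ∈ Finset.range (θ i), (∫ f, Y (κ i n) f ^ 2 ∂μ n -
      (∫ f, Y (κ i n) f ∂μ n) ^ 2) = θ i * (A x - a x ^ 2) + t i := by
    simp only [ha, hA, ht]
    rw [Finset.sum_sub_distrib (f := fun n => A (κ i n) - a (κ i n) ^ 2), Finset.sum_const,
      Finset.card_range, nsmul_eq_mul]
    ring
  have e1 : ∫ q, cellSum θ κ Y q ∂(π.prod (Measure.infinitePi μ)) =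
      m₁ * a x + ∫ i, r i ∂π := by
    rw [h.integral_cellSum hY hB]
    simp_rw [hS]
    rw [integral_add (i1.mul_const _) ir, integral_mul_const]
  have e2 : ∫ q, cellSum θ κ Y q ^ 2 ∂(π.prod (Measure.infinitePi μ)) =
      m₂ * a x ^ 2 + 2 * a x * ∫ i, θ i * r i ∂π + ∫ i, r i ^ 2 ∂π + m₁ * (A x - a x ^ 2) +
        ∫ i, t i ∂π := by
    rw [h.integral_cellSum_sq hY hB]
    simp_rw [hS, hT]
    have e (i : I) : (θ i * a x + r i) ^ 2 + (θ i * (A x - a x ^ 2) + t i) =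
        (θ i : ℝ) ^ 2 * a x ^ 2 + 2 * a x * (θ i * r i) + r i ^ 2 + θ i * (A x - a x ^ 2) + t i := by
      ring
    simp_rw [e]
    have j1 := i2.mul_const (a x ^ 2)
    have j2 := iθr.const_mul (2 * a x)
    have j3 := i1.mul_const (A x - a x ^ 2)
    rw [integral_add (((j1.fun_add j2).fun_add ir2).fun_add j3) it,
      integral_add ((j1.fun_add j2).fun_add ir2) j3, integral_add (j1.fun_add j2) ir2,
      integral_add j1 j2, integral_mul_const, integral_mul_const, integral_const_mul]
  have hL : MemLp (cellSum θ κ Y) 2 (π.prod (Measure.infinitePi μ)) :=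
    (memLp_two_iff_integrable_sq (h.measurable_cellSum hY).aestronglyMeasurable).2
      (h.integrable_cellSum_pow hY hB (by norm_num))
  rw [variance_eq_sub hL, hvθ]
  simp only [Pi.pow_apply]
  rw [e1, e2]
  set R₁ := ∫ i, r i ∂π
  set R₂ := ∫ i, θ i * r i ∂π
  set R₃ := ∫ i, r i ^ 2 ∂π
  set R₄ := ∫ i, t i ∂π
  have hx1 := hM x
  have f1 : |2 * a x * (R₂ - m₁ * R₁)| ≤ 2 * M * (2 * ε * m₂) := by
    rw [abs_mul, abs_mul, abs_two]
    have : |R₂ - m₁ * R₁| ≤ 2 * ε * m₂ := by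
      refine (abs_sub _ _).trans ?_
      rw [abs_mul, abs_of_nonneg hm₁0]
      have : m₁ * |R₁| ≤ m₁ * (ε * m₁) := by gcongr
      nlinarith
    gcongr
  have f2 : |R₁ ^ 2| ≤ ε ^ 2 * m₂ := by
    rw [abs_pow]
    calc |R₁| ^ 2 ≤ (ε * m₁) ^ 2 := by gcongr
      _ = ε ^ 2 * m₁ ^ 2 := by ring
      _ ≤ _ := by gcongr
  -- The remainder is a covariance of `θ` with `r`, a variance of `r`, and the mean of `t`.
  have e5 : m₂ * a x ^ 2 + 2 * a x * R₂ + R₃ + m₁ * (A x - a x ^ 2) + R₄ - (m₁ * a x + R₁) ^ 2 -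
      (m₁ * (A x - a x ^ 2) + (m₂ - m₁ ^ 2) * a x ^ 2) =
      2 * a x * (R₂ - m₁ * R₁) + (R₃ - R₁ ^ 2) + R₄ := by ring
  rw [e5]
  have g1 := abs_add_le (2 * a x * (R₂ - m₁ * R₁) + (R₃ - R₁ ^ 2)) R₄
  have g2 := abs_add_le (2 * a x * (R₂ - m₁ * R₁)) (R₃ - R₁ ^ 2)
  have g3 := abs_sub R₃ (R₁ ^ 2)
  linarith

end

/-! ### A quantitative Lyapunov theorem for series of independent variables. -/

/-- Taylor's formula for `|x| ≤ 1`. For `|x| ≥ 1` the triangle inequality gives `2 + |x| + x²/2`, at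
most `3.5 |x|³`. -/
theorem norm_exp_mul_I_sub_le (x : ℝ) :
    ‖Complex.exp (x * Complex.I) - (1 + x * Complex.I - (x : ℂ) ^ 2 / 2)‖ ≤ 4 * |x| ^ 3 := by
  rcases le_total |x| 1 with h | h
  · have h1 := Complex.exp_bound' (x := x * Complex.I) (n := 3) (by
      rw [norm_mul, Complex.norm_real, Complex.norm_I, mul_one, Real.norm_eq_abs]
      norm_num
      linarith)
    rw [norm_mul, Complex.norm_real, Complex.norm_I, mul_one, Real.norm_eq_abs] at h1
    have h2 : ∑ m ∈ Finset.range 3, (x * Complex.I) ^ m / (m.factorial : ℂ) =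
        1 + x * Complex.I - (x : ℂ) ^ 2 / 2 := by
      simp [Finset.sum_range_succ, Nat.factorial, mul_pow]
      ring
    rw [h2] at h1
    refine h1.trans ?_
    have : 0 ≤ |x| ^ 3 := by positivity
    norm_num [Nat.factorial]
    linarith
  · have h1 : ‖(1 : ℂ) + x * Complex.I - (x : ℂ) ^ 2 / 2‖ ≤ 1 + |x| + |x| ^ 2 / 2 := by
      refine (norm_sub_le _ _).trans (add_le_add ((norm_add_le _ _).trans ?_) ?_)
      · simp
      · simp
    refine (norm_sub_le _ _).trans ?_
    rw [Complex.norm_exp_ofReal_mul_I]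
    have h2 : |x| ^ 2 ≤ |x| ^ 3 := pow_le_pow_right₀ h (by norm_num)
    have h3 : |x| ≤ |x| ^ 2 := by nlinarith
    linarith

theorem abs_exp_neg_sub_le {y : ℝ} (hy : 0 ≤ y) :
    |Real.exp (-(y ^ 2 / 2)) - (1 - y ^ 2 / 2)| ≤ y ^ 3 := by
  have h1 := Real.add_one_le_exp (-(y ^ 2 / 2))
  rw [abs_of_nonneg (by linarith)]
  rcases le_total y 1 with h | h
  · have hz : |-(y ^ 2 / 2)| ≤ 1 := by
      rw [abs_neg, abs_of_nonneg (by positivity)]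
      nlinarith
    have := (abs_le.1 (Real.abs_exp_sub_one_sub_id_le hz)).2
    have h3 : y ^ 4 ≤ y ^ 3 := pow_le_pow_of_le_one hy h (by norm_num)
    have h4 : 0 ≤ y ^ 3 := by positivity
    nlinarith
  · have : Real.exp (-(y ^ 2 / 2)) ≤ 1 := Real.exp_le_one_iff.2 (by nlinarith [sq_nonneg y])
    have h2 : y ^ 2 ≤ y ^ 3 := pow_le_pow_right₀ h (by norm_num)
    nlinarith

/-- Factors are replaced one at a time; all remaining factors have norm at most one. -/
theorem norm_prod_sub_prod_le {ι : Type*} (s : Finset ι) {a b : ι → ℂ} (ha : ∀ i, ‖a i‖ ≤ 1)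
    (hb : ∀ i, ‖b i‖ ≤ 1) : ‖∏ i ∈ s, a i - ∏ i ∈ s, b i‖ ≤ ∑ i ∈ s, ‖a i - b i‖ := by
  classical
  induction s using Finset.induction_on with
  | empty => simp
  | insert i s hi ih =>
    rw [Finset.prod_insert hi, Finset.prod_insert hi, Finset.sum_insert hi]
    have e : a i * ∏ k ∈ s, a k - b i * ∏ k ∈ s, b k =
        (a i - b i) * ∏ k ∈ s, a k + b i * (∏ k ∈ s, a k - ∏ k ∈ s, b k) := by ring
    rw [e]
    refine (norm_add_le _ _).trans (add_le_add ?_ ?_)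
    · rw [norm_mul]
      refine mul_le_of_le_one_right (norm_nonneg _) ?_
      rw [norm_prod]
      exact Finset.prod_le_one (fun _ _ => norm_nonneg _) fun k _ => ha k
    · rw [norm_mul]
      exact (mul_le_of_le_one_left (norm_nonneg _) (hb i)).trans ih

section

variable {Ω : Type*} [MeasurableSpace Ω] {P : Measure Ω} [IsProbabilityMeasure P]

theorem integrable_pow_of_cube {X : Ω → ℝ} (hX : AEMeasurable X P)
    (h3 : Integrable (fun ω => |X ω| ^ 3) P) {p : ℕ} (hp : p ≤ 3) :
    Integrable (fun ω => X ω ^ p) P := by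
  refine (h3.add (integrable_const 1)).mono' (hX.pow_const p).aestronglyMeasurable
    (Eventually.of_forall fun ω => ?_)
  rw [norm_pow, Real.norm_eq_abs, Pi.add_apply]
  rcases le_total |X ω| 1 with h | h
  · have := pow_le_one₀ (n := p) (abs_nonneg _) h
    have : 0 ≤ |X ω| ^ 3 := by positivity
    linarith
  · linarith [pow_le_pow_right₀ h hp]

/-- The characteristic function of a centered variable, compared to the Gaussian one. -/
theorem norm_integral_exp_sub_le {X : Ω → ℝ} (hX : AEMeasurable X P)
    (h3 : Integrable (fun ω => |X ω| ^ 3) P) (h0 : ∫ ω, X ω ∂P = 0) :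
    ‖∫ ω, Complex.exp (X ω * Complex.I) ∂P - (Real.exp (-((∫ ω, X ω ^ 2 ∂P) / 2)) : ℝ)‖ ≤
      5 * ∫ ω, |X ω| ^ 3 ∂P := by
  have i1 : Integrable X P := by
    simpa using integrable_pow_of_cube hX h3 (p := 1) (by norm_num)
  have i2 : Integrable (fun ω => X ω ^ 2) P := integrable_pow_of_cube hX h3 (by norm_num)
  set v := ∫ ω, X ω ^ 2 ∂P with hv
  have hv0 : 0 ≤ v := integral_nonneg fun ω => sq_nonneg _
  -- Lyapunov's inequality `σ³ ≤ E|X|³`, obtained by integrating `(|X| - σ)² (2|X| + σ) ≥ 0`, that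
  -- is `3σX² ≤ 2|X|³ + σ³`.
  have hcube : √v ^ 3 ≤ ∫ ω, |X ω| ^ 3 ∂P := by
    have hs := Real.sq_sqrt hv0
    have h : 3 * √v * v ≤ 2 * ∫ ω, |X ω| ^ 3 ∂P + √v ^ 3 := by
      have e : 2 * ∫ ω, |X ω| ^ 3 ∂P + √v ^ 3 = ∫ ω, (2 * |X ω| ^ 3 + √v ^ 3) ∂P := by
        rw [integral_add (h3.const_mul 2) (integrable_const _), integral_const_mul]
        simp
      rw [e, hv, ← integral_const_mul, ← hv]
      refine integral_mono (i2.const_mul _) ((h3.const_mul 2).add (integrable_const _)) fun ω => ?_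
      dsimp only
      rw [← sq_abs (X ω)]
      have := mul_nonneg (sq_nonneg (|X ω| - √v)) (by positivity : 0 ≤ 2 * |X ω| + √v)
      nlinarith
    have : 3 * √v * v = 3 * √v ^ 3 := by
      calc 3 * √v * v = 3 * √v * √v ^ 2 := by rw [hs]
        _ = _ := by ring
    linarith
  have hexp : Integrable (fun ω => Complex.exp (X ω * Complex.I)) P := by
    refine Integrable.of_bound (C := 1) ?_ (Eventually.of_forall fun ω => ?_)
    · have : Continuous fun x : ℝ => Complex.exp (x * Complex.I) := by fun_prop
      exact (this.measurable.comp_aemeasurable hX).aestronglyMeasurable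
    · rw [Complex.norm_exp_ofReal_mul_I]
  have hpoly : Integrable (fun ω => (1 : ℂ) + X ω * Complex.I - (X ω : ℂ) ^ 2 / 2) P := by
    have := (i2.ofReal (𝕜 := ℂ)).div_const 2
    refine ((integrable_const 1).add (i1.ofReal.mul_const Complex.I)).sub ?_
    simpa using this
  have hpi : ∫ ω, ((1 : ℂ) + X ω * Complex.I - (X ω : ℂ) ^ 2 / 2) ∂P = ((1 - v / 2 : ℝ) : ℂ) := by
    have j2 : Integrable (fun ω => (X ω : ℂ) ^ 2 / 2) P := by
      simpa using (i2.ofReal (𝕜 := ℂ)).div_const 2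
    have j1 : Integrable (fun ω => (X ω : ℂ) * Complex.I) P := i1.ofReal.mul_const Complex.I
    have j0 : Integrable (fun _ : Ω => (1 : ℂ)) P := integrable_const 1
    rw [integral_sub (j0.fun_add j1) j2, integral_add j0 j1,
      integral_mul_const, integral_div]
    have e1 : ∫ ω, (X ω : ℂ) ∂P = 0 := by
      rw [integral_complex_ofReal, h0, Complex.ofReal_zero]
    have e2 : ∫ ω, (X ω : ℂ) ^ 2 ∂P = (v : ℂ) := by
      rw [hv, ← integral_complex_ofReal]
      simp
    rw [e1, e2]
    simp
  have hA : ‖∫ ω, Complex.exp (X ω * Complex.I) ∂P - ((1 - v / 2 : ℝ) : ℂ)‖ ≤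
      4 * ∫ ω, |X ω| ^ 3 ∂P := by
    rw [← hpi, ← integral_sub hexp hpoly, ← integral_const_mul]
    exact norm_integral_le_of_norm_le (h3.const_mul 4)
      (Eventually.of_forall fun ω => norm_exp_mul_I_sub_le (X ω))
  have hB : ‖((1 - v / 2 : ℝ) : ℂ) - (Real.exp (-(v / 2)) : ℝ)‖ ≤ ∫ ω, |X ω| ^ 3 ∂P := by
    rw [← Complex.ofReal_sub, Complex.norm_real, Real.norm_eq_abs, abs_sub_comm]
    have := abs_exp_neg_sub_le (Real.sqrt_nonneg v)
    rw [Real.sq_sqrt hv0] at this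
    exact this.trans hcube
  calc _ ≤ _ := norm_sub_le_norm_sub_add_norm_sub _ ((1 - v / 2 : ℝ) : ℂ) _
    _ ≤ 4 * ∫ ω, |X ω| ^ 3 ∂P + ∫ ω, |X ω| ^ 3 ∂P := add_le_add hA hB
    _ = _ := by ring

/-- The quantitative Lyapunov central limit theorem for series of independent variables. -/
theorem norm_integral_exp_series_sub_le {ι : Type*} [Countable ι] {ζ : ι → Ω → ℝ} {Z : Ω → ℝ}
    (hm : ∀ j, AEMeasurable (ζ j) P) (hind : iIndepFun ζ P)
    (h3 : ∀ j, Integrable (fun ω => |ζ j ω| ^ 3) P) (h0 : ∀ j, ∫ ω, ζ j ω ∂P = 0) {V L : ℝ}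
    (hV : HasSum (fun j => ∫ ω, ζ j ω ^ 2 ∂P) V) (hL : HasSum (fun j => ∫ ω, |ζ j ω| ^ 3 ∂P) L)
    (hZ : ∀ᵐ ω ∂P, HasSum (fun j => ζ j ω) (Z ω)) :
    ‖∫ ω, Complex.exp (Z ω * Complex.I) ∂P - (Real.exp (-(V / 2)) : ℝ)‖ ≤ 5 * L := by
  have hchar (X : Ω → ℝ) (hX : AEMeasurable X P) :
      charFun (P.map X) 1 = ∫ ω, Complex.exp (X ω * Complex.I) ∂P := by
    rw [charFun_apply_real, integral_map hX (by fun_prop)]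
    simp
  have hfin (s : Finset ι) : ∫ ω, Complex.exp ((∑ j ∈ s, ζ j ω : ℝ) * Complex.I) ∂P =
      ∏ j ∈ s, ∫ ω, Complex.exp (ζ j ω * Complex.I) ∂P := by
    rw [← hchar _ (Finset.aemeasurable_fun_sum s fun j _ => hm j),
      (hind.restrict _).charFun_map_fun_finsetSum_eq_prod fun _ _ => hm _]
    simp_rw [Finset.prod_apply, hchar _ (hm _)]
  have hbound (s : Finset ι) : ‖∫ ω, Complex.exp ((∑ j ∈ s, ζ j ω : ℝ) * Complex.I) ∂P -
      (Real.exp (-((∑ j ∈ s, ∫ ω, ζ j ω ^ 2 ∂P) / 2)) : ℝ)‖ ≤ 5 * L := by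
    have e : ((Real.exp (-((∑ j ∈ s, ∫ ω, ζ j ω ^ 2 ∂P) / 2)) : ℝ) : ℂ) =
        ∏ j ∈ s, ((Real.exp (-((∫ ω, ζ j ω ^ 2 ∂P) / 2)) : ℝ) : ℂ) := by
      rw [← Complex.ofReal_prod, ← Real.exp_sum, Finset.sum_neg_distrib, Finset.sum_div]
    rw [hfin, e]
    refine (norm_prod_sub_prod_le s (fun j => ?_) (fun j => ?_)).trans ?_
    · refine (norm_integral_le_integral_norm _).trans ?_
      simp [Complex.norm_exp_ofReal_mul_I]
    · rw [Complex.norm_real, Real.norm_eq_abs, Real.abs_exp, Real.exp_le_one_iff]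
      have : 0 ≤ ∫ ω, ζ j ω ^ 2 ∂P := integral_nonneg fun ω => sq_nonneg _
      linarith
    · refine (Finset.sum_le_sum fun j _ => norm_integral_exp_sub_le (hm j) (h3 j) (h0 j)).trans ?_
      rw [← Finset.mul_sum]
      gcongr
      exact sum_le_hasSum s (fun j _ => integral_nonneg fun ω => by positivity) hL
  -- The bound for finite sums does not depend on the finite set, so it passes to the limit by
  -- dominated convergence; countability of the index set makes the filter of finite sets countably
  -- generated.
  have hlim : Tendsto (fun s : Finset ι => ∫ ω, Complex.exp ((∑ j ∈ s, ζ j ω : ℝ) * Complex.I) ∂P)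
      atTop (𝓝 (∫ ω, Complex.exp (Z ω * Complex.I) ∂P)) := by
    refine tendsto_integral_filter_of_dominated_convergence (fun _ => 1)
      (Eventually.of_forall fun s => ?_) (Eventually.of_forall fun s => Eventually.of_forall
        fun ω => ?_) (integrable_const 1) ?_
    · have : Continuous fun x : ℝ => Complex.exp (x * Complex.I) := by fun_prop
      exact (this.measurable.comp_aemeasurable
        (Finset.aemeasurable_fun_sum s fun j _ => hm j)).aestronglyMeasurable
    · rw [Complex.norm_exp_ofReal_mul_I]
    · filter_upwards [hZ] with ω hω
      have : Continuous fun x : ℝ => Complex.exp (x * Complex.I) := by fun_prop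
      exact (this.tendsto _).comp hω
  have hlim2 : Tendsto (fun s : Finset ι =>
      ((Real.exp (-((∑ j ∈ s, ∫ ω, ζ j ω ^ 2 ∂P) / 2)) : ℝ) : ℂ)) atTop
      (𝓝 ((Real.exp (-(V / 2)) : ℝ) : ℂ)) := by
    have : Continuous fun v : ℝ => ((Real.exp (-(v / 2)) : ℝ) : ℂ) := by fun_prop
    exact (this.tendsto V).comp hV
  exact le_of_tendsto (hlim.sub hlim2).norm (Eventually.of_forall hbound)

end

/-! ### Coding of paths by countably many coordinates -/

/-- The values of a path at the times `k / (n + 1)`. -/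
noncomputable def pathCode (f : ℝ≥0 → ℝ) (p : ℕ × ℕ) : ℝ := f ((p.2 : ℝ≥0) / ((p.1 : ℝ≥0) + 1))

/-- The reconstruction of a right-continuous path. -/
noncomputable def decode (c : ℕ × ℕ → ℝ) (s : ℝ) : ℝ :=
  limsup (fun n : ℕ => c (n, ⌈s * ((n : ℝ) + 1)⌉₊)) atTop

/-- A limsup of countably many coordinates is jointly measurable in code and time, and it is defined
for every code, including those that come from no path. Joint measurability is what Fubini needs
later on. -/
theorem measurable_decode : Measurable fun p : (ℕ × ℕ → ℝ) × ℝ => decode p.1 p.2 := by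
  refine Measurable.limsup fun n => ?_
  have h : Measurable fun q : ℕ × (ℕ × ℕ → ℝ) => q.2 (n, q.1) :=
    measurable_from_prod_countable_right fun k => measurable_pi_apply (n, k)
  have h2 : Measurable fun p : (ℕ × ℕ → ℝ) × ℝ => (⌈p.2 * ((n : ℝ) + 1)⌉₊, p.1) :=
    (Nat.measurable_ceil.comp (by fun_prop)).prodMk measurable_fst
  exact h.comp h2

/-- Rounding up keeps the grid times at or to the right of `s`, so right-continuity of the path
suffices for the reconstruction. -/
theorem tendsto_ceil_div (s : ℝ≥0) :
    Tendsto (fun n : ℕ => ((⌈(s : ℝ) * ((n : ℝ) + 1)⌉₊ : ℝ≥0) / ((n : ℝ≥0) + 1))) atTop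
      (𝓝[≥] s) := by
  have hle (n : ℕ) : s ≤ (⌈(s : ℝ) * ((n : ℝ) + 1)⌉₊ : ℝ≥0) / ((n : ℝ≥0) + 1) := by
    rw [le_div_iff₀ (by positivity), ← NNReal.coe_le_coe]
    push_cast
    exact Nat.le_ceil _
  refine tendsto_nhdsWithin_iff.2 ⟨?_, Eventually.of_forall hle⟩
  rw [← NNReal.tendsto_coe]
  have h1 : Tendsto (fun n : ℕ => (s : ℝ) + 1 / ((n : ℝ) + 1)) atTop (𝓝 (s + 0)) :=
    tendsto_const_nhds.add tendsto_one_div_add_atTop_nhds_zero_nat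
  rw [add_zero] at h1
  refine tendsto_of_tendsto_of_tendsto_of_le_of_le tendsto_const_nhds h1
    (fun n => NNReal.coe_le_coe.2 (hle n)) fun n => ?_
  have h0 : (0 : ℝ) < (n : ℝ) + 1 := by positivity
  push_cast
  rw [div_le_iff₀ h0, add_mul, div_mul_cancel₀ _ h0.ne']
  exact (Nat.ceil_lt_add_one (by positivity)).le

theorem decode_pathCode {f : ℝ≥0 → ℝ} (hf : ∀ t, ContinuousWithinAt f (Set.Ici t) t) {s : ℝ}
    (hs : 0 ≤ s) : decode (pathCode f) s = f s.toNNReal := by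
  lift s to ℝ≥0 using hs
  rw [Real.toNNReal_coe]
  exact ((hf s).tendsto.comp (tendsto_ceil_div s)).limsup_eq

attribute [irreducible] decode

theorem measurable_decode_apply (s : ℝ) : Measurable fun c : ℕ × ℕ → ℝ => decode c s := by
  have h : Measurable fun c : ℕ × ℕ → ℝ => (c, s) := measurable_id.prodMk measurable_const
  exact Measurable.comp (g := fun p : (ℕ × ℕ → ℝ) × ℝ => decode p.1 p.2) measurable_decode h

/-! ### The law of the paths -/

section

variable {Ω : Type*} [MeasurableSpace Ω] {P : Measure Ω} [IsProbabilityMeasure P] {α : ℝ}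

/-- The coded path of a process. -/
noncomputable def codedPath (η : ℝ≥0 → Ω → ℝ) (ω : Ω) : ℕ × ℕ → ℝ := pathCode fun t => η t ω

theorem measurable_codedPath {η : ℝ≥0 → Ω → ℝ} (h : ∀ t, Measurable (η t)) :
    Measurable (codedPath η) :=
  measurable_pi_iff.2 fun _ => h _

theorem IsStableLevy.ae_decode_eq {η : ℝ≥0 → Ω → ℝ} (h : IsStableLevy α η P) :
    ∀ᵐ ω ∂P, ∀ s, 0 ≤ s → decode (codedPath η ω) s = η s.toNNReal ω := by
  filter_upwards [h.cadlag] with ω hω s hs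
  exact decode_pathCode (fun t => (hω t).1) hs

/-- Joint measurability of `decode` makes the law of the decoded value a kernel in the time
variable. -/
theorem exists_kernel (μ : Measure (ℕ × ℕ → ℝ)) [IsProbabilityMeasure μ] :
    ∃ ν : Kernel ℝ ℝ, IsMarkovKernel ν ∧ ∀ s, ν s = μ.map fun c => decode c s := by
  have hm : Measurable fun p : ℝ × (ℕ × ℕ → ℝ) => decode p.2 p.1 :=
    Measurable.comp (g := fun p : (ℕ × ℕ → ℝ) × ℝ => decode p.1 p.2) measurable_decode
      measurable_swap
  refine ⟨(Kernel.id ×ₖ Kernel.const ℝ μ).map fun p => decode p.2 p.1,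
    Kernel.IsMarkovKernel.map _ hm, fun s => ?_⟩
  have hp : Measurable fun c : ℕ × ℕ → ℝ => (s, c) := measurable_const.prodMk measurable_id
  rw [Kernel.map_apply _ hm, Kernel.prod_apply, Kernel.id_apply, Kernel.const_apply,
    Measure.dirac_prod, Measure.map_map hm hp]
  rfl

theorem IsStableLevy.charFun_decode {η : ℝ≥0 → Ω → ℝ} (h : IsStableLevy α η P) {s u : ℝ}
    (hs : 0 ≤ s) (hsu : s ≤ u) (z : ℝ) :
    charFun (P.map fun ω => η u.toNNReal ω - η s.toNNReal ω) z =
      ((Real.exp (-(u - s) * |z| ^ α) : ℝ) : ℂ) := by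
  rw [h.charFun_increment _ _ (Real.toNNReal_le_toNNReal hsu), Real.coe_toNNReal _ (hs.trans hsu),
    Real.coe_toNNReal _ hs]

theorem IsStableLevy.map_increment {η : ℝ≥0 → Ω → ℝ} (h : IsStableLevy α η P) {ν : Kernel ℝ ℝ}
    (hν : IsStableKernel α ν) {s u : ℝ} (hs : 0 ≤ s) (hsu : s ≤ u) :
    P.map (fun ω => η u.toNNReal ω - η s.toNNReal ω) = ν (u - s) := by
  have := Measure.isProbabilityMeasure_map (μ := P)
    ((h.measurable u.toNNReal).sub (h.measurable s.toNNReal)).aemeasurable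
  exact hν.eq_of_charFun (sub_nonneg.2 hsu) (h.charFun_decode hs hsu)

/-- The process itself supplies the stable laws, measurably in time, so they need no separate
construction. -/
theorem IsStableLevy.exists_isStableKernel {η : ℝ≥0 → Ω → ℝ} (h : IsStableLevy α η P) :
    ∃ ν : Kernel ℝ ℝ, IsStableKernel α ν := by
  have hm := measurable_codedPath h.measurable
  have := Measure.isProbabilityMeasure_map (μ := P) hm.aemeasurable
  obtain ⟨ν, hν, hνs⟩ := exists_kernel (P.map (codedPath η))
  refine ⟨ν, hν, fun s hs z => ?_⟩
  rw [hνs, Measure.map_map (measurable_decode_apply s) hm]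
  have := h.charFun_decode le_rfl hs z
  rw [sub_zero] at this
  rw [← this]
  congr 1
  refine Measure.map_congr ?_
  filter_upwards [h.ae_decode_eq, h.zero] with ω h1 h2
  rw [Function.comp_apply, h1 s hs, Real.toNNReal_zero, h2, sub_zero]

theorem IsStableLevy.isMarkovPath {η : ℝ≥0 → Ω → ℝ} (h : IsStableLevy α η P) {ν : Kernel ℝ ℝ}
    (hν : IsStableKernel α ν) : IsMarkovPath ν (P.map (codedPath η)) decode := by
  have hm := measurable_codedPath h.measurable
  refine ⟨Measure.isProbabilityMeasure_map hm.aemeasurable, measurable_decode,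
    fun s u r hs hsu hur => ?_⟩
  have hd := measurable_decode_apply
  have hd3 : Measurable fun c : ℕ × ℕ → ℝ => (decode c s, decode c u - decode c s, decode c r - decode c u) :=
    (hd s).prodMk (((hd u).sub (hd s)).prodMk ((hd r).sub (hd u)))
  rw [Measure.map_map hd3 hm]
  -- Time zero is included because independence concerns increments; `η 0 = 0` almost surely turns
  -- the first increment into the value at `s`.
  set t : Fin 4 → ℝ≥0 := ![0, s.toNNReal, u.toNNReal, r.toNNReal] with ht
  have hmono : Monotone t := by
    refine Fin.monotone_iff_le_succ.2 fun i => ?_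
    fin_cases i
    · exact zero_le
    · exact Real.toNNReal_le_toNNReal hsu
    · exact Real.toNNReal_le_toNNReal hur
  have hind := h.indep_increments 3 t hmono
  have hmeas (i : Fin 3) : Measurable fun ω => η (t i.succ) ω - η (t i.castSucc) ω :=
    (h.measurable _).sub (h.measurable _)
  have h12 : IndepFun (fun ω => η u.toNNReal ω - η s.toNNReal ω)
      (fun ω => η r.toNNReal ω - η u.toNNReal ω) P := hind.indepFun (i := 1) (j := 2) (by decide)
  have h0 : IndepFun (fun ω => η s.toNNReal ω - η 0 ω) (fun ω =>
      (η u.toNNReal ω - η s.toNNReal ω, η r.toNNReal ω - η u.toNNReal ω)) P :=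
    (hind.indepFun_prodMk hmeas 1 2 0 (by decide) (by decide)).symm
  have e : P.map ((fun c => (decode c s, decode c u - decode c s, decode c r - decode c u)) ∘
      codedPath η) = P.map (fun ω => (η s.toNNReal ω - η 0 ω,
        (η u.toNNReal ω - η s.toNNReal ω, η r.toNNReal ω - η u.toNNReal ω))) := by
    refine Measure.map_congr ?_
    filter_upwards [h.ae_decode_eq, h.zero] with ω h1 h2
    simp only [Function.comp_apply]
    rw [h1 s hs, h1 u (hs.trans hsu), h1 r (hs.trans (hsu.trans hur)), h2, sub_zero]
  have m (a b : ℝ≥0) : Measurable fun ω => η a ω - η b ω := (h.measurable a).sub (h.measurable b)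
  have m1 := m s.toNNReal 0
  have m2 := m u.toNNReal s.toNNReal
  have m3 := m r.toNNReal u.toNNReal
  rw [e, (indepFun_iff_map_prod_eq_prod_map_map m1.aemeasurable (m2.prodMk m3).aemeasurable).1 h0,
    (indepFun_iff_map_prod_eq_prod_map_map m2.aemeasurable m3.aemeasurable).1 h12,
    h.map_increment hν hs hsu, h.map_increment hν (hs.trans hsu) hur]
  have := h.map_increment hν le_rfl hs
  rw [sub_zero, Real.toNNReal_zero] at this
  rw [this]

/-! ### Independence of the cells -/

/-- It is enough to test measurable rectangles. Independence of the two families separates the two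
intersections, independence inside each family factorises them, and the factors are then recombined
index by index. -/
theorem iIndepFun_prodMk {ι : Type*} {β γ : ι → Type*} [∀ i, MeasurableSpace (β i)]
    [∀ i, MeasurableSpace (γ i)] {f : ∀ i, Ω → β i} {g : ∀ i, Ω → γ i} (hfm : ∀ i, Measurable (f i))
    (hgm : ∀ i, Measurable (g i)) (hf : iIndepFun f P) (hg : iIndepFun g P)
    (hfg : IndepFun (fun ω i => f i ω) (fun ω i => g i ω) P) :
    iIndepFun (fun i ω => (f i ω, g i ω)) P := by
  have hfg' (i : ι) : IndepFun (f i) (g i) P :=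
    hfg.comp (measurable_pi_apply i) (measurable_pi_apply i)
  set S : ∀ i, Set (Set Ω) := fun i => (fun s => (fun ω => (f i ω, g i ω)) ⁻¹' s) ''
    (Set.image2 (· ×ˢ ·) {s : Set (β i) | MeasurableSet s} {t : Set (γ i) | MeasurableSet t}) with hS
  rw [iIndepFun_iff_iIndep]
  refine iIndepSets.iIndep (fun i => ((hfm i).prodMk (hgm i)).comap_le) S (fun i => ?_) (fun i => ?_) ?_
  · exact isPiSystem_prod.comap _
  · rw [hS, ← MeasurableSpace.comap_generateFrom, generateFrom_prod]
  · rw [iIndepSets_iff]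
    intro s A hA
    have hA' (i : ι) : ∃ B : Set (β i) × Set (γ i), MeasurableSet B.1 ∧ MeasurableSet B.2 ∧
        (i ∈ s → A i = f i ⁻¹' B.1 ∩ g i ⁻¹' B.2) := by
      by_cases hi : i ∈ s
      · obtain ⟨_, ⟨B, hB, C, hC, rfl⟩, hBC⟩ := hA i hi
        exact ⟨(B, C), hB, hC, fun _ => hBC ▸ rfl⟩
      -- Indices outside `s` receive an arbitrary value, so that the choice is defined for every
      -- index.
      · exact ⟨(∅, ∅), MeasurableSet.empty, MeasurableSet.empty, fun h => absurd h hi⟩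
    choose B hB1 hB2 hAB using hA'
    have e1 : ⋂ i ∈ s, A i = (⋂ i ∈ s, f i ⁻¹' (B i).1) ∩ ⋂ i ∈ s, g i ⁻¹' (B i).2 := by
      rw [Set.iInter₂_congr hAB]
      ext ω
      simp only [Set.mem_iInter, Set.mem_inter_iff]
      exact ⟨fun h => ⟨fun i hi => (h i hi).1, fun i hi => (h i hi).2⟩,
        fun h i hi => ⟨h.1 i hi, h.2 i hi⟩⟩
    have e2 : (⋂ i ∈ s, f i ⁻¹' (B i).1) =
        (fun ω i => f i ω) ⁻¹' (⋂ i ∈ s, {x | x i ∈ (B i).1}) := by ext; simp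
    have e3 : (⋂ i ∈ s, g i ⁻¹' (B i).2) =
        (fun ω i => g i ω) ⁻¹' (⋂ i ∈ s, {x | x i ∈ (B i).2}) := by ext; simp
    have e4 : P ((⋂ i ∈ s, f i ⁻¹' (B i).1) ∩ ⋂ i ∈ s, g i ⁻¹' (B i).2) =
        P (⋂ i ∈ s, f i ⁻¹' (B i).1) * P (⋂ i ∈ s, g i ⁻¹' (B i).2) := by
      rw [e2, e3]
      refine hfg.measure_inter_preimage_eq_mul _ _ ?_ ?_
      · exact Finset.measurableSet_biInter s fun i _ => measurable_pi_apply i (hB1 i)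
      · exact Finset.measurableSet_biInter s fun i _ => measurable_pi_apply i (hB2 i)
    rw [e1, e4, hf.measure_inter_preimage_eq_mul s fun i _ => hB1 i,
      hg.measure_inter_preimage_eq_mul s fun i _ => hB2 i, ← Finset.prod_mul_distrib]
    refine Finset.prod_congr rfl fun i hi => ?_
    rw [hAB i hi, (hfg' i).measure_inter_preimage_eq_mul _ _ (hB1 i) (hB2 i)]

/-- The joint law is an infinite product measure over pairs, which currying turns into a product
over rows of products. -/
theorem iIndepFun_curry {ι κ X : Type*} [MeasurableSpace X] {f : ι × κ → Ω → X}
    (hm : ∀ p, Measurable (f p)) (h : iIndepFun f P) :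
    iIndepFun (fun i ω k => f (i, k) ω) P := by
  have hp (p : ι × κ) := Measure.isProbabilityMeasure_map (μ := P) (hm p).aemeasurable
  have h1 := (iIndepFun_iff_map_fun_eq_infinitePi_map hm).1 h
  have hrow (i : ι) : P.map (fun ω k => f (i, k) ω) = Measure.infinitePi fun k => P.map (f (i, k)) :=
    (h.precomp (g := fun k => (i, k)) (Prod.mk_right_injective i)).map_fun_eq_infinitePi_map
      fun k => hm (i, k)
  rw [iIndepFun_iff_map_fun_eq_infinitePi_map fun i => measurable_pi_iff.2 fun k => hm (i, k)]
  simp_rw [hrow]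
  rw [← Measure.infinitePi_map_curry fun i k => P.map (f (i, k)), ← h1,
    Measure.map_map (by fun_prop) (measurable_pi_iff.2 hm)]
  rfl

/-- The initial data of a cell: the number of points and the families of position vectors. -/
abbrev CellData : Type := ℕ × ((k : ℕ) → Fin k → ℝ)

/-- The position of the `n`-th point of the cell `[j, j + 1)`. -/
noncomputable def cellPos (j : ℤ) (i : CellData) (n : ℕ) : ℝ :=
  if h : n < i.1 then
    -- The fallback value `j` keeps the position in the cell for every conceivable datum; it is
    -- never taken by the particles of the actual system.
    if i.2 i.1 ⟨n, h⟩ ∈ Set.Ico (j : ℝ) (j + 1) then i.2 i.1 ⟨n, h⟩ else j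
  else j

theorem cellPos_mem (j : ℤ) (i : CellData) (n : ℕ) : cellPos j i n ∈ Set.Ico (j : ℝ) (j + 1) := by
  have hj : (j : ℝ) ∈ Set.Ico (j : ℝ) (j + 1) := ⟨le_rfl, lt_add_one _⟩
  unfold cellPos
  split_ifs with h1 h2
  · exact h2
  · exact hj
  · exact hj

theorem measurable_cellPos (j : ℤ) (n : ℕ) : Measurable fun i => cellPos j i n := by
  refine measurable_from_prod_countable_right fun k => ?_
  unfold cellPos
  by_cases h : n < k
  · simp only [h, dite_true]
    have hm : Measurable fun r : (k : ℕ) → Fin k → ℝ => r k ⟨n, h⟩ := by fun_prop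
    exact Measurable.ite (hm measurableSet_Ico) hm measurable_const
  · simp only [h, dite_false]
    exact measurable_const

variable {θ : ℤ → Ω → ℕ} {ρ : ℤ → (k : ℕ) → Ω → Fin k → ℝ} {η : ℤ × ℕ → ℝ≥0 → Ω → ℝ}

/-- The initial data of the cell `[j, j + 1)`. -/
def cellInit (θ : ℤ → Ω → ℕ) (ρ : ℤ → (k : ℕ) → Ω → Fin k → ℝ) (j : ℤ) (ω : Ω) : CellData :=
  (θ j ω, fun k => ρ j k ω)

/-- All data of the cell `[j, j + 1)`. -/
noncomputable def cellAll (θ : ℤ → Ω → ℕ) (ρ : ℤ → (k : ℕ) → Ω → Fin k → ℝ)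
    (η : ℤ × ℕ → ℝ≥0 → Ω → ℝ) (j : ℤ) (ω : Ω) : CellData × (ℕ → ℕ × ℕ → ℝ) :=
  (cellInit θ ρ j ω, fun n => codedPath (η (j, n)) ω)

theorem IsQuasiHomogeneous.measurable_cellInit (h : IsQuasiHomogeneous θ ρ P) (j : ℤ) :
    Measurable (cellInit θ ρ j) :=
  (h.measurable_number j).prodMk (measurable_pi_iff.2 fun k => h.measurable_position j k)

theorem IsQuasiHomogeneous.cellPos_cellInit (h : IsQuasiHomogeneous θ ρ P) (j : ℤ) (ω : Ω)
    (n : Fin (θ j ω)) : cellPos j (cellInit θ ρ j ω) n = ρ j (θ j ω) ω n := by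
  have h1 : (n : ℕ) < (cellInit θ ρ j ω).1 := n.2
  rw [cellPos, dif_pos h1, if_pos]
  · rfl
  · exact h.position_mem j (θ j ω) ω n

theorem IsQuasiHomogeneous.integral_number_pow (h : IsQuasiHomogeneous θ ρ P) (j : ℤ) (p : ℕ) :
    ∫ i, (i.1 : ℝ) ^ p ∂(P.map (cellInit θ ρ j)) = ∫ ω, (θ 0 ω : ℝ) ^ p ∂P := by
  have hm : Measurable fun k : ℕ => (k : ℝ) ^ p := by fun_prop
  rw [integral_map (h.measurable_cellInit j).aemeasurable
    (Measurable.aestronglyMeasurable (by fun_prop))]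
  exact ((h.identDistrib j).comp hm).integral_eq

theorem IsQuasiHomogeneous.isCellLaw (h : IsQuasiHomogeneous θ ρ P) (j : ℤ) :
    IsCellLaw (fun i : CellData => i.1) (cellPos j) j (P.map (cellInit θ ρ j)) := by
  have hm := h.measurable_cellInit j
  refine ⟨Measure.isProbabilityMeasure_map hm.aemeasurable, measurable_fst, measurable_cellPos j,
    fun i n _ => cellPos_mem j i n, ?_⟩
  have hc : Measurable fun k : ℕ => (k : ℝ) ^ 3 := by fun_prop
  rw [integrable_map_measure (Measurable.aestronglyMeasurable (by fun_prop)) hm.aemeasurable]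
  exact ((h.identDistrib j).comp hc).integrable_iff.2 h.integrable_cube

theorem IsQuasiHomogeneous.variance_number (h : IsQuasiHomogeneous θ ρ P) (j : ℤ) :
    variance (fun i : CellData => (i.1 : ℝ)) (P.map (cellInit θ ρ j)) =
      variance (fun ω => (θ 0 ω : ℝ)) P := by
  have hc : Measurable fun k : ℕ => (k : ℝ) := by fun_prop
  rw [variance_map (Measurable.aemeasurable (by fun_prop)) (h.measurable_cellInit j).aemeasurable]
  exact ((h.identDistrib j).comp hc).variance_eq

theorem IsStableSystem.measurable_cellAll (h : IsStableSystem α θ ρ η P) (j : ℤ) :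
    Measurable (cellAll θ ρ η j) :=
  (h.initial.measurable_cellInit j).prodMk
    (measurable_pi_iff.2 fun n => measurable_codedPath (h.motion (j, n)).measurable)

theorem measurable_pathCode : Measurable pathCode :=
  measurable_pi_iff.2 fun _ => measurable_pi_apply _

/-- The initial data of the cells are independent by assumption, the motions are independent when
grouped by cell, and the two families are independent of each other. -/
theorem IsStableSystem.iIndepFun_cellAll (h : IsStableSystem α θ ρ η P) :
    iIndepFun (cellAll θ ρ η) P := by
  have hX : iIndepFun (fun i : ℤ × ℕ => codedPath (η i)) P :=
    h.indep_motion.comp (fun _ => pathCode) fun _ => measurable_pathCode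
  have hXm (i : ℤ × ℕ) := measurable_codedPath (h.motion i).measurable
  refine iIndepFun_prodMk h.initial.measurable_cellInit
    (fun j => measurable_pi_iff.2 fun n => hXm (j, n)) h.initial.indep (iIndepFun_curry hXm hX) ?_
  exact h.indep_initial.comp measurable_id
    (ψ := fun (c : ℤ × ℕ → ℝ≥0 → ℝ) (j : ℤ) (n : ℕ) => pathCode (c (j, n)))
    (measurable_pi_iff.2 fun j => measurable_pi_iff.2 fun n =>
      measurable_pathCode.comp (measurable_pi_apply (j, n)))

theorem IsStableSystem.map_cellAll (h : IsStableSystem α θ ρ η P) (j : ℤ) :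
    P.map (cellAll θ ρ η j) = (P.map (cellInit θ ρ j)).prod
      (Measure.infinitePi fun n => P.map (codedPath (η (j, n)))) := by
  have hX : iIndepFun (fun i : ℤ × ℕ => codedPath (η i)) P :=
    h.indep_motion.comp (fun _ => pathCode) fun _ => measurable_pathCode
  have hXm (i : ℤ × ℕ) := measurable_codedPath (h.motion i).measurable
  have hrow := (hX.precomp (g := fun n => (j, n)) (Prod.mk_right_injective j)).map_fun_eq_infinitePi_map
    fun n => hXm (j, n)
  have hind : IndepFun (cellInit θ ρ j) (fun ω n => codedPath (η (j, n)) ω) P :=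
    h.indep_initial.comp (measurable_pi_apply j)
      (ψ := fun (c : ℤ × ℕ → ℝ≥0 → ℝ) (n : ℕ) => pathCode (c (j, n)))
      (measurable_pi_iff.2 fun n => measurable_pathCode.comp (measurable_pi_apply (j, n)))
  rw [← hrow, ← (indepFun_iff_map_prod_eq_prod_map_map
    (h.initial.measurable_cellInit j).aemeasurable
    (measurable_pi_iff.2 fun n => hXm (j, n)).aemeasurable).1 hind]
  rfl

end

/-! ### Occupation times of the particles of a cell -/

theorem hasSum_integral_cell {f : ℝ → ℝ} (hf : Integrable f) :
    HasSum (fun j : ℤ => ∫ x in Set.Ico (j : ℝ) (j + 1), f x) (∫ x, f x) := by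
  have := hasSum_integral_iUnion (μ := volume) (f := f) (fun j : ℤ => measurableSet_Ico)
    (Set.pairwise_disjoint_Ico_intCast ℝ) (by rw [iUnion_Ico_intCast]; exact hf.integrableOn)
  rwa [iUnion_Ico_intCast, setIntegral_univ] at this

/-- Two points of a cell are at distance at most one, so the value at one point is at most three
times the mean over the cell. This turns sums over cells into integrals. -/
theorem IsStableKernel.meanWeight_le_integral_cell {α : ℝ} {ν : Kernel ℝ ℝ}
    (hν : IsStableKernel α ν) (S : ℝ) {j : ℤ} {x : ℝ} (hx : x ∈ Set.Ico (j : ℝ) (j + 1)) :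
    meanWeight ν S x ≤ 3 * ∫ y in Set.Ico (j : ℝ) (j + 1), meanWeight ν S y := by
  have hv : volume.real (Set.Ico (j : ℝ) (j + 1)) = 1 := by simp [Measure.real]
  have h1 : ∫ _ in Set.Ico (j : ℝ) (j + 1), meanWeight ν S x = meanWeight ν S x := by
    rw [setIntegral_const, hv, one_smul]
  rw [← integral_const_mul, ← h1]
  refine setIntegral_mono_on (by simp) ((integrable_meanWeight hν S).const_mul 3).integrableOn
    measurableSet_Ico fun y hy => ?_
  refine meanWeight_le_three_mul hν S (abs_le.2 ⟨?_, ?_⟩)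
  · linarith [hx.1, hy.2]
  · linarith [hx.2, hy.1]

section

variable {Ω : Type*} [MeasurableSpace Ω] {P : Measure Ω} [IsProbabilityMeasure P] {α : ℝ}
  {θ : ℤ → Ω → ℕ} {ρ : ℤ → (k : ℕ) → Ω → Fin k → ℝ} {η : ℤ × ℕ → ℝ≥0 → Ω → ℝ} {ν : Kernel ℝ ℝ}
  {S K : ℝ} {g : ℝ → ℝ → ℝ}

/-- The total occupation time functional of the particles that start from the cell `[j, j + 1)`. -/
noncomputable def cellOcc (θ : ℤ → Ω → ℕ) (ρ : ℤ → (k : ℕ) → Ω → Fin k → ℝ)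
    (η : ℤ × ℕ → ℝ≥0 → Ω → ℝ) (S : ℝ) (g : ℝ → ℝ → ℝ) (j : ℤ) (ω : Ω) : ℝ :=
  cellSum (fun i : CellData => i.1) (cellPos j) (occ decode S g) (cellAll θ ρ η j ω)

theorem abs_cellOcc_le (hgK : ∀ s x, |g s x| ≤ K * weight x) (j : ℤ) (ω : Ω) :
    |cellOcc θ ρ η S g j ω| ≤ K * cellOcc θ ρ η S (fun _ => weight) j ω := by
  refine (abs_cellSum_le (Z := fun x f => K * occ decode S (fun _ => weight) x f)
    (abs_occ_le measurable_decode hgK) _).trans (le_of_eq ?_)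
  simp only [cellOcc, cellSum, Finset.mul_sum]

theorem cellOcc_weight_nonneg (j : ℤ) (ω : Ω) : 0 ≤ cellOcc θ ρ η S (fun _ => weight) j ω := by
  unfold cellOcc cellSum
  exact Finset.sum_nonneg fun _ _ => occ_weight_nonneg _ _

namespace IsStableSystem

theorem measurable_cellSum_decode (h : IsStableSystem α θ ρ η P)
    (hg : Measurable (Function.uncurry g)) (j : ℤ) :
    Measurable (cellSum (fun i : CellData => i.1) (cellPos j) (occ decode S g)) :=
  (h.initial.isCellLaw j).measurable_cellSum (measurable_occ measurable_decode hg)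

theorem measurable_cellOcc (h : IsStableSystem α θ ρ η P) (hg : Measurable (Function.uncurry g))
    (j : ℤ) : Measurable (cellOcc θ ρ η S g j) :=
  (h.measurable_cellSum_decode hg j).comp (h.measurable_cellAll j)

theorem isProbabilityMeasure_map_codedPath (h : IsStableSystem α θ ρ η P) (j : ℤ) (n : ℕ) :
    IsProbabilityMeasure (P.map (codedPath (η (j, n)))) :=
  Measure.isProbabilityMeasure_map (measurable_codedPath (h.motion (j, n)).measurable).aemeasurable

theorem integral_comp_cellOcc (h : IsStableSystem α θ ρ η P) (hg : Measurable (Function.uncurry g))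
    (j : ℤ) {F : ℝ → ℝ} (hF : Measurable F) :
    ∫ ω, F (cellOcc θ ρ η S g j ω) ∂P =
      ∫ q, F (cellSum (fun i : CellData => i.1) (cellPos j) (occ decode S g) q)
        ∂((P.map (cellInit θ ρ j)).prod (Measure.infinitePi fun n => P.map (codedPath (η (j, n))))) := by
  rw [← h.map_cellAll j, integral_map (h.measurable_cellAll j).aemeasurable]
  · rfl
  · exact (hF.comp (h.measurable_cellSum_decode hg j)).aestronglyMeasurable

theorem integrable_cellOcc_pow (h : IsStableSystem α θ ρ η P) (hS : 0 ≤ S) (hK : 0 ≤ K)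
    (hg : Measurable (Function.uncurry g)) (hgK : ∀ s x, |g s x| ≤ K * weight x) (j : ℤ) {p : ℕ}
    (hp : p ≤ 3) : Integrable (fun ω => cellOcc θ ρ η S g j ω ^ p) P := by
  have := h.isProbabilityMeasure_map_codedPath j
  have := (h.initial.isCellLaw j).integrable_cellSum_pow (Y := occ decode S g)
    (μ := fun n => P.map (codedPath (η (j, n)))) (measurable_occ measurable_decode hg)
    (abs_occ_le_mul measurable_decode hS hK hgK) hp
  rw [← h.map_cellAll j] at this
  exact this.comp_measurable (h.measurable_cellAll j)

theorem variance_cellOcc (h : IsStableSystem α θ ρ η P)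
    (hg : Measurable (Function.uncurry g)) (j : ℤ) : variance (cellOcc θ ρ η S g j) P =
      variance (cellSum (fun i : CellData => i.1) (cellPos j) (occ decode S g))
        ((P.map (cellInit θ ρ j)).prod (Measure.infinitePi fun n => P.map (codedPath (η (j, n))))) := by
  rw [← h.map_cellAll j, variance_map (h.measurable_cellSum_decode hg j).aemeasurable
    (h.measurable_cellAll j).aemeasurable]
  rfl

theorem integral_cellOcc_weight_pow_le (h : IsStableSystem α θ ρ η P) (hν : IsStableKernel α ν)
    (hα : 0 < α) (hS : 0 < S) (j : ℤ) {p : ℕ} (hp : p ≤ 2) :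
    ∫ ω, cellOcc θ ρ η S (fun _ => weight) j ω ^ (p + 1) ∂P ≤ (∫ ω, (θ 0 ω : ℝ) ^ (p + 1) ∂P) *
      (72 * (decayConst α * totalRate α S) ^ p * ∫ x in Set.Ico (j : ℝ) (j + 1), meanWeight ν S x) := by
  have := h.isProbabilityMeasure_map_codedPath j
  have hw : Measurable (Function.uncurry fun _ : ℝ => weight) := measurable_weight.comp measurable_snd
  have hd : 0 ≤ decayConst α * totalRate α S :=
    mul_nonneg (decayConst_pos hα).le (totalRate_nonneg α S)
  rw [h.integral_comp_cellOcc hw j (F := fun x => x ^ (p + 1)) (by fun_prop),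
    ← h.initial.integral_number_pow j (p + 1)]
  refine (h.initial.isCellLaw j).integral_cellSum_pow_le (measurable_occ measurable_decode hw)
    (fun _ _ => occ_weight_nonneg _ _) (B := S) (fun x f => ?_) (by omega) fun n x hx => ?_
  · rw [abs_of_nonneg (occ_weight_nonneg _ _)]
    exact occ_weight_le hS.le x f
  · have hM := (h.motion (j, n)).isMarkovPath hν
    have hm := hν.meanWeight_le_integral_cell S hx
    have hm0 := meanWeight_nonneg ν S x
    -- The one-particle constants for the first, second and third moments are 1, 13 and 24, so 24
    -- covers all three; passing from a point to the cell integral multiplies by 3.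
    refine le_trans (b := 24 * (decayConst α * totalRate α S) ^ p * meanWeight ν S x) ?_ ?_
    · have hp0 : 0 ≤ (decayConst α * totalRate α S) ^ p * meanWeight ν S x := by positivity
      interval_cases p
      · have := hM.integral_occ_weight hν S x
        simp only [zero_add, pow_one, pow_zero] at hp0 ⊢
        linarith
      · have := hM.integral_occ_weight_sq_le hν hα hS x
        simp only [pow_one] at hp0
        norm_num at this ⊢
        linarith
      · exact hM.integral_occ_weight_cube_le hν hα S x
    · have hc : 0 ≤ 24 * (decayConst α * totalRate α S) ^ p := by positivity
      calc _ ≤ 24 * (decayConst α * totalRate α S) ^ p *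
            (3 * ∫ y in Set.Ico (j : ℝ) (j + 1), meanWeight ν S y) :=
            mul_le_mul_of_nonneg_left hm hc
        _ = _ := by ring

theorem summable_integral_cellOcc_weight_pow (h : IsStableSystem α θ ρ η P)
    (hν : IsStableKernel α ν) (hα : 0 < α) (hS : 0 < S) {p : ℕ} (hp : p ≤ 2) :
    Summable (fun j => ∫ ω, cellOcc θ ρ η S (fun _ => weight) j ω ^ (p + 1) ∂P) ∧
    ∑' j, ∫ ω, cellOcc θ ρ η S (fun _ => weight) j ω ^ (p + 1) ∂P ≤
      (∫ ω, (θ 0 ω : ℝ) ^ (p + 1) ∂P) *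
        (72 * (decayConst α * totalRate α S) ^ p * (S * Real.pi)) := by
  have hs := (((hasSum_integral_cell (integrable_meanWeight hν S)).mul_left
    (72 * (decayConst α * totalRate α S) ^ p)).mul_left (∫ ω, (θ 0 ω : ℝ) ^ (p + 1) ∂P))
  rw [integral_meanWeight hν hS.le] at hs
  have hle := fun j => h.integral_cellOcc_weight_pow_le hν hα hS j hp
  have hsum := Summable.of_nonneg_of_le
    (fun j => integral_nonneg fun ω => pow_nonneg (cellOcc_weight_nonneg j ω) _) hle hs.summable
  exact ⟨hsum, hs.tsum_eq ▸ hsum.tsum_le_tsum hle hs.summable⟩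

theorem ae_summable_cellOcc_weight (h : IsStableSystem α θ ρ η P)
    (hν : IsStableKernel α ν) (hα : 0 < α) (hS : 0 < S) :
    ∀ᵐ ω ∂P, Summable fun j => cellOcc θ ρ η S (fun _ => weight) j ω := by
  have hw : Measurable (Function.uncurry fun _ : ℝ => weight) := measurable_weight.comp measurable_snd
  have hs := (h.summable_integral_cellOcc_weight_pow hν hα hS (p := 0) (by norm_num)).1
  simp only [zero_add, pow_one] at hs
  have hi (j : ℤ) : Integrable (cellOcc θ ρ η S (fun _ => weight) j) P := by
    have := h.integrable_cellOcc_pow hS.le zero_le_one hw (fun s x => by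
      rw [one_mul, abs_of_pos (weight_pos x)]) j (p := 1) (by norm_num)
    simpa using this
  have hfin : ∫⁻ ω, ∑' j, ENNReal.ofReal (cellOcc θ ρ η S (fun _ => weight) j ω) ∂P ≠ ∞ := by
    rw [lintegral_tsum fun j => (h.measurable_cellOcc hw j).ennreal_ofReal.aemeasurable]
    simp_rw [← fun j => ofReal_integral_eq_lintegral_ofReal (hi j)
      (Eventually.of_forall (cellOcc_weight_nonneg j))]
    exact hs.tsum_ofReal_ne_top
  filter_upwards [ae_lt_top' (AEMeasurable.tsum fun j =>
    (h.measurable_cellOcc hw j).ennreal_ofReal.aemeasurable) hfin] with ω hω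
  have := ENNReal.summable_toReal hω.ne
  simpa only [ENNReal.toReal_ofReal (cellOcc_weight_nonneg _ ω)] using this

theorem integral_cellOcc_sq_le (h : IsStableSystem α θ ρ η P) (hS : 0 ≤ S) (hK : 0 ≤ K)
    (hg : Measurable (Function.uncurry g)) (hgK : ∀ s x, |g s x| ≤ K * weight x) (j : ℤ) :
    ∫ ω, cellOcc θ ρ η S g j ω ^ 2 ∂P ≤
      K ^ 2 * ∫ ω, cellOcc θ ρ η S (fun _ => weight) j ω ^ 2 ∂P := by
  have hw : Measurable (Function.uncurry fun _ : ℝ => weight) := measurable_weight.comp measurable_snd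
  rw [← integral_const_mul]
  refine integral_mono (h.integrable_cellOcc_pow hS hK hg hgK j (by norm_num))
    ((h.integrable_cellOcc_pow hS zero_le_one hw (fun s x => by
      rw [one_mul, abs_of_pos (weight_pos x)]) j (by norm_num)).const_mul _) fun ω => ?_
  have := abs_cellOcc_le (θ := θ) (ρ := ρ) (η := η) (S := S) hgK j ω
  rw [← sq_abs, ← mul_pow]
  exact pow_le_pow_left₀ (abs_nonneg _) this 2

theorem summable_variance_cellOcc (h : IsStableSystem α θ ρ η P)
    (hν : IsStableKernel α ν) (hα : 0 < α) (hS : 0 < S) (hK : 0 ≤ K)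
    (hg : Measurable (Function.uncurry g)) (hgK : ∀ s x, |g s x| ≤ K * weight x) :
    Summable (fun j => variance (cellOcc θ ρ η S g j) P) ∧
    ∑' j, variance (cellOcc θ ρ η S g j) P ≤ K ^ 2 * ((∫ ω, (θ 0 ω : ℝ) ^ 2 ∂P) *
        (72 * (decayConst α * totalRate α S) * (S * Real.pi))) := by
  obtain ⟨h1, h2⟩ := h.summable_integral_cellOcc_weight_pow hν hα hS (p := 1) (by norm_num)
  simp only [Nat.reduceAdd, pow_one] at h1 h2
  have hle (j : ℤ) : variance (cellOcc θ ρ η S g j) P ≤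
      K ^ 2 * ∫ ω, cellOcc θ ρ η S (fun _ => weight) j ω ^ 2 ∂P := by
    refine (variance_le_expectation_sq ?_).trans (h.integral_cellOcc_sq_le hS.le hK hg hgK j)
    exact (h.measurable_cellOcc hg j).aestronglyMeasurable
  have hs := Summable.of_nonneg_of_le (fun j => variance_nonneg _ _) hle (h1.mul_left _)
  refine ⟨hs, (hs.tsum_le_tsum hle (h1.mul_left _)).trans ?_⟩
  rw [tsum_mul_left]
  exact mul_le_mul_of_nonneg_left h2 (sq_nonneg K)

/-- The leading term of the variance of the total occupation time. -/
noncomputable def mainVar (ν : Kernel ℝ ℝ) (m v S : ℝ) (g : ℝ → ℝ → ℝ) : ℝ :=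
  m * ((∫ x, occSq ν S g x) - ∫ x, occMean ν S g x ^ 2) + v * ∫ x, occMean ν S g x ^ 2

/-- On the cell `j` the variance differs from `f x` by at most a multiple of `ε j`, for every `x` in
the cell, and so also from the cell integral of `f`. The `ε j` sum to at most a multiple of `U`,
which leaves a total error of order `U²`, negligible against `F_T²`. -/
theorem exists_abs_tsum_variance_sub_le (h : IsStableSystem α θ ρ η P)
    (hν : IsStableKernel α ν) (hα : 0 < α) : ∃ C, 0 ≤ C ∧ ∀ (S K : ℝ) (g : ℝ → ℝ → ℝ), 0 < S → 0 < K →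
      Measurable (Function.uncurry g) → (∀ s x, |g s x| ≤ K * weight x) →
      |∑' j, variance (cellOcc θ ρ η S g j) P -
        mainVar ν (∫ ω, (θ 0 ω : ℝ) ∂P) (variance (fun ω => (θ 0 ω : ℝ)) P) S g| ≤
      C * K ^ 2 * totalRate α S ^ 2 := by
  obtain ⟨C, hC, hosc⟩ := hν.exists_oscillation_occ hα
  set d := decayConst α with hd
  have hd0 : 0 < d := decayConst_pos hα
  set m := ∫ ω, (θ 0 ω : ℝ) ∂P with hm
  set m2 := ∫ ω, (θ 0 ω : ℝ) ^ 2 ∂P with hm2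
  set v := variance (fun ω => (θ 0 ω : ℝ)) P with hv
  have hm0 : 0 ≤ m := integral_nonneg fun ω => Nat.cast_nonneg _
  have hm20 : 0 ≤ m2 := integral_nonneg fun ω => by positivity
  refine ⟨(m * (6 * d) + m2 * (4 * d + 2 * C)) * C, by positivity, fun S K g hS hK hg hgK => ?_⟩
  obtain ⟨ε, hε0, hεs, hεC, hε⟩ := hosc S
  set U := totalRate α S with hU
  have hU0 : 0 ≤ U := totalRate_nonneg α S
  have hεle (j : ℤ) : ε j ≤ C * U := (hεs.le_tsum j fun i _ => hε0 i).trans hεC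
  set f : ℝ → ℝ := fun x => m * (occSq ν S g x - occMean ν S g x ^ 2) + v * occMean ν S g x ^ 2 with hf
  have hi1 := integrable_occSq hν hK.le hg hgK (S := S)
  have hi2 := integrable_sq_occMean hν hα hg hgK (S := S)
  have hi3 : Integrable fun x => occSq ν S g x - occMean ν S g x ^ 2 := hi1.sub hi2
  have hfi : Integrable f := (hi3.const_mul m).add (hi2.const_mul v)
  have hfm : ∫ x, f x = mainVar ν m v S g := by
    rw [mainVar, hf, integral_add (hi3.const_mul m) (hi2.const_mul v), integral_const_mul,
      integral_const_mul, integral_sub hi1 hi2]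
  have hfs := hasSum_integral_cell hfi
  have hVs := (h.summable_variance_cellOcc hν hα hS hK.le hg hgK).1
  set c := K ^ 2 * U * (m * (6 * d) + m2 * (4 * d + 2 * C)) with hc
  have hc0 : 0 ≤ c := by positivity
  have hcell (j : ℤ) : |variance (cellOcc θ ρ η S g j) P - ∫ x in Set.Ico (j : ℝ) (j + 1), f x| ≤
      c * ε j := by
    have := h.isProbabilityMeasure_map_codedPath j
    have hM (n : ℕ) := (h.motion (j, n)).isMarkovPath hν
    have hpt (x : ℝ) (hx : x ∈ Set.Ico (j : ℝ) (j + 1)) :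
        |variance (cellOcc θ ρ η S g j) P - f x| ≤ c * ε j := by
      have h1 := (h.initial.isCellLaw j).abs_variance_cellSum_sub_le (Y := occ decode S g)
        (μ := fun n => P.map (codedPath (η (j, n)))) (measurable_occ measurable_decode hg)
        (abs_occ_le_mul measurable_decode hS.le hK.le hgK)
        (fun n x => (hM n).integral_occ hν hK.le hg hgK x)
        (fun n x => (hM n).integral_occ_sq hν hK.le hg hgK x)
        (fun x hx y hy => (hε K g hK hg hgK j x hx y hy).1)
        (fun x hx y hy => (hε K g hK hg hgK j x hx y hy).2) (M := K * (d * U))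
        (fun x => (abs_occMean_le hν hgK x).trans
          (mul_le_mul_of_nonneg_left (meanWeight_le hν hα S x) hK.le)) hx
      have e1 := h.initial.integral_number_pow j 1
      simp only [pow_one] at e1
      rw [← h.variance_cellOcc hg j, e1, h.initial.integral_number_pow j 2,
        h.initial.variance_number j, ← hm, ← hm2, ← hv] at h1
      refine h1.trans ?_
      -- The term quadratic in `ε j` is made linear by `ε j ≤ C U`, so that only the sum of the `ε
      -- j` is needed.
      have h2 : 2 * (K * ε j) ^ 2 ≤ K ^ 2 * (2 * (C * U) * ε j) := by
        nlinarith [mul_le_mul_of_nonneg_left (hεle j) (mul_nonneg (sq_nonneg K) (hε0 j))]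
      calc _ ≤ m * (K ^ 2 * (4 * d * U) * ε j + 2 * (K * (d * U)) * (K * ε j)) +
            m2 * (4 * (K * (d * U)) * (K * ε j) + K ^ 2 * (2 * (C * U) * ε j)) := by gcongr
        _ = c * ε j := by rw [hc]; ring
    have hv1 : volume.real (Set.Ico (j : ℝ) (j + 1)) = 1 := by simp [Measure.real]
    have e : variance (cellOcc θ ρ η S g j) P - ∫ x in Set.Ico (j : ℝ) (j + 1), f x =
        ∫ x in Set.Ico (j : ℝ) (j + 1), (variance (cellOcc θ ρ η S g j) P - f x) := by
      rw [integral_sub (by simp) hfi.integrableOn, setIntegral_const, hv1, one_smul]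
    rw [e]
    have := norm_setIntegral_le_of_norm_le_const (μ := volume) (s := Set.Ico (j : ℝ) (j + 1))
      (f := fun x => variance (cellOcc θ ρ η S g j) P - f x)
      (by simp) hpt
    rwa [hv1, mul_one] at this
  rw [← hfm, ← hfs.tsum_eq, ← hVs.tsum_sub hfs.summable]
  have hb := tsum_of_norm_bounded (f := fun j : ℤ => variance (cellOcc θ ρ η S g j) P -
    ∫ x in Set.Ico (j : ℝ) (j + 1), f x) (hεs.mul_left c).hasSum hcell
  rw [Real.norm_eq_abs, tsum_mul_left] at hb
  refine hb.trans ((mul_le_mul_of_nonneg_left hεC hc0).trans (le_of_eq ?_))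
  rw [hc]; ring

end IsStableSystem

end

/-! ### The centered occupation time of the whole system. -/

section

variable {Ω : Type*} [MeasurableSpace Ω] {P : Measure Ω} [IsProbabilityMeasure P]

/-- Convexity gives `|x - m|³ ≤ 4(|x|³ + |m|³)`, and Jensen's inequality bounds `|m|³` by the third
absolute moment. -/
theorem integral_abs_sub_mean_cube_le {X : Ω → ℝ} (hX : AEMeasurable X P)
    (h3 : Integrable (fun ω => |X ω| ^ 3) P) :
    Integrable (fun ω => |X ω - ∫ ω', X ω' ∂P| ^ 3) P ∧
    ∫ ω, |X ω - ∫ ω', X ω' ∂P| ^ 3 ∂P ≤ 8 * ∫ ω, |X ω| ^ 3 ∂P := by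
  have h1 : Integrable X P := by simpa using integrable_pow_of_cube hX h3 (p := 1) (by norm_num)
  set m := ∫ ω', X ω' ∂P with hm
  have hm3 : |m| ^ 3 ≤ ∫ ω, |X ω| ^ 3 ∂P := by
    refine (pow_le_pow_left₀ (abs_nonneg _) (abs_integral_le_integral_abs (f := X)) 3).trans ?_
    exact (convexOn_pow 3).map_integral_le (by fun_prop) isClosed_Ici
      (Eventually.of_forall fun ω => abs_nonneg (X ω)) h1.abs h3
  have hpt (ω : Ω) : |X ω - m| ^ 3 ≤ 4 * (|X ω| ^ 3 + |m| ^ 3) := by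
    have ha := abs_nonneg (X ω)
    have hb := abs_nonneg m
    refine (pow_le_pow_left₀ (abs_nonneg _) (abs_sub _ _) 3).trans ?_
    nlinarith [mul_nonneg (add_nonneg ha hb) (sq_nonneg (|X ω| - |m|))]
  have hi : Integrable (fun ω => 4 * (|X ω| ^ 3 + |m| ^ 3)) P :=
    (h3.add (integrable_const _)).const_mul 4
  have hj : Integrable (fun ω => |X ω - m| ^ 3) P := by
    refine hi.mono' ?_ (Eventually.of_forall fun ω => ?_)
    · exact (((hX.sub_const m).abs).pow_const 3).aestronglyMeasurable
    · rw [Real.norm_eq_abs, abs_of_nonneg (by positivity)]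
      exact hpt ω
  refine ⟨hj, (integral_mono hj hi hpt).trans ?_⟩
  rw [integral_const_mul, integral_add h3 (integrable_const _)]
  simp only [integral_const, probReal_univ, one_smul]
  linarith

/-- Fatou's lemma along a sequence of finite index sets exhausting the series. -/
theorem lintegral_sq_series_le {ι : Type*} [Countable ι] {ζ : ι → Ω → ℝ} {Z : Ω → ℝ}
    (hL : ∀ j, MemLp (ζ j) 2 P) (hind : iIndepFun ζ P) (h0 : ∀ j, ∫ ω, ζ j ω ∂P = 0)
    (hV : Summable fun j => variance (ζ j) P)
    (hZ : ∀ᵐ ω ∂P, HasSum (fun j => ζ j ω) (Z ω)) :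
    ∫⁻ ω, ENNReal.ofReal (Z ω ^ 2) ∂P ≤ ENNReal.ofReal (∑' j, variance (ζ j) P) := by
  obtain ⟨s, hs⟩ := exists_seq_tendsto (atTop : Filter (Finset ι))
  have hpart (n : ℕ) : ∫⁻ ω, ENNReal.ofReal ((∑ j ∈ s n, ζ j ω) ^ 2) ∂P ≤
      ENNReal.ofReal (∑' j, variance (ζ j) P) := by
    have hM : MemLp (fun ω => ∑ j ∈ s n, ζ j ω) 2 P := memLp_finsetSum _ fun j _ => hL j
    rw [← ofReal_integral_eq_lintegral_ofReal hM.integrable_sq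
      (Eventually.of_forall fun ω => sq_nonneg _)]
    refine ENNReal.ofReal_le_ofReal ?_
    have hmean : ∫ ω, ∑ j ∈ s n, ζ j ω ∂P = 0 := by
      rw [integral_finsetSum _ fun j _ => (hL j).integrable one_le_two]
      exact Finset.sum_eq_zero fun j _ => h0 j
    have hv := IndepFun.variance_sum (s := s n) (fun j _ => hL j)
      (fun i _ j _ hij => hind.indepFun hij)
    have hsum : (∑ j ∈ s n, ζ j) = fun ω => ∑ j ∈ s n, ζ j ω := by funext; simp
    rw [hsum, variance_of_integral_eq_zero hM.aemeasurable hmean] at hv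
    rw [hv]
    exact hV.sum_le_tsum _ fun j _ => variance_nonneg _ _
  calc ∫⁻ ω, ENNReal.ofReal (Z ω ^ 2) ∂P
      = ∫⁻ ω, liminf (fun n => ENNReal.ofReal ((∑ j ∈ s n, ζ j ω) ^ 2)) atTop ∂P := by
        refine lintegral_congr_ae ?_
        filter_upwards [hZ] with ω hω
        have : Tendsto (fun n => ∑ j ∈ s n, ζ j ω) atTop (𝓝 (Z ω)) := hω.comp hs
        exact ((ENNReal.continuous_ofReal.tendsto _).comp (this.pow 2)).liminf_eq.symm
    _ ≤ liminf (fun n => ∫⁻ ω, ENNReal.ofReal ((∑ j ∈ s n, ζ j ω) ^ 2) ∂P) atTop :=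
        lintegral_liminf_le' fun n => ((Finset.aemeasurable_fun_sum _
          fun j _ => (hL j).aemeasurable).pow_const 2).ennreal_ofReal
    _ ≤ _ := by
        refine liminf_le_of_frequently_le' (Frequently.of_forall hpart)

variable {α : ℝ}
  {θ : ℤ → Ω → ℕ} {ρ : ℤ → (k : ℕ) → Ω → Fin k → ℝ} {η : ℤ × ℕ → ℝ≥0 → Ω → ℝ} {ν : Kernel ℝ ℝ}
  {S K : ℝ} {g : ℝ → ℝ → ℝ}

/-- The centered occupation time of the whole system. -/
noncomputable def totalFluct (θ : ℤ → Ω → ℕ) (ρ : ℤ → (k : ℕ) → Ω → Fin k → ℝ)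
    (η : ℤ × ℕ → ℝ≥0 → Ω → ℝ) (P : Measure Ω) (S : ℝ) (g : ℝ → ℝ → ℝ) (ω : Ω) : ℝ :=
  ∑' j, (cellOcc θ ρ η S g j ω - ∫ ω', cellOcc θ ρ η S g j ω' ∂P)

namespace IsStableSystem

theorem integrable_cellOcc (h : IsStableSystem α θ ρ η P) (hS : 0 ≤ S) (hK : 0 ≤ K)
    (hg : Measurable (Function.uncurry g)) (hgK : ∀ s x, |g s x| ≤ K * weight x) (j : ℤ) :
    Integrable (cellOcc θ ρ η S g j) P := by
  simpa using h.integrable_cellOcc_pow hS hK hg hgK j (p := 1) (by norm_num)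

theorem integrable_cellOcc_weight (h : IsStableSystem α θ ρ η P) (hS : 0 ≤ S) (j : ℤ) {p : ℕ}
    (hp : p ≤ 3) : Integrable (fun ω => cellOcc θ ρ η S (fun _ => weight) j ω ^ p) P :=
  h.integrable_cellOcc_pow hS zero_le_one (g := fun _ => weight)
    (measurable_weight.comp measurable_snd)
    (fun s x => by rw [one_mul, abs_of_pos (weight_pos x)]) j hp

theorem summable_integral_cellOcc (h : IsStableSystem α θ ρ η P) (hν : IsStableKernel α ν)
    (hα : 0 < α) (hS : 0 < S) (hgK : ∀ s x, |g s x| ≤ K * weight x) :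
    Summable fun j => ∫ ω, cellOcc θ ρ η S g j ω ∂P := by
  have hs := (h.summable_integral_cellOcc_weight_pow hν hα hS (p := 0) (by norm_num)).1
  simp only [zero_add, pow_one] at hs
  refine Summable.of_norm_bounded (hs.mul_left K) fun j => ?_
  rw [← integral_const_mul]
  have hw := h.integrable_cellOcc_weight hS.le j (p := 1) (by norm_num)
  simp only [pow_one] at hw
  exact norm_integral_le_of_norm_le (hw.const_mul K) (Eventually.of_forall fun ω =>
    abs_cellOcc_le hgK j ω)

/-- Summability for the weight alone controls every dominated functional, so a single null set
serves all of them; statements about all test functions at once need this. -/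
theorem ae_hasSum_cellOcc (h : IsStableSystem α θ ρ η P) (hν : IsStableKernel α ν)
    (hα : 0 < α) (hS : 0 < S) : ∀ᵐ ω ∂P, ∀ (K : ℝ) (g : ℝ → ℝ → ℝ), 0 ≤ K →
      (∀ s x, |g s x| ≤ K * weight x) → Summable (fun j => cellOcc θ ρ η S g j ω) ∧
      HasSum (fun j => cellOcc θ ρ η S g j ω - ∫ ω', cellOcc θ ρ η S g j ω' ∂P)
        (totalFluct θ ρ η P S g ω) := by
  filter_upwards [h.ae_summable_cellOcc_weight hν hα hS] with ω hω K g hK hgK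
  have h1 : Summable (fun j => cellOcc θ ρ η S g j ω) :=
    Summable.of_norm_bounded (hω.mul_left K) fun j => abs_cellOcc_le hgK j ω
  exact ⟨h1, (h1.sub (h.summable_integral_cellOcc hν hα hS hgK)).hasSum⟩

theorem iIndepFun_centered (h : IsStableSystem α θ ρ η P) (hg : Measurable (Function.uncurry g))
    (c : ℝ) : iIndepFun (fun j ω => c * (cellOcc θ ρ η S g j ω - ∫ ω', cellOcc θ ρ η S g j ω' ∂P)) P :=
  h.iIndepFun_cellAll.comp (fun j q => c * (cellSum (fun i : CellData => i.1) (cellPos j)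
    (occ decode S g) q - ∫ ω', cellOcc θ ρ η S g j ω' ∂P))
    fun j => ((h.measurable_cellSum_decode hg j).sub_const _).const_mul c

theorem integral_centered (h : IsStableSystem α θ ρ η P) (hS : 0 ≤ S) (hK : 0 ≤ K)
    (hg : Measurable (Function.uncurry g)) (hgK : ∀ s x, |g s x| ≤ K * weight x) (c : ℝ) (j : ℤ) :
    ∫ ω, c * (cellOcc θ ρ η S g j ω - ∫ ω', cellOcc θ ρ η S g j ω' ∂P) ∂P = 0 := by
  rw [integral_const_mul, integral_sub (h.integrable_cellOcc hS hK hg hgK j) (integrable_const _)]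
  simp

/-- The Lyapunov bound applied to the cells. The 40 is its constant 5 times the factor 8 lost by
centering third moments. -/
theorem norm_integral_exp_totalFluct_sub_le (h : IsStableSystem α θ ρ η P) (hν : IsStableKernel α ν)
    (hα : 0 < α) (hS : 0 < S) (hK : 0 ≤ K) (hg : Measurable (Function.uncurry g))
    (hgK : ∀ s x, |g s x| ≤ K * weight x) {c : ℝ} (hc : 0 ≤ c) :
    ‖∫ ω, Complex.exp ((c * totalFluct θ ρ η P S g ω : ℝ) * Complex.I) ∂P -
      (Real.exp (-((c ^ 2 * ∑' j, variance (cellOcc θ ρ η S g j) P) / 2)) : ℝ)‖ ≤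
    c ^ 3 * (40 * K ^ 3 * ((∫ ω, (θ 0 ω : ℝ) ^ 3 ∂P) *
        (72 * (decayConst α * totalRate α S) ^ 2 * (S * Real.pi)))) := by
  set ζ : ℤ → Ω → ℝ := fun j ω => c * (cellOcc θ ρ η S g j ω - ∫ ω', cellOcc θ ρ η S g j ω' ∂P) with hζ
  have hm (j : ℤ) : Measurable (ζ j) := ((h.measurable_cellOcc hg j).sub_const _).const_mul c
  have habs3 (j : ℤ) (ω : Ω) : |cellOcc θ ρ η S g j ω| ^ 3 ≤
      K ^ 3 * cellOcc θ ρ η S (fun _ => weight) j ω ^ 3 := by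
    rw [← mul_pow]
    exact pow_le_pow_left₀ (abs_nonneg _) (abs_cellOcc_le hgK j ω) 3
  have hw3 (j : ℤ) := (h.integrable_cellOcc_weight hS.le j (p := 3) le_rfl).const_mul (K ^ 3)
  have hi3 (j : ℤ) : Integrable (fun ω => |cellOcc θ ρ η S g j ω| ^ 3) P := by
    refine (hw3 j).mono' (((h.measurable_cellOcc hg j).abs).pow_const 3).aestronglyMeasurable
      (Eventually.of_forall fun ω => ?_)
    rw [Real.norm_eq_abs, abs_of_nonneg (by positivity)]
    exact habs3 j ω
  have hcen (j : ℤ) := integral_abs_sub_mean_cube_le (h.measurable_cellOcc hg j).aemeasurable (hi3 j)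
  have e3 (j : ℤ) (ω : Ω) : |ζ j ω| ^ 3 =
      c ^ 3 * |cellOcc θ ρ η S g j ω - ∫ ω', cellOcc θ ρ η S g j ω' ∂P| ^ 3 := by
    rw [hζ, abs_mul, abs_of_nonneg hc, mul_pow]
  have hζ3 (j : ℤ) : Integrable (fun ω => |ζ j ω| ^ 3) P := by
    simp_rw [e3]
    exact (hcen j).1.const_mul _
  obtain ⟨hs, hle⟩ := h.summable_integral_cellOcc_weight_pow hν hα hS (p := 2) le_rfl
  simp only [Nat.reduceAdd] at hs hle
  have hζle (j : ℤ) : ∫ ω, |ζ j ω| ^ 3 ∂P ≤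
      c ^ 3 * (8 * K ^ 3) * ∫ ω, cellOcc θ ρ η S (fun _ => weight) j ω ^ 3 ∂P := by
    simp_rw [e3]
    rw [integral_const_mul]
    have h1 := integral_mono (hi3 j) (hw3 j) (habs3 j)
    rw [integral_const_mul] at h1
    have h2 := (hcen j).2
    have hc3 : 0 ≤ c ^ 3 := by positivity
    calc _ ≤ c ^ 3 * (8 * (K ^ 3 * ∫ ω, cellOcc θ ρ η S (fun _ => weight) j ω ^ 3 ∂P)) := by
          gcongr
          linarith
      _ = _ := by ring
  have hLs := Summable.of_nonneg_of_le (fun j => integral_nonneg fun ω => by positivity) hζle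
    (hs.mul_left _)
  have hvar (j : ℤ) : ∫ ω, ζ j ω ^ 2 ∂P = c ^ 2 * variance (cellOcc θ ρ η S g j) P := by
    rw [variance_eq_integral (h.measurable_cellOcc hg j).aemeasurable, ← integral_const_mul]
    exact integral_congr_ae (Eventually.of_forall fun ω => mul_pow _ _ _)
  have hVs := (h.summable_variance_cellOcc hν hα hS hK hg hgK).1
  have hV : HasSum (fun j => ∫ ω, ζ j ω ^ 2 ∂P)
      (c ^ 2 * ∑' j, variance (cellOcc θ ρ η S g j) P) := by
    simp_rw [hvar]
    exact hVs.hasSum.mul_left _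
  have hZ : ∀ᵐ ω ∂P, HasSum (fun j => ζ j ω) (c * totalFluct θ ρ η P S g ω) := by
    filter_upwards [h.ae_hasSum_cellOcc hν hα hS] with ω hω
    exact (hω K g hK hgK).2.mul_left c
  refine (norm_integral_exp_series_sub_le (fun j => (hm j).aemeasurable) (h.iIndepFun_centered hg c)
    hζ3 (h.integral_centered hS.le hK hg hgK c) hV hLs.hasSum hZ).trans ?_
  have h1 := hLs.tsum_le_tsum hζle (hs.mul_left _)
  rw [tsum_mul_left] at h1
  have hcK : 0 ≤ c ^ 3 * (8 * K ^ 3) := by positivity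
  have h2 := mul_le_mul_of_nonneg_left hle hcK
  calc _ ≤ 5 * (c ^ 3 * (8 * K ^ 3) * ((∫ ω, (θ 0 ω : ℝ) ^ 3 ∂P) *
        (72 * (decayConst α * totalRate α S) ^ 2 * (S * Real.pi)))) := by linarith
    _ = _ := by ring

theorem lintegral_sq_totalFluct_le (h : IsStableSystem α θ ρ η P) (hν : IsStableKernel α ν)
    (hα : 0 < α) (hS : 0 < S) (hK : 0 ≤ K) (hg : Measurable (Function.uncurry g))
    (hgK : ∀ s x, |g s x| ≤ K * weight x) :
    ∫⁻ ω, ENNReal.ofReal (totalFluct θ ρ η P S g ω ^ 2) ∂P ≤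
      ENNReal.ofReal (K ^ 2 * ((∫ ω, (θ 0 ω : ℝ) ^ 2 ∂P) *
        (72 * (decayConst α * totalRate α S) * (S * Real.pi)))) := by
  obtain ⟨hVs, hVle⟩ := h.summable_variance_cellOcc hν hα hS hK hg hgK
  have hvar (j : ℤ) : variance (fun ω => 1 * (cellOcc θ ρ η S g j ω -
      ∫ ω', cellOcc θ ρ η S g j ω' ∂P)) P = variance (cellOcc θ ρ η S g j) P := by
    simp only [one_mul]
    exact variance_sub_const (h.measurable_cellOcc hg j).aestronglyMeasurable _
  have hL (j : ℤ) : MemLp (cellOcc θ ρ η S g j) 2 P :=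
    (memLp_two_iff_integrable_sq (h.measurable_cellOcc hg j).aestronglyMeasurable).2
      (h.integrable_cellOcc_pow hS.le hK hg hgK j (by norm_num))
  have := lintegral_sq_series_le (Z := totalFluct θ ρ η P S g)
    (ζ := fun j ω => 1 * (cellOcc θ ρ η S g j ω - ∫ ω', cellOcc θ ρ η S g j ω' ∂P))
    (fun j => ((hL j).sub (memLp_const _)).const_mul 1) (h.iIndepFun_centered hg 1)
    (h.integral_centered hS.le hK hg hgK 1) (by simpa only [hvar] using hVs) (by
      filter_upwards [h.ae_hasSum_cellOcc hν hα hS] with ω hω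
      simpa only [one_mul] using (hω K g hK hgK).2)
  simp only [hvar] at this
  exact this.trans (ENNReal.ofReal_le_ofReal hVle)

end IsStableSystem

end

/-! ### Double primitives -/

/-- The primitive of the even extension of `c`. -/
noncomputable def prim (c : ℝ → ℝ) (x : ℝ) : ℝ := ∫ r in (0)..x, c |r|

/-- The double primitive of the even extension of `c`. -/
noncomputable def doublePrim (c : ℝ → ℝ) (x : ℝ) : ℝ := ∫ s in (0)..x, prim c s

section

variable {c : ℝ → ℝ} {B : ℝ}

theorem intervalIntegrable_of_bounded {f : ℝ → ℝ} (hf : Measurable f) (hB : ∀ r, |f r| ≤ B)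
    (a b : ℝ) : IntervalIntegrable f volume a b :=
  (intervalIntegrable_const (c := B)).mono_fun hf.aestronglyMeasurable
    (Eventually.of_forall fun r => (hB r).trans (le_abs_self B))

theorem intervalIntegrable_comp_abs (hc : Measurable c) (hB : ∀ r, |c r| ≤ B) (a b : ℝ) :
    IntervalIntegrable (fun r => c |r|) volume a b :=
  intervalIntegrable_of_bounded (hc.comp measurable_norm) (fun r => hB |r|) a b

theorem continuous_prim (hc : Measurable c) (hB : ∀ r, |c r| ≤ B) : Continuous (prim c) :=
  intervalIntegral.continuous_primitive (intervalIntegrable_comp_abs hc hB) 0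

theorem prim_neg (c : ℝ → ℝ) (x : ℝ) : prim c (-x) = -prim c x := by
  have := intervalIntegral.integral_comp_neg (a := 0) (b := x) fun r => c |r|
  simp only [abs_neg, neg_zero] at this
  rw [prim, intervalIntegral.integral_symm, ← this, prim]

theorem doublePrim_neg (c : ℝ → ℝ) (x : ℝ) : doublePrim c (-x) = doublePrim c x := by
  have := intervalIntegral.integral_comp_neg (a := 0) (b := x) (prim c)
  rw [neg_zero] at this
  rw [doublePrim, intervalIntegral.integral_symm, ← this, ← intervalIntegral.integral_neg]
  simp only [prim_neg, neg_neg]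
  rfl

theorem doublePrim_abs (c : ℝ → ℝ) (x : ℝ) : doublePrim c |x| = doublePrim c x := by
  rcases abs_choice x with h | h
  · rw [h]
  · rw [h, doublePrim_neg]

theorem integral_prim_eq (hc : Measurable c) (hB : ∀ r, |c r| ≤ B) (a b : ℝ) :
    ∫ s in a..b, prim c s = doublePrim c b - doublePrim c a :=
  (intervalIntegral.integral_interval_sub_left ((continuous_prim hc hB).intervalIntegrable _ _)
    ((continuous_prim hc hB).intervalIntegrable _ _)).symm

theorem integral_comp_abs_eq (hc : Measurable c) (hB : ∀ r, |c r| ≤ B) (a b : ℝ) :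
    ∫ s in a..b, c |s| = prim c b - prim c a :=
  (intervalIntegral.integral_interval_sub_left (intervalIntegrable_comp_abs hc hB _ _)
    (intervalIntegrable_comp_abs hc hB _ _)).symm

/-- The double primitive is even with second derivative the even extension of `c`, so the integral
over a rectangle is a combination of its values at the corners. -/
theorem integral_integral_abs_sub (hc : Measurable c) (hB : ∀ r, |c r| ≤ B) (a b : ℝ) :
    ∫ s in (0)..a, ∫ u in (0)..b, c |s - u| = doublePrim c a + doublePrim c b - doublePrim c (a - b) := by
  have h1 (s : ℝ) : ∫ u in (0)..b, c |s - u| = prim c s - prim c (s - b) := by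
    rw [intervalIntegral.integral_comp_sub_left fun r => c |r|, integral_comp_abs_eq hc hB, sub_zero]
  have hp := continuous_prim hc hB
  have hps : Continuous fun s => prim c (s - b) := by fun_prop
  simp_rw [h1]
  rw [intervalIntegral.integral_sub (hp.intervalIntegrable _ _)
    (hps.intervalIntegrable _ _),
    intervalIntegral.integral_comp_sub_right (prim c), integral_prim_eq hc hB, integral_prim_eq hc hB,
    zero_sub, doublePrim_neg]
  simp [doublePrim]
  ring

theorem integral_integral_abs_add (hc : Measurable c) (hB : ∀ r, |c r| ≤ B) (a b : ℝ) :
    ∫ s in (0)..a, ∫ u in (0)..b, c |s + u| = doublePrim c (a + b) - doublePrim c a - doublePrim c b := by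
  have h1 (s : ℝ) : ∫ u in (0)..b, c |s + u| = prim c (s + b) - prim c s := by
    rw [intervalIntegral.integral_comp_add_left fun r => c |r|, integral_comp_abs_eq hc hB, add_zero]
  have hp := continuous_prim hc hB
  have hps : Continuous fun s => prim c (s + b) := by fun_prop
  simp_rw [h1]
  rw [intervalIntegral.integral_sub (hps.intervalIntegrable _ _)
    (hp.intervalIntegrable _ _),
    intervalIntegral.integral_comp_add_right (prim c), integral_prim_eq hc hB, integral_prim_eq hc hB,
    zero_add]
  simp [doublePrim]
  ring

/-- Rescaling the time variable by `T` turns the double primitive into an integral over the fixed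
interval `[0, a]`, where dominated convergence applies. -/
theorem tendsto_doublePrim (hc : Measurable c) (hB : ∀ r, |c r| ≤ B) {k L : ℝ → ℝ} {a M : ℝ}
    (ha : 0 ≤ a)
    (hL : ∀ s, 0 < s → Tendsto (fun T => T * k T * prim c (T * s)) atTop (𝓝 (L s)))
    (hM : ∀ᶠ T in atTop, ∀ s ∈ Set.Ioc 0 a, |T * k T * prim c (T * s)| ≤ M) :
    Tendsto (fun T => k T * doublePrim c (T * a)) atTop (𝓝 (∫ s in (0)..a, L s)) := by
  have hp := continuous_prim hc hB
  have e (T : ℝ) : k T * doublePrim c (T * a) = ∫ s in (0)..a, T * k T * prim c (T * s) := by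
    rw [intervalIntegral.integral_const_mul, mul_comm T (k T), mul_assoc,
      intervalIntegral.mul_integral_comp_mul_left, mul_zero, doublePrim]
  simp_rw [e]
  refine intervalIntegral.tendsto_integral_filter_of_dominated_convergence (fun _ => M)
    (Eventually.of_forall fun T => ?_) ?_ intervalIntegrable_const ?_
  · exact (Continuous.aestronglyMeasurable (by fun_prop))
  · filter_upwards [hM] with T hT
    refine Eventually.of_forall fun s hs => hT s ?_
    rwa [Set.uIoc_of_le ha] at hs
  · refine Eventually.of_forall fun s hs => hL s ?_
    rw [Set.uIoc_of_le ha] at hs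
    exact hs.1

theorem abs_prim_le {α C : ℝ} (hcr : ∀ r, |c r| ≤ C * rate α r) {x : ℝ}
    (hx : 0 ≤ x) : |prim c x| ≤ C * totalRate α x := by
  rw [prim, totalRate, intervalIntegral.integral_of_le hx, ← integral_const_mul]
  refine norm_integral_le_of_norm_le (f := fun r => c |r|) (Integrable.const_mul (integrableOn_rate x) C) ?_
  filter_upwards [ae_restrict_mem measurableSet_Ioc] with r hr
  rw [abs_of_pos hr.1]
  exact hcr r

theorem totalRate_mono (α : ℝ) : Monotone (totalRate α) := fun _ y hxy =>
  setIntegral_mono_set (integrableOn_rate y)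
    (Eventually.of_forall fun s => (rate_pos α s).le) (Set.Ioc_subset_Ioc_right hxy).eventuallyLE

/-- With `r = xv` the primitive becomes an integral over `[0, 1]` whose integrand tends to `L
v^(-β)` and is dominated by `C v^(-β)`, integrable as `β < 1`. -/
theorem tendsto_prim_of_lt_one (hc : Measurable c) {β C L : ℝ} (hβ : β < 1)
    (hcr : ∀ r, 0 < r → |c r| ≤ C * r ^ (-β))
    (hL : Tendsto (fun r => r ^ β * c r) atTop (𝓝 L)) :
    Tendsto (fun x => x ^ (β - 1) * prim c x) atTop (𝓝 (L / (1 - β))) := by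
  have e : ∀ᶠ x : ℝ in atTop, ∫ v in (0)..1, x ^ β * c |x * v| = x ^ (β - 1) * prim c x := by
    filter_upwards [eventually_gt_atTop 0] with x hx
    rw [intervalIntegral.integral_const_mul, Real.rpow_sub_one hx.ne', div_eq_mul_inv, mul_assoc,
      intervalIntegral.integral_comp_mul_left (fun r => c |r|) hx.ne', mul_zero, mul_one, smul_eq_mul,
      prim]
  have hlim : ∫ v in (0 : ℝ)..1, L * v ^ (-β) = L / (1 - β) := by
    rw [intervalIntegral.integral_const_mul, integral_rpow (Or.inl (by linarith)), Real.one_rpow,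
      Real.zero_rpow (by linarith)]
    rw [neg_add_eq_sub, sub_zero, mul_one_div]
  rw [← hlim]
  refine Tendsto.congr' e ?_
  refine intervalIntegral.tendsto_integral_filter_of_dominated_convergence (fun v => C * v ^ (-β))
    (Eventually.of_forall fun x => Measurable.aestronglyMeasurable (by fun_prop)) ?_ ?_ ?_
  · filter_upwards [eventually_gt_atTop 0] with x hx
    refine Eventually.of_forall fun v hv => ?_
    rw [Set.uIoc_of_le zero_le_one] at hv
    have hxv : 0 < x * v := mul_pos hx hv.1
    rw [Real.norm_eq_abs, abs_mul, abs_of_pos (Real.rpow_pos_of_pos hx β), abs_of_pos hxv]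
    refine (mul_le_mul_of_nonneg_left (hcr _ hxv) (Real.rpow_pos_of_pos hx β).le).trans (le_of_eq ?_)
    rw [Real.mul_rpow hx.le hv.1.le, Real.rpow_neg hx.le]
    field_simp [(Real.rpow_pos_of_pos hx β).ne']
  · exact (intervalIntegral.intervalIntegrable_rpow' (by linarith)).const_mul C
  · refine Eventually.of_forall fun v hv => ?_
    rw [Set.uIoc_of_le zero_le_one] at hv
    have h1 : Tendsto (fun x : ℝ => x * v) atTop atTop := tendsto_id.atTop_mul_const hv.1
    have h2 := (hL.comp h1).mul_const (v ^ (-β))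
    refine h2.congr' ?_
    filter_upwards [eventually_gt_atTop 0] with x hx
    rw [abs_of_pos (mul_pos hx hv.1), Function.comp_apply, Real.mul_rpow hx.le hv.1.le,
      Real.rpow_neg hv.1.le]
    field_simp [(Real.rpow_pos_of_pos hv.1 β).ne']

theorem image_exp_mul_Ioc {l : ℝ} (hl : 0 < l) :
    (fun w => Real.exp (w * l)) '' Set.Ioc 0 1 = Set.Ioc 1 (Real.exp l) := by
  ext y
  constructor
  · rintro ⟨w, ⟨h0, h1⟩, rfl⟩
    exact ⟨Real.one_lt_exp_iff.2 (mul_pos h0 hl),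
      Real.exp_le_exp.2 (mul_le_of_le_one_left hl.le h1)⟩
  · rintro ⟨h1, h2⟩
    have hy : 0 < y := by linarith
    refine ⟨Real.log y / l, ⟨div_pos (Real.log_pos h1) hl, ?_⟩, ?_⟩
    · rw [div_le_one hl, ← Real.log_exp l]
      exact Real.log_le_log hy h2
    · simp only
      rw [div_mul_cancel₀ _ hl.ne', Real.exp_log hy]

/-- The substitution `r = x^w` turns `(log x)⁻¹ ∫_1^x c(r) dr` into the integral of `r c(r)` over `w
∈ [0, 1]`; this integrand is bounded by `C` and tends to `L` for `w > 0`. -/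
theorem tendsto_prim_of_eq_one (hc : Measurable c) (hB : ∀ r, |c r| ≤ B) {C L : ℝ}
    (hcr : ∀ r, 0 < r → |r * c r| ≤ C) (hL : Tendsto (fun r => r * c r) atTop (𝓝 L)) :
    Tendsto (fun x => (Real.log x)⁻¹ * prim c x) atTop (𝓝 L) := by
  have e : ∀ᶠ x : ℝ in atTop, (Real.log x)⁻¹ * prim c 1 +
      ∫ w in (0)..1, Real.exp (w * Real.log x) * c (Real.exp (w * Real.log x)) =
        (Real.log x)⁻¹ * prim c x := by
    filter_upwards [eventually_gt_atTop 1] with x hx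
    have hl : 0 < Real.log x := Real.log_pos hx
    have h1 := integral_image_eq_integral_deriv_smul_of_monotoneOn (s := Set.Ioc (0 : ℝ) 1)
      (f := fun w => Real.exp (w * Real.log x)) (f' := fun w => Real.exp (w * Real.log x) * Real.log x)
      measurableSet_Ioc (fun w _ => by
        have := ((hasDerivAt_id w).mul_const (Real.log x)).exp
        simpa using this.hasDerivWithinAt)
      (fun a _ b _ hab => Real.exp_le_exp.2 (mul_le_mul_of_nonneg_right hab hl.le)) c
    rw [image_exp_mul_Ioc hl, Real.exp_log (by linarith)] at h1
    have h2 : prim c x - prim c 1 = ∫ r in Set.Ioc 1 x, c r := by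
      rw [← integral_comp_abs_eq hc hB, intervalIntegral.integral_of_le hx.le]
      refine setIntegral_congr_fun measurableSet_Ioc fun r hr => ?_
      rw [abs_of_pos (show 0 < r by linarith [hr.1])]
    rw [intervalIntegral.integral_of_le zero_le_one]
    have h3 : ∫ w in Set.Ioc (0 : ℝ) 1, (Real.exp (w * Real.log x) * Real.log x) •
        c (Real.exp (w * Real.log x)) = Real.log x *
        ∫ w in Set.Ioc (0 : ℝ) 1, Real.exp (w * Real.log x) * c (Real.exp (w * Real.log x)) := by
      rw [← integral_const_mul]
      refine integral_congr_ae (Eventually.of_forall fun w => ?_)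
      simp only [smul_eq_mul]
      ring
    rw [h3, ← h2] at h1
    rw [← eq_sub_iff_add_eq', ← mul_sub, h1, inv_mul_cancel_left₀ hl.ne']
  refine Tendsto.congr' e ?_
  have h0 : Tendsto (fun x => (Real.log x)⁻¹ * prim c 1) atTop (𝓝 (0 * prim c 1)) :=
    Real.tendsto_log_atTop.inv_tendsto_atTop.mul_const _
  have hlim : ∫ _ in (0 : ℝ)..1, L = L := by simp
  rw [show L = 0 * prim c 1 + ∫ _ in (0 : ℝ)..1, L by rw [hlim]; ring]
  refine h0.add ?_
  refine intervalIntegral.tendsto_integral_filter_of_dominated_convergence (fun _ => C)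
    (Eventually.of_forall fun x => Measurable.aestronglyMeasurable (by fun_prop)) ?_
    intervalIntegrable_const ?_
  · exact Eventually.of_forall fun x => Eventually.of_forall fun w _ => hcr _ (Real.exp_pos _)
  · refine Eventually.of_forall fun w hw => ?_
    rw [Set.uIoc_of_le zero_le_one] at hw
    exact hL.comp (Real.tendsto_exp_atTop.comp (Real.tendsto_log_atTop.const_mul_atTop hw.1))

theorem tendsto_prim_of_integrable (hi : IntegrableOn c (Set.Ioi 0)) :
    Tendsto (prim c) atTop (𝓝 (∫ r in Set.Ioi 0, c r)) := by
  refine (intervalIntegral_tendsto_integral_Ioi 0 hi tendsto_id).congr' ?_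
  filter_upwards [eventually_ge_atTop 0] with x hx
  rw [prim, intervalIntegral.integral_of_le hx, id, intervalIntegral.integral_of_le hx]
  refine setIntegral_congr_fun measurableSet_Ioc fun r hr => ?_
  rw [abs_of_pos (show 0 < r from hr.1)]

end

/-! ### Asymptotics of the overlaps. -/

section

variable {α : ℝ} {ν : Kernel ℝ ℝ} {f h : ℝ → ℝ} {K K' : ℝ}

namespace IsStableKernel

theorem measurable_overlap (hν : IsStableKernel α ν) (hf : Measurable f) (hh : Measurable h) :
    Measurable (overlap ν f h) := by
  have h1 : Measurable fun p : ℝ × ℝ => f p.2 * semi ν p.1 h p.2 :=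
    (hf.comp measurable_snd).mul
      (hν.measurable_semi (h := fun _ : ℝ × ℝ => h) (hh.comp measurable_snd) measurable_fst
        measurable_snd)
  exact h1.stronglyMeasurable.integral_prod_right.measurable

theorem abs_overlap_le (hν : IsStableKernel α ν) (hα : 0 < α) (hK' : 0 ≤ K')
    (hf : ∀ x, |f x| ≤ K * weight x) (hh : ∀ x, |h x| ≤ K' * weight x) (r : ℝ) :
    |overlap ν f h r| ≤ K * K' * Real.pi * decayConst α * rate α r := by
  have hb : Integrable fun x => K * weight x * (K' * (decayConst α * rate α r)) :=
    (integrable_weight.const_mul K).mul_const _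
  refine (norm_integral_le_of_norm_le (f := fun x => f x * semi ν r h x) hb (Eventually.of_forall fun x => ?_)).trans (le_of_eq ?_)
  · rw [norm_mul]
    exact mul_le_mul (hf x) (abs_semi_le_rate hν hα hK' hh r x) (abs_nonneg _)
      ((abs_nonneg _).trans (hf x))
  · rw [integral_mul_const, integral_const_mul, integral_weight]
    ring

/-- By self-similarity `r^(1/α) p_r(z - x) = p_1((z - x) r^(-1/α))`, which is at most `p_1(0)` in
absolute value and tends to it. Dominated convergence is applied first in `z`, then in `x`. -/
theorem tendsto_rpow_mul_overlap (hν : IsStableKernel α ν) (hα : 0 < α) (hfm : Measurable f)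
    (hhm : Measurable h) (hf : ∀ x, |f x| ≤ K * weight x) (hh : ∀ x, |h x| ≤ K' * weight x) :
    Tendsto (fun r => r ^ (1 / α) * overlap ν f h r) atTop
      (𝓝 (stableDensity α 1 0 * ((∫ x, f x) * ∫ x, h x))) := by
  have hfi := integrable_of_abs_le_weight hfm hf
  have hhi := integrable_of_abs_le_weight hhm hh
  have hpc := continuous_stableDensity hα one_pos
  have e : ∀ᶠ r in atTop, ∫ x, f x * ∫ z, stableDensity α 1 ((z - x) * r ^ (-1 / α)) * h z =
      r ^ (1 / α) * overlap ν f h r := by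
    filter_upwards [eventually_gt_atTop 0] with r hr
    rw [overlap, ← integral_const_mul]
    refine integral_congr_ae (Eventually.of_forall fun x => ?_)
    simp only [semi]
    rw [hν.integral_add hα hr, mul_left_comm, ← integral_const_mul (r ^ (1 / α))]
    refine congrArg (f x * ·) (integral_congr_ae (Eventually.of_forall fun z => ?_))
    simp only
    rw [stableDensity_eq_scaled hα hr, ← mul_assoc, ← mul_assoc, ← Real.rpow_add hr]
    rw [show 1 / α + -1 / α = 0 by ring, Real.rpow_zero, one_mul]
  refine Tendsto.congr' e ?_
  have hlim : ∫ x, f x * ∫ z, stableDensity α 1 0 * h z =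
      stableDensity α 1 0 * ((∫ x, f x) * ∫ x, h x) := by
    rw [integral_mul_const, integral_const_mul]; ring
  rw [← hlim]
  have hbd (x r : ℝ) : ‖∫ z, stableDensity α 1 ((z - x) * r ^ (-1 / α)) * h z‖ ≤
      ∫ z, stableDensity α 1 0 * |h z| := by
    refine norm_integral_le_of_norm_le (hhi.abs.const_mul _) (Eventually.of_forall fun z => ?_)
    rw [norm_mul]
    exact mul_le_mul_of_nonneg_right (abs_stableDensity_le hα one_pos _) (abs_nonneg _)
  have hr0 : Tendsto (fun r : ℝ => r ^ (-1 / α)) atTop (𝓝 0) := by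
    rw [neg_div]
    exact tendsto_rpow_neg_atTop (by positivity)
  refine tendsto_integral_filter_of_dominated_convergence
    (fun x => |f x| * ∫ z, stableDensity α 1 0 * |h z|) (Eventually.of_forall fun r => ?_)
    (Eventually.of_forall fun r => Eventually.of_forall fun x => ?_) (hfi.abs.mul_const _)
    (Eventually.of_forall fun x => ?_)
  · have h1 : Measurable fun p : ℝ × ℝ => stableDensity α 1 ((p.2 - p.1) * r ^ (-1 / α)) * h p.2 :=
      (hpc.measurable.comp (by fun_prop)).mul (hhm.comp measurable_snd)
    exact (hfm.mul h1.stronglyMeasurable.integral_prod_right.measurable).aestronglyMeasurable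
  · rw [norm_mul]
    exact mul_le_mul_of_nonneg_left (hbd x r) (abs_nonneg _)
  · refine Tendsto.const_mul _ ?_
    refine tendsto_integral_filter_of_dominated_convergence
      (fun z => stableDensity α 1 0 * |h z|) (Eventually.of_forall fun r => ?_)
      (Eventually.of_forall fun r => Eventually.of_forall fun z => ?_) (hhi.abs.const_mul _)
      (Eventually.of_forall fun z => ?_)
    · exact ((hpc.measurable.comp (by fun_prop)).mul hhm).aestronglyMeasurable
    · rw [norm_mul]
      exact mul_le_mul_of_nonneg_right (abs_stableDensity_le hα one_pos _) (abs_nonneg _)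
    · have h1 := hr0.const_mul (z - x)
      rw [mul_zero] at h1
      exact ((hpc.tendsto 0).comp h1).mul_const _

theorem semi_eq_stableSemigroup (hν : IsStableKernel α ν) (hα : 0 < α) {t : ℝ} (ht : 0 < t) (x : ℝ) :
    semi ν t h x = stableSemigroup α t h x := by
  rw [semi, hν.integral_add hα ht, stableSemigroup]
  refine integral_congr_ae (Eventually.of_forall fun z => ?_)
  simp only
  rw [← stableDensity_neg, neg_sub]

theorem integrableOn_rate_Ioi (hα : 0 < α) (hα1 : α < 1) : IntegrableOn (rate α) (Set.Ioi 0) := by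
  rw [← Set.Ioc_union_Ioi_eq_Ioi zero_le_one]
  refine (integrableOn_rate 1).union ?_
  refine ((integrableOn_Ioi_rpow_of_lt (a := -1 / α) ?_ one_pos)).congr_fun (fun s hs => ?_)
    measurableSet_Ioi
  · rw [div_lt_iff₀ hα]
    linarith
  · exact (rate_of_one_le α (le_of_lt hs)).symm

/-- For `α < 1` the decay rate is integrable over all times, so Fubini exchanges time and space. -/
theorem integral_overlap (hν : IsStableKernel α ν) (hα : 0 < α) (hα1 : α < 1) (hfm : Measurable f)
    (hhm : Measurable h) (hK : 0 ≤ K) (hK' : 0 ≤ K')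
    (hf : ∀ x, |f x| ≤ K * weight x) (hh : ∀ x, |h x| ≤ K' * weight x) :
    IntegrableOn (overlap ν f h) (Set.Ioi 0) ∧
    ∫ r in Set.Ioi 0, overlap ν f h r = ∫ x, f x * potential α h x := by
  have h1 : Measurable fun p : ℝ × ℝ => f p.2 * semi ν p.1 h p.2 :=
    (hfm.comp measurable_snd).mul
      (hν.measurable_semi (h := fun _ : ℝ × ℝ => h) (hhm.comp measurable_snd) measurable_fst
        measurable_snd)
  have hi := integrableOn_rate_Ioi hα hα1
  have hprod : Integrable (fun p : ℝ × ℝ => f p.2 * semi ν p.1 h p.2)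
      ((volume.restrict (Set.Ioi 0)).prod volume) := by
    have hb := (Integrable.mul_prod hi integrable_weight).const_mul (K * K' * decayConst α)
    refine hb.mono' h1.aestronglyMeasurable (Eventually.of_forall fun p => ?_)
    rw [norm_mul]
    refine (mul_le_mul (hf p.2) (abs_semi_le_rate hν hα hK' hh p.1 p.2) (abs_nonneg _)
      (mul_nonneg hK (weight_pos _).le)).trans (le_of_eq ?_)
    ring
  refine ⟨hprod.integral_prod_left, ?_⟩
  simp only [overlap]
  rw [integral_integral_swap (f := fun r x => f x * semi ν r h x) hprod]
  refine integral_congr_ae (Eventually.of_forall fun x => ?_)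
  simp only
  rw [integral_const_mul, potential]
  congr 1
  exact setIntegral_congr_fun measurableSet_Ioi fun t ht => hν.semi_eq_stableSemigroup hα ht x

end IsStableKernel

end

/-! ### The leading term of the variance -/

/-- A finite combination of test functions, each switched off at its own time. -/
noncomputable def stepFun {m : ℕ} (A : Fin m → ℝ) (ψ : Fin m → ℝ → ℝ) (s x : ℝ) : ℝ :=
  ∑ i, (if s ≤ A i then 1 else 0) * ψ i x

section

variable {m : ℕ} {A : Fin m → ℝ} {ψ : Fin m → ℝ → ℝ} {K : Fin m → ℝ}

theorem measurable_stepFun (hψ : ∀ i, Measurable (ψ i)) :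
    Measurable (Function.uncurry (stepFun A ψ)) := by
  have h (i : Fin m) : Measurable fun p : ℝ × ℝ => (if p.1 ≤ A i then 1 else 0) * ψ i p.2 :=
    (Measurable.ite (measurableSet_le measurable_fst measurable_const) measurable_const
      measurable_const).mul ((hψ i).comp measurable_snd)
  exact Finset.measurable_fun_sum Finset.univ fun i _ => h i

theorem abs_ite_le_one (p : Prop) [Decidable p] : |(if p then 1 else 0 : ℝ)| ≤ 1 := by
  split_ifs <;> simp

theorem abs_stepFun_le (hK : ∀ i x, |ψ i x| ≤ K i * weight x) (s x : ℝ) :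
    |stepFun A ψ s x| ≤ (∑ i, K i) * weight x := by
  rw [Finset.sum_mul]
  refine (Finset.abs_sum_le_sum_abs _ _).trans (Finset.sum_le_sum fun i _ => ?_)
  rw [abs_mul]
  exact (mul_le_of_le_one_left (abs_nonneg _) (abs_ite_le_one _)).trans (hK i x)

theorem setIntegral_ite_mul {S a : ℝ} (ha : 0 ≤ a) (haS : a ≤ S) (F : ℝ → ℝ) :
    ∫ s in Set.Ioc 0 S, (if s ≤ a then 1 else 0) * F s = ∫ s in (0)..a, F s := by
  rw [intervalIntegral.integral_of_le ha]
  have : (fun s => (if s ≤ a then 1 else 0) * F s) = (Set.Iic a).indicator F := by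
    funext s
    by_cases h : s ≤ a <;> simp [h]
  rw [this, setIntegral_indicator measurableSet_Iic]
  congr 2
  ext s
  simp only [Set.mem_inter_iff, Set.mem_Ioc, Set.mem_Iic]
  constructor
  · rintro ⟨⟨h1, _⟩, h2⟩
    exact ⟨h1, h2⟩
  · rintro ⟨h1, h2⟩
    exact ⟨⟨h1, h2.trans haS⟩, h2⟩

theorem integral_integral_step {S B : ℝ} (hA : ∀ i, 0 ≤ A i) (hAS : ∀ i, A i ≤ S)
    {G : Fin m → Fin m → ℝ → ℝ → ℝ} (hG : ∀ i j, Measurable (Function.uncurry (G i j)))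
    (hB : ∀ i j s u, |G i j s u| ≤ B) :
    ∫ s in Set.Ioc 0 S, ∫ u in Set.Ioc 0 S,
      ∑ i, ∑ j, (if s ≤ A i then 1 else 0) * ((if u ≤ A j then 1 else 0) * G i j s u) =
    ∑ i, ∑ j, ∫ s in (0)..A i, ∫ u in (0)..A j, G i j s u := by
  have hite (a : ℝ) : Measurable fun s : ℝ => (if s ≤ a then 1 else 0 : ℝ) :=
    Measurable.ite measurableSet_Iic measurable_const measurable_const
  have hGs (i j : Fin m) (s : ℝ) : Measurable fun u => G i j s u :=
    (hG i j).comp measurable_prodMk_left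
  have hin (i j : Fin m) (s : ℝ) : Integrable (fun u => (if s ≤ A i then 1 else 0) *
      ((if u ≤ A j then 1 else 0) * G i j s u)) (volume.restrict (Set.Ioc 0 S)) := by
    refine Integrable.of_bound (C := B) (((hite (A j)).mul (hGs i j s)).const_mul _).aestronglyMeasurable
      (Eventually.of_forall fun u => ?_)
    rw [norm_mul, norm_mul]
    exact (mul_le_of_le_one_left (by positivity) (abs_ite_le_one _)).trans
      ((mul_le_of_le_one_left (abs_nonneg _) (abs_ite_le_one _)).trans (hB i j s u))
  have h1 (s : ℝ) : ∫ u in Set.Ioc 0 S,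
      ∑ i, ∑ j, (if s ≤ A i then 1 else 0) * ((if u ≤ A j then 1 else 0) * G i j s u) =
      ∑ i, ∑ j, (if s ≤ A i then 1 else 0) * ∫ u in Set.Ioc 0 (A j), G i j s u := by
    rw [integral_finsetSum _ fun i _ => integrable_finsetSum _ fun j _ => hin i j s]
    refine Finset.sum_congr rfl fun i _ => ?_
    rw [integral_finsetSum _ fun j _ => hin i j s]
    refine Finset.sum_congr rfl fun j _ => ?_
    rw [integral_const_mul, setIntegral_ite_mul (hA j) (hAS j) fun u => G i j s u,
      intervalIntegral.integral_of_le (hA j)]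
  simp_rw [h1]
  have hout (i j : Fin m) : Integrable (fun s => (if s ≤ A i then 1 else 0) *
      ∫ u in Set.Ioc 0 (A j), G i j s u) (volume.restrict (Set.Ioc 0 S)) := by
    refine Integrable.of_bound (C := B * volume.real (Set.Ioc 0 (A j)))
      ((hite (A i)).mul (hG i j).stronglyMeasurable.integral_prod_right.measurable).aestronglyMeasurable
      (Eventually.of_forall fun s => ?_)
    rw [norm_mul]
    refine (mul_le_of_le_one_left (norm_nonneg _) (abs_ite_le_one _)).trans ?_
    exact norm_setIntegral_le_of_norm_le_const (by simp) fun u _ => hB i j s u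
  rw [integral_finsetSum _ fun i _ => integrable_finsetSum _ fun j _ => hout i j]
  refine Finset.sum_congr rfl fun i _ => ?_
  rw [integral_finsetSum _ fun j _ => hout i j]
  refine Finset.sum_congr rfl fun j _ => ?_
  rw [setIntegral_ite_mul (hA i) (hAS i) fun s => ∫ u in Set.Ioc 0 (A j), G i j s u]
  simp only [intervalIntegral.integral_of_le (hA j)]

variable {α : ℝ} {ν : Kernel ℝ ℝ}

theorem overlap_stepFun (hν : IsStableKernel α ν) (hα : 0 < α) (hψ : ∀ i, Measurable (ψ i))
    (hK0 : ∀ i, 0 ≤ K i) (hK : ∀ i x, |ψ i x| ≤ K i * weight x) (s u r : ℝ) :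
    overlap ν (stepFun A ψ s) (stepFun A ψ u) r = ∑ i, ∑ j, (if s ≤ A i then 1 else 0) *
      ((if u ≤ A j then 1 else 0) * overlap ν (ψ i) (ψ j) r) := by
  have := hν.markov
  have hsemi (x : ℝ) : semi ν r (stepFun A ψ u) x =
      ∑ j, (if u ≤ A j then 1 else 0) * semi ν r (ψ j) x := by
    simp only [semi, stepFun]
    rw [integral_finsetSum]
    · exact Finset.sum_congr rfl fun j _ => integral_const_mul _ _
    · intro j _
      refine Integrable.const_mul ?_ _
      refine Integrable.of_bound (C := K j) ((hψ j).comp (by fun_prop)).aestronglyMeasurable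
        (Eventually.of_forall fun z => (hK j _).trans ?_)
      exact mul_le_of_le_one_right (hK0 j) (weight_le_one _)
  have hint (i j : Fin m) : Integrable fun x => ψ i x * semi ν r (ψ j) x := by
    refine ((integrable_of_abs_le_weight (hψ i) (hK i)).mul_const
      (K j * (decayConst α * rate α r))).mono
      ((hψ i).mul (hν.measurable_semi_apply (hψ j) r)).aestronglyMeasurable
      (Eventually.of_forall fun x => ?_)
    rw [norm_mul, norm_mul]
    exact mul_le_mul_of_nonneg_left
      ((abs_semi_le_rate hν hα (hK0 j) (hK j) r x).trans (le_abs_self _)) (norm_nonneg _)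
  have e (x : ℝ) : stepFun A ψ s x * semi ν r (stepFun A ψ u) x =
      ∑ i, ∑ j, (if s ≤ A i then 1 else 0) * ((if u ≤ A j then 1 else 0) *
        (ψ i x * semi ν r (ψ j) x)) := by
    rw [hsemi, stepFun, Finset.sum_mul_sum]
    refine Finset.sum_congr rfl fun i _ => Finset.sum_congr rfl fun j _ => ?_
    ring
  simp only [overlap, e]
  have hint2 (i j : Fin m) := ((hint i j).const_mul (if u ≤ A j then 1 else 0 : ℝ)).const_mul
    (if s ≤ A i then 1 else 0 : ℝ)
  rw [integral_finsetSum _ fun i _ => integrable_finsetSum _ fun j _ => hint2 i j]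
  refine Finset.sum_congr rfl fun i _ => ?_
  rw [integral_finsetSum _ fun j _ => hint2 i j]
  refine Finset.sum_congr rfl fun j _ => ?_
  rw [integral_const_mul, integral_const_mul]

/-- Overlaps are bilinear, and the switches restrict the time square to the rectangles `[0, A_i] ×
[0, A_j]`, where the corner formulas for the double primitive apply. -/
theorem mainVar_stepFun (hν : IsStableKernel α ν) (hα : 0 < α) (hψ : ∀ i, Measurable (ψ i))
    (hK0 : ∀ i, 0 ≤ K i) (hK : ∀ i x, |ψ i x| ≤ K i * weight x) {S : ℝ} (hA : ∀ i, 0 ≤ A i)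
    (hAS : ∀ i, A i ≤ S) (a v : ℝ) :
    IsStableSystem.mainVar ν a v S (stepFun A ψ) = ∑ i, ∑ j,
      (a * ((doublePrim (overlap ν (ψ i) (ψ j)) (A i) + doublePrim (overlap ν (ψ i) (ψ j)) (A j) -
          doublePrim (overlap ν (ψ i) (ψ j)) |A i - A j|) -
          (doublePrim (overlap ν (ψ i) (ψ j)) (A i + A j) - doublePrim (overlap ν (ψ i) (ψ j)) (A i) -
          doublePrim (overlap ν (ψ i) (ψ j)) (A j))) +
        v * (doublePrim (overlap ν (ψ i) (ψ j)) (A i + A j) - doublePrim (overlap ν (ψ i) (ψ j)) (A i) -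
          doublePrim (overlap ν (ψ i) (ψ j)) (A j))) := by
  have hKs : 0 ≤ ∑ i, K i := Finset.sum_nonneg fun i _ => hK0 i
  have hgm := measurable_stepFun (A := A) hψ
  have hgK := abs_stepFun_le (A := A) hK
  have hd := decayConst_pos hα
  have hom (i j : Fin m) := hν.measurable_overlap (hψ i) (hψ j)
  have hob' (i j : Fin m) (r : ℝ) : |overlap ν (ψ i) (ψ j) r| ≤ K i * K j * Real.pi * decayConst α := by
    have hp : 0 ≤ K i * K j * Real.pi * decayConst α :=
      mul_nonneg (mul_nonneg (mul_nonneg (hK0 i) (hK0 j)) Real.pi_pos.le) hd.le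
    exact (hν.abs_overlap_le hα (hK0 j) (hK i) (hK j) r).trans
      (mul_le_of_le_one_right hp (rate_le_one hα r))
  set B := ∑ i, ∑ j, K i * K j * Real.pi * decayConst α with hBdef
  have hnn (i j : Fin m) : 0 ≤ K i * K j * Real.pi * decayConst α :=
    mul_nonneg (mul_nonneg (mul_nonneg (hK0 i) (hK0 j)) Real.pi_pos.le) hd.le
  have hob (i j : Fin m) (r : ℝ) : |overlap ν (ψ i) (ψ j) r| ≤ B := by
    refine (hob' i j r).trans ((Finset.single_le_sum (f := fun j => K i * K j * Real.pi * decayConst α)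
      (fun j _ => hnn i j) (Finset.mem_univ j)).trans ?_)
    exact Finset.single_le_sum (f := fun i => ∑ j, K i * K j * Real.pi * decayConst α)
      (fun i _ => Finset.sum_nonneg fun j _ => hnn i j) (Finset.mem_univ i)
  have e1 : ∫ x, occSq ν S (stepFun A ψ) x = ∑ i, ∑ j,
      (doublePrim (overlap ν (ψ i) (ψ j)) (A i) + doublePrim (overlap ν (ψ i) (ψ j)) (A j) -
          doublePrim (overlap ν (ψ i) (ψ j)) |A i - A j|) := by
    rw [integral_occSq hν hKs hgm hgK]
    simp_rw [overlap_stepFun hν hα hψ hK0 hK]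
    rw [integral_integral_step hA hAS (G := fun i j s u => overlap ν (ψ i) (ψ j) |s - u|)
      (fun i j => (hom i j).comp (by fun_prop)) (fun i j s u => hob i j _)]
    refine Finset.sum_congr rfl fun i _ => Finset.sum_congr rfl fun j _ => ?_
    rw [integral_integral_abs_sub (hom i j) (hob i j), doublePrim_abs]
  have e2 : ∫ x, occMean ν S (stepFun A ψ) x ^ 2 = ∑ i, ∑ j,
      (doublePrim (overlap ν (ψ i) (ψ j)) (A i + A j) - doublePrim (overlap ν (ψ i) (ψ j)) (A i) -
          doublePrim (overlap ν (ψ i) (ψ j)) (A j)) := by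
    rw [integral_sq_occMean hν hKs hgm hgK]
    have e3 : ∀ s ∈ Set.Ioc 0 S, ∫ u in Set.Ioc 0 S, overlap ν (stepFun A ψ s) (stepFun A ψ u) (s + u) =
        ∫ u in Set.Ioc 0 S, overlap ν (stepFun A ψ s) (stepFun A ψ u) |s + u| := fun s hs =>
      setIntegral_congr_fun measurableSet_Ioc fun u hu => by
        rw [abs_of_pos (add_pos hs.1 hu.1)]
    rw [setIntegral_congr_fun measurableSet_Ioc e3]
    simp_rw [overlap_stepFun hν hα hψ hK0 hK]
    rw [integral_integral_step hA hAS (G := fun i j s u => overlap ν (ψ i) (ψ j) |s + u|)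
      (fun i j => (hom i j).comp (by fun_prop)) (fun i j s u => hob i j _)]
    refine Finset.sum_congr rfl fun i _ => Finset.sum_congr rfl fun j _ => ?_
    rw [integral_integral_abs_add (hom i j) (hob i j)]
  rw [IsStableSystem.mainVar, e1, e2, ← Finset.sum_sub_distrib, Finset.mul_sum, Finset.mul_sum,
    ← Finset.sum_add_distrib]
  refine Finset.sum_congr rfl fun i _ => ?_
  rw [← Finset.sum_sub_distrib, Finset.mul_sum, Finset.mul_sum, ← Finset.sum_add_distrib]

end

/-! ### Normings in the three regimes. -/

/-- The quotient is the integral over `[0, a]` of `rate α (T s)`, which is bounded by one and tends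
to zero for `s > 0`. -/
theorem tendsto_totalRate_div {α : ℝ} (hα : 0 < α) {a : ℝ} (ha : 0 ≤ a) :
    Tendsto (fun T => totalRate α (T * a) / T) atTop (𝓝 0) := by
  have e : ∀ᶠ T in atTop, ∫ s in (0)..a, rate α (T * s) = totalRate α (T * a) / T := by
    filter_upwards [eventually_gt_atTop 0] with T hT
    rw [intervalIntegral.integral_comp_mul_left _ hT.ne', mul_zero, totalRate,
      intervalIntegral.integral_of_le (mul_nonneg hT.le ha), smul_eq_mul, div_eq_inv_mul]
  refine Tendsto.congr' e ?_
  have h0 : ∫ _ in (0 : ℝ)..a, (0 : ℝ) = 0 := by simp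
  suffices hs : Tendsto (fun T => ∫ s in (0)..a, rate α (T * s)) atTop
      (𝓝 (∫ _ in (0 : ℝ)..a, (0 : ℝ))) by rwa [h0] at hs
  refine intervalIntegral.tendsto_integral_filter_of_dominated_convergence (fun _ => 1)
    (Eventually.of_forall fun T => ?_) (Eventually.of_forall fun T => Eventually.of_forall fun s _ => ?_)
    intervalIntegrable_const (Eventually.of_forall fun s hs => ?_)
  · exact ((continuous_rate α).comp (by fun_prop)).aestronglyMeasurable
  · rw [Real.norm_eq_abs, abs_of_pos (rate_pos α _)]
    exact rate_le_one hα _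
  · rw [Set.uIoc_of_le ha] at hs
    have h1 : Tendsto (fun r : ℝ => r ^ (-1 / α)) atTop (𝓝 0) := by
      rw [neg_div]
      exact tendsto_rpow_neg_atTop (by positivity)
    have h2 : Tendsto (fun T : ℝ => max 1 (T * s)) atTop atTop :=
      tendsto_atTop_mono (fun T => le_max_right _ _) (tendsto_id.atTop_mul_const hs.1)
    exact h1.comp h2

/-- A norming `F`, together with the exponent `γ` and the bilinear functional `q` that describe the
growth of the double primitives of the overlaps. -/
structure IsScaling (α : ℝ) (ν : Kernel ℝ ℝ) (F : ℝ → ℝ) (γ : ℝ)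
    (q : (ℝ → ℝ) → (ℝ → ℝ) → ℝ) : Prop where
  pos : ∀ᶠ T in atTop, 0 < F T
  bounded : ∀ a, 0 < a → ∃ M, ∀ᶠ T in atTop, T * totalRate α (T * a) / F T ^ 2 ≤ M
  tendsto : ∀ (K K' : ℝ) (f h : ℝ → ℝ), 0 ≤ K → 0 ≤ K' → Measurable f → Measurable h →
    (∀ x, |f x| ≤ K * weight x) → (∀ x, |h x| ≤ K' * weight x) → ∀ a, 0 ≤ a →
    Tendsto (fun T => (F T ^ 2)⁻¹ * doublePrim (overlap ν f h) (T * a)) atTop (𝓝 (q f h * a ^ γ))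

section

variable {α γ : ℝ} {ν : Kernel ℝ ℝ} {F : ℝ → ℝ} {q : (ℝ → ℝ) → (ℝ → ℝ) → ℝ}

/-- `(U/F)² = (T U/F²) · (U/T)` is a bounded factor times a vanishing one. This kills both the cell
error in the variance and the Lyapunov error. -/
theorem IsScaling.tendsto_totalRate_div (hF : IsScaling α ν F γ q) (hα : 0 < α) {a : ℝ} (ha : 0 < a) :
    Tendsto (fun T => totalRate α (T * a) / F T) atTop (𝓝 0) := by
  obtain ⟨M, hM⟩ := hF.bounded a ha
  have h1 := (OccupationTime.tendsto_totalRate_div hα ha.le).const_mul M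
  rw [mul_zero] at h1
  have h2 : Tendsto (fun T => (totalRate α (T * a) / F T) ^ 2) atTop (𝓝 0) := by
    refine tendsto_of_tendsto_of_tendsto_of_le_of_le' tendsto_const_nhds h1
      (Eventually.of_forall fun T => sq_nonneg _) ?_
    filter_upwards [hM, hF.pos, eventually_gt_atTop 0] with T hT hFT hT0
    have h0 : 0 ≤ totalRate α (T * a) / T := div_nonneg (totalRate_nonneg _ _) hT0.le
    refine le_trans (le_of_eq ?_) (mul_le_mul_of_nonneg_right hT h0)
    field_simp
  have h3 := (Real.continuous_sqrt.tendsto 0).comp h2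
  rw [Real.sqrt_zero] at h3
  refine h3.congr' ?_
  filter_upwards [hF.pos] with T hFT
  exact Real.sqrt_sq (div_nonneg (totalRate_nonneg _ _) hFT.le)

/-- Only the first primitive has to be analysed: integrating the limit `q γ s^(γ-1)` over `[0, a]`
gives `q a^γ`, and the bound on `T U/F²` provides the domination. -/
theorem isScaling_of_prim (hν : IsStableKernel α ν) (hα : 0 < α) (hγ : 0 < γ)
    (pos : ∀ᶠ T in atTop, 0 < F T)
    (bounded : ∀ a, 0 < a → ∃ M, ∀ᶠ T in atTop, T * totalRate α (T * a) / F T ^ 2 ≤ M)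
    (hprim : ∀ (K K' : ℝ) (f h : ℝ → ℝ), 0 ≤ K → 0 ≤ K' → Measurable f → Measurable h →
      (∀ x, |f x| ≤ K * weight x) → (∀ x, |h x| ≤ K' * weight x) → ∀ s, 0 < s →
      Tendsto (fun T => T * (F T ^ 2)⁻¹ * prim (overlap ν f h) (T * s)) atTop
        (𝓝 (q f h * γ * s ^ (γ - 1)))) : IsScaling α ν F γ q := by
  refine ⟨pos, bounded, fun K K' f h hK hK' hfm hhm hf hh a ha => ?_⟩
  have hd := decayConst_pos hα
  set C := K * K' * Real.pi * decayConst α with hC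
  have hC0 : 0 ≤ C := mul_nonneg (mul_nonneg (mul_nonneg hK hK') Real.pi_pos.le) hd.le
  have hle := hν.abs_overlap_le hα hK' hf hh
  have hlim : ∫ s in (0)..a, q f h * γ * s ^ (γ - 1) = q f h * a ^ γ := by
    rw [intervalIntegral.integral_const_mul, integral_rpow (Or.inl (by linarith)), sub_add_cancel,
      Real.zero_rpow hγ.ne', sub_zero]
    field_simp
  rw [← hlim]
  rcases ha.eq_or_lt with rfl | ha0
  · simp [doublePrim]
  obtain ⟨M, hM⟩ := bounded a ha0
  refine tendsto_doublePrim (hν.measurable_overlap hfm hhm)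
    (fun r => (hle r).trans (mul_le_of_le_one_right hC0 (rate_le_one hα r))) (M := C * M) ha
    (hprim K K' f h hK hK' hfm hhm hf hh) ?_
  filter_upwards [hM, pos, eventually_gt_atTop 0] with T hT hFT hT0 s hs
  have h1 := abs_prim_le hle (x := T * s) (mul_nonneg hT0.le hs.1.le)
  have h2 := totalRate_mono α (mul_le_mul_of_nonneg_left hs.2 hT0.le)
  have h3 : 0 ≤ T * (F T ^ 2)⁻¹ := by positivity
  rw [abs_mul, abs_of_nonneg h3]
  calc _ ≤ T * (F T ^ 2)⁻¹ * (C * totalRate α (T * a)) :=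
        mul_le_mul_of_nonneg_left (h1.trans (mul_le_mul_of_nonneg_left h2 hC0)) h3
    _ = C * (T * totalRate α (T * a) / F T ^ 2) := by ring
    _ ≤ C * M := mul_le_mul_of_nonneg_left hT hC0

/-- With `β = 1/α` one has `F² = T^(2-β)`. The overlap decays like `r^(-β)`, and the two
integrations produce the factors `1 - β` and `2 - β`. -/
theorem isScaling_of_one_lt (hν : IsStableKernel α ν) (hα : 1 < α) :
    IsScaling α ν (fun T => T ^ (1 - 1 / (2 * α))) (2 - 1 / α) fun f h =>
      stableDensity α 1 0 * ((∫ x, f x) * ∫ x, h x) / ((1 - 1 / α) * (2 - 1 / α)) := by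
  have hα0 : 0 < α := by linarith
  have hβ : 1 / α < 1 := by rw [div_lt_one hα0]; exact hα
  have hβ0 : 0 < 1 / α := by positivity
  set β := 1 / α with hβdef
  have hF2 (T : ℝ) (hT : 0 < T) : (T ^ (1 - 1 / (2 * α))) ^ 2 = T ^ (2 - β) := by
    rw [← Real.rpow_natCast, ← Real.rpow_mul hT.le]
    congr 1
    rw [hβdef]
    push_cast
    field_simp
  have hrate (s : ℝ) (hs : 0 < s) : rate α s ≤ s ^ (-β) := by
    rw [rate, hβdef, ← neg_div]
    exact Real.rpow_le_rpow_of_nonpos hs (le_max_right _ _)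
      (div_nonpos_of_nonpos_of_nonneg (by norm_num) hα0.le)
  have hU (x : ℝ) (hx : 0 ≤ x) : totalRate α x ≤ x ^ (1 - β) / (1 - β) := by
    have h1 := integral_rpow (a := 0) (b := x) (r := -β) (Or.inl (by linarith))
    rw [Real.zero_rpow (by linarith), sub_zero, neg_add_eq_sub, intervalIntegral.integral_of_le hx]
      at h1
    rw [← h1]
    refine setIntegral_mono_on (integrableOn_rate x) ?_ measurableSet_Ioc fun s hs => hrate s hs.1
    exact (intervalIntegrable_iff_integrableOn_Ioc_of_le hx).1
      (intervalIntegral.intervalIntegrable_rpow' (by linarith))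
  refine isScaling_of_prim hν hα0 (by linarith) ?_ (fun a ha => ⟨a ^ (1 - β) / (1 - β), ?_⟩) ?_
  · filter_upwards [eventually_gt_atTop 0] with T hT
    positivity
  · filter_upwards [eventually_gt_atTop 0] with T hT
    rw [hF2 T hT, div_le_iff₀ (by positivity)]
    have h1 := mul_le_mul_of_nonneg_left (hU (T * a) (by positivity)) hT.le
    refine h1.trans (le_of_eq ?_)
    rw [Real.mul_rpow hT.le ha.le, show 2 - β = 1 + (1 - β) by ring, Real.rpow_add hT, Real.rpow_one]
    ring
  · intro K K' f h hK hK' hfm hhm hf hh s hs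
    have hd := decayConst_pos hα0
    have hC0 : 0 ≤ K * K' * Real.pi * decayConst α :=
      mul_nonneg (mul_nonneg (mul_nonneg hK hK') Real.pi_pos.le) hd.le
    have h1 := tendsto_prim_of_lt_one (hν.measurable_overlap hfm hhm) hβ
      (fun r hr => (hν.abs_overlap_le hα0 hK' hf hh r).trans
        (mul_le_mul_of_nonneg_left (hrate r hr) hC0))
      (hν.tendsto_rpow_mul_overlap hα0 hfm hhm hf hh)
    have h2 := (h1.comp (tendsto_id.atTop_mul_const hs)).mul_const (s ^ (1 - β))
    have e : stableDensity α 1 0 * ((∫ x, f x) * ∫ x, h x) / (1 - β) * s ^ (1 - β) =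
        stableDensity α 1 0 * ((∫ x, f x) * ∫ x, h x) / ((1 - β) * (2 - β)) * (2 - β) *
          s ^ (2 - β - 1) := by
      rw [show 2 - β - 1 = 1 - β by ring]
      have h3 : (2 - β) ≠ 0 := by linarith
      have h4 : (1 - β) ≠ 0 := by linarith
      field_simp
    rw [e] at h2
    refine h2.congr' ?_
    filter_upwards [eventually_gt_atTop 0] with T hT
    rw [hF2 T hT, Function.comp_apply, id, Real.mul_rpow hT.le hs.le]
    have h3 : s ^ (β - 1) * s ^ (1 - β) = 1 := by
      rw [← Real.rpow_add hs]; simp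
    have h4 : T ^ (β - 1) = T * (T ^ (2 - β))⁻¹ := by
      rw [← Real.rpow_neg hT.le, ← Real.rpow_one_add' hT.le (by linarith)]
      congr 1; ring
    rw [h4]
    linear_combination T * (T ^ (2 - β))⁻¹ * prim (overlap ν f h) (T * s) * h3

theorem totalRate_one {x : ℝ} (hx : 1 ≤ x) : totalRate 1 x = 1 + Real.log x := by
  rw [totalRate, ← Set.Ioc_union_Ioc_eq_Ioc zero_le_one hx,
    setIntegral_union (Set.Ioc_disjoint_Ioc_of_le le_rfl) measurableSet_Ioc (integrableOn_rate 1)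
      ((integrableOn_rate x).mono_set (Set.Ioc_subset_Ioc_left zero_le_one))]
  congr 1
  · rw [setIntegral_congr_fun measurableSet_Ioc fun s hs => rate_of_le_one 1 hs.2]
    simp
  · rw [← sub_zero (Real.log x), ← Real.log_one, ← Real.log_div (by linarith) one_ne_zero,
      ← integral_inv_of_pos one_pos (by linarith), intervalIntegral.integral_of_le hx]
    refine setIntegral_congr_fun measurableSet_Ioc fun s hs => ?_
    rw [rate_of_one_le 1 hs.1.le, div_one, Real.rpow_neg_one]

theorem tendsto_log_mul_div_log {a : ℝ} (ha : 0 < a) :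
    Tendsto (fun T => Real.log (T * a) / Real.log T) atTop (𝓝 1) := by
  have h1 : Tendsto (fun T => 1 + Real.log a * (Real.log T)⁻¹) atTop (𝓝 (1 + Real.log a * 0)) :=
    (Real.tendsto_log_atTop.inv_tendsto_atTop.const_mul _).const_add 1
  rw [mul_zero, add_zero] at h1
  refine h1.congr' ?_
  filter_upwards [eventually_gt_atTop 1] with T hT
  have hl := Real.log_pos hT
  rw [Real.log_mul (by linarith) ha.ne']
  field_simp

/-- The overlap decays like `1/r`, so its primitive grows like `log`. Since `log (Ts) ~ log T`, the
dependence on `s` disappears and the double primitive is linear in the limit. -/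
theorem isScaling_of_eq_one (hν : IsStableKernel 1 ν) :
    IsScaling 1 ν (fun T => Real.sqrt (T * Real.log T)) 1 fun f h =>
      stableDensity 1 1 0 * ((∫ x, f x) * ∫ x, h x) := by
  have hF2 (T : ℝ) (hT : 1 < T) : Real.sqrt (T * Real.log T) ^ 2 = T * Real.log T :=
    Real.sq_sqrt (mul_nonneg (by linarith) (Real.log_pos hT).le)
  refine isScaling_of_prim hν one_pos one_pos ?_ (fun a ha => ⟨2, ?_⟩) ?_
  · filter_upwards [eventually_gt_atTop 1] with T hT
    exact Real.sqrt_pos.2 (mul_pos (by linarith) (Real.log_pos hT))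
  · have h1 := (Real.tendsto_log_atTop.inv_tendsto_atTop).add (tendsto_log_mul_div_log ha)
    rw [zero_add] at h1
    have hTa : ∀ᶠ T : ℝ in atTop, 1 ≤ T * a :=
      (tendsto_id.atTop_mul_const ha).eventually_ge_atTop 1
    filter_upwards [eventually_gt_atTop 1, hTa, h1.eventually_le_const one_lt_two] with T hT hTa h2
    have hl := Real.log_pos hT
    rw [hF2 T hT, totalRate_one hTa]
    refine le_trans (le_of_eq ?_) h2
    have hT0 : T ≠ 0 := by linarith
    simp only [Pi.inv_apply]
    field_simp
  · intro K K' f h hK hK' hfm hhm hf hh s hs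
    have hd := decayConst_pos one_pos
    set C := K * K' * Real.pi * decayConst 1 with hC
    have hC0 : 0 ≤ C := mul_nonneg (mul_nonneg (mul_nonneg hK hK') Real.pi_pos.le) hd.le
    have hle := hν.abs_overlap_le one_pos hK' hf hh
    have hlim := hν.tendsto_rpow_mul_overlap one_pos hfm hhm hf hh
    simp only [div_one, Real.rpow_one] at hlim
    have hcr (r : ℝ) (hr : 0 < r) : |r * overlap ν f h r| ≤ C := by
      have h1 : r * rate 1 r ≤ 1 := by
        rcases le_total r 1 with h | h
        · rw [rate_of_le_one 1 h, mul_one]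
          exact h
        · rw [rate_of_one_le 1 h, div_one, Real.rpow_neg_one, mul_inv_cancel₀ hr.ne']
      rw [abs_mul, abs_of_pos hr]
      calc _ ≤ r * (C * rate 1 r) := mul_le_mul_of_nonneg_left (hle r) hr.le
        _ = C * (r * rate 1 r) := by ring
        _ ≤ C := mul_le_of_le_one_right hC0 h1
    have h1 := tendsto_prim_of_eq_one (hν.measurable_overlap hfm hhm)
      (fun r => (hle r).trans (mul_le_of_le_one_right hC0 (rate_le_one one_pos r))) hcr hlim
    have h2 := (h1.comp (tendsto_id.atTop_mul_const hs)).mul (tendsto_log_mul_div_log hs)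
    simp only [sub_self, Real.rpow_zero, mul_one]
    rw [mul_one] at h2
    have hTs : ∀ᶠ T : ℝ in atTop, 1 < T * s :=
      (tendsto_id.atTop_mul_const hs).eventually_gt_atTop 1
    refine h2.congr' ?_
    filter_upwards [eventually_gt_atTop 1, hTs] with T hT hTs
    have hl := Real.log_pos hT
    have hl2 := Real.log_pos hTs
    rw [hF2 T hT, Function.comp_apply, id]
    field_simp

/-- The overlap is integrable, so its primitive converges to the potential form and the double
primitive is asymptotically linear. -/
theorem isScaling_of_lt_one (hν : IsStableKernel α ν) (hα : 0 < α) (hα1 : α < 1) :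
    IsScaling α ν (fun T => Real.sqrt T) 1 fun f h => ∫ x, f x * potential α h x := by
  have hi := IsStableKernel.integrableOn_rate_Ioi hα hα1
  refine isScaling_of_prim hν hα one_pos ?_
    (fun a ha => ⟨∫ s in Set.Ioi 0, rate α s, ?_⟩) ?_
  · filter_upwards [eventually_gt_atTop 0] with T hT
    exact Real.sqrt_pos.2 hT
  · filter_upwards [eventually_gt_atTop 0] with T hT
    rw [Real.sq_sqrt hT.le, mul_div_cancel_left₀ _ hT.ne']
    exact setIntegral_mono_set hi (Eventually.of_forall fun s => (rate_pos α s).le)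
      Set.Ioc_subset_Ioi_self.eventuallyLE
  · intro K K' f h hK hK' hfm hhm hf hh s hs
    obtain ⟨h1, h2⟩ := hν.integral_overlap hα hα1 hfm hhm hK hK' hf hh
    have h3 := (tendsto_prim_of_integrable h1).comp (tendsto_id.atTop_mul_const hs)
    simp only [sub_self, Real.rpow_zero, mul_one]
    rw [← h2]
    refine h3.congr' ?_
    filter_upwards [eventually_gt_atTop 0] with T hT
    rw [Real.sq_sqrt hT.le, mul_inv_cancel₀ hT.ne', one_mul]
    rfl

/-! ### The limit covariance and convergence of characteristic functions. -/

/-- The limit covariance in time, for the exponent `γ`, and for the mean `a` and the variance `v` of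
the number of points in a cell. -/
noncomputable def limCov (γ a v A B : ℝ) : ℝ :=
  a * (2 * A ^ γ + 2 * B ^ γ - |A - B| ^ γ - (A + B) ^ γ) + v * ((A + B) ^ γ - A ^ γ - B ^ γ)

theorem IsScaling.tendsto_mainVar (hF : IsScaling α ν F γ q) (hν : IsStableKernel α ν) (hα : 0 < α)
    {m : ℕ} (t : Fin m → ℝ≥0) {ψ : Fin m → ℝ → ℝ} {K : Fin m → ℝ} (hψ : ∀ i, Measurable (ψ i))
    (hK0 : ∀ i, 0 ≤ K i) (hK : ∀ i x, |ψ i x| ≤ K i * weight x) {τ : ℝ} (ht : ∀ i, t i ≤ τ) (a v : ℝ) :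
    Tendsto (fun T => (F T ^ 2)⁻¹ *
        IsStableSystem.mainVar ν a v (T * τ) (stepFun (fun i => T * t i) ψ)) atTop
      (𝓝 (∑ i, ∑ j, q (ψ i) (ψ j) * limCov γ a v (t i) (t j))) := by
  have hD (i j : Fin m) {b : ℝ} (hb : 0 ≤ b) :=
    hF.tendsto (K i) (K j) (ψ i) (ψ j) (hK0 i) (hK0 j) (hψ i) (hψ j) (hK i) (hK j) b hb
  have hlim : Tendsto (fun T => ∑ i, ∑ j,
      (a * (((F T ^ 2)⁻¹ * doublePrim (overlap ν (ψ i) (ψ j)) (T * t i) +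
          (F T ^ 2)⁻¹ * doublePrim (overlap ν (ψ i) (ψ j)) (T * t j) -
          (F T ^ 2)⁻¹ * doublePrim (overlap ν (ψ i) (ψ j)) (T * |(t i : ℝ) - t j|)) -
          ((F T ^ 2)⁻¹ * doublePrim (overlap ν (ψ i) (ψ j)) (T * (t i + t j)) -
          (F T ^ 2)⁻¹ * doublePrim (overlap ν (ψ i) (ψ j)) (T * t i) -
          (F T ^ 2)⁻¹ * doublePrim (overlap ν (ψ i) (ψ j)) (T * t j))) +
        v * ((F T ^ 2)⁻¹ * doublePrim (overlap ν (ψ i) (ψ j)) (T * (t i + t j)) -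
          (F T ^ 2)⁻¹ * doublePrim (overlap ν (ψ i) (ψ j)) (T * t i) -
          (F T ^ 2)⁻¹ * doublePrim (overlap ν (ψ i) (ψ j)) (T * t j)))) atTop
      (𝓝 (∑ i, ∑ j, (a * ((q (ψ i) (ψ j) * (t i : ℝ) ^ γ + q (ψ i) (ψ j) * (t j : ℝ) ^ γ -
          q (ψ i) (ψ j) * |(t i : ℝ) - t j| ^ γ) - (q (ψ i) (ψ j) * ((t i : ℝ) + t j) ^ γ -
          q (ψ i) (ψ j) * (t i : ℝ) ^ γ - q (ψ i) (ψ j) * (t j : ℝ) ^ γ)) +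
        v * (q (ψ i) (ψ j) * ((t i : ℝ) + t j) ^ γ -
          q (ψ i) (ψ j) * (t i : ℝ) ^ γ - q (ψ i) (ψ j) * (t j : ℝ) ^ γ)))) := by
    refine tendsto_finsetSum _ fun i _ => tendsto_finsetSum _ fun j _ => ?_
    have h1 := hD i j (t i).coe_nonneg
    have h2 := hD i j (t j).coe_nonneg
    have h3 := hD i j (abs_nonneg ((t i : ℝ) - t j))
    have h4 := hD i j (add_nonneg (t i).coe_nonneg (t j).coe_nonneg)
    exact ((((h1.add h2).sub h3).sub ((h4.sub h1).sub h2)).const_mul a).add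
      (((h4.sub h1).sub h2).const_mul v)
  have e : ∑ i, ∑ j, q (ψ i) (ψ j) * limCov γ a v (t i) (t j) =
      ∑ i, ∑ j, (a * ((q (ψ i) (ψ j) * (t i : ℝ) ^ γ + q (ψ i) (ψ j) * (t j : ℝ) ^ γ -
          q (ψ i) (ψ j) * |(t i : ℝ) - t j| ^ γ) - (q (ψ i) (ψ j) * ((t i : ℝ) + t j) ^ γ -
          q (ψ i) (ψ j) * (t i : ℝ) ^ γ - q (ψ i) (ψ j) * (t j : ℝ) ^ γ)) +
        v * (q (ψ i) (ψ j) * ((t i : ℝ) + t j) ^ γ -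
          q (ψ i) (ψ j) * (t i : ℝ) ^ γ - q (ψ i) (ψ j) * (t j : ℝ) ^ γ)) := by
    refine Finset.sum_congr rfl fun i _ => Finset.sum_congr rfl fun j _ => ?_
    rw [limCov]
    ring
  rw [e]
  refine hlim.congr' ?_
  filter_upwards [eventually_ge_atTop 0] with T hT
  rw [mainVar_stepFun hν hα hψ hK0 hK (fun i => mul_nonneg hT (t i).coe_nonneg)
    (fun i => mul_le_mul_of_nonneg_left (ht i) hT), Finset.mul_sum]
  refine Finset.sum_congr rfl fun i _ => ?_
  rw [Finset.mul_sum]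
  refine Finset.sum_congr rfl fun j _ => ?_
  rw [← mul_sub T, abs_mul, abs_of_nonneg hT, ← mul_add T]
  ring

end

section

variable {Ω : Type*} [MeasurableSpace Ω] {P : Measure Ω} [IsProbabilityMeasure P] {α γ : ℝ}
  {θ : ℤ → Ω → ℕ} {ρ : ℤ → (k : ℕ) → Ω → Fin k → ℝ} {η : ℤ × ℕ → ℝ≥0 → Ω → ℝ} {ν : Kernel ℝ ℝ}
  {F : ℝ → ℝ} {q : (ℝ → ℝ) → (ℝ → ℝ) → ℝ}

/-- Two errors are compared with `U/F → 0`: replacing the variance by its leading term costs a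
multiple of `(U/F)²`, and replacing the law by a Gaussian one costs a multiple of `(T U/F²)(U/F)`.
-/
theorem IsStableSystem.tendsto_integral_exp (h : IsStableSystem α θ ρ η P) (hν : IsStableKernel α ν)
    (hα : 0 < α) (hF : IsScaling α ν F γ q) {m : ℕ} (t : Fin m → ℝ≥0) {ψ : Fin m → ℝ → ℝ}
    {K : Fin m → ℝ} (hψ : ∀ i, Measurable (ψ i)) (hK0 : ∀ i, 0 ≤ K i)
    (hK : ∀ i x, |ψ i x| ≤ K i * weight x) {τ : ℝ} (hτ : 0 < τ) (ht : ∀ i, t i ≤ τ) :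
    Tendsto (fun T => ∫ ω, Complex.exp (((F T)⁻¹ *
        totalFluct θ ρ η P (T * τ) (stepFun (fun i => T * t i) ψ) ω : ℝ) * Complex.I) ∂P) atTop
      (𝓝 (Real.exp (-((∑ i, ∑ j, q (ψ i) (ψ j) * limCov γ (∫ ω, (θ 0 ω : ℝ) ∂P)
        (variance (fun ω => (θ 0 ω : ℝ)) P) (t i) (t j)) / 2)) : ℝ)) := by
  set L := ∑ i, ∑ j, q (ψ i) (ψ j) * limCov γ (∫ ω, (θ 0 ω : ℝ) ∂P)
        (variance (fun ω => (θ 0 ω : ℝ)) P) (t i) (t j) with hL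
  -- Adding one keeps the constant positive even when all test functions vanish or there are none.
  set K1 : ℝ := (∑ i, K i) + 1 with hK1
  have hKs : 0 ≤ ∑ i, K i := Finset.sum_nonneg fun i _ => hK0 i
  have hK1pos : 0 < K1 := by linarith
  set g : ℝ → ℝ → ℝ → ℝ := fun T => stepFun (fun i => T * t i) ψ with hg
  have hgm (T : ℝ) : Measurable (Function.uncurry (g T)) := measurable_stepFun hψ
  have hgK (T s x : ℝ) : |g T s x| ≤ K1 * weight x := by
    refine (abs_stepFun_le hK s x).trans (mul_le_mul_of_nonneg_right ?_ (weight_pos x).le)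
    linarith
  obtain ⟨C, hC, hvar⟩ := h.exists_abs_tsum_variance_sub_le hν hα
  have hU := hF.tendsto_totalRate_div hα hτ
  obtain ⟨M, hM⟩ := hF.bounded τ hτ
  set V : ℝ → ℝ := fun T => ∑' j, variance (cellOcc θ ρ η (T * τ) (g T) j) P with hV
  have hVlim : Tendsto (fun T => (F T)⁻¹ ^ 2 * V T) atTop (𝓝 L) := by
    have h1 := hF.tendsto_mainVar hν hα t hψ hK0 hK ht (∫ ω, (θ 0 ω : ℝ) ∂P)
      (variance (fun ω => (θ 0 ω : ℝ)) P)
    refine h1.congr_dist ?_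
    have h2 := (hU.pow 2).const_mul (C * K1 ^ 2)
    rw [zero_pow two_ne_zero, mul_zero] at h2
    refine squeeze_zero' (Eventually.of_forall fun T => dist_nonneg) ?_ h2
    filter_upwards [eventually_gt_atTop 0, hF.pos] with T hT hFT
    have h3 := hvar (T * τ) K1 (g T) (mul_pos hT hτ) hK1pos (hgm T) (hgK T)
    rw [dist_comm, Real.dist_eq, inv_pow, ← mul_sub, abs_mul, abs_of_pos (by positivity)]
    refine (mul_le_mul_of_nonneg_left h3 (by positivity)).trans (le_of_eq ?_)
    rw [div_pow]
    ring
  have hexp : Tendsto (fun T => ((Real.exp (-(((F T)⁻¹ ^ 2 * V T) / 2)) : ℝ) : ℂ)) atTop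
      (𝓝 ((Real.exp (-(L / 2)) : ℝ) : ℂ)) := by
    have hc : Continuous fun x : ℝ => ((Real.exp (-(x / 2)) : ℝ) : ℂ) := by fun_prop
    exact (hc.tendsto L).comp hVlim
  refine hexp.congr_dist ?_
  set D : ℝ := 40 * K1 ^ 3 * ((∫ ω, (θ 0 ω : ℝ) ^ 3 ∂P) * (72 * decayConst α ^ 2 * (τ * Real.pi))) with hD
  have hD0 : 0 ≤ D := by
    have : 0 ≤ ∫ ω, (θ 0 ω : ℝ) ^ 3 ∂P := integral_nonneg fun ω => by positivity
    positivity
  have h2 := hU.const_mul (D * M)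
  rw [mul_zero] at h2
  refine squeeze_zero' (Eventually.of_forall fun T => dist_nonneg) ?_ h2
  filter_upwards [eventually_gt_atTop 0, hF.pos, hM] with T hT hFT hMT
  rw [dist_comm, dist_eq_norm]
  refine (h.norm_integral_exp_totalFluct_sub_le hν hα (mul_pos hT hτ) hK1pos.le (hgm T) (hgK T)
    (inv_nonneg.2 hFT.le)).trans ?_
  have hUF : 0 ≤ totalRate α (T * τ) / F T := div_nonneg (totalRate_nonneg _ _) hFT.le
  calc _ = D * (T * totalRate α (T * τ) / F T ^ 2) * (totalRate α (T * τ) / F T) := by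
        rw [hD]; field_simp
    _ ≤ D * M * (totalRate α (T * τ) / F T) := by gcongr

end

/-! ### Occupation measures -/

theorem abs_le_seminorm_mul_weight (φ : 𝓢(ℝ, ℝ)) (x : ℝ) :
    |φ x| ≤ (SchwartzMap.seminorm ℝ 0 0 φ + SchwartzMap.seminorm ℝ 2 0 φ) * weight x := by
  have a0 := SchwartzMap.le_seminorm' ℝ 0 0 φ x
  have a2 := SchwartzMap.le_seminorm' ℝ 2 0 φ x
  simp only [iteratedDeriv_zero, pow_zero, one_mul, Real.norm_eq_abs, sq_abs] at a0 a2
  rw [weight, ← div_eq_mul_inv, le_div_iff₀ (by positivity)]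
  linarith

theorem exists_abs_le_weight (φ : 𝓢(ℝ, ℝ)) : ∃ K, 0 ≤ K ∧ ∀ x, |φ x| ≤ K * weight x :=
  ⟨_, add_nonneg (apply_nonneg _ _) (apply_nonneg _ _), abs_le_seminorm_mul_weight φ⟩

theorem hasTemperateGrowth_of_lintegral_weight {M : Measure ℝ}
    (h : ∫⁻ x, ENNReal.ofReal (weight x) ∂M ≠ ∞) : M.HasTemperateGrowth := by
  have hw : Integrable weight M :=
    ⟨measurable_weight.aestronglyMeasurable, by
      rw [hasFiniteIntegral_iff_ofReal (Eventually.of_forall fun x => (weight_pos x).le)]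
      exact h.lt_top⟩
  refine ⟨2, hw.mono' (Measurable.aestronglyMeasurable (by fun_prop)) (Eventually.of_forall fun x => ?_)⟩
  have h1 : 0 ≤ |x| := abs_nonneg x
  rw [Real.norm_eq_abs, Real.norm_eq_abs, abs_of_nonneg (by positivity), Nat.cast_ofNat,
    Real.rpow_neg (by positivity), weight]
  refine inv_anti₀ (by positivity) ?_
  rw [Real.rpow_two, ← sq_abs x]
  nlinarith

/-- `Λ` describes the measure on nonnegative functions only and is not assumed additive, so a signed
function is treated through its positive and negative parts. -/
theorem integral_eq_of_lintegral {M : Measure ℝ} {Λ : (ℝ → ℝ) → ℝ}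
    (hM : ∀ (K : ℝ) (g : ℝ → ℝ), 0 ≤ K → Measurable g → (∀ x, 0 ≤ g x) → (∀ x, |g x| ≤ K * weight x) →
      ∫⁻ x, ENNReal.ofReal (g x) ∂M = ENNReal.ofReal (Λ g) ∧ 0 ≤ Λ g)
    {K : ℝ} {g : ℝ → ℝ} (hK : 0 ≤ K) (hg : Measurable g) (hgK : ∀ x, |g x| ≤ K * weight x) :
    ∫ x, g x ∂M = Λ (fun x => max (g x) 0) - Λ (fun x => max (-g x) 0) := by
  have hpos : ∀ x, |max (g x) 0| ≤ K * weight x := fun x =>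
    (abs_max_le_max_abs_abs).trans (by
      rw [abs_zero, max_eq_left (abs_nonneg _)]; exact hgK x)
  have hneg : ∀ x, |max (-g x) 0| ≤ K * weight x := fun x =>
    (abs_max_le_max_abs_abs).trans (by
      rw [abs_zero, max_eq_left (abs_nonneg _), abs_neg]; exact hgK x)
  obtain ⟨h1, h1'⟩ := hM K _ hK (hg.max measurable_const) (fun x => le_max_right _ _) hpos
  obtain ⟨h2, h2'⟩ := hM K (fun x => max (-g x) 0) hK (hg.neg.max measurable_const) (fun x => le_max_right _ _) hneg
  have hi : Integrable g M := by
    have h3 := (hM 1 weight zero_le_one measurable_weight (fun x => (weight_pos x).le)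
      (fun x => by rw [one_mul, abs_of_pos (weight_pos x)])).1
    have hw : Integrable weight M := ⟨measurable_weight.aestronglyMeasurable, by
      rw [hasFiniteIntegral_iff_ofReal (Eventually.of_forall fun x => (weight_pos x).le), h3]
      exact ENNReal.ofReal_lt_top⟩
    exact (hw.const_mul K).mono' hg.aestronglyMeasurable (Eventually.of_forall hgK)
  rw [integral_eq_lintegral_pos_part_sub_lintegral_neg_part hi]
  have e1 (x : ℝ) : ENNReal.ofReal (g x) = ENNReal.ofReal (max (g x) 0) := by
    rw [ENNReal.ofReal_max, ENNReal.ofReal_zero, max_eq_left (by simp)]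
  have e2 (x : ℝ) : ENNReal.ofReal (-g x) = ENNReal.ofReal (max (-g x) 0) := by
    rw [ENNReal.ofReal_max, ENNReal.ofReal_zero, max_eq_left (by simp)]
  simp_rw [e1, e2]
  rw [h1, h2, ENNReal.toReal_ofReal h1', ENNReal.toReal_ofReal h2']

section

variable {Ω : Type*} [MeasurableSpace Ω] {P : Measure Ω} [IsProbabilityMeasure P] {α : ℝ}
  {θ : ℤ → Ω → ℕ} {ρ : ℤ → (k : ℕ) → Ω → Fin k → ℝ} {η : ℤ × ℕ → ℝ≥0 → Ω → ℝ} {ν : Kernel ℝ ℝ}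
  {S K : ℝ}

/-- The position at time `s` of the `n`-th particle of a cell. -/
noncomputable def particlePos (θ : ℤ → Ω → ℕ) (ρ : ℤ → (k : ℕ) → Ω → Fin k → ℝ)
    (η : ℤ × ℕ → ℝ≥0 → Ω → ℝ) (j : ℤ) (n : ℕ) (p : ℝ × Ω) : ℝ :=
  cellPos j (cellInit θ ρ j p.2) n + decode (codedPath (η (j, n)) p.2) p.1

/-- A jointly measurable version of the empirical process. -/
noncomputable def empDecode (θ : ℤ → Ω → ℕ) (ρ : ℤ → (k : ℕ) → Ω → Fin k → ℝ)
    (η : ℤ × ℕ → ℝ≥0 → Ω → ℝ) (p : ℝ × Ω) : Measure ℝ :=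
  Measure.sum fun j : ℤ =>
    ∑ n ∈ Finset.range (θ j p.2), Measure.dirac (particlePos θ ρ η j n p)

theorem lintegral_empDecode {f : ℝ → ℝ≥0∞} (hf : Measurable f) (p : ℝ × Ω) :
    ∫⁻ x, f x ∂empDecode θ ρ η p =
      ∑' j, ∑ n ∈ Finset.range (θ j p.2), f (particlePos θ ρ η j n p) := by
  rw [empDecode, lintegral_sum_measure]
  congr 1
  funext j
  rw [lintegral_finsetSum_measure]
  simp only [lintegral_dirac' _ hf]

namespace IsStableSystem

theorem measurable_particlePos (h : IsStableSystem α θ ρ η P) (j : ℤ) (n : ℕ) :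
    Measurable (particlePos θ ρ η j n) := by
  have h1 : Measurable fun p : ℝ × Ω => (codedPath (η (j, n)) p.2, p.1) :=
    ((measurable_codedPath (h.motion (j, n)).measurable).comp measurable_snd).prodMk measurable_fst
  exact ((measurable_cellPos j n).comp ((h.initial.measurable_cellInit j).comp measurable_snd)).add
    (Measurable.comp (g := fun p : (ℕ × ℕ → ℝ) × ℝ => decode p.1 p.2) measurable_decode h1)

theorem measurable_lintegral_empDecode (h : IsStableSystem α θ ρ η P) {f : ℝ → ℝ≥0∞}
    (hf : Measurable f) : Measurable fun p : ℝ × Ω => ∫⁻ x, f x ∂empDecode θ ρ η p := by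
  simp_rw [lintegral_empDecode hf]
  refine Measurable.tsum fun j => ?_
  exact measurable_sum_range ((h.initial.measurable_number j).comp measurable_snd)
    fun n => hf.comp (h.measurable_particlePos j n)

theorem measurable_empDecode (h : IsStableSystem α θ ρ η P) : Measurable (empDecode θ ρ η) := by
  refine Measure.measurable_of_measurable_coe _ fun s hs => ?_
  have := h.measurable_lintegral_empDecode (f := s.indicator 1) (measurable_one.indicator hs)
  simpa only [lintegral_indicator_one hs] using this

/-- The equality holds at all times simultaneously off one null set, so the measurable version may
replace the empirical process inside the time integral as well as inside the expectation. -/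
theorem ae_empirical_eq (h : IsStableSystem α θ ρ η P) :
    ∀ᵐ ω ∂P, ∀ s, 0 ≤ s → empirical θ ρ η s.toNNReal ω = empDecode θ ρ η (s, ω) := by
  have h1 : ∀ᵐ ω ∂P, ∀ i, ∀ s, 0 ≤ s → decode (codedPath (η i) ω) s = η i s.toNNReal ω :=
    ae_all_iff.2 fun i => (h.motion i).ae_decode_eq
  filter_upwards [h1] with ω hω s hs
  rw [empirical, empDecode]
  congr 1
  funext j
  rw [← Fin.sum_univ_eq_sum_range (fun n => Measure.dirac (particlePos θ ρ η j n (s, ω)))]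
  refine Finset.sum_congr rfl fun n _ => ?_
  rw [particlePos, h.initial.cellPos_cellInit j ω n, hω _ s hs]

theorem lintegral_bind_empDecode (h : IsStableSystem α θ ρ η P) (S : ℝ) {g : ℝ → ℝ}
    (hg : Measurable g) (hg0 : ∀ x, 0 ≤ g x) (hgK : ∀ x, |g x| ≤ K * weight x) (hK : 0 ≤ K) (ω : Ω) :
    ∫⁻ s in Set.Ioc 0 S, ∫⁻ x, ENNReal.ofReal (g x) ∂empDecode θ ρ η (s, ω) =
      ∑' j, ENNReal.ofReal (cellOcc θ ρ η S (fun _ => g) j ω) := by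
  have hpm (j : ℤ) (n : ℕ) : Measurable fun s : ℝ => particlePos θ ρ η j n (s, ω) :=
    (h.measurable_particlePos j n).comp measurable_prodMk_right
  have hgm (j : ℤ) (n : ℕ) : Measurable fun s : ℝ => ENNReal.ofReal (g (particlePos θ ρ η j n (s, ω))) :=
    (hg.comp (hpm j n)).ennreal_ofReal
  simp_rw [lintegral_empDecode hg.ennreal_ofReal]
  rw [lintegral_tsum fun j => (Finset.measurable_fun_sum _ fun n _ => hgm j n).aemeasurable]
  congr 1
  funext j
  have hocc (n : ℕ) : 0 ≤ occ decode S (fun _ => g) (cellPos j (cellInit θ ρ j ω) n)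
      (codedPath (η (j, n)) ω) := integral_nonneg fun s => hg0 _
  rw [lintegral_finsetSum _ fun n _ => hgm j n, cellOcc, cellSum]
  refine Eq.trans ?_ (ENNReal.ofReal_sum_of_nonneg fun n _ => hocc n).symm
  refine Finset.sum_congr rfl fun n _ => ?_
  rw [occ, ofReal_integral_eq_lintegral_ofReal]
  · rfl
  · refine Integrable.of_bound (C := K) ((hg.comp (hpm j n)).aestronglyMeasurable)
      (Eventually.of_forall fun s => ?_)
    exact (hgK _).trans (mul_le_of_le_one_right hK (weight_le_one _))
  · exact Eventually.of_forall fun s => hg0 _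

theorem cellOcc_max_sub (h : IsStableSystem α θ ρ η P) {g : ℝ → ℝ} (hg : Measurable g)
    (hgK : ∀ x, |g x| ≤ K * weight x) (hK : 0 ≤ K) (j : ℤ) (ω : Ω) :
    cellOcc θ ρ η S (fun _ x => max (g x) 0) j ω - cellOcc θ ρ η S (fun _ x => max (-g x) 0) j ω =
      cellOcc θ ρ η S (fun _ => g) j ω := by
  have hpm (n : ℕ) : Measurable fun s : ℝ => particlePos θ ρ η j n (s, ω) :=
    (h.measurable_particlePos j n).comp measurable_prodMk_right
  simp only [cellOcc, cellSum]
  rw [← Finset.sum_sub_distrib]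
  refine Finset.sum_congr rfl fun n _ => ?_
  have hb (x : ℝ) : |g x| ≤ K := (hgK x).trans (mul_le_of_le_one_right hK (weight_le_one _))
  have hint {f : ℝ → ℝ} (hf : Measurable f) (hfK : ∀ x, |f x| ≤ K) :
      Integrable (fun s => f (particlePos θ ρ η j n (s, ω))) (volume.restrict (Set.Ioc 0 S)) :=
    Integrable.of_bound (C := K) ((hf.comp (hpm n)).aestronglyMeasurable)
      (Eventually.of_forall fun s => hfK _)
  have h1 := hint (hg.max measurable_const) (f := fun x => max (g x) 0) fun x =>
    (abs_max_le_max_abs_abs).trans (by rw [abs_zero, max_eq_left (abs_nonneg _)]; exact hb x)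
  have h2 := hint (hg.neg.max measurable_const) (f := fun x => max (-g x) 0) fun x =>
    (abs_max_le_max_abs_abs).trans (by
      rw [abs_zero, max_eq_left (abs_nonneg _), abs_neg]; exact hb x)
  have h3 := integral_sub h1 h2
  refine Eq.trans h3.symm ?_
  refine integral_congr_ae (Eventually.of_forall fun s => ?_)
  exact max_zero_sub_max_neg_zero_eq_self _

theorem ae_lintegral_occupation (h : IsStableSystem α θ ρ η P) (hν : IsStableKernel α ν)
    (hα : 0 < α) (hS : 0 < S) : ∀ᵐ ω ∂P, ∀ (K : ℝ) (g : ℝ → ℝ), 0 ≤ K → Measurable g → (∀ x, 0 ≤ g x) →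
      (∀ x, |g x| ≤ K * weight x) →
      ∫⁻ x, ENNReal.ofReal (g x)
        ∂((volume.restrict (Set.Ioc (0 : ℝ) S)).bind fun s => empirical θ ρ η s.toNNReal ω) =
      ENNReal.ofReal (∑' j, cellOcc θ ρ η S (fun _ => g) j ω) ∧
      0 ≤ ∑' j, cellOcc θ ρ η S (fun _ => g) j ω := by
  filter_upwards [h.ae_empirical_eq, h.ae_hasSum_cellOcc hν hα hS] with ω h1 h2 K g hK hg hg0 hgK
  have hnn (j : ℤ) : 0 ≤ cellOcc θ ρ η S (fun _ => g) j ω := by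
    unfold cellOcc cellSum
    exact Finset.sum_nonneg fun n _ => integral_nonneg fun s => hg0 _
  have hm : Measurable fun s : ℝ => empDecode θ ρ η (s, ω) :=
    h.measurable_empDecode.comp measurable_prodMk_right
  have e : ((volume.restrict (Set.Ioc (0 : ℝ) S)).bind fun s => empirical θ ρ η s.toNNReal ω) =
      (volume.restrict (Set.Ioc (0 : ℝ) S)).bind fun s => empDecode θ ρ η (s, ω) := by
    refine Measure.bind_congr_right ?_
    filter_upwards [ae_restrict_mem measurableSet_Ioc] with s hs
    exact h1 s hs.1.le
  refine ⟨?_, tsum_nonneg hnn⟩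
  rw [e, Measure.lintegral_bind hm.aemeasurable hg.ennreal_ofReal.aemeasurable,
    h.lintegral_bind_empDecode S hg hg0 hgK hK,
    ENNReal.ofReal_tsum_of_nonneg hnn (h2 K (fun _ => g) hK fun _ => hgK).1]

theorem lintegral_mean_occupation (h : IsStableSystem α θ ρ η P) (hν : IsStableKernel α ν)
    (hα : 0 < α) (hS : 0 < S) {g : ℝ → ℝ} (hK : 0 ≤ K) (hg : Measurable g) (hg0 : ∀ x, 0 ≤ g x)
    (hgK : ∀ x, |g x| ≤ K * weight x) :
      ∫⁻ x, ENNReal.ofReal (g x)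
        ∂((volume.restrict (Set.Ioc (0 : ℝ) S)).bind fun s => P.bind (empirical θ ρ η s.toNNReal)) =
      ENNReal.ofReal (∑' j, ∫ ω, cellOcc θ ρ η S (fun _ => g) j ω ∂P) ∧
      0 ≤ ∑' j, ∫ ω, cellOcc θ ρ η S (fun _ => g) j ω ∂P := by
  have hnn (j : ℤ) (ω : Ω) : 0 ≤ cellOcc θ ρ η S (fun _ => g) j ω := by
    unfold cellOcc cellSum
    exact Finset.sum_nonneg fun n _ => integral_nonneg fun s => hg0 _
  have hgm : Measurable (Function.uncurry fun _ : ℝ => g) := hg.comp measurable_snd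
  have hm := h.measurable_empDecode
  have hmω (s : ℝ) : Measurable fun ω => empDecode θ ρ η (s, ω) := hm.comp measurable_prodMk_left
  have e : ((volume.restrict (Set.Ioc (0 : ℝ) S)).bind fun s => P.bind (empirical θ ρ η s.toNNReal)) =
      (volume.restrict (Set.Ioc (0 : ℝ) S)).bind fun s => P.bind fun ω => empDecode θ ρ η (s, ω) := by
    refine Measure.bind_congr_right ?_
    filter_upwards [ae_restrict_mem measurableSet_Ioc] with s hs
    refine Measure.bind_congr_right ?_
    filter_upwards [h.ae_empirical_eq] with ω h1
    exact h1 s hs.1.le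
  have hbm : Measurable fun s : ℝ => P.bind fun ω => empDecode θ ρ η (s, ω) := by
    refine Measure.measurable_of_measurable_coe _ fun A hA => ?_
    have hb (s : ℝ) : (P.bind fun ω => empDecode θ ρ η (s, ω)) A = ∫⁻ ω, empDecode θ ρ η (s, ω) A ∂P :=
      Measure.bind_apply hA (hmω s).aemeasurable
    simp_rw [hb]
    exact ((Measure.measurable_coe hA).comp hm).lintegral_prod_right'
  refine ⟨?_, tsum_nonneg fun j => integral_nonneg (hnn j)⟩
  have hgo := hg.ennreal_ofReal
  rw [e, Measure.lintegral_bind hbm.aemeasurable hgo.aemeasurable]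
  have hb (s : ℝ) : ∫⁻ x, ENNReal.ofReal (g x) ∂(P.bind fun ω => empDecode θ ρ η (s, ω)) =
      ∫⁻ ω, ∫⁻ x, ENNReal.ofReal (g x) ∂empDecode θ ρ η (s, ω) ∂P :=
    Measure.lintegral_bind (hmω s).aemeasurable hgo.aemeasurable
  simp_rw [hb]
  rw [lintegral_lintegral_swap (h.measurable_lintegral_empDecode hgo).aemeasurable]
  simp_rw [h.lintegral_bind_empDecode S hg hg0 hgK hK]
  rw [lintegral_tsum fun j => (h.measurable_cellOcc hgm j).ennreal_ofReal.aemeasurable,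
    ENNReal.ofReal_tsum_of_nonneg (fun j => integral_nonneg (hnn j))
      (h.summable_integral_cellOcc hν hα hS fun _ => hgK)]
  congr 1
  funext j
  exact (ofReal_integral_eq_lintegral_ofReal (h.integrable_cellOcc hS.le hK hgm (fun _ => hgK) j)
    (Eventually.of_forall (hnn j))).symm

/-- The cell contributions and their means are summable separately, so the centered series splits
into the integral against the occupation measure minus that against its mean. The null set does not
depend on the function. -/
theorem ae_totalFluct_eq (h : IsStableSystem α θ ρ η P) (hν : IsStableKernel α ν)
    (hα : 0 < α) (hS : 0 < S) : ∀ᵐ ω ∂P, ∃ M₁ M₂ : Measure ℝ,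
      (M₁ = (volume.restrict (Set.Ioc (0 : ℝ) S)).bind fun s => empirical θ ρ η s.toNNReal ω) ∧
      (M₂ = (volume.restrict (Set.Ioc (0 : ℝ) S)).bind fun s => P.bind (empirical θ ρ η s.toNNReal)) ∧
      ∫⁻ x, ENNReal.ofReal (weight x) ∂M₁ ≠ ∞ ∧ ∫⁻ x, ENNReal.ofReal (weight x) ∂M₂ ≠ ∞ ∧
      ∀ (K : ℝ) (g : ℝ → ℝ), 0 ≤ K → Measurable g → (∀ x, |g x| ≤ K * weight x) →
        totalFluct θ ρ η P S (fun _ => g) ω = ∫ x, g x ∂M₁ - ∫ x, g x ∂M₂ := by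
  filter_upwards [h.ae_lintegral_occupation hν hα hS, h.ae_hasSum_cellOcc hν hα hS] with ω h1 h2
  have h3 := fun (K : ℝ) (g : ℝ → ℝ) (hK : 0 ≤ K) (hg : Measurable g) (hg0 : ∀ x, 0 ≤ g x)
    (hgK : ∀ x, |g x| ≤ K * weight x) => h.lintegral_mean_occupation hν hα hS hK hg hg0 hgK
  have hw1 : ∀ x, |weight x| ≤ 1 * weight x := fun x => by rw [one_mul, abs_of_pos (weight_pos x)]
  refine ⟨_, _, rfl, rfl, ?_, ?_, fun K φ hK hφm hφ => ?_⟩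
  · rw [(h1 1 weight zero_le_one measurable_weight (fun x => (weight_pos x).le) hw1).1]
    exact ENNReal.ofReal_ne_top
  · rw [(h3 1 weight zero_le_one measurable_weight (fun x => (weight_pos x).le) hw1).1]
    exact ENNReal.ofReal_ne_top
  rw [integral_eq_of_lintegral h1 hK hφm hφ, integral_eq_of_lintegral h3 hK hφm hφ, totalFluct]
  have hb {f : ℝ → ℝ} (hf : ∀ x, |f x| ≤ |φ x|) (x : ℝ) : |max (f x) 0| ≤ K * weight x :=
    (abs_max_le_max_abs_abs).trans (by
      rw [abs_zero, max_eq_left (abs_nonneg _)]; exact (hf x).trans (hφ x))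
  have hp1 : ∀ x, |max (φ x) 0| ≤ K * weight x := hb fun x => le_rfl
  have hp2 : ∀ x, |max (-φ x) 0| ≤ K * weight x := hb (f := fun x => -φ x) fun x => (abs_neg _).le
  have s1 := (h2 K (fun _ x => max (φ x) 0) hK fun _ => hp1).1
  have s2 := (h2 K (fun _ x => max (-φ x) 0) hK fun _ => hp2).1
  have s3 := h.summable_integral_cellOcc hν hα hS (g := fun _ x => max (φ x) 0) fun _ => hp1
  have s4 := h.summable_integral_cellOcc hν hα hS (g := fun _ x => max (-φ x) 0) fun _ => hp2
  rw [← s1.tsum_sub s2, ← s3.tsum_sub s4, ← (s1.sub s2).tsum_sub (s3.sub s4)]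
  congr 1
  funext j
  have m1 : Measurable (Function.uncurry fun (_ : ℝ) x => max (φ x) 0) :=
    (hφm.max measurable_const).comp measurable_snd
  have m2 : Measurable (Function.uncurry fun (_ : ℝ) x => max (-φ x) 0) :=
    (hφm.neg.max measurable_const).comp measurable_snd
  rw [h.cellOcc_max_sub hφm hφ hK, ← integral_sub (h.integrable_cellOcc hS.le hK m1 (fun _ => hp1) j)
    (h.integrable_cellOcc hS.le hK m2 (fun _ => hp2) j)]
  simp only [h.cellOcc_max_sub hφm hφ hK]

theorem ae_fluctuation_apply (h : IsStableSystem α θ ρ η P) (hν : IsStableKernel α ν)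
    (hα : 0 < α) (F : ℝ → ℝ) (T : ℝ) (t : ℝ≥0) : ∀ᵐ ω ∂P, ∀ φ : 𝓢(ℝ, ℝ),
      fluctuation (empirical θ ρ η) P F T t ω φ =
        (F T)⁻¹ * totalFluct θ ρ η P (T * t) (fun _ => φ) ω := by
  -- With an empty time interval both sides are zero; the other lemmas need a positive horizon.
  rcases le_or_gt (T * t) 0 with hS | hS
  · refine Eventually.of_forall fun ω φ => ?_
    rw [fluctuation, totalFluct]
    simp [Set.Ioc_eq_empty (not_lt.2 hS), cellOcc, cellSum, occ]
  filter_upwards [h.ae_totalFluct_eq hν hα hS] with ω hω φ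
  obtain ⟨M₁, M₂, h1, h2, hw1, hw2, hM⟩ := hω
  obtain ⟨K, hK, hφ⟩ := exists_abs_le_weight φ
  have i1 := hasTemperateGrowth_of_lintegral_weight hw1
  have i2 := hasTemperateGrowth_of_lintegral_weight hw2
  have e : fluctuation (empirical θ ρ η) P F T t ω φ = (F T)⁻¹ * (toDist M₁ φ - toDist M₂ φ) := by
    rw [h1, h2]
    rfl
  rw [e, toDist_apply, toDist_apply, hM K φ hK φ.continuous.measurable hφ]

end IsStableSystem

end

/-! ### A bound that is uniform in the test function -/

/-- The weight restricted to `[y, ∞)`. -/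
noncomputable def cutWeight (y x : ℝ) : ℝ := if y ≤ x then weight x else 0

theorem measurable_cutWeight : Measurable (Function.uncurry cutWeight) :=
  Measurable.ite (measurableSet_le measurable_fst measurable_snd)
    (measurable_weight.comp measurable_snd) measurable_const

theorem abs_cutWeight_le (y x : ℝ) : |cutWeight y x| ≤ 1 * weight x := by
  rw [one_mul, cutWeight]
  split_ifs
  · rw [abs_of_pos (weight_pos x)]
  · rw [abs_zero]
    exact (weight_pos x).le

/-- The map `φ ↦ ((1 + x²) φ)'`. -/
noncomputable def testDeriv : 𝓢(ℝ, ℝ) →L[ℝ] 𝓢(ℝ, ℝ) :=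
  (SchwartzMap.derivCLM ℝ ℝ).comp (SchwartzMap.smulLeftCLM ℝ (fun x : ℝ => 1 + x ^ 2))

/-- The size of a test function. -/
noncomputable def testNorm (φ : 𝓢(ℝ, ℝ)) : ℝ :=
  SchwartzMap.seminorm ℝ 0 0 (testDeriv φ) + SchwartzMap.seminorm ℝ 2 0 (testDeriv φ)

theorem tendsto_testNorm : Tendsto testNorm (𝓝 0) (𝓝 0) := by
  have hc (k : ℕ) : Continuous fun φ => SchwartzMap.seminorm ℝ k 0 (testDeriv φ) :=
    ((schwartz_withSeminorms ℝ ℝ ℝ).continuous_seminorm (k, 0)).comp testDeriv.continuous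
  have hcont : Continuous testNorm := (hc 0).add (hc 2)
  exact hcont.tendsto' 0 0 (by simp [testNorm])

/-- The fundamental theorem of calculus for `(1 + x²) φ(x)`, divided by `1 + x²`. -/
theorem eq_integral_testDeriv (φ : 𝓢(ℝ, ℝ)) (x : ℝ) :
    φ x = weight x * ∫ y, testDeriv φ y * (if y ≤ x then 1 else 0) := by
  set ψ : 𝓢(ℝ, ℝ) := SchwartzMap.smulLeftCLM ℝ (fun x : ℝ => 1 + x ^ 2) φ with hψ
  have hψx (x : ℝ) : ψ x = (1 + x ^ 2) * φ x := by
    rw [hψ, SchwartzMap.smulLeftCLM_apply_apply (by fun_prop), smul_eq_mul]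
  have hint : Integrable (fun y => deriv ψ y) := (SchwartzMap.derivCLM ℝ ℝ ψ).integrable
  have h0 : Tendsto ψ atBot (𝓝 0) :=
    ψ.tendsto_cocompact.mono_left (_root_.atBot_le_cocompact)
  have h1 : ∫ y in Set.Iic x, deriv ψ y = ψ x - 0 :=
    integral_Iic_of_hasDerivAt_of_tendsto' (fun y _ => ψ.hasDerivAt y) hint.integrableOn h0
  have e : ∫ y, testDeriv φ y * (if y ≤ x then 1 else 0) = ∫ y in Set.Iic x, deriv ψ y := by
    rw [← integral_indicator measurableSet_Iic]
    refine integral_congr_ae (Eventually.of_forall fun y => ?_)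
    by_cases h : y ≤ x
    · simp [h]
      rfl
    · simp [h]
  have hx : (1 + x ^ 2) ≠ 0 := by positivity
  rw [e, h1, sub_zero, hψx, weight, inv_mul_cancel_left₀ hx]

/-- Fubini for the finite measure with density `weight` with respect to `M`. The measure then enters
only through its values on the cut weights. -/
theorem integral_eq_integral_testDeriv {M : Measure ℝ}
    (hM : ∫⁻ x, ENNReal.ofReal (weight x) ∂M ≠ ∞) :
    Measurable (fun y => ∫ x, cutWeight y x ∂M) ∧ (∃ C, ∀ y, |∫ x, cutWeight y x ∂M| ≤ C) ∧
    ∀ φ : 𝓢(ℝ, ℝ), ∫ x, φ x ∂M = ∫ y, testDeriv φ y * ∫ x, cutWeight y x ∂M := by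
  set μ := M.withDensity fun x => ENNReal.ofReal (weight x) with hμ
  have hfin : IsFiniteMeasure μ := isFiniteMeasure_withDensity hM
  have hint (g : ℝ → ℝ) : ∫ x, g x ∂μ = ∫ x, weight x * g x ∂M := by
    rw [hμ, integral_withDensity_eq_integral_toReal_smul measurable_weight.ennreal_ofReal
      (Eventually.of_forall fun x => ENNReal.ofReal_lt_top)]
    refine integral_congr_ae (Eventually.of_forall fun x => ?_)
    simp only
    rw [ENNReal.toReal_ofReal (weight_pos x).le, smul_eq_mul]
  have hcut (y : ℝ) : ∫ x, cutWeight y x ∂M = ∫ x, (if y ≤ x then 1 else 0) ∂μ := by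
    rw [hint]
    refine integral_congr_ae (Eventually.of_forall fun x => ?_)
    simp only [cutWeight]
    split_ifs <;> simp
  have hitem : Measurable fun p : ℝ × ℝ => (if p.1 ≤ p.2 then 1 else 0 : ℝ) :=
    Measurable.ite (measurableSet_le measurable_fst measurable_snd) measurable_const measurable_const
  simp_rw [hcut]
  refine ⟨hitem.stronglyMeasurable.integral_prod_right.measurable, ⟨1 * μ.real Set.univ, fun y => ?_⟩,
    fun φ => ?_⟩
  · exact norm_integral_le_of_norm_le_const (f := fun x => if y ≤ x then (1 : ℝ) else 0)
      (Eventually.of_forall fun x => abs_ite_le_one (y ≤ x))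
  · have h1 : ∫ x, φ x ∂M = ∫ x, (∫ y, testDeriv φ y * (if y ≤ x then 1 else 0)) ∂μ := by
      rw [hint]
      exact integral_congr_ae (Eventually.of_forall fun x => eq_integral_testDeriv φ x)
    rw [h1, integral_integral_swap]
    · simp only [integral_const_mul]
    · have h2 : Integrable (fun p : ℝ × ℝ => testDeriv φ p.2) (μ.prod volume) :=
        (testDeriv φ).integrable.comp_snd μ
      refine h2.mono ((((testDeriv φ).continuous.measurable.comp measurable_snd).mul
        (hitem.comp measurable_swap)).aestronglyMeasurable) (Eventually.of_forall fun p => ?_)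
      rw [Function.uncurry, norm_mul]
      exact mul_le_of_le_one_right (norm_nonneg _) (abs_ite_le_one _)

/-- The factor depending on the measures is the same for all `φ`, and `testNorm` is continuous at
zero. This is what equicontinuity in probability requires. -/
theorem abs_integral_sub_le {M₁ M₂ : Measure ℝ} (h1 : ∫⁻ x, ENNReal.ofReal (weight x) ∂M₁ ≠ ∞)
    (h2 : ∫⁻ x, ENNReal.ofReal (weight x) ∂M₂ ≠ ∞) (φ : 𝓢(ℝ, ℝ)) :
    |∫ x, φ x ∂M₁ - ∫ x, φ x ∂M₂| ≤
      (∫ y, weight y * |∫ x, cutWeight y x ∂M₁ - ∫ x, cutWeight y x ∂M₂|) * testNorm φ := by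
  obtain ⟨m1, ⟨C1, hC1⟩, e1⟩ := integral_eq_integral_testDeriv h1
  obtain ⟨m2, ⟨C2, hC2⟩, e2⟩ := integral_eq_integral_testDeriv h2
  have hi {B : ℝ → ℝ} (hB : Measurable B) {C : ℝ} (hC : ∀ y, |B y| ≤ C) {f : ℝ → ℝ}
      (hf : Integrable f) : Integrable fun y => f y * B y :=
    hf.mul_bdd hB.aestronglyMeasurable (Eventually.of_forall hC)
  have hC (y : ℝ) : |∫ x, cutWeight y x ∂M₁ - ∫ x, cutWeight y x ∂M₂| ≤ C1 + C2 :=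
    (abs_sub _ _).trans (add_le_add (hC1 y) (hC2 y))
  rw [e1, e2, ← integral_sub (hi m1 hC1 (testDeriv φ).integrable) (hi m2 hC2 (testDeriv φ).integrable)]
  simp_rw [← mul_sub]
  rw [← integral_mul_const]
  refine norm_integral_le_of_norm_le (f := fun y => testDeriv φ y *
    (∫ x, cutWeight y x ∂M₁ - ∫ x, cutWeight y x ∂M₂))
    ((hi (m1.sub m2).norm (fun y => (abs_abs _).trans_le (hC y)) integrable_weight).mul_const _)
    (Eventually.of_forall fun y => ?_)
  rw [norm_mul, Real.norm_eq_abs, Real.norm_eq_abs]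
  refine (mul_le_mul_of_nonneg_right (abs_le_seminorm_mul_weight (testDeriv φ) y)
    (abs_nonneg _)).trans (le_of_eq ?_)
  rw [testNorm]
  ring

section

variable {Ω : Type*} [MeasurableSpace Ω] {P : Measure Ω} [IsProbabilityMeasure P] {α : ℝ}
  {θ : ℤ → Ω → ℕ} {ρ : ℤ → (k : ℕ) → Ω → Fin k → ℝ} {η : ℤ × ℕ → ℝ≥0 → Ω → ℝ} {ν : Kernel ℝ ℝ}
  {S K : ℝ}

namespace IsStableSystem

theorem measurable_totalFluct (h : IsStableSystem α θ ρ η P) {X : Type*} [MeasurableSpace X]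
    {g : X → ℝ → ℝ} (hg : Measurable (Function.uncurry g)) (S : ℝ) :
    Measurable fun p : X × Ω => totalFluct θ ρ η P S (fun _ => g p.1) p.2 := by
  have hcell (j : ℤ) : Measurable fun p : X × Ω => cellOcc θ ρ η S (fun _ => g p.1) j p.2 := by
    refine measurable_sum_range ((h.initial.measurable_number j).comp measurable_snd) fun n => ?_
    have h1 : Measurable fun p : (X × Ω) × ℝ => g p.1.1 (particlePos θ ρ η j n (p.2, p.1.2)) := by
      have h2 : Measurable fun p : (X × Ω) × ℝ => (p.1.1, particlePos θ ρ η j n (p.2, p.1.2)) :=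
        (measurable_fst.comp measurable_fst).prodMk ((h.measurable_particlePos j n).comp
          (measurable_snd.prodMk (measurable_snd.comp measurable_fst)))
      exact hg.comp h2
    exact h1.stronglyMeasurable.integral_prod_right.measurable
  refine Measurable.tsum fun j => (hcell j).sub ?_
  have h3 : Measurable fun x : X => ∫ ω, cellOcc θ ρ η S (fun _ => g x) j ω ∂P :=
    (hcell j).stronglyMeasurable.integral_prod_right.measurable
  exact h3.comp measurable_fst

theorem ae_abs_totalFluct_le (h : IsStableSystem α θ ρ η P) (hν : IsStableKernel α ν)
    (hα : 0 < α) (hS : 0 < S) : ∀ᵐ ω ∂P, ∀ φ : 𝓢(ℝ, ℝ), |totalFluct θ ρ η P S (fun _ => φ) ω| ≤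
      (∫ y, weight y * |totalFluct θ ρ η P S (fun _ => cutWeight y) ω|) * testNorm φ := by
  filter_upwards [h.ae_totalFluct_eq hν hα hS] with ω hω φ
  obtain ⟨M₁, M₂, -, -, hw1, hw2, hM⟩ := hω
  obtain ⟨K, hK, hφ⟩ := exists_abs_le_weight φ
  rw [hM K φ hK φ.continuous.measurable hφ]
  have e (y : ℝ) := hM 1 (cutWeight y) zero_le_one (measurable_cutWeight.comp measurable_prodMk_left)
    (abs_cutWeight_le y)
  simp_rw [e]
  exact abs_integral_sub_le hw1 hw2 φ

/-- The second moment bound is uniform in the cut `y`. With `|z| ≤ 1 + z²` and Fubini it bounds the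
mean by the total weight `π` times `1 + M`. -/
theorem integrable_weight_mul_totalFluct (h : IsStableSystem α θ ρ η P) (hν : IsStableKernel α ν)
    (hα : 0 < α) (hS : 0 < S) {c M : ℝ} (hc : 0 ≤ c)
    (hM : c ^ 2 * (((∫ ω, (θ 0 ω : ℝ) ^ 2 ∂P) *
      (72 * (decayConst α * totalRate α S) * (S * Real.pi)))) ≤ M) :
    Integrable (fun ω => c * ∫ y, weight y * |totalFluct θ ρ η P S (fun _ => cutWeight y) ω|) P ∧
    ∫ ω, c * (∫ y, weight y * |totalFluct θ ρ η P S (fun _ => cutWeight y) ω|) ∂P ≤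
      Real.pi * (1 + M) := by
  have hM0 : 0 ≤ M := by
    refine le_trans ?_ hM
    have h1 := decayConst_pos hα
    have h2 := totalRate_nonneg α S
    have h3 : 0 ≤ ∫ ω, (θ 0 ω : ℝ) ^ 2 ∂P := integral_nonneg fun ω => by positivity
    have h4 := Real.pi_pos
    positivity
  set Z : ℝ × Ω → ℝ := fun p => totalFluct θ ρ η P S (fun _ => cutWeight p.1) p.2 with hZ
  have hZm : Measurable Z := h.measurable_totalFluct measurable_cutWeight S
  set G : ℝ × Ω → ℝ := fun p => weight p.1 * |c * Z p| with hG
  have hGm : Measurable G := (measurable_weight.comp measurable_fst).mul ((hZm.const_mul c).norm)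
  have hG0 (p : ℝ × Ω) : 0 ≤ G p := mul_nonneg (weight_pos _).le (abs_nonneg _)
  have hfirst (y : ℝ) : ∫⁻ ω, ENNReal.ofReal |c * Z (y, ω)| ∂P ≤ ENNReal.ofReal (1 + M) := by
    have h1 := h.lintegral_sq_totalFluct_le hν hα hS zero_le_one (g := fun _ => cutWeight y)
      (measurable_cutWeight.comp (measurable_const.prodMk measurable_snd))
      (fun _ => abs_cutWeight_le y)
    have hZy : Measurable fun ω => Z (y, ω) := hZm.comp measurable_prodMk_left
    calc ∫⁻ ω, ENNReal.ofReal |c * Z (y, ω)| ∂P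
        ≤ ∫⁻ ω, (1 + ENNReal.ofReal (c ^ 2) * ENNReal.ofReal (Z (y, ω) ^ 2)) ∂P := by
          refine lintegral_mono fun ω => ?_
          rw [← ENNReal.ofReal_mul (sq_nonneg c), ← ENNReal.ofReal_one,
            ← ENNReal.ofReal_add zero_le_one (by positivity)]
          refine ENNReal.ofReal_le_ofReal ?_
          rw [← mul_pow]
          nlinarith [sq_abs (c * Z (y, ω)), sq_nonneg (|c * Z (y, ω)| - 1), abs_nonneg (c * Z (y, ω))]
      _ = 1 + ENNReal.ofReal (c ^ 2) * ∫⁻ ω, ENNReal.ofReal (Z (y, ω) ^ 2) ∂P := by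
          rw [lintegral_add_left measurable_const, lintegral_const_mul _ (hZy.pow_const 2).ennreal_ofReal]
          simp
      _ ≤ 1 + ENNReal.ofReal M := by
          gcongr
          refine (mul_le_mul_right h1 _).trans ?_
          rw [← ENNReal.ofReal_mul (sq_nonneg c)]
          refine ENNReal.ofReal_le_ofReal ?_
          rwa [one_pow, one_mul]
      _ = ENNReal.ofReal (1 + M) := by
          rw [ENNReal.ofReal_add zero_le_one hM0, ENNReal.ofReal_one]
  have hlint : ∫⁻ p, ENNReal.ofReal (G p) ∂((volume : Measure ℝ).prod P) ≤
      ENNReal.ofReal (Real.pi * (1 + M)) := by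
    rw [lintegral_prod _ hGm.ennreal_ofReal.aemeasurable]
    calc ∫⁻ y, ∫⁻ ω, ENNReal.ofReal (G (y, ω)) ∂P
        ≤ ∫⁻ y, ENNReal.ofReal (weight y) * ENNReal.ofReal (1 + M) := by
          refine lintegral_mono fun y => ?_
          have hm : Measurable fun ω => ENNReal.ofReal |c * Z (y, ω)| :=
            ((hZm.comp measurable_prodMk_left).const_mul c).norm.ennreal_ofReal
          have e (ω : Ω) : ENNReal.ofReal (G (y, ω)) =
            ENNReal.ofReal (weight y) * ENNReal.ofReal |c * Z (y, ω)| :=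
            ENNReal.ofReal_mul (weight_pos y).le
          simp_rw [e]
          rw [lintegral_const_mul _ hm]
          exact mul_le_mul_right (hfirst y) _
      _ = ENNReal.ofReal (Real.pi * (1 + M)) := by
          rw [lintegral_mul_const _ measurable_weight.ennreal_ofReal, lintegral_weight,
            ENNReal.ofReal_mul Real.pi_pos.le]
  have hGi : Integrable G ((volume : Measure ℝ).prod P) := by
    refine ⟨hGm.aestronglyMeasurable, ?_⟩
    rw [hasFiniteIntegral_iff_ofReal (Eventually.of_forall hG0)]
    exact hlint.trans_lt ENNReal.ofReal_lt_top
  have e (ω : Ω) : c * ∫ y, weight y * |totalFluct θ ρ η P S (fun _ => cutWeight y) ω| =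
      ∫ y, G (y, ω) := by
    rw [← integral_const_mul]
    refine integral_congr_ae (Eventually.of_forall fun y => ?_)
    simp only [hG, hZ]
    rw [abs_mul, abs_of_nonneg hc]
    ring
  simp_rw [e]
  refine ⟨hGi.integral_prod_right, ?_⟩
  rw [← integral_prod_symm _ hGi, integral_eq_lintegral_of_nonneg_ae (Eventually.of_forall hG0)
    hGm.aestronglyMeasurable]
  exact ENNReal.toReal_le_of_le_ofReal (mul_nonneg Real.pi_pos.le (by linarith)) hlint

/-! ### Several times combined into one functional. -/

theorem cellOcc_stepFun (h : IsStableSystem α θ ρ η P) {m : ℕ} {A : Fin m → ℝ} {ψ : Fin m → ℝ → ℝ}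
    {K : Fin m → ℝ} (hψ : ∀ i, Measurable (ψ i)) (hK : ∀ i x, |ψ i x| ≤ K i) (hA : ∀ i, 0 ≤ A i)
    (hAS : ∀ i, A i ≤ S) (j : ℤ) (ω : Ω) : cellOcc θ ρ η S (stepFun A ψ) j ω =
      ∑ i, cellOcc θ ρ η (A i) (fun _ => ψ i) j ω := by
  simp only [cellOcc, cellSum]
  rw [Finset.sum_comm]
  refine Finset.sum_congr rfl fun n _ => ?_
  have hpm : Measurable fun s : ℝ => particlePos θ ρ η j n (s, ω) :=
    (h.measurable_particlePos j n).comp measurable_prodMk_right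
  have e : occ decode S (stepFun A ψ) (cellPos j (cellAll θ ρ η j ω).1 n) ((cellAll θ ρ η j ω).2 n) =
      ∫ s in Set.Ioc 0 S, ∑ i, (if s ≤ A i then 1 else 0) * ψ i (particlePos θ ρ η j n (s, ω)) := rfl
  rw [e, integral_finsetSum]
  · refine Finset.sum_congr rfl fun i _ => ?_
    rw [setIntegral_ite_mul (hA i) (hAS i) fun s => ψ i (particlePos θ ρ η j n (s, ω)),
      intervalIntegral.integral_of_le (hA i)]
    rfl
  · intro i _
    refine Integrable.of_bound (C := K i) ((Measurable.ite measurableSet_Iic measurable_const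
      measurable_const).mul ((hψ i).comp hpm)).aestronglyMeasurable (Eventually.of_forall fun s => ?_)
    rw [norm_mul]
    exact (mul_le_of_le_one_left (norm_nonneg _) (abs_ite_le_one _)).trans (hK i _)

/-- Fluctuations up to different times become one fluctuation up to the common horizon `S`, each
test function being switched off at its own time. One central limit estimate then covers all
finite-dimensional distributions. -/
theorem ae_sum_totalFluct (h : IsStableSystem α θ ρ η P) (hν : IsStableKernel α ν)
    (hα : 0 < α) {m : ℕ} {A : Fin m → ℝ} {ψ : Fin m → ℝ → ℝ}
    {K : Fin m → ℝ} (hψ : ∀ i, Measurable (ψ i)) (hK0 : ∀ i, 0 ≤ K i)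
    (hK : ∀ i x, |ψ i x| ≤ K i * weight x) (hA : ∀ i, 0 ≤ A i) (hAS : ∀ i, A i ≤ S) :
    ∀ᵐ ω ∂P, ∑ i, totalFluct θ ρ η P (A i) (fun _ => ψ i) ω =
      totalFluct θ ρ η P S (stepFun A ψ) ω := by
  have hsum (i : Fin m) : ∀ᵐ ω ∂P, Summable fun j => cellOcc θ ρ η (A i) (fun _ => ψ i) j ω -
      ∫ ω', cellOcc θ ρ η (A i) (fun _ => ψ i) j ω' ∂P := by
    rcases (hA i).eq_or_lt with h0 | h0
    · rw [← h0]
      simp [cellOcc, cellSum, occ]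
    · filter_upwards [h.ae_hasSum_cellOcc hν hα h0] with ω hω
      exact (hω (K i) _ (hK0 i) fun _ => hK i).2.summable
  filter_upwards [ae_all_iff.2 hsum] with ω hω
  simp only [totalFluct]
  rw [← Summable.tsum_finsetSum fun i _ => hω i]
  congr 1
  funext j
  have hb (i : Fin m) (x : ℝ) : |ψ i x| ≤ K i :=
    (hK i x).trans (mul_le_of_le_one_right (hK0 i) (weight_le_one _))
  simp_rw [h.cellOcc_stepFun hψ hb hA hAS]
  have hint (i : Fin m) : Integrable (fun ω => cellOcc θ ρ η (A i) (fun _ => ψ i) j ω) P :=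
    h.integrable_cellOcc (g := fun _ => ψ i) (hA i) (hK0 i) ((hψ i).comp measurable_snd)
      (fun _ => hK i) j
  rw [integral_finsetSum _ fun i _ => hint i, Finset.sum_sub_distrib]

end IsStableSystem

end

/-! ### Convergence to a Gaussian process -/

section

variable {T Ω' : Type*} [MeasurableSpace Ω'] {P' : Measure Ω'}

theorem integral_exp_sum_of_isGaussianProcess {X : T → Ω' → ℝ} (hX : IsGaussianProcess X P')
    (h0 : ∀ t, ∫ ω, X t ω ∂P' = 0) {m : ℕ} (p : Fin m → T) :
    ∫ ω, Complex.exp ((∑ i, X (p i) ω : ℝ) * Complex.I) ∂P' =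
      (Real.exp (-((∑ i, ∑ j, ∫ ω, X (p i) ω * X (p j) ω ∂P') / 2)) : ℝ) := by
  have hG : HasGaussianLaw (fun ω => ∑ i, X (p i) ω) P' :=
    (hX.comp_right p).hasGaussianLaw_fun_sum (I := Finset.univ)
  have hint (i : Fin m) : Integrable (X (p i)) P' := (hX.hasGaussianLaw_eval (p i)).integrable
  have hint2 (i j : Fin m) : Integrable (fun ω => X (p i) ω * X (p j) ω) P' :=
    (hX.hasGaussianLaw_eval (p i)).memLp_two.integrable_mul (hX.hasGaussianLaw_eval (p j)).memLp_two
  have hm : ∫ ω, ∑ i, X (p i) ω ∂P' = 0 := by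
    rw [integral_finsetSum _ fun i _ => hint i]
    exact Finset.sum_eq_zero fun i _ => h0 (p i)
  have hv : Var[fun ω => ∑ i, X (p i) ω; P'] = ∑ i, ∑ j, ∫ ω, X (p i) ω * X (p j) ω ∂P' := by
    rw [variance_of_integral_eq_zero hG.aemeasurable hm]
    simp_rw [sq, Finset.sum_mul_sum]
    rw [integral_finsetSum _ fun i _ => integrable_finsetSum _ fun j _ => hint2 i j]
    exact Finset.sum_congr rfl fun i _ => integral_finsetSum _ fun j _ => hint2 i j
  have h1 := hG.charFun_map_eq 1
  have e : (fun ω => inner ℝ (1 : ℝ) (∑ i, X (p i) ω)) = fun ω => ∑ i, X (p i) ω := by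
    simp
  rw [e, hm, hv] at h1
  simp only [charFun_apply_real, Complex.ofReal_one, one_mul] at h1
  rw [integral_map hG.aemeasurable (by fun_prop)] at h1
  rw [h1]
  push_cast
  congr 1
  ring

theorem isGaussianProcess_add_of_indepFun {X Y : T → Ω' → ℝ} (hX : IsGaussianProcess X P')
    (hY : IsGaussianProcess Y P') (h : IndepFun (fun ω t => X t ω) (fun ω t => Y t ω) P') :
    IsGaussianProcess (fun t ω => X t ω + Y t ω) P' where
  hasGaussianLaw I := by
    have hr : Measurable fun f : T → ℝ => I.restrict f := Finset.measurable_restrict I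
    exact ((h.comp hr hr).hasGaussianLaw (hX.hasGaussianLaw I) (hY.hasGaussianLaw I)).add

end

section

variable {Ω Ω' : Type*} [MeasurableSpace Ω] [MeasurableSpace Ω'] {P : Measure Ω}
  [IsProbabilityMeasure P] {P' : Measure Ω'} [IsProbabilityMeasure P'] {α γ : ℝ}
  {θ : ℤ → Ω → ℕ} {ρ : ℤ → (k : ℕ) → Ω → Fin k → ℝ} {η : ℤ × ℕ → ℝ≥0 → Ω → ℝ} {ν : Kernel ℝ ℝ}
  {F : ℝ → ℝ} {q : (ℝ → ℝ) → (ℝ → ℝ) → ℝ}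

namespace IsStableSystem

theorem measurable_totalFluct_const (h : IsStableSystem α θ ρ η P) {f : ℝ → ℝ} (hf : Measurable f)
    (S : ℝ) : Measurable fun ω => totalFluct θ ρ η P S (fun _ => f) ω := by
  have h1 : Measurable (Function.uncurry fun _ : ℝ => f) := hf.comp measurable_snd
  have h2 := h.measurable_totalFluct h1 S
  have h3 : Measurable fun ω : Ω => ((0 : ℝ), ω) := measurable_prodMk_left
  simpa only [Function.comp_def] using h2.comp h3

theorem aemeasurable_fluctuation (h : IsStableSystem α θ ρ η P) (hν : IsStableKernel α ν)
    (hα : 0 < α) (F : ℝ → ℝ) (T : ℝ) (t : ℝ≥0) (φ : 𝓢(ℝ, ℝ)) :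
    AEMeasurable (fun ω => fluctuation (empirical θ ρ η) P F T t ω φ) P := by
  have h2 := h.measurable_totalFluct_const φ.continuous.measurable (T * t)
  refine (h2.const_mul (F T)⁻¹).aemeasurable.congr ?_
  filter_upwards [h.ae_fluctuation_apply hν hα F T t] with ω hω
  exact (hω φ).symm

theorem exists_fluctuation_le (h : IsStableSystem α θ ρ η P) (hν : IsStableKernel α ν)
    (hα : 0 < α) (hF : IsScaling α ν F γ q) (t : ℝ≥0) : ∃ C, ∀ᶠ T in atTop,
      ∃ Ξ : Ω → ℝ, Integrable Ξ P ∧ 0 ≤ Ξ ∧ ∫ ω, Ξ ω ∂P ≤ C ∧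
        ∀ᵐ ω ∂P, ∀ φ, |fluctuation (empirical θ ρ η) P F T t ω φ| ≤ Ξ ω * testNorm φ := by
  rcases eq_zero_or_pos t with rfl | ht
  -- At time zero the horizon is not positive, but the fluctuation vanishes.
  · refine ⟨0, Eventually.of_forall fun T => ⟨fun _ => 0, integrable_zero _ _ _, le_rfl, by simp, ?_⟩⟩
    filter_upwards [h.ae_fluctuation_apply hν hα F T 0] with ω hω φ
    rw [hω]
    simp [totalFluct, cellOcc, cellSum, occ]
  have ht' : (0 : ℝ) < t := ht
  obtain ⟨M, hM⟩ := hF.bounded t ht'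
  set D := (∫ ω, (θ 0 ω : ℝ) ^ 2 ∂P) * 72 * decayConst α * t * Real.pi with hD
  have hD0 : 0 ≤ D := by
    have h1 := decayConst_pos hα
    have h3 : 0 ≤ ∫ ω, (θ 0 ω : ℝ) ^ 2 ∂P := integral_nonneg fun ω => by positivity
    have h4 := Real.pi_pos
    positivity
  refine ⟨Real.pi * (1 + D * M), ?_⟩
  filter_upwards [hM, hF.pos, eventually_gt_atTop 0] with T hT hFT hT0
  have hS : 0 < T * t := mul_pos hT0 ht'
  have hc : 0 ≤ (F T)⁻¹ := (inv_pos.2 hFT).le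
  obtain ⟨hi, hle⟩ := h.integrable_weight_mul_totalFluct hν hα hS hc (M := D * M) (by
    refine le_trans (le_of_eq ?_) (mul_le_mul_of_nonneg_left hT hD0)
    rw [hD]
    field_simp)
  refine ⟨_, hi, fun ω => mul_nonneg hc (integral_nonneg fun y =>
    mul_nonneg (weight_pos y).le (abs_nonneg _)), hle, ?_⟩
  filter_upwards [h.ae_fluctuation_apply hν hα F T t, h.ae_abs_totalFluct_le hν hα hS] with ω h1 h2 φ
  rw [h1, abs_mul, abs_of_nonneg hc, mul_assoc]
  exact mul_le_mul_of_nonneg_left (h2 φ) hc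

/-- The rescaled fluctuations converge to the centered Gaussian process with the limiting
covariance. -/
theorem tendstoFDD (h : IsStableSystem α θ ρ η P) (hν : IsStableKernel α ν)
    (hα : 0 < α) (hF : IsScaling α ν F γ q) {Y : ℝ≥0 → Ω' → TemperedDist}
    (hY : IsGaussianProcess (fun (p : ℝ≥0 × 𝓢(ℝ, ℝ)) (ω : Ω') => Y p.1 ω p.2) P')
    (hY0 : ∀ t φ, ∫ ω, Y t ω φ ∂P' = 0)
    (hcov : ∀ (s t : ℝ≥0) (φ ψ : 𝓢(ℝ, ℝ)), ∫ ω, Y s ω φ * Y t ω ψ ∂P' =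
      q φ ψ * limCov γ (∫ ω, (θ 0 ω : ℝ) ∂P) (variance (fun ω => (θ 0 ω : ℝ)) P) s t) :
    TendstoFDD (fluctuation (empirical θ ρ η) P F) P Y P' := by
  refine tendstoFDD_of_charFun (h.aemeasurable_fluctuation hν hα F) (fun t φ => hY.aemeasurable (t, φ))
    (fun t => ?_) fun m t ψ => ?_
  · obtain ⟨C, hC⟩ := h.exists_fluctuation_le hν hα hF t
    exact ⟨testNorm, C, tendsto_testNorm, hC⟩
  rw [integral_exp_sum_of_isGaussianProcess hY (fun p => hY0 p.1 p.2) fun i => (t i, ψ i)]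
  simp only [hcov]
  choose K hK0 hK using fun i => exists_abs_le_weight (ψ i)
  have hψ (i : Fin m) : Measurable (ψ i) := (ψ i).continuous.measurable
  -- A common horizon that dominates all times and is positive even if they all vanish.
  set τ : ℝ := 1 + ∑ i, (t i : ℝ) with hτ
  have hτ0 : 0 < τ := by
    have : 0 ≤ ∑ i, (t i : ℝ) := Finset.sum_nonneg fun i _ => (t i).coe_nonneg
    linarith
  have ht (i : Fin m) : (t i : ℝ) ≤ τ := by
    have := Finset.single_le_sum (f := fun i => (t i : ℝ)) (fun i _ => (t i).coe_nonneg)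
      (Finset.mem_univ i)
    linarith
  refine (h.tendsto_integral_exp hν hα hF t hψ hK0 hK hτ0 ht).congr' ?_
  filter_upwards [eventually_gt_atTop 0] with T hT
  refine integral_congr_ae ?_
  filter_upwards [ae_all_iff.2 fun i => h.ae_fluctuation_apply hν hα F T (t i),
    h.ae_sum_totalFluct hν hα hψ hK0 hK
      (fun i => mul_nonneg hT.le (t i).coe_nonneg)
      (fun i => mul_le_mul_of_nonneg_left (ht i) hT.le)] with ω h1 h2
  rw [← h2, Finset.mul_sum]
  simp only [h1]

end IsStableSystem

end

/-! ### The limit processes -/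

section

variable {Ω' : Type*} [MeasurableSpace Ω'] {P' : Measure Ω'}

theorem smul_toDist_volume_apply (c : ℝ) (φ : 𝓢(ℝ, ℝ)) :
    (c • toDist volume) φ = (∫ x, φ x) * c := by
  have e : (c • toDist volume) φ = c * toDist volume φ := rfl
  rw [e, toDist_apply, mul_comm]

theorem isGaussianProcess_smul_toDist {X : ℝ≥0 → Ω' → ℝ} (hX : IsGaussianProcess X P') :
    IsGaussianProcess (fun (p : ℝ≥0 × 𝓢(ℝ, ℝ)) (ω : Ω') => (X p.1 ω • toDist volume) p.2) P' := by
  simp_rw [smul_toDist_volume_apply]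
  exact (hX.comp_right Prod.fst).smul fun p : ℝ≥0 × 𝓢(ℝ, ℝ) => ∫ x, p.2 x

/-- For `γ = 1` the factor `(A + B) - A - B` of `v` is zero. Hence the variance of the number of
points leaves no trace when `α ≤ 1`. -/
theorem limCov_one (a v : ℝ) {A B : ℝ} : limCov 1 a v A B = 2 * a * min A B := by
  rw [limCov, min_def]
  simp only [Real.rpow_one]
  split_ifs with h
  · rw [abs_of_nonpos (sub_nonpos.2 h)]
    ring
  · rw [abs_of_nonneg (by linarith)]
    ring

/-- The coefficient of `a` is twice the sub-fractional covariance; `H > 1/2` makes the sign in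
`initCov` positive, so the coefficient of `v` is twice `Q^H`. -/
theorem limCov_eq {H : ℝ} (hH : 1 / 2 < H) (a v A B : ℝ) :
    limCov (2 * H) a v A B = 2 * (a * subFBMCov H A B + v * initCov H A B) := by
  rw [limCov, subFBMCov, initCov, Real.sign_of_pos (by linarith)]
  ring

theorem stableDensity_one_one_zero : stableDensity 1 1 0 = 1 / Real.pi := by
  rw [stableDensity_one_zero one_pos]
  simp

/-- The variance constant of the limit for `α > 1`. -/
theorem sq_limConst {α H : ℝ} (hα : 1 < α) (hH : H = 1 - 1 / (2 * α)) :
    Real.sqrt (Real.Gamma (2 - 2 * H) / (Real.pi * α * H * (2 * H - 1))) ^ 2 =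
      2 * (stableDensity α 1 0 / ((1 - 1 / α) * (2 - 1 / α))) := by
  have hα0 : 0 < α := by linarith
  have h1 : 1 / α < 1 := (div_lt_one hα0).2 hα
  have h2 : 2 - 2 * H = 1 / α := by
    rw [hH]
    field_simp
    ring
  have h3 : 2 * H - 1 = 1 - 1 / α := by linarith
  have h4 : 0 < H := by linarith
  have h5 : 0 < 1 - 1 / α := by linarith
  have hG : 0 < Real.Gamma (1 / α) := Real.Gamma_pos_of_pos (by positivity)
  have hpi := Real.pi_pos
  rw [h2, h3, Real.sq_sqrt (by positivity), stableDensity_one_zero hα0,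
    show 2 - 1 / α = 2 * H by linarith]
  generalize Real.Gamma (1 / α) = G at *
  generalize 1 - 1 / α = c at *
  field_simp

/-- The cross terms vanish because independent centered variables are uncorrelated. -/
theorem integral_mul_of_indepFun [IsProbabilityMeasure P'] {ζ ϑ : ℝ≥0 → Ω' → ℝ}
    {C Q : ℝ → ℝ → ℝ} (hζ : IsCenteredGaussian ζ C P') (hϑ : IsCenteredGaussian ϑ Q P')
    (hi : IndepFun (fun ω t => ζ t ω) (fun ω t => ϑ t ω) P') (a b : ℝ) (s t : ℝ≥0) :
    ∫ ω, (a * ζ s ω + b * ϑ s ω) * (a * ζ t ω + b * ϑ t ω) ∂P' =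
      a ^ 2 * C s t + b ^ 2 * Q s t := by
  have hL1 (r : ℝ≥0) : MemLp (ζ r) 2 P' := (hζ.gaussian.hasGaussianLaw_eval r).memLp_two
  have hL2 (r : ℝ≥0) : MemLp (ϑ r) 2 P' := (hϑ.gaussian.hasGaussianLaw_eval r).memLp_two
  have h0 (r u : ℝ≥0) : ∫ ω, ζ r ω * ϑ u ω ∂P' = 0 := by
    have h1 : IndepFun (ζ r) (ϑ u) P' := hi.comp (measurable_pi_apply r) (measurable_pi_apply u)
    rw [h1.integral_fun_mul_eq_mul_integral (hL1 r).1 (hL2 u).1, hζ.centered, zero_mul]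
  have i1 : Integrable (fun ω => a ^ 2 * (ζ s ω * ζ t ω)) P' :=
    ((hL1 s).integrable_mul (hL1 t)).const_mul _
  have i2 : Integrable (fun ω => b ^ 2 * (ϑ s ω * ϑ t ω)) P' :=
    ((hL2 s).integrable_mul (hL2 t)).const_mul _
  have i3 : Integrable (fun ω => a * b * (ζ s ω * ϑ t ω)) P' :=
    ((hL1 s).integrable_mul (hL2 t)).const_mul _
  have i4 : Integrable (fun ω => a * b * (ζ t ω * ϑ s ω)) P' :=
    ((hL1 t).integrable_mul (hL2 s)).const_mul _
  have e (ω : Ω') : (a * ζ s ω + b * ϑ s ω) * (a * ζ t ω + b * ϑ t ω) =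
      a ^ 2 * (ζ s ω * ζ t ω) + b ^ 2 * (ϑ s ω * ϑ t ω) + a * b * (ζ s ω * ϑ t ω) +
        a * b * (ζ t ω * ϑ s ω) := by ring
  simp_rw [e]
  have i12 : Integrable (fun ω => a ^ 2 * (ζ s ω * ζ t ω) + b ^ 2 * (ϑ s ω * ϑ t ω)) P' := i1.add i2
  rw [integral_add (i12.fun_add i3) i4, integral_add i12 i3, integral_add i1 i2, integral_const_mul,
    integral_const_mul, integral_const_mul, integral_const_mul, h0, h0, hζ.covariance, hϑ.covariance]
  ring

end

section

variable {Ω Ω' : Type*} [MeasurableSpace Ω] [MeasurableSpace Ω'] {P : Measure Ω}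
  [IsProbabilityMeasure P] {P' : Measure Ω'} [IsProbabilityMeasure P'] {α : ℝ}
  {θ : ℤ → Ω → ℕ} {ρ : ℤ → (k : ℕ) → Ω → Fin k → ℝ} {η : ℤ × ℕ → ℝ≥0 → Ω → ℝ}

namespace IsStableSystem

theorem tendstoFDD_of_one_lt (h : IsStableSystem α θ ρ η P) (hα : 1 < α) {H : ℝ}
    (hH : H = 1 - 1 / (2 * α)) {ζ ϑ : ℝ≥0 → Ω' → ℝ} (hζ : IsCenteredGaussian ζ (subFBMCov H) P')
    (hϑ : IsCenteredGaussian ϑ (initCov H) P')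
    (hi : IndepFun (fun ω t => ζ t ω) (fun ω t => ϑ t ω) P') :
    TendstoFDD (fluctuation (empirical θ ρ η) P fun T => T ^ (1 - 1 / (2 * α))) P
      (fun t ω => (Real.sqrt (Real.Gamma (2 - 2 * H) / (Real.pi * α * H * (2 * H - 1))) *
        (Real.sqrt (∫ ω, (θ 0 ω : ℝ) ∂P) * ζ t ω +
          Real.sqrt (variance (fun ω => (θ 0 ω : ℝ)) P) * ϑ t ω)) • toDist volume) P' := by
  obtain ⟨ν, hν⟩ := (h.motion (0, 0)).exists_isStableKernel
  have hα0 : 0 < α := by linarith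
  have hk := sq_limConst hα hH
  set k := Real.sqrt (Real.Gamma (2 - 2 * H) / (Real.pi * α * H * (2 * H - 1)))
  set a := Real.sqrt (∫ ω, (θ 0 ω : ℝ) ∂P) with ha
  set b := Real.sqrt (variance (fun ω => (θ 0 ω : ℝ)) P) with hb
  have ha2 : a ^ 2 = ∫ ω, (θ 0 ω : ℝ) ∂P := Real.sq_sqrt (integral_nonneg fun ω => Nat.cast_nonneg _)
  have hb2 : b ^ 2 = variance (fun ω => (θ 0 ω : ℝ)) P := Real.sq_sqrt (variance_nonneg _ _)
  have hγ : 2 - 1 / α = 2 * H := by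
    rw [hH]
    field_simp
  have hH2 : 1 / 2 < H := by
    have : 1 / α < 1 := (div_lt_one hα0).2 hα
    linarith
  have hG : IsGaussianProcess (fun t ω => a * ζ t ω + b * ϑ t ω) P' := by
    refine isGaussianProcess_add_of_indepFun (hζ.gaussian.smul fun _ => a)
      (hϑ.gaussian.smul fun _ => b) ?_
    exact hi.comp (φ := fun f t => a * f t) (ψ := fun f t => b * f t) (by fun_prop) (by fun_prop)
  refine h.tendstoFDD hν hα0 (isScaling_of_one_lt hν hα)
    (isGaussianProcess_smul_toDist (hG.smul fun _ => k)) (fun t φ => ?_) fun s t φ ψ => ?_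
  · simp_rw [smul_toDist_volume_apply]
    rw [integral_const_mul, integral_const_mul, integral_add, integral_const_mul,
      integral_const_mul, hζ.centered, hϑ.centered]
    · simp
    · exact (hζ.gaussian.hasGaussianLaw_eval t).integrable.const_mul _
    · exact (hϑ.gaussian.hasGaussianLaw_eval t).integrable.const_mul _
  · simp_rw [smul_toDist_volume_apply]
    have e (ω : Ω') : (∫ x, φ x) * (k * (a * ζ s ω + b * ϑ s ω)) *
        ((∫ x, ψ x) * (k * (a * ζ t ω + b * ϑ t ω))) = (∫ x, φ x) * (∫ x, ψ x) * k ^ 2 *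
        ((a * ζ s ω + b * ϑ s ω) * (a * ζ t ω + b * ϑ t ω)) := by ring
    simp_rw [e]
    rw [integral_const_mul, integral_mul_of_indepFun hζ hϑ hi, hγ, limCov_eq hH2, ha2, hb2, hk, hγ]
    ring

theorem tendstoFDD_of_eq_one (h : IsStableSystem 1 θ ρ η P) {β : ℝ≥0 → Ω' → ℝ}
    (hβ : IsPreBrownianReal β P') :
    TendstoFDD (fluctuation (empirical θ ρ η) P fun T => Real.sqrt (T * Real.log T)) P
      (fun t ω => (Real.sqrt (2 / Real.pi * ∫ ω, (θ 0 ω : ℝ) ∂P) * β t ω) • toDist volume) P' := by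
  obtain ⟨ν, hν⟩ := (h.motion (0, 0)).exists_isStableKernel
  have hk : Real.sqrt (2 / Real.pi * ∫ ω, (θ 0 ω : ℝ) ∂P) ^ 2 =
      2 / Real.pi * ∫ ω, (θ 0 ω : ℝ) ∂P := Real.sq_sqrt (mul_nonneg (by positivity)
        (integral_nonneg fun ω => Nat.cast_nonneg _))
  set k := Real.sqrt (2 / Real.pi * ∫ ω, (θ 0 ω : ℝ) ∂P)
  have hG := hβ.isGaussianProcess
  refine h.tendstoFDD hν one_pos (isScaling_of_eq_one hν)
    (isGaussianProcess_smul_toDist (hG.smul fun _ => k)) (fun t φ => ?_) fun s t φ ψ => ?_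
  · simp_rw [smul_toDist_volume_apply]
    rw [integral_const_mul, integral_const_mul, hβ.integral_eval, mul_zero, mul_zero]
  · simp_rw [smul_toDist_volume_apply]
    have e (ω : Ω') : (∫ x, φ x) * (k * β s ω) * ((∫ x, ψ x) * (k * β t ω)) =
        (∫ x, φ x) * (∫ x, ψ x) * k ^ 2 * (β s ω * β t ω) := by ring
    simp_rw [e]
    have hL (r : ℝ≥0) := (hG.hasGaussianLaw_eval r).memLp_two
    have hc := hβ.covariance_eval s t
    rw [covariance_eq_sub (hL s) (hL t), hβ.integral_eval, zero_mul, sub_zero] at hc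
    have hc' : ∫ ω, β s ω * β t ω ∂P' = min (s : ℝ) t := by exact_mod_cast hc
    rw [integral_const_mul, hc', limCov_one, hk, stableDensity_one_one_zero]
    ring

theorem tendstoFDD_of_lt_one (h : IsStableSystem α θ ρ η P) (hα : 0 < α) (hα1 : α < 1)
    {W : ℝ≥0 → Ω' → TemperedDist} (hW : IsHomogeneousWiener W
      (fun φ ψ => 2 * (∫ ω, (θ 0 ω : ℝ) ∂P) * ∫ x, φ x * potential α (fun y => ψ y) x) P') :
    TendstoFDD (fluctuation (empirical θ ρ η) P fun T => Real.sqrt T) P W P' := by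
  obtain ⟨ν, hν⟩ := (h.motion (0, 0)).exists_isStableKernel
  refine h.tendstoFDD hν hα (isScaling_of_lt_one hν hα hα1) hW.gaussian hW.centered
    fun s t φ ψ => ?_
  rw [hW.covariance, limCov_one]
  ring

end IsStableSystem

end

end OccupationTime

theorem theorem2p2 {Ω Ω' : Type*} [MeasurableSpace Ω] [MeasurableSpace Ω']
    (P : Measure Ω) [IsProbabilityMeasure P] (P' : Measure Ω') [IsProbabilityMeasure P']
    (α : ℝ) (hα : 0 < α) (hα2 : α ≤ 2)
    (θ : ℤ → Ω → ℕ) (ρ : ℤ → (k : ℕ) → Ω → Fin k → ℝ) (η : ℤ × ℕ → ℝ≥0 → Ω → ℝ)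
    (hsys : OccupationTime.IsStableSystem α θ ρ η P)
    (Eθ Vθ : ℝ) (hE : Eθ = ∫ ω, (θ 0 ω : ℝ) ∂P)
    (hV : Vθ = variance (fun ω => (θ 0 ω : ℝ)) P) :
    (1 < α → ∀ H K₁ : ℝ, H = 1 - 1 / (2 * α) →
      K₁ = Real.sqrt (Real.Gamma (2 - 2 * H) / (Real.pi * α * H * (2 * H - 1))) →
      ∀ ζ ϑ : ℝ≥0 → Ω' → ℝ, OccupationTime.IsSubFBM H ζ P' →
        OccupationTime.IsCenteredGaussian ϑ (OccupationTime.initCov H) P' →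
        IndepFun (fun ω t => ζ t ω) (fun ω t => ϑ t ω) P' →
        OccupationTime.TendstoFDD
          (OccupationTime.fluctuation (OccupationTime.empirical θ ρ η) P
            (fun T => T ^ (1 - 1 / (2 * α)))) P
          (fun t ω => (K₁ * (Real.sqrt Eθ * ζ t ω + Real.sqrt Vθ * ϑ t ω)) •
            OccupationTime.toDist volume) P') ∧
    (α = 1 → ∀ K₂ : ℝ, K₂ = Real.sqrt (2 / Real.pi * Eθ) →
      ∀ β : ℝ≥0 → Ω' → ℝ, IsBrownianReal β P' →
        OccupationTime.TendstoFDD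
          (OccupationTime.fluctuation (OccupationTime.empirical θ ρ η) P
            (fun T => Real.sqrt (T * Real.log T))) P
          (fun t ω => (K₂ * β t ω) • OccupationTime.toDist volume) P') ∧
    (α < 1 → ∀ W : ℝ≥0 → Ω' → OccupationTime.TemperedDist,
      OccupationTime.IsHomogeneousWiener W
        (fun φ ψ => 2 * Eθ * ∫ x, φ x * OccupationTime.potential α (fun y => ψ y) x) P' →
        OccupationTime.TendstoFDD
          (OccupationTime.fluctuation (OccupationTime.empirical θ ρ η) P
            (fun T => Real.sqrt T)) P W P') := by
  subst hE hV
  refine ⟨fun h1 H K₁ hH hK ζ ϑ hζ hϑ hi => ?_, fun h1 K₂ hK β hβ => ?_, fun h1 W hW => ?_⟩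
  · subst hK
    exact hsys.tendstoFDD_of_one_lt h1 hH hζ.toIsCenteredGaussian hϑ hi
  · subst h1 hK
    exact hsys.tendstoFDD_of_eq_one hβ.toIsPreBrownianReal
  · exact hsys.tendstoFDD_of_lt_one hα h1 hW
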